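/- Let $d\ge 1$, let $m=(m_1,\dots,m_q)$ be a composition of $d$, let $g\in\frac12\mathbb Z_{\ge 0}$ and put $k=2g-2+q+d\ge 0$. Let $b$ be a parameter (a formal variable, or an element with $1+b\ne 0$ of a field of characteristic $0$). **Monotone $b$-Hurwitz numbers.** On the set $\{1,\bar 1,\dots,d,\bar d\}$ let $\tau=(1\,\bar 1)\cdots(d\,\bar d)$. For a fixed point-free involution $\rho$, the graph $\rho\cup\tau$ (union of the two perfect matchings) is a union of cycles of even length; the half-lengths of these cycles form a partition of $d$, the type of $\rho$. A transposition $\sigma$ acts by $\sigma.\rho=\sigma\rho\sigma^{-1}$, and the pair $(\rho,\sigma)$ has weight $C$ (a cut) if the type of $\sigma.\rho$ has one part more than the type of $\rho$, weight $J$ (a join) if it has one part less, and weight $T$ (a twist) if the types agree. Consider strings $(\sigma_1,\dots,\sigma_k)$ of transpositions $\sigma_i=(p_i\,q_i)$ with $q_i\in\{1,\dots,d\}$, $p_i\in\{1,\bar 1,\dots,q_i-1,\overline{q_i-1}\}$ and $q_1\le\dots\le q_k$, such that the group $\langle\tau,\sigma_1,\dots,\sigma_k\rangle$ is transitive, together with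 a labelling by $1,\dots,q$ of the cycles of $\varrho\cup\tau$, where $\varrho=\sigma_k\cdots\sigma_1.\tau$, for which the cycle with label $i$ has length $2m_i$. The weight of a string is the product of the weights of the pairs $(\sigma_{i-1}\cdots\sigma_1.\tau,\ \sigma_i)$. Let $\mathcal N_g(m)$ be the sum of the weights of all these pairs (string, labelling), divided by $d!\,C^qJ^d2^d$; it depends on $C,J,T$ only through $CJ$ and $T$, and $$h^{\le}_g(m)=\mathcal N_g(m)\big|_{CJ\to\frac{1+b}2,\ T\to b}.$$ **Tropical count.** For $k>0$, a tropical quotient cover is a connected tropical cover $\overline\pi\colon\overline\Gamma\to\mathbb R$ (up to isomorphism over $\mathbb R$ respecting the labels of the ends) with labelled ends, with left ends of weights $m_1,\dots,m_q$ and $d$ right ends of weight $1$, with exactly one inner vertex over each of the $k$ branch points $p_1<\dots<p_k$ and positive integral edge weights, such that each inner vertex has edges on both sides, is $2$- or $3$-valent, and is balanced (the weights on its left and on its right have the same sum). Two such covers are equivalent if they are related by the equivalence relation generated by the following moves: cut all edges between $p_{i-1}$ and $p_i$, and change the images in $\{p_i,\dots,p_k\}$ of the vertices on the right of the cut, keeping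 the order of the vertices within each connected component on the right of the cut. For a vertex $V$ over $p_i$ let $d_V$ be the degree of the connected component containing $V$ after all edges between $p_{i-1}$ and $p_i$ have been cut; put $\mathrm m(V)=b(\omega_V-1)/d_V$ if $V$ is $2$-valent with adjacent edges of weight $\omega_V$, and $\mathrm m(V)=2/d_V$ if $V$ is $3$-valent. Put $$h^{\le,\mathrm{trop}}_g(m)=\sum_{\overline\pi}(1+b)^{g(\overline\Gamma)-1}\Big(\frac12\Big)^{w}\prod_e\omega(e)\prod_V\mathrm m(V),$$ where the sum is over the equivalence classes of tropical quotient covers, $g(\overline\Gamma)$ is the first Betti number of $\overline\Gamma$, $w$ is the number of wieners (cycles formed by two edges of the same weight), $e$ runs over the internal edges and $V$ over the inner vertices. For $k=0$ (that is, $g=0$ and $m=(1)$) put $h^{\le,\mathrm{trop}}_0((1))=\frac1{1+b}$. **Theorem.** There are finitely many equivalence classes, the multiplicity of a tropical quotient cover depends only on its equivalence class, and $$d!\;h^{\le}_g(m)=h^{\le,\mathrm{trop}}_g(m).$$ -/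

import Mathlib

namespace BHurwitz

noncomputable section

/-! ### Monotone Hurwitz numbers through weighted factorisations -/

/-- The set `{1, 1̄, …, n, n̄}`: `(i, false)` is the element `i` and `(i, true)` is `ī`. -/
abbrev Pt (n : ℕ) : Type := Fin n × Bool

/-- The fixed point-free involution `τ = (1 1̄)(2 2̄) ⋯ (n n̄)`. -/
def tau (n : ℕ) : Equiv.Perm (Pt n) := Equiv.prodCongr (Equiv.refl (Fin n)) Equiv.boolNot

/-- The number of parts of the type of a fixed point-free involution `ρ`. The type is the
partition `λ` of `n` such that the cycle type of `ρ τ` (fixed points counted as cycles of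
length one) is `λ ∪ λ`. -/
def numParts {n : ℕ} (ρ : Equiv.Perm (Pt n)) : ℕ :=
  Multiset.card (ρ * tau n).partition.parts / 2

/-- The action of a permutation on fixed point-free involutions, by conjugation. -/
def act {n : ℕ} (σ ρ : Equiv.Perm (Pt n)) : Equiv.Perm (Pt n) := σ * ρ * σ⁻¹

/-- The weight of a transposition `σ` at the fixed point-free involution `ρ`: it is `C` for a cut
(one more part), `J` for a join (one part less) and `T` for a twist (no change of the type). -/
def cjtWeight {K : Type*} (C J T : K) {n : ℕ} (ρ σ : Equiv.Perm (Pt n)) : K :=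
  if numParts (act σ ρ) = numParts ρ + 1 then C
  else if numParts ρ = numParts (act σ ρ) + 1 then J
  else T

/-- The involution `σ_k ⋯ σ_1 . ρ` for the list `[σ_1, …, σ_k]`. -/
def actList {n : ℕ} : Equiv.Perm (Pt n) → List (Equiv.Perm (Pt n)) → Equiv.Perm (Pt n)
  | ρ, [] => ρ
  | ρ, σ :: s => actList (act σ ρ) s

/-- The product of the weights of `σ_1, …, σ_k`, where `σ_i` is applied to
`σ_{i-1} ⋯ σ_1 . ρ`. -/
def weightList {K : Type*} [Field K] (C J T : K) {n : ℕ} :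
    Equiv.Perm (Pt n) → List (Equiv.Perm (Pt n)) → K
  | _, [] => 1
  | ρ, σ :: s => cjtWeight C J T ρ σ * weightList C J T (act σ ρ) s

/-- The transposition `(p q)`, where `p` is any element and `q` is an unbarred one. -/
def transp {n : ℕ} (t : Pt n × Fin n) : Equiv.Perm (Pt n) := Equiv.swap t.1 (t.2, false)

/-- The string of transpositions `(σ_1, …, σ_k)`, as a list. -/
def string {n k : ℕ} (t : Fin k → Pt n × Fin n) : List (Equiv.Perm (Pt n)) :=
  List.ofFn fun i => transp (t i)

/-- `t` encodes a transitive monotone string of transpositions `σ_i = (p_i q_i)` starting at the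
involution `τ`: `q_i` is unbarred, `p_i ∈ {1, 1̄, …, q_i - 1, \bar{q_i - 1}}`, `q_1 ≤ ⋯ ≤ q_k`, and
the group generated by `τ, σ_1, …, σ_k` is transitive. -/
structure IsTransitiveMonotone {n k : ℕ} (t : Fin k → Pt n × Fin n) : Prop where
  lt : ∀ i, (t i).1.1 < (t i).2
  monotone : Monotone fun i => (t i).2
  transitive : ∀ x y : Pt n,
    ∃ g ∈ Subgroup.closure ({tau n} ∪ Set.range fun i => transp (t i)), g x = y

/-- `ℓ` is a labelling of the cycles of the graph `ρ ∪ τ` by `1, …, q` such that the cycle with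
label `i` has length `2 m_i`. In particular `ρ` has type `{m_1, …, m_q}`, and the labelling is the
same as a linear order on the parts that turns the type into the composition `m`. -/
structure IsCycleLabelling {n q : ℕ} (m : Fin q → ℕ) (ρ : Equiv.Perm (Pt n))
    (ℓ : Pt n → Fin q) : Prop where
  eq_iff : ∀ x y, ℓ x = ℓ y ↔ ∃ g ∈ Subgroup.closure {tau n, ρ}, g x = y
  card_fiber : ∀ i, Nat.card {x // ℓ x = i} = 2 * m i

/-- The number of transpositions (and of branch points) `k = 2g - 2 + q + d`, where `G = 2g`. The
subtraction is not truncated when `q` and `d` are positive. -/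
def numTransp (G q d : ℕ) : ℕ := G + q + d - 2

open Classical in
/-- The refined connected monotone Hurwitz number `N_g(1^d ; m_1, …, m_q)`, where `G = 2g`: the
weighted number of pairs of a transitive monotone string of `k = 2g - 2 + q + d` transpositions
starting at `τ` (the only involution of type `1^d`) and a labelling of the cycles of the resulting
involution with half-lengths `m`, divided by `C^q J^d 2^d`. -/
def refinedN {K : Type*} [Field K] (C J T : K) (G : ℕ) {d : ℕ} (m : Composition d) : K :=
  (∑ x : (Fin (numTransp G m.length d) → Pt d × Fin d) × (Pt d → Fin m.length) with
      IsTransitiveMonotone x.1 ∧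
        IsCycleLabelling m.blocksFun (actList (tau d) (string x.1)) x.2,
    weightList C J T (tau d) (string x.1)) / (C ^ m.length * J ^ d * 2 ^ d)

/-- The single monotone numbers `(1 / d!) N_g(1^d ; m)`, where `G = 2g`. -/
def singleMonotone {K : Type*} [Field K] (C J T : K) (G : ℕ) {d : ℕ} (m : Composition d) : K :=
  refinedN C J T G m / (d.factorial : K)

/-! ### Tropical quotient covers -/

/-- A bounded edge `(start, end, weight)` from the vertex over one branch point to the vertex over
a branch point further right. -/
abbrev Edge (k : ℕ) : Type := Fin k × Fin k × ℕ

/-- The combinatorial data of a tropical cover of the real line with exactly one vertex over each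
of the branch points `p_0 < ⋯ < p_{k-1}`, with `q` labelled left ends and `d` labelled right ends.
The vertices are numbered by the branch points below them. The bounded edges are not labelled, so
they form a multiset: two covers are isomorphic over the line, respecting the labels of the ends,
iff these data agree (up to the position of the branch points). -/
structure CoverData (k q d : ℕ) where
  /-- the internal edges -/
  edges : Multiset (Edge k)
  /-- the vertex at which the left end with a given label is attached -/
  left : Fin q → Fin k
  /-- the vertex at which the right end with a given label is attached -/
  right : Fin d → Fin k

namespace CoverData

variable {k q d : ℕ}

/-- The number of edges and ends going from the left into the vertex `v`. -/
def inDeg (Γ : CoverData k q d) (v : Fin k) : ℕ :=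
  Multiset.card (Γ.edges.filter fun e => e.2.1 = v) +
    (Finset.univ.filter fun i => Γ.left i = v).card

/-- The number of edges and ends going from the vertex `v` to the right. -/
def outDeg (Γ : CoverData k q d) (v : Fin k) : ℕ :=
  Multiset.card (Γ.edges.filter fun e => e.1 = v) +
    (Finset.univ.filter fun j => Γ.right j = v).card

/-- The sum of the weights of the edges and ends entering `v` from the left, where the left ends
have weights `m`. -/
def inWeight (Γ : CoverData k q d) (m : Fin q → ℕ) (v : Fin k) : ℕ :=
  ((Γ.edges.filter fun e => e.2.1 = v).map fun e => e.2.2).sum +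
    ∑ i with Γ.left i = v, m i

/-- The sum of the weights of the edges and ends leaving `v` to the right, where all right ends
have weight one. -/
def outWeight (Γ : CoverData k q d) (v : Fin k) : ℕ :=
  ((Γ.edges.filter fun e => e.1 = v).map fun e => e.2.2).sum +
    ∑ j with Γ.right j = v, 1

/-- The vertices `u` and `v` both lie over a branch point `p_j` with `j ≥ i`, and are joined by an
edge. -/
def AdjFrom (Γ : CoverData k q d) (i u v : Fin k) : Prop :=
  i ≤ u ∧ i ≤ v ∧ ∃ e ∈ Γ.edges, (e.1 = u ∧ e.2.1 = v) ∨ (e.1 = v ∧ e.2.1 = u)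

/-- After all edges between the branch points `p_{i-1}` and `p_i` have been cut, the vertices `u`
and `v` to the right of the cut lie in the same connected component. -/
def SameCompFrom (Γ : CoverData k q d) (i u v : Fin k) : Prop :=
  i ≤ u ∧ i ≤ v ∧ Relation.ReflTransGen (Γ.AdjFrom i) u v

/-- The graph is connected. -/
def Connected (Γ : CoverData k q d) : Prop :=
  ∀ u v : Fin k, Relation.ReflTransGen
    (fun x y => ∃ e ∈ Γ.edges, (e.1 = x ∧ e.2.1 = y) ∨ (e.1 = y ∧ e.2.1 = x)) u v

/-- The connected tropical quotient covers with left ends of weights `m` and right ends of weight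
one: weights are positive, each vertex is either `2`-valent (one edge on each side) or `3`-valent
with edges on both sides, and the cover is balanced at each vertex. -/
structure IsQuotientCover (Γ : CoverData k q d) (m : Fin q → ℕ) : Prop where
  lt : ∀ e ∈ Γ.edges, e.1 < e.2.1
  weight_pos : ∀ e ∈ Γ.edges, 0 < e.2.2
  valence : ∀ v, (Γ.inDeg v = 1 ∧ Γ.outDeg v = 1) ∨ (Γ.inDeg v = 1 ∧ Γ.outDeg v = 2) ∨
    (Γ.inDeg v = 2 ∧ Γ.outDeg v = 1)
  balanced : ∀ v, Γ.inWeight m v = Γ.outWeight v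
  connected : Γ.Connected

/-- The genus (first Betti number) of the quotient graph. -/
def genus (Γ : CoverData k q d) : ℤ := 1 + (Multiset.card Γ.edges : ℤ) - (k : ℤ)

/-- The number of wieners: cycles formed by two edges of the same weight. (No three edges of a
quotient cover have the same two end vertices.) -/
def wieners (Γ : CoverData k q d) : ℕ := (Γ.edges.toFinset.filter fun e => 2 ≤ Γ.edges.count e).card

/-- The degree of the connected component containing the vertex `v` over `p_i` after all edges
between `p_{i-1}` and `p_i` have been cut: the number of its right ends, all of weight one. -/
def compDegree (Γ : CoverData k q d) (v : Fin k) : ℕ :=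
  Nat.card {j : Fin d // Γ.SameCompFrom v v (Γ.right j)}

/-- The vertex multiplicity: `b (ω_V - 1) / deg` at a `2`-valent vertex with adjacent edges of
weight `ω_V`, and `2 / deg` at a `3`-valent vertex. -/
def vertexMult {K : Type*} [Field K] (b : K) (Γ : CoverData k q d) (m : Fin q → ℕ) (v : Fin k) : K :=
  if Γ.inDeg v + Γ.outDeg v = 2 then b * ((Γ.inWeight m v : K) - 1) / (Γ.compDegree v : K)
  else 2 / (Γ.compDegree v : K)

/-- The multiplicity
`(1 + b)^(genus - 1) (1/2)^(number of wieners) ∏ (weights of internal edges) ∏ (vertex multiplicities)`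
of a quotient cover. -/
def mult {K : Type*} [Field K] (b : K) (Γ : CoverData k q d) (m : Fin q → ℕ) : K :=
  (1 + b) ^ (Γ.genus - 1) * (1 / 2) ^ Γ.wieners * (Γ.edges.map fun e => (e.2.2 : K)).prod *
    ∏ v, Γ.vertexMult b m v

/-- `Γ'` arises from `Γ` as follows: all edges between `p_{i-1}` and `p_i` are cut, and the
vertices on the right of the cut are distributed anew over `p_i, p_{i+1}, …`, such that the order
of the vertices within each connected component on the right of the cut is kept. -/
def Reorder (Γ Γ' : CoverData k q d) : Prop :=
  ∃ (i : Fin k) (σ : Equiv.Perm (Fin k)),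
    (∀ v, v < i → σ v = v) ∧
    (∀ u v, u < v → Γ.SameCompFrom i u v → σ u < σ v) ∧
    Γ'.edges = Γ.edges.map (fun e => (σ e.1, σ e.2.1, e.2.2)) ∧
    (∀ a, Γ'.left a = σ (Γ.left a)) ∧
    (∀ a, Γ'.right a = σ (Γ.right a))

end CoverData

/-- The tropical quotient covers with `k` inner vertices, left ends of weights `m` and `d` right
ends of weight one. -/
def QuotientCover (k d : ℕ) {q : ℕ} (m : Fin q → ℕ) : Type :=
  {Γ : CoverData k q d // Γ.IsQuotientCover m}

/-- Equivalence of tropical quotient covers: the equivalence relation generated by reorderings of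
the branch points below different connected components on the right of a cut. -/
def coverSetoid (k d : ℕ) {q : ℕ} (m : Fin q → ℕ) : Setoid (QuotientCover k d m) :=
  Relation.EqvGen.setoid fun Γ Γ' => Γ.1.Reorder Γ'.1

/-- Equivalence classes of tropical quotient covers. -/
def CoverClass (k d : ℕ) {q : ℕ} (m : Fin q → ℕ) : Type := Quotient (coverSetoid k d m)

/-- The tropical monotone `b`-Hurwitz number, where `G = 2g`: the sum over all equivalence classes
of the multiplicity of a representative, if there are `k = 2g - 2 + q + d > 0` inner vertices, and
`1 / (1 + b)` if `k = 0`. -/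
def tropicalMonotone {K : Type*} [Field K] (b : K) (G : ℕ) {d : ℕ} (m : Composition d) : K :=
  if numTransp G m.length d = 0 then 1 / (1 + b)
  else ∑ᶠ c : CoverClass (numTransp G m.length d) d m.blocksFun,
    (Quotient.out c).1.mult b m.blocksFun

end

end BHurwitz

/-! Both numbers are `d!` times a labelled coefficient of one sequence of polynomials `F_k`
(`hurwitzPoly`) in variables `X_1, X_2, …`, one for each size of a part. The index `k` counts
transpositions on one side and inner vertices on the other.

Let `R_{k,x}` (`recTerm`) be `b x (x-1) ∂_x F_k + ∑_{z>x} z X_{z-x} ∂_z F_k + (1+b) ∑_{α+β=x} α β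
(∂_α ∂_β F_k + ∑_{i+j=k} ∂_α F_i ∂_β F_j)`. Starting from `F_0 = X_1/(1+b)`, the polynomials are
defined by the total recursion `∑_x x X_x ∂_x F_{k+1} = ∑_x X_x R_{k,x}`. This is what covers give,
since the leftmost vertex may be attached to any of the left ends. Monotone strings give the refined
recursion `x ∂_x F_{k+1} = R_{k,x}`, since the last transposition of a connected string always moves
the largest element and only the cycle of this element has to be followed.

The heart of the proof is that the total recursion implies the refined one (`recursion_of_total`).
Put `F = ∑ t^k F_k`. The refined recursion says that the operators `L_x = x ∂_x - δ_{x,1}/(1+b) -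
t(…)` annihilate `e^F`. They form a half-Virasoro algebra, `[L_x, L_y] = -(x-y) t L_{x+y}`
(`virOp_comm`). Let `V_x = e^{-F} L_x e^F`. In the lowest order in which some `V_x` might not
vanish, the commutation relation becomes `x ∂_x V_y = y ∂_y V_x`. The total recursion says `∑_y X_y
V_y = 0`; applying `x ∂_x` yields `(∑_y y X_y ∂_y + x) V_x = 0`. The weight operator has nonnegative
eigenvalues, so `V_x = 0`.

Tropical side. The covers in an equivalence class are the images of one cover under the admissible
permutations of its vertices, and different permutations give different covers. The admissible
permutations are the linear extensions of a forest, whose hooks are the components to the right of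
each vertex. By the hook length formula (`exists_linearExtensions`) the sum over classes is a sum
over all covers with an additional factor `∏ hooks / k!` (`finsum_classes`). In a connected cover
the leftmost vertex has hook `k` and component degree `d`. Cutting it off leaves a cover with one
vertex less, or two covers if a split disconnects the graph. Since `d` is the sum of the left
weights, this is the total recursion for the coefficients (`coverSum_insert`, `coverSum_eq`).

Hurwitz side. A transposition at `e` cuts the cycle of `e`, twists it, or joins it with another one,
according to the position of the other point (`blk_join`, `blk_twist`, `card_blk_cut`). After
removal of the last transposition a connected string is still connected, or it is a unique merge of
two connected strings on complementary sets (`sum_connWords_succ`, `sum_splitWords`). The generating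
polynomial in which the cycle of the largest element is marked therefore obeys the refined recursion
(`markedSum_succ`), and induction identifies it with a homogeneous part of `F_k` (`markedSum_eq`).
-/

namespace BHurwitz

open Finset.HasAntidiagonal

/-! ### A half-Virasoro algebra of differential operators -/

section Virasoro

variable {K A : Type*} [Field K] [CommRing A] [Algebra K A]

/-- The derivation `D` conjugated by the exponential of `F`. -/
def conjDer (D : Derivation K A A) (F : A) : A →ₗ[K] A :=
  D.toLinearMap + LinearMap.mulLeft K (D F)

theorem conjDer_apply (D : Derivation K A A) (F g : A) : conjDer D F g = D g + D F * g := rfl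

/-- Conjugation with `e^F` respects commutators; the products of two first derivatives of `F` are
symmetric and cancel. -/
theorem conjDer_comm {D₁ D₂ D₃ : Derivation K A A} {c : K}
    (h : ∀ a, D₁ (D₂ a) = D₂ (D₁ a) + c • D₃ a) (F g : A) :
    conjDer D₁ F (conjDer D₂ F g) = conjDer D₂ F (conjDer D₁ F g) + c • conjDer D₃ F g := by
  simp only [conjDer_apply, map_add, Derivation.leibniz, h, smul_eq_mul, Algebra.smul_def]
  ring

theorem conjDer_mul_left {D : Derivation K A A} {t : A} (h : D t = 0) (F g : A) :
    conjDer D F (t * g) = t * conjDer D F g := by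
  simp only [conjDer_apply, Derivation.leibniz, h, smul_eq_mul]
  ring

/-- Reflected by `a ↦ x + y - a`, the second sum continues the first one beyond `a = x` with the
same summand `(x - a) G a`. The left side is thus twice the sum of `(x - a) G a` over all `a ≤ x +
y`; averaging with its reflection replaces `2 (x - a)` by `x - y`. -/
theorem sum_reflect_identity {M : Type*} [AddCommGroup M] [Module K M] (G : ℕ → M) (x y : ℕ)
    (hG : ∀ a b, a + b = x + y → G a = G b) :
    (2 : K) • ∑ a ∈ Finset.range (x + 1), ((x : K) - a) • G a -
      (2 : K) • ∑ a ∈ Finset.range (y + 1), ((y : K) - a) • G a =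
    ((x : K) - y) • ∑ a ∈ Finset.range (x + y + 1), G a := by
  have h1 : ∑ a ∈ Finset.range (y + 1), ((y : K) - a) • G a =
      - ∑ a ∈ Finset.range (y + 1), ((x : K) - (x + a : ℕ)) • G (x + a) := by
    rw [← Finset.sum_range_reflect, ← Finset.sum_neg_distrib]
    refine Finset.sum_congr rfl fun a ha => ?_
    rw [Finset.mem_range] at ha
    rw [hG (y + 1 - 1 - a) (x + a) (by omega), ← neg_smul]
    congr 1
    rw [Nat.cast_sub (by omega)]
    push_cast [Nat.add_sub_cancel]
    ring
  have h2 : ∑ a ∈ Finset.range (x + y + 1), ((x : K) - a) • G a =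
      ∑ a ∈ Finset.range (x + 1), ((x : K) - a) • G a +
        ∑ a ∈ Finset.range (y + 1), ((x : K) - (x + a : ℕ)) • G (x + a) := by
    rw [show x + y + 1 = x + (y + 1) by ring, Finset.sum_range_add, Finset.sum_range_succ _ x]
    simp
  have h3 : ∑ a ∈ Finset.range (x + y + 1), ((x : K) - a) • G a =
      ∑ a ∈ Finset.range (x + y + 1), ((a : K) - y) • G a := by
    rw [← Finset.sum_range_reflect]
    refine Finset.sum_congr rfl fun a ha => ?_
    rw [Finset.mem_range] at ha
    rw [hG (x + y + 1 - 1 - a) a (by omega)]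
    congr 1
    rw [Nat.cast_sub (by omega)]
    push_cast [Nat.add_sub_cancel]
    ring
  have h4 : ((x : K) - y) • ∑ a ∈ Finset.range (x + y + 1), G a =
      ∑ a ∈ Finset.range (x + y + 1), ((x : K) - a) • G a +
      ∑ a ∈ Finset.range (x + y + 1), ((a : K) - y) • G a := by
    rw [← Finset.sum_add_distrib, Finset.smul_sum]
    refine Finset.sum_congr rfl fun a _ => ?_
    rw [← add_smul]
    congr 1
    ring
  rw [h4, ← h3, h1, h2, smul_neg, sub_neg_eq_add, ← smul_add, two_smul]

/-- The quadratic part of the operators. -/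
def quadOp (N : ℕ → A →ₗ[K] A) (x : ℕ) : A →ₗ[K] A :=
  ∑ a ∈ antidiagonal x, ((a.1 : K) * a.2) • (N a.1 ∘ₗ N a.2)

theorem quadOp_apply (N : ℕ → A →ₗ[K] A) (x : ℕ) (g : A) :
    quadOp N x g = ∑ a ∈ antidiagonal x, ((a.1 : K) * a.2) • N a.1 (N a.2 g) := by
  simp [quadOp, LinearMap.sum_apply]

theorem quadOp_comm_left {N : ℕ → A →ₗ[K] A} {T : A →ₗ[K] A}
    (h : ∀ x g, N x (T g) = T (N x g)) (x : ℕ) (g : A) :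
    quadOp N x (T g) = T (quadOp N x g) := by
  simp [quadOp_apply, h, map_sum]

/-- This is the quadratic part of the relation `[C_x, C_y] = (x - y) C_{x+y}` for the operators
`cutJoinOp`. Commuting with `E y` raises the index of one of the two factors by `y`, so only
products `N a ∘ N (x + y - a)` occur, and `sum_reflect_identity` collects them. -/
theorem quadOp_comm_euler {N E : ℕ → A →ₗ[K] A}
    (hNN : ∀ x y g, N x (N y g) = N y (N x g))
    (hNE : ∀ x y g, 1 ≤ x → 1 ≤ y → N x (E y g) = E y (N x g) + ((x : K) + y) • N (x + y) g)
    {x y : ℕ} (hx : 1 ≤ x) (hy : 1 ≤ y) (g : A) :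
    (quadOp N x (E y g) - E y (quadOp N x g)) - (quadOp N y (E x g) - E x (quadOp N y g)) =
      ((x : K) - y) • quadOp N (x + y) g := by
  -- The two factors of the quadratic operator contribute equally, whence the factor `2`. The weight
  -- `x - a` is the index of the factor before it is raised to `x + y - a`.
  have key : ∀ x y, 1 ≤ y → quadOp N x (E y g) - E y (quadOp N x g) =
      (2 : K) • ∑ a ∈ Finset.range (x + 1), ((x : K) - a) •
        (((a : K) * ((x + y - a : ℕ) : K)) • N a (N (x + y - a) g)) := by
    intro x y hy
    have h1 : quadOp N x (E y g) - E y (quadOp N x g) =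
        ∑ a ∈ antidiagonal x, ((a.1 : K) * a.2) •
          (((a.2 : K) + y) • N a.1 (N (a.2 + y) g) + ((a.1 : K) + y) • N (a.1 + y) (N a.2 g)) := by
      rw [quadOp_apply, quadOp_apply, map_sum, ← Finset.sum_sub_distrib]
      refine Finset.sum_congr rfl fun a _ => ?_
      -- The commutation relation is available for positive indices only; the terms with an index
      -- `0` have coefficient zero.
      rcases Nat.eq_zero_or_pos a.1 with h0 | h0
      · simp [h0]
      rcases Nat.eq_zero_or_pos a.2 with h0' | h0'
      · simp [h0']
      rw [hNE _ _ _ h0' hy, map_add, hNE _ _ _ h0 hy, map_smul, map_smul, ← smul_sub]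
      congr 1
      abel
    have h2 : ∑ a ∈ antidiagonal x, (((a.1 : K) * a.2) * ((a.1 : K) + y)) •
          N (a.1 + y) (N a.2 g) =
        ∑ a ∈ antidiagonal x, (((a.1 : K) * a.2) * ((a.2 : K) + y)) •
          N a.1 (N (a.2 + y) g) := by
      rw [← Finset.Nat.sum_antidiagonal_swap]
      refine Finset.sum_congr rfl fun a _ => ?_
      simp only [Prod.fst_swap, Prod.snd_swap]
      rw [hNN, mul_comm (a.2 : K)]
    rw [h1]
    simp only [smul_add, smul_smul, Finset.sum_add_distrib]
    rw [h2, ← two_smul K, Finset.Nat.sum_antidiagonal_eq_sum_range_succ_mk]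
    congr 1
    refine Finset.sum_congr rfl fun a ha => ?_
    rw [Finset.mem_range] at ha
    dsimp only
    rw [show x - a + y = x + y - a by omega, Nat.cast_sub (by omega : a ≤ x),
      Nat.cast_sub (by omega : a ≤ x + y)]
    congr 1
    push_cast
    ring
  rw [key x y hy, key y x hx]
  have := sum_reflect_identity (K := K)
    (fun a => ((a : K) * ((x + y - a : ℕ) : K)) • N a (N (x + y - a) g)) x y (by
      intro a b hab
      rw [show x + y - a = b by omega, show x + y - b = a by omega, hNN, mul_comm])
  simp only [add_comm y x]
  rw [this, quadOp_apply, Finset.Nat.sum_antidiagonal_eq_sum_range_succ_mk]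

/-- The operator of higher order in the operator `virOp`. -/
def cutJoinOp (b : K) (N E : ℕ → A →ₗ[K] A) (x : ℕ) : A →ₗ[K] A :=
  (b * x * (x - 1)) • N x + E x + (1 + b) • quadOp N x

theorem cutJoinOp_apply (b : K) (N E : ℕ → A →ₗ[K] A) (x : ℕ) (g : A) :
    cutJoinOp b N E x g = (b * x * (x - 1)) • N x g + E x g + (1 + b) • quadOp N x g := rfl

/-- These are Witt algebra relations. The coefficient `b x (x-1)` of the twist term is compatible
with them because `x (x-1) - y (y-1) = (x-y) (x+y-1)`. -/
theorem cutJoinOp_comm (b : K) {N E : ℕ → A →ₗ[K] A}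
    (hNN : ∀ x y g, N x (N y g) = N y (N x g))
    (hNE : ∀ x y g, 1 ≤ x → 1 ≤ y → N x (E y g) = E y (N x g) + ((x : K) + y) • N (x + y) g)
    (hEE : ∀ x y g, 1 ≤ x → 1 ≤ y → E x (E y g) = E y (E x g) + ((x : K) - y) • E (x + y) g)
    {x y : ℕ} (hx : 1 ≤ x) (hy : 1 ≤ y) (g : A) :
    cutJoinOp b N E x (cutJoinOp b N E y g) - cutJoinOp b N E y (cutJoinOp b N E x g) =
      ((x : K) - y) • cutJoinOp b N E (x + y) g := by
  have hQ := quadOp_comm_euler hNN hNE hx hy g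
  have hNQ : ∀ x y g, N x (quadOp N y g) = quadOp N y (N x g) := fun x y g =>
    (quadOp_comm_left (fun z g => hNN z x g) y g).symm
  have hQQ : quadOp N x (quadOp N y g) = quadOp N y (quadOp N x g) :=
    quadOp_comm_left (fun z g => hNQ z y g) x g
  have e1 := hNE x y g hx hy
  have e2 := hNE y x g hy hx
  have e3 := hEE x y g hx hy
  rw [add_comm y x] at e2
  simp only [cutJoinOp_apply, map_add, map_smul, hNQ, hQQ, e1, e2, e3, hNN x y g]
  have hQ' : quadOp N x (E y g) = E y (quadOp N x g) + (quadOp N y (E x g) - E x (quadOp N y g)) +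
      ((x : K) - y) • quadOp N (x + y) g := by
    rw [← hQ]; abel
  rw [hQ']
  push_cast
  module

/-- The operators of a half-Virasoro algebra. -/
def virOp (b c : K) (t : A) (N E : ℕ → A →ₗ[K] A) (x : ℕ) : A →ₗ[K] A :=
  (x : K) • N x - (if x = 1 then c else 0) • LinearMap.id -
    LinearMap.mulLeft K t ∘ₗ cutJoinOp b N E x

theorem virOp_apply (b c : K) (t : A) (N E : ℕ → A →ₗ[K] A) (x : ℕ) (g : A) :
    virOp b c t N E x g = (x : K) • N x g - (if x = 1 then c else 0) • g -
      t * cutJoinOp b N E x g := rfl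

/-- The commutators of `x N_x` with `t C_y` and of `t C_x` with `y N_y` add up to the first order
part, and the `C` part is `cutJoinOp_comm`. No constant appears on the right because `x + y ≥ 2`. -/
theorem virOp_comm (b c : K) {t : A} {N E : ℕ → A →ₗ[K] A}
    (hNN : ∀ x y g, N x (N y g) = N y (N x g))
    (hNE : ∀ x y g, 1 ≤ x → 1 ≤ y → N x (E y g) = E y (N x g) + ((x : K) + y) • N (x + y) g)
    (hEE : ∀ x y g, 1 ≤ x → 1 ≤ y → E x (E y g) = E y (E x g) + ((x : K) - y) • E (x + y) g)
    (hNt : ∀ x g, N x (t * g) = t * N x g) (hEt : ∀ x g, E x (t * g) = t * E x g)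
    {x y : ℕ} (hx : 1 ≤ x) (hy : 1 ≤ y) (g : A) :
    virOp b c t N E x (virOp b c t N E y g) - virOp b c t N E y (virOp b c t N E x g) =
      -(((x : K) - y) • (t * virOp b c t N E (x + y) g)) := by
  have hC := cutJoinOp_comm b hNN hNE hEE hx hy g
  have hNQ : ∀ x y g, N x (quadOp N y g) = quadOp N y (N x g) := fun x y g =>
    (quadOp_comm_left (fun z g => hNN z x g) y g).symm
  have hQt : ∀ x g, quadOp N x (t * g) = t * quadOp N x g := fun x g =>
    quadOp_comm_left (T := LinearMap.mulLeft K t) (fun z g => hNt z g) x g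
  have hCt : ∀ x g, cutJoinOp b N E x (t * g) = t * cutJoinOp b N E x g := by
    intro x g
    simp only [cutJoinOp_apply, hNt, hEt, hQt, mul_add, mul_smul_comm]
  have hNC : ∀ x y, 1 ≤ x → 1 ≤ y → N x (cutJoinOp b N E y g) =
      cutJoinOp b N E y (N x g) + ((x : K) + y) • N (x + y) g := by
    intro x y hx hy
    simp only [cutJoinOp_apply, map_add, map_smul, hNQ, hNE _ _ _ hx hy, hNN x y g]
    abel
  have e1 := hNC x y hx hy
  have e2 := hNC y x hy hx
  rw [add_comm y x] at e2
  have hxy : ¬ x + y = 1 := by omega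
  have hC' : cutJoinOp b N E x (cutJoinOp b N E y g) =
      cutJoinOp b N E y (cutJoinOp b N E x g) + ((x : K) - y) • cutJoinOp b N E (x + y) g := by
    rw [← hC]; abel
  simp only [virOp_apply, map_sub, map_smul, hNt, hCt, e1, e2, hC', hNN x y g, if_neg hxy,
    mul_sub, mul_add, mul_smul_comm, zero_smul, mul_zero]
  push_cast
  module

end Virasoro

end BHurwitz

/-! ### Derivations of the polynomial ring and the right hand side of the recursion -/

namespace BHurwitz

open Finset.HasAntidiagonal MvPolynomial

section Recursion

variable {K : Type*} [Field K]

/-- The derivation `∑_{z > x} z X_{z-x} ∂_z`. -/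
noncomputable def mergeDer (K : Type*) [Field K] (x : ℕ) :
    Derivation K (MvPolynomial ℕ K) (MvPolynomial ℕ K) :=
  mkDerivation K fun z => if x < z then (z : K) • X (z - x) else 0

/-- The derivation `∑_z z X_z ∂_z`. -/
noncomputable def weightDer (K : Type*) [Field K] :
    Derivation K (MvPolynomial ℕ K) (MvPolynomial ℕ K) :=
  mkDerivation K fun z => (z : K) • X z

theorem pderiv_comm (x y : ℕ) (f : MvPolynomial ℕ K) :
    pderiv x (pderiv y f) = pderiv y (pderiv x f) := by
  have h : ⁅pderiv (R := K) x, pderiv (R := K) y⁆ = 0 := by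
    refine derivation_ext fun i => ?_
    simp only [Derivation.commutator_apply, pderiv_X, Pi.single_apply]
    split_ifs <;> simp
  have := congrArg (fun D => D f) h
  simpa [Derivation.commutator_apply, sub_eq_zero] using this

/-- Derivations agree if they agree on the variables, and only `X (x + y)` gives a nonzero value.
Positivity of `x` matters: the term `z = y` is missing from `mergeDer K y`. -/
theorem pderiv_mergeDer (x y : ℕ) (hx : 1 ≤ x) (f : MvPolynomial ℕ K) :
    pderiv x (mergeDer K y f) = mergeDer K y (pderiv x f) +
      ((x : K) + y) • pderiv (x + y) f := by
  have h : ⁅pderiv (R := K) x, mergeDer K y⁆ = ((x : K) + y) • pderiv (R := K) (x + y) := by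
    refine derivation_ext fun i => ?_
    simp only [Derivation.commutator_apply, pderiv_X, Pi.single_apply, mergeDer, mkDerivation_X,
      Derivation.smul_apply]
    have h0 : mkDerivation K (fun z => if y < z then (z : K) •
      (X (z - y) : MvPolynomial ℕ K) else 0)
        (if i = x then (1 : MvPolynomial ℕ K) else 0) = 0 := by
      split_ifs <;> simp
    rw [h0, sub_zero]
    by_cases h2 : i = x + y
    · subst h2
      rw [if_pos (by omega), if_pos rfl, Nat.add_sub_cancel, Derivation.map_smul, pderiv_X_self]
      push_cast
      rfl
    · rw [if_neg h2, smul_zero]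
      split_ifs with h
      · have h3 : i - y ≠ x := by omega
        rw [Derivation.map_smul, pderiv_X_of_ne h3, smul_zero]
      · simp
  have := congrArg (fun D => D f) h
  simp only [Derivation.commutator_apply, Derivation.smul_apply] at this
  rw [← this]
  abel

/-- On `X i` the two orders of composition give `i (i - y)` and `i (i - x)` times the same variable.
-/
theorem mergeDer_comm (x y : ℕ) (f : MvPolynomial ℕ K) :
    mergeDer K x (mergeDer K y f) = mergeDer K y (mergeDer K x f) +
      ((x : K) - y) • mergeDer K (x + y) f := by
  have h : ⁅mergeDer K x, mergeDer K y⁆ = ((x : K) - y) • mergeDer K (x + y) := by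
    refine derivation_ext fun i => ?_
    have key : ∀ x y, mergeDer K x (mergeDer K y (X i)) =
        if x + y < i then ((i : K) * ((i : K) - y)) • X (i - (x + y)) else 0 := by
      intro x y
      rw [mergeDer, mergeDer, mkDerivation_X]
      split_ifs with h1 h2 h2
      · rw [Derivation.map_smul, mkDerivation_X, if_pos (by omega), smul_smul,
          Nat.cast_sub (by omega), show i - y - x = i - (x + y) by omega]
      · rw [Derivation.map_smul, mkDerivation_X, if_neg (by omega), smul_zero]
      · omega
      · simp
    rw [Derivation.commutator_apply, key, key, Derivation.smul_apply, mergeDer, mkDerivation_X,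
      add_comm y x]
    split_ifs
    · module
    · simp
  have := congrArg (fun D => D f) h
  simp only [Derivation.commutator_apply, Derivation.smul_apply] at this
  rw [← this]
  abel

/-- Coefficientwise extension of a derivation to power series. -/
noncomputable def liftDer (D : Derivation K (MvPolynomial ℕ K) (MvPolynomial ℕ K)) :
    Derivation K (PowerSeries (MvPolynomial ℕ K)) (PowerSeries (MvPolynomial ℕ K)) :=
  Derivation.mk'
    { toFun := fun f => PowerSeries.mk fun n => D (PowerSeries.coeff n f)
      map_add' := fun f g => by ext1 n; simp
      map_smul' := fun c f => by
        ext1 n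
        simp only [PowerSeries.coeff_mk, RingHom.id_apply]
        have h : ∀ g : PowerSeries (MvPolynomial ℕ K), PowerSeries.coeff n (c • g) =
          c • PowerSeries.coeff n g := fun g => rfl
        rw [h, h, Derivation.map_smul, PowerSeries.coeff_mk] }
    (fun f g => by
      ext1 n
      simp only [LinearMap.coe_mk, AddHom.coe_mk, PowerSeries.coeff_mk, smul_eq_mul, map_add,
        PowerSeries.coeff_mul, map_sum, Derivation.leibniz, Finset.sum_add_distrib]
      congr 1
      rw [← Finset.Nat.sum_antidiagonal_swap]
      rfl)

theorem coeff_liftDer (D : Derivation K (MvPolynomial ℕ K) (MvPolynomial ℕ K)) (n : ℕ)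
    (f : PowerSeries (MvPolynomial ℕ K)) :
    PowerSeries.coeff n (liftDer D f) = D (PowerSeries.coeff n f) := by
  simp [liftDer]

theorem coeff_smul_field (n : ℕ) (c : K) (g : PowerSeries (MvPolynomial ℕ K)) :
    PowerSeries.coeff n (c • g) = c • PowerSeries.coeff n g := rfl

theorem liftDer_X (D : Derivation K (MvPolynomial ℕ K) (MvPolynomial ℕ K)) :
    liftDer D PowerSeries.X = 0 := by
  ext1 n
  rw [coeff_liftDer, PowerSeries.coeff_X]
  split_ifs <;> simp

/-- The right hand side of the recursion for the variable `X_x`. -/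
noncomputable def recTerm (b : K) (F : ℕ → MvPolynomial ℕ K) (k x : ℕ) : MvPolynomial ℕ K :=
  (b * x * (x - 1)) • pderiv x (F k) + mergeDer K x (F k) +
    (1 + b) • ∑ a ∈ antidiagonal x, ((a.1 : K) * a.2) •
      (pderiv a.1 (pderiv a.2 (F k)) + ∑ j ∈ antidiagonal k,
        pderiv a.1 (F j.1) * pderiv a.2 (F j.2))

theorem coe_sum_derivation {ι A : Type*} [CommRing A] [Algebra K A] (s : Finset ι)
    (D : ι → Derivation K A A) : ⇑(∑ i ∈ s, D i) = ∑ i ∈ s, ⇑(D i) :=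
  map_sum (Derivation.coeFnAddMonoidHom (R := K) (A := A) (M := A)) D s

/-- A polynomial has finitely many variables, so a finite sum is already the weight operator. The
index `0` may be left out because its weight is zero. -/
theorem X_mul_pderiv_sum_eq {N : ℕ} {f : MvPolynomial ℕ K} (hN : ∀ i ∈ f.vars, i < N) :
    ∑ x ∈ Finset.Ico 1 N, (x : K) • (X x * pderiv x f) = weightDer K f := by
  have h : (∑ x ∈ Finset.Ico 1 N, ((x : K) • (X x : MvPolynomial ℕ K)) • pderiv (R := K) x) f =
      weightDer K f := by
    refine derivation_eq_of_forall_mem_vars fun i hi => ?_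
    have := hN i hi
    rw [weightDer, mkDerivation_X]
    rw [coe_sum_derivation, Finset.sum_apply]
    simp only [Derivation.smul_apply, pderiv_X, Pi.single_apply, smul_eq_mul, mul_ite, mul_one,
      mul_zero]
    rw [Finset.sum_ite_eq]
    split_ifs with h
    · rfl
    · have : i = 0 := by
        rw [Finset.mem_Ico] at h
        omega
      simp [this]
  rw [← h, coe_sum_derivation, Finset.sum_apply]
  simp [Derivation.smul_apply]

end Recursion

end BHurwitz

/-! ### From the total recursion to the refined recursion -/

namespace BHurwitz

open Finset.HasAntidiagonal MvPolynomial

section Star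

variable {K : Type*} [Field K]

/-- Applied to `1`, the conjugated operators give `∂_x F`, and the conjugated second derivatives
give `∂_α ∂_β F + ∂_α F ∂_β F`. Hence the refined recursion is the statement that the operators
`virOp` annihilate `1`. -/
theorem coeff_virOp_one (b c : K) (F : ℕ → MvPolynomial ℕ K) (x : ℕ) :
    let V := virOp b c (PowerSeries.X : PowerSeries (MvPolynomial ℕ K))
      (fun x => conjDer (liftDer (pderiv x)) (PowerSeries.mk F))
      (fun x => conjDer (liftDer (mergeDer K x)) (PowerSeries.mk F)) x 1
    PowerSeries.coeff 0 V = (x : K) • pderiv x (F 0) - C (if x = 1 then c else 0) ∧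
      ∀ k, PowerSeries.coeff (k + 1) V = (x : K) • pderiv x (F (k + 1)) - recTerm b F k x := by
  intro V
  have hV : V = (x : K) • liftDer (pderiv x) (PowerSeries.mk F) -
      (if x = 1 then c else 0) • 1 - PowerSeries.X * ((b * x * (x - 1)) •
        liftDer (pderiv x) (PowerSeries.mk F) + liftDer (mergeDer K x) (PowerSeries.mk F) +
      (1 + b) • ∑ a ∈ antidiagonal x, ((a.1 : K) * a.2) •
        (liftDer (pderiv a.1) (liftDer (pderiv a.2) (PowerSeries.mk F)) +
          liftDer (pderiv a.1) (PowerSeries.mk F) * liftDer (pderiv a.2) (PowerSeries.mk F))) := by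
    simp only [V, virOp_apply, cutJoinOp_apply, quadOp_apply, conjDer_apply,
      Derivation.map_one_eq_zero,
      zero_add, mul_one]
  constructor
  · rw [hV, map_sub, map_sub, PowerSeries.coeff_zero_X_mul, sub_zero, coeff_smul_field,
      coeff_smul_field, coeff_liftDer, PowerSeries.coeff_mk]
    split_ifs <;> simp [smul_eq_C_mul]
  · intro k
    rw [hV, map_sub, map_sub, PowerSeries.coeff_succ_X_mul, coeff_smul_field, coeff_smul_field,
      coeff_liftDer, PowerSeries.coeff_mk, PowerSeries.coeff_one, if_neg (Nat.succ_ne_zero k),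
      smul_zero, sub_zero]
    congr 1
    simp only [map_add, coeff_smul_field, coeff_liftDer, PowerSeries.coeff_mk, map_sum,
      PowerSeries.coeff_mul, recTerm]

theorem coeff_weightDer (s : ℕ →₀ ℕ) (f : MvPolynomial ℕ K) :
    coeff s (weightDer K f) = ((s.sum fun i n => i * n : ℕ) : K) * coeff s f := by
  have hm : ∀ (s : ℕ →₀ ℕ) (a : K), weightDer K (monomial s a) =
      ((s.sum fun i n => i * n : ℕ) : K) • monomial s a := by
    intro s a
    rw [weightDer, mkDerivation_monomial, Finsupp.sum, Finsupp.sum, Nat.cast_sum, Finset.sum_smul,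
      Finset.smul_sum]
    refine Finset.sum_congr rfl fun i hi => ?_
    have h1 : Finsupp.single i 1 ≤ s := by
      rw [Finsupp.single_le_iff]
      exact Nat.one_le_iff_ne_zero.mpr (Finsupp.mem_support_iff.mp hi)
    rw [X, smul_eq_mul, mul_smul_comm, monomial_mul, mul_one, tsub_add_cancel_of_le h1, smul_smul]
    simp only [smul_eq_C_mul, C_mul_monomial]
    congr 1
    push_cast
    ring
  induction f using MvPolynomial.induction_on' with
  | monomial t a =>
    rw [hm, coeff_smul, smul_eq_mul, coeff_monomial]
    split_ifs with h
    · rw [h]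
    · simp
  | add p q hp hq => rw [map_add, coeff_add, coeff_add, hp, hq, mul_add]

/-- Monomials are eigenvectors of `weightDer` with eigenvalues in `ℕ`, so adding a positive `x`
makes the operator injective in characteristic zero. -/
theorem weightDer_add_eq_zero [CharZero K] {x : ℕ} (hx : 1 ≤ x) {f : MvPolynomial ℕ K}
    (h : weightDer K f + (x : K) • f = 0) : f = 0 := by
  ext s
  have h2 := congrArg (coeff s) h
  rw [coeff_add, coeff_weightDer, coeff_smul, smul_eq_mul, ← add_mul, coeff_zero] at h2
  rcases mul_eq_zero.mp h2 with h3 | h3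
  · exfalso
    have : (((s.sum fun i n => i * n) + x : ℕ) : K) = 0 := by
      push_cast
      push_cast at h3
      exact h3
    rw [Nat.cast_eq_zero] at this
    omega
  · simpa using h3

/-- By induction on the order `n`, all `V x` vanish in order `n`. The commutation relation applied
to `1` makes `y ∂_y` of the coefficient of `V x` symmetric in `x` and `y`, and with this symmetry
the single total relation splits into one relation for each `x`. -/
theorem recursion_of_total [CharZero K] (b c : K) (F : ℕ → MvPolynomial ℕ K)
    (h0 : F 0 = c • X 1)
    (hF : ∀ k, ∃ N₀, ∀ N, N₀ ≤ N →
      weightDer K (F (k + 1)) = ∑ x ∈ Finset.Ico 1 N, X x * recTerm b F k x)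
    (k x : ℕ) (hx : 1 ≤ x) : (x : K) • pderiv x (F (k + 1)) = recTerm b F k x := by
  set Fp : PowerSeries (MvPolynomial ℕ K) := PowerSeries.mk F with hFp
  set Nb := fun x => conjDer (liftDer (pderiv (R := K) x)) Fp with hNb
  set E := fun x => conjDer (liftDer (mergeDer K x)) Fp with hE
  set V := fun x => virOp b c (PowerSeries.X : PowerSeries (MvPolynomial ℕ K)) Nb E x 1 with hV
  have hV0 : ∀ x, PowerSeries.coeff 0 (V x) =
      (x : K) • pderiv x (F 0) - C (if x = 1 then c else 0) :=
    fun x => (coeff_virOp_one b c F x).1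
  have hVs : ∀ x k, PowerSeries.coeff (k + 1) (V x) =
      (x : K) • pderiv x (F (k + 1)) - recTerm b F k x :=
    fun x => (coeff_virOp_one b c F x).2
  have hcomm : ∀ x y, 1 ≤ x → 1 ≤ y →
      virOp b c PowerSeries.X Nb E x (V y) - virOp b c PowerSeries.X Nb E y (V x) =
        -(((x : K) - y) • (PowerSeries.X * V (x + y))) := by
    intro x y hx hy
    refine virOp_comm b c ?_ ?_ ?_ ?_ ?_ hx hy 1
    · intro x y g
      have := conjDer_comm (D₁ := liftDer (pderiv (R := K) x)) (D₂ := liftDer (pderiv y))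
        (D₃ := 0) (c := 0) (by
          intro a; ext1 n; simp [coeff_liftDer, pderiv_comm x y]) Fp g
      simpa using this
    · intro x y g hx _
      refine conjDer_comm (fun a => ?_) Fp g
      ext1 n
      simp only [map_add, coeff_liftDer, coeff_smul_field, pderiv_mergeDer x y hx]
    · intro x y g _ _
      refine conjDer_comm (fun a => ?_) Fp g
      ext1 n
      simp only [map_add, coeff_liftDer, coeff_smul_field, mergeDer_comm x y]
    · exact fun x g => conjDer_mul_left (liftDer_X _) Fp g
    · exact fun x g => conjDer_mul_left (liftDer_X _) Fp g
  have hz : ∀ n x, 1 ≤ x → PowerSeries.coeff n (V x) = 0 := by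
    intro n
    induction n using Nat.strong_induction_on with
    | _ n ih =>
      have hcoeff : ∀ D W, (∀ j < n, PowerSeries.coeff j W = 0) → ∀ j ≤ n,
          PowerSeries.coeff j (conjDer (liftDer D) Fp W) =
            D (PowerSeries.coeff j W) + D (F 0) * PowerSeries.coeff j W := by
        intro D W hW j hj
        rw [conjDer_apply, map_add, coeff_liftDer, PowerSeries.coeff_mul,
          Finset.sum_eq_single (0, j)]
        · rw [coeff_liftDer, hFp, PowerSeries.coeff_mk]
        · rintro ⟨i, l⟩ hij hne
          rw [mem_antidiagonal] at hij
          dsimp only at hij ⊢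
          have : l < n := by
            rcases Nat.eq_zero_or_pos i with rfl | h
            · exact absurd (by simp at hij; simp [hij]) hne
            · omega
          rw [hW l this, mul_zero]
        · simp
      have hlow : ∀ D W, (∀ j < n, PowerSeries.coeff j W = 0) →
          ∀ j < n, PowerSeries.coeff j (conjDer (liftDer D) Fp W) = 0 := by
        intro D W hW j hj
        rw [hcoeff D W hW j hj.le, hW j hj, map_zero, mul_zero, add_zero]
      -- If the orders below `n` vanish, the terms with a factor `t` do not contribute in order `n`,
      -- and `x ∂_x (F 0)` cancels the constant `c` at `x = 1`. This cancellation is the reason for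
      -- the initial value `c • X 1`.
      have hvir : ∀ x y : ℕ, 1 ≤ x → 1 ≤ y →
          PowerSeries.coeff n (virOp b c PowerSeries.X Nb E x (V y)) =
            (x : K) • pderiv x (PowerSeries.coeff n (V y)) := by
        intro x y hx hy
        have hVy : ∀ j < n, PowerSeries.coeff j (V y) = 0 := fun j hj => ih j hj y hy
        have hC : PowerSeries.coeff n (PowerSeries.X * cutJoinOp b Nb E x (V y)) = 0 := by
          rcases n with _ | n
          · rw [PowerSeries.coeff_zero_X_mul]
          · rw [PowerSeries.coeff_succ_X_mul, cutJoinOp_apply, map_add, map_add, coeff_smul_field,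
              coeff_smul_field, quadOp_apply, map_sum, hlow _ _ hVy _ n.lt_succ_self,
              hlow _ _ hVy _ n.lt_succ_self, Finset.sum_eq_zero]
            · simp
            · intro a _
              rw [coeff_smul_field, hlow _ _ (hlow _ _ hVy) _ n.lt_succ_self, smul_zero]
        rw [virOp_apply, map_sub, hC, sub_zero, map_sub, coeff_smul_field, coeff_smul_field,
          hcoeff _ _ hVy n le_rfl, h0, Derivation.map_smul, pderiv_X, Pi.single_apply]
        by_cases h1 : x = 1
        · subst h1
          simp
        · rw [if_neg h1, if_neg fun h => h1 h.symm]
          simp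
      -- The right side of the commutation relation has a factor `t`, so it involves only lower
      -- orders, which vanish.
      have hu : ∀ x y : ℕ, 1 ≤ x → 1 ≤ y → (x : K) • pderiv x (PowerSeries.coeff n (V y)) =
          (y : K) • pderiv y (PowerSeries.coeff n (V x)) := by
        intro x y hx hy
        have h := congrArg (PowerSeries.coeff n) (hcomm x y hx hy)
        rw [map_sub, hvir x y hx hy, hvir y x hy hx, map_neg, coeff_smul_field] at h
        have h3 : PowerSeries.coeff n (PowerSeries.X * V (x + y)) = 0 := by
          rcases n with _ | n
          · rw [PowerSeries.coeff_zero_X_mul]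
          · rw [PowerSeries.coeff_succ_X_mul, ih n n.lt_succ_self _ (by omega)]
        rw [h3, smul_zero, neg_zero, sub_eq_zero] at h
        exact h
      have htot : ∃ N₀, ∀ N, N₀ ≤ N →
          ∑ x ∈ Finset.Ico 1 N, X x * PowerSeries.coeff n (V x) = 0 := by
        rcases n with _ | n
        · refine ⟨0, fun N _ => Finset.sum_eq_zero fun x _ => ?_⟩
          rw [hV0, h0, Derivation.map_smul, pderiv_X, Pi.single_apply]
          by_cases h1 : x = 1
          · subst h1
            simp [smul_eq_C_mul]
          · rw [if_neg h1, if_neg fun h => h1 h.symm]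
            simp
        · obtain ⟨N₀, hN₀⟩ := hF n
          -- Beyond all variables of `F (n + 1)` the truncated sum is the full weight operator.
          refine ⟨max N₀ ((F (n + 1)).vars.sup id + 1), fun N hN => ?_⟩
          simp only [hVs, mul_sub, Finset.sum_sub_distrib, mul_smul_comm]
          rw [← hN₀ N (by omega), X_mul_pderiv_sum_eq, sub_self]
          intro i hi
          have : i ≤ (F (n + 1)).vars.sup id := Finset.le_sup (f := id) hi
          omega
      intro x hx
      obtain ⟨N₀, hN₀⟩ := htot
      set u := PowerSeries.coeff n (V x) with hu'
      -- Applying `x ∂_x` to `∑ X_y V_y = 0` yields `x V_x + ∑ X_y (x ∂_x V_y)`, and the symmetry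
      -- `hu` turns the sum into the weight operator applied to `V_x`.
      have h := congrArg (fun f => (x : K) • pderiv x f)
        (hN₀ (max N₀ (max (x + 1) (u.vars.sup id + 1))) (le_max_left _ _))
      set N := max N₀ (max (x + 1) (u.vars.sup id + 1)) with hN
      refine weightDer_add_eq_zero hx ?_
      rw [← X_mul_pderiv_sum_eq (N := N) (f := u)]
      · simp only [map_zero, smul_zero, map_sum, Derivation.leibniz, smul_eq_mul, Finset.smul_sum,
          smul_add, ← mul_smul_comm] at h
        rw [Finset.sum_add_distrib] at h
        rw [← h]
        congr 1
        · refine Finset.sum_congr rfl fun y hy => ?_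
          rw [hu x y hx (Finset.mem_Ico.mp hy).1, mul_smul_comm]
        · rw [Finset.sum_eq_single x]
          · simp [hu', mul_comm]
          · intro y _ hyx
            rw [pderiv_X_of_ne hyx]
            simp
          · intro hx2
            exact absurd (Finset.mem_Ico.mpr ⟨hx, by omega⟩) hx2
      · intro i hi
        have : i ≤ u.vars.sup id := Finset.le_sup (f := id) hi
        omega
  have := hz (k + 1) x hx
  rwa [hVs, sub_eq_zero] at this

end Star

end BHurwitz

/-! ### Construction of the sequence of polynomials -/

namespace BHurwitz

open Finset.HasAntidiagonal MvPolynomial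

section Sequence

variable {K : Type*} [Field K]

/-- A right inverse of `weightDer` on polynomials without terms of weight zero. -/
noncomputable def weightInv (f : MvPolynomial ℕ K) : MvPolynomial ℕ K :=
  ∑ s ∈ f.support, monomial s (coeff s f / ((s.sum fun i n => i * n : ℕ) : K))

theorem weightDer_weightInv [CharZero K] {f : MvPolynomial ℕ K}
    (h : ∀ s, (s.sum fun i n => i * n) = 0 → coeff s f = 0) : weightDer K (weightInv f) = f := by
  ext s
  rw [coeff_weightDer, weightInv, coeff_sum]
  simp only [coeff_monomial, Finset.sum_ite_eq']
  split_ifs with hs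
  · refine mul_div_cancel₀ _ ?_
    rw [Nat.cast_ne_zero]
    exact fun h0 => mem_support_iff.mp hs (h s h0)
  · rw [mul_zero]
    exact (notMem_support_iff.mp hs).symm

theorem coeff_X_mul_eq_zero {x : ℕ} (hx : 1 ≤ x) (f : MvPolynomial ℕ K) (s : ℕ →₀ ℕ)
    (hs : (s.sum fun i n => i * n) = 0) : coeff s (X x * f) = 0 := by
  rw [coeff_X_mul', if_neg]
  intro hm
  rw [Finsupp.sum, Finset.sum_eq_zero_iff] at hs
  have := hs x hm
  rw [Finsupp.mem_support_iff] at hm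
  rcases Nat.mul_eq_zero.mp this with h | h
  · omega
  · exact hm h

/-- The right side in step `k` uses the members of the sequence up to index `k` only, which
justifies a definition by recursion. -/
theorem recTerm_congr (b : K) {F G : ℕ → MvPolynomial ℕ K} {k : ℕ} (h : ∀ j ≤ k, F j = G j)
    (x : ℕ) : recTerm b F k x = recTerm b G k x := by
  have h2 : ∀ a : ℕ × ℕ, ∑ j ∈ antidiagonal k,
      pderiv a.1 (F j.1) * pderiv a.2 (F j.2) = ∑ j ∈ antidiagonal k,
      pderiv a.1 (G j.1) * pderiv a.2 (G j.2) := by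
    intro a
    refine Finset.sum_congr rfl fun j hj => ?_
    rw [mem_antidiagonal] at hj
    rw [h j.1 (by omega), h j.2 (by omega)]
  simp only [recTerm, h k le_rfl, h2]

/-- A strict bound for the variables in the first polynomials of a sequence. -/
noncomputable def varBound (F : ℕ → MvPolynomial ℕ K) (k : ℕ) : ℕ :=
  (Finset.range (k + 1)).sup (fun j => (F j).vars.sup id) + 1

theorem pderiv_eq_zero_of_varBound {F : ℕ → MvPolynomial ℕ K} {j k x : ℕ} (hj : j ≤ k)
    (hx : varBound F k ≤ x) : pderiv x (F j) = 0 := by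
  refine pderiv_eq_zero_of_notMem_vars fun h => ?_
  have h1 : x ≤ (F j).vars.sup id := Finset.le_sup (f := id) h
  have h2 := Finset.le_sup (f := fun j => (F j).vars.sup id)
    (Finset.mem_range.mpr (Nat.lt_succ_of_le hj))
  rw [varBound] at hx
  rw [Nat.succ_eq_add_one] at h2
  omega

/-- If `α + β = x` is at least twice the bound, one of the indices exceeds all variables. Hence the
sum over `x` in the total recursion is finite. -/
theorem recTerm_eq_zero (b : K) {F : ℕ → MvPolynomial ℕ K} {k x : ℕ}
    (hx : 2 * varBound F k ≤ x) : recTerm b F k x = 0 := by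
  have h2 : mergeDer K x (F k) = 0 := by
    refine derivation_eq_zero_of_forall_mem_vars fun i hi => ?_
    rw [mergeDer, mkDerivation_X, if_neg]
    have h1 : i ≤ (F k).vars.sup id := Finset.le_sup (f := id) hi
    have h2 := Finset.le_sup (f := fun j => (F j).vars.sup id)
      (Finset.mem_range.mpr (Nat.lt_succ_self k))
    rw [varBound] at hx
    rw [Nat.succ_eq_add_one] at h2
    omega
  rw [recTerm, h2, pderiv_eq_zero_of_varBound le_rfl (by omega), Finset.sum_eq_zero]
  · simp
  · intro a ha
    rw [mem_antidiagonal] at ha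
    rcases (by omega : varBound F k ≤ a.1 ∨ varBound F k ≤ a.2) with h | h
    · rw [pderiv_comm, pderiv_eq_zero_of_varBound le_rfl h, Finset.sum_eq_zero]
      · simp
      · intro j hj
        rw [mem_antidiagonal] at hj
        rw [pderiv_eq_zero_of_varBound (by omega) h, zero_mul]
    · rw [pderiv_eq_zero_of_varBound le_rfl h, Finset.sum_eq_zero]
      · simp
      · intro j hj
        rw [mem_antidiagonal] at hj
        rw [pderiv_eq_zero_of_varBound (by omega) h, mul_zero]

/-- The generating polynomials of the connected monotone `b`-Hurwitz numbers. -/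
noncomputable def hurwitzPoly (b c : K) : ℕ → MvPolynomial ℕ K
  | 0 => c • X 1
  | k + 1 =>
    -- The guard makes the recursive calls visibly smaller; the indices above `k`, where `G` is
    -- zero, are never read.
    let G : ℕ → MvPolynomial ℕ K := fun j => if _h : j < k + 1 then hurwitzPoly b c j else 0
    weightInv (∑ x ∈ Finset.Ico 1 (2 * varBound G k), X x * recTerm b G k x)

theorem hurwitzPoly_zero (b c : K) : hurwitzPoly b c 0 = c • X 1 := by rw [hurwitzPoly]

theorem hurwitzPoly_total [CharZero K] (b c : K) (k : ℕ) : ∃ N₀, ∀ N, N₀ ≤ N →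
    weightDer K (hurwitzPoly b c (k + 1)) =
      ∑ x ∈ Finset.Ico 1 N, X x * recTerm b (hurwitzPoly b c) k x := by
  set G : ℕ → MvPolynomial ℕ K := fun j => if _h : j < k + 1 then hurwitzPoly b c j else 0 with hG
  refine ⟨2 * varBound G k, fun N hN => ?_⟩
  have h1 : hurwitzPoly b c (k + 1) =
      weightInv (∑ x ∈ Finset.Ico 1 (2 * varBound G k), X x * recTerm b G k x) := by
    rw [hurwitzPoly]
  have h2 : ∀ x, recTerm b G k x = recTerm b (hurwitzPoly b c) k x :=
    recTerm_congr b fun j hj => by rw [hG]; exact dif_pos (Nat.lt_succ_of_le hj)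
  rw [h1, weightDer_weightInv]
  · simp only [← h2]
    refine Finset.sum_subset (Finset.Ico_subset_Ico_right hN) fun x hx hx' => ?_
    rw [recTerm_eq_zero, mul_zero]
    rw [Finset.mem_Ico] at hx hx'
    omega
  · intro s hs
    rw [coeff_sum]
    exact Finset.sum_eq_zero fun x hx => coeff_X_mul_eq_zero (Finset.mem_Ico.mp hx).1 _ s hs

theorem hurwitzPoly_recursion [CharZero K] (b c : K) (k x : ℕ) (hx : 1 ≤ x) :
    (x : K) • pderiv x (hurwitzPoly b c (k + 1)) = recTerm b (hurwitzPoly b c) k x :=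
  recursion_of_total b c _ (hurwitzPoly_zero b c) (hurwitzPoly_total b c) k x hx

end Sequence

/-! ### Coefficients for labelled parts -/

section Labelled

variable {K : Type*} [Field K]

instance : LeftCommutative fun (i : ℕ) (f : MvPolynomial ℕ K) => pderiv i f :=
  ⟨fun i j f => pderiv_comm i j f⟩

/-- The iterated derivative of `f` with respect to the variables with indices in `M`. -/
noncomputable def iterDeriv (M : Multiset ℕ) (f : MvPolynomial ℕ K) : MvPolynomial ℕ K :=
  M.foldr (fun i f => pderiv i f) f

@[simp]
theorem iterDeriv_cons (i : ℕ) (M : Multiset ℕ) (f : MvPolynomial ℕ K) :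
    iterDeriv (i ::ₘ M) f = pderiv i (iterDeriv M f) := Multiset.foldr_cons _ _ _ _

theorem iterDeriv_pderiv (i : ℕ) (M : Multiset ℕ) (f : MvPolynomial ℕ K) :
    iterDeriv M (pderiv i f) = pderiv i (iterDeriv M f) := by
  induction M using Multiset.induction_on with
  | empty => rfl
  | cons j M ih => rw [iterDeriv_cons, iterDeriv_cons, ih, pderiv_comm]

/-- The coefficient of `f` belonging to a multiset of labelled parts. -/
noncomputable def labCoeff (M : Multiset ℕ) (f : MvPolynomial ℕ K) : K :=
  constantCoeff (iterDeriv M f)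

theorem labCoeff_zero (f : MvPolynomial ℕ K) : labCoeff 0 f = constantCoeff f := rfl

theorem labCoeff_cons (i : ℕ) (M : Multiset ℕ) (f : MvPolynomial ℕ K) :
    labCoeff (i ::ₘ M) f = labCoeff M (pderiv i f) := by
  rw [labCoeff, labCoeff, iterDeriv_cons, iterDeriv_pderiv]

theorem labCoeff_add (M : Multiset ℕ) (f g : MvPolynomial ℕ K) :
    labCoeff M (f + g) = labCoeff M f + labCoeff M g := by
  induction M using Multiset.induction_on generalizing f g with
  | empty => simp [labCoeff_zero]
  | cons j M ih => rw [labCoeff_cons, map_add, ih, labCoeff_cons, labCoeff_cons]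

theorem labCoeff_smul (M : Multiset ℕ) (c : K) (f : MvPolynomial ℕ K) :
    labCoeff M (c • f) = c * labCoeff M f := by
  induction M using Multiset.induction_on generalizing f with
  | empty => simp [labCoeff_zero, smul_eq_C_mul]
  | cons j M ih => rw [labCoeff_cons, Derivation.map_smul, ih, labCoeff_cons]

theorem labCoeff_zero_right (M : Multiset ℕ) : labCoeff M (0 : MvPolynomial ℕ K) = 0 := by
  simpa using labCoeff_smul M (0 : K) 0

theorem labCoeff_sum {ι : Type*} (M : Multiset ℕ) (s : Finset ι) (f : ι → MvPolynomial ℕ K) :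
    labCoeff M (∑ i ∈ s, f i) = ∑ i ∈ s, labCoeff M (f i) := by
  classical
  induction s using Finset.induction_on with
  | empty => simpa using labCoeff_zero_right M
  | insert a s ha ih => rw [Finset.sum_insert ha, Finset.sum_insert ha, labCoeff_add, ih]

variable {ι : Type*}

/-- The coefficient of `f` belonging to a finite set of labels `i` with parts `m i`. -/
noncomputable def partCoeff (I : Finset ι) (m : ι → ℕ) (f : MvPolynomial ℕ K) : K :=
  labCoeff (I.val.map m) f

theorem partCoeff_empty (m : ι → ℕ) (f : MvPolynomial ℕ K) :
    partCoeff ∅ m f = constantCoeff f := rfl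

theorem partCoeff_congr {I : Finset ι} {m m' : ι → ℕ} (h : ∀ i ∈ I, m i = m' i)
    (f : MvPolynomial ℕ K) : partCoeff I m f = partCoeff I m' f := by
  rw [partCoeff, partCoeff, Multiset.map_congr rfl h]

theorem partCoeff_add (I : Finset ι) (m : ι → ℕ) (f g : MvPolynomial ℕ K) :
    partCoeff I m (f + g) = partCoeff I m f + partCoeff I m g := labCoeff_add _ _ _

theorem partCoeff_smul (I : Finset ι) (m : ι → ℕ) (c : K) (f : MvPolynomial ℕ K) :
    partCoeff I m (c • f) = c * partCoeff I m f := labCoeff_smul _ _ _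

theorem partCoeff_sum {κ : Type*} (I : Finset ι) (m : ι → ℕ) (s : Finset κ)
    (f : κ → MvPolynomial ℕ K) : partCoeff I m (∑ i ∈ s, f i) = ∑ i ∈ s, partCoeff I m (f i) :=
  labCoeff_sum _ _ _

variable [DecidableEq ι]

theorem partCoeff_insert {i : ι} {I : Finset ι} (hi : i ∉ I) (m : ι → ℕ) (f : MvPolynomial ℕ K) :
    partCoeff (insert i I) m f = partCoeff I m (pderiv (m i) f) := by
  rw [partCoeff, Finset.insert_val_of_notMem hi, Multiset.map_cons, labCoeff_cons, partCoeff]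

theorem partCoeff_erase {i : ι} {I : Finset ι} (hi : i ∈ I) (m : ι → ℕ) (f : MvPolynomial ℕ K) :
    partCoeff (I.erase i) m (pderiv (m i) f) = partCoeff I m f := by
  rw [← partCoeff_insert (Finset.notMem_erase i I), Finset.insert_erase hi]

/-- At the origin the factor `X x` has to be hit by exactly one of the derivatives, and that
derivative belongs to a label with part `x`. -/
theorem partCoeff_X_mul (I : Finset ι) (m : ι → ℕ) (x : ℕ) (f : MvPolynomial ℕ K) :
    partCoeff I m (X x * f) = ∑ i ∈ I with m i = x, partCoeff (I.erase i) m f := by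
  induction I using Finset.induction_on generalizing f with
  | empty => simp [partCoeff_empty]
  | insert i I hi ih =>
    rw [partCoeff_insert hi, Derivation.leibniz, smul_eq_mul, smul_eq_mul, pderiv_X,
      Finset.filter_insert]
    have h1 : ∑ j ∈ I with m j = x, partCoeff ((insert i I).erase j) m f =
        partCoeff I m (X x * pderiv (m i) f) := by
      rw [ih]
      refine Finset.sum_congr rfl fun j hj => ?_
      rw [Finset.mem_filter] at hj
      have hij : i ≠ j := fun h => hi (h ▸ hj.1)
      rw [Finset.erase_insert_of_ne hij, partCoeff_insert]
      exact fun h => hi (Finset.mem_of_mem_erase h)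
    by_cases h : m i = x
    · subst h
      rw [if_pos rfl, Finset.sum_insert (by simp [hi]), h1, Finset.erase_insert hi,
        Pi.single_eq_same,
        mul_one, partCoeff_add, add_comm]
    · rw [if_neg h, h1, Pi.single_eq_of_ne (Ne.symm h), mul_zero, add_zero]

/-- By the Leibniz rule each label goes to one of the two factors, so a product corresponds to
distributing the labelled ends over two components. -/
theorem partCoeff_mul (I : Finset ι) (m : ι → ℕ) (f g : MvPolynomial ℕ K) :
    partCoeff I m (f * g) = ∑ J ∈ I.powerset, partCoeff J m f * partCoeff (I \ J) m g := by
  induction I using Finset.induction_on generalizing f g with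
  | empty => simp [partCoeff_empty]
  | insert i I hi ih =>
    rw [partCoeff_insert hi, Derivation.leibniz, smul_eq_mul, smul_eq_mul, partCoeff_add,
      mul_comm g, ih, ih, Finset.sum_powerset_insert hi]
    congr 1
    · refine Finset.sum_congr rfl fun J hJ => ?_
      rw [Finset.mem_powerset] at hJ
      rw [Finset.insert_sdiff_of_notMem _ fun h => hi (hJ h), partCoeff_insert]
      simp [hi]
    · refine Finset.sum_congr rfl fun J hJ => ?_
      rw [Finset.mem_powerset] at hJ
      rw [partCoeff_insert fun h => hi (hJ h), Finset.insert_sdiff_insert,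
        Finset.sdiff_insert_of_notMem hi]

theorem partCoeff_weightDer (I : Finset ι) (m : ι → ℕ) (f : MvPolynomial ℕ K) :
    partCoeff I m (weightDer K f) = (∑ i ∈ I, (m i : K)) * partCoeff I m f := by
  have hc : ∀ f : MvPolynomial ℕ K, constantCoeff (weightDer K f) = 0 := by
    intro f
    rw [constantCoeff_eq, coeff_weightDer]
    simp
  have hcomm : ∀ x (f : MvPolynomial ℕ K), pderiv x (weightDer K f) =
      weightDer K (pderiv x f) + (x : K) • pderiv x f := by
    intro x f
    have h : ⁅pderiv (R := K) x, weightDer K⁆ = (x : K) • pderiv (R := K) x := by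
      refine derivation_ext fun i => ?_
      simp only [Derivation.commutator_apply, pderiv_X, Pi.single_apply, weightDer, mkDerivation_X,
        Derivation.smul_apply, Derivation.map_smul]
      split_ifs with h <;> simp [h]
    have := congrArg (fun D => D f) h
    simp only [Derivation.commutator_apply, Derivation.smul_apply] at this
    rw [← this]
    abel
  induction I using Finset.induction_on generalizing f with
  | empty => simp [partCoeff_empty, hc]
  | insert i I hi ih =>
    rw [partCoeff_insert hi, hcomm, partCoeff_add, partCoeff_smul,
      ih, partCoeff_insert hi, Finset.sum_insert hi]
    ring

/-- Each derivative `∂_{m i}` passes `mergeDer K x` at the cost of a term `(m i + x) ∂_{m i + x}`,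
and what remains has no constant term. The term with label `i` means that `i` has been joined with
an end of weight `x`. -/
theorem partCoeff_mergeDer (I : Finset ι) (m : ι → ℕ) (hm : ∀ i ∈ I, 1 ≤ m i) (x : ℕ)
    (f : MvPolynomial ℕ K) : partCoeff I m (mergeDer K x f) =
      ∑ i ∈ I, ((m i : K) + x) * partCoeff (I.erase i) m (pderiv (m i + x) f) := by
  have hc : ∀ f : MvPolynomial ℕ K, constantCoeff (mergeDer K x f) = 0 := by
    intro f
    induction f using MvPolynomial.induction_on with
    | C a => simp
    | add p q hp hq => rw [map_add, map_add, hp, hq, add_zero]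
    | mul_X p n hp =>
      rw [Derivation.leibniz, mergeDer, mkDerivation_X, smul_eq_mul, smul_eq_mul, map_add, map_mul,
        map_mul]
      split_ifs <;> simp
  induction I using Finset.induction_on generalizing f with
  | empty => simp [partCoeff_empty, hc]
  | insert i I hi ih =>
    rw [partCoeff_insert hi, pderiv_mergeDer _ _ (hm i (Finset.mem_insert_self _ _)), partCoeff_add,
      partCoeff_smul,
      ih (fun j hj => hm j (Finset.mem_insert_of_mem hj)), Finset.sum_insert hi,
      Finset.erase_insert hi, add_comm]
    congr 1
    refine Finset.sum_congr rfl fun j hj => ?_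
    have hij : i ≠ j := fun h => hi (h ▸ hj)
    rw [Finset.erase_insert_of_ne hij, partCoeff_insert, pderiv_comm]
    exact fun h => hi (Finset.mem_of_mem_erase h)

/-- The recursion for the labelled coefficients of the generating polynomials. -/
theorem partCoeff_hurwitzPoly_succ [CharZero K] (b c : K) (I : Finset ι) (m : ι → ℕ)
    (hm : ∀ i ∈ I, 1 ≤ m i) (k : ℕ) :
    (∑ i ∈ I, (m i : K)) * partCoeff I m (hurwitzPoly b c (k + 1)) =
      ∑ i ∈ I, partCoeff (I.erase i) m (recTerm b (hurwitzPoly b c) k (m i)) := by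
  obtain ⟨N₀, hN₀⟩ := hurwitzPoly_total b c k
  -- The range of `x` has to contain all parts, so that each label appears for exactly one `x`.
  rw [← partCoeff_weightDer, hN₀ (max N₀ (I.sup m + 1)) (le_max_left _ _), partCoeff_sum]
  simp only [partCoeff_X_mul]
  rw [Finset.sum_comm' (t' := I) (s' := fun i => {m i})]
  · simp
  · intro x i
    simp only [Finset.mem_Ico, Finset.mem_filter, Finset.mem_singleton]
    constructor
    · rintro ⟨_, h, rfl⟩
      exact ⟨rfl, h⟩
    · rintro ⟨rfl, h⟩
      have := Finset.le_sup (f := m) h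
      exact ⟨⟨hm i h, by omega⟩, h, rfl⟩

end Labelled

end BHurwitz

namespace BHurwitz

/-! ### Covers with sets of nodes -/

section NodeCover

variable {N : Type*} [LinearOrder N]

/-- Attach the left end `i` at a new vertex `v`. -/
def attach (Γ : N → Multiset (N × ℕ)) (i v : N) (w : ℕ) : N → Multiset (N × ℕ) :=
  Function.update (Function.update Γ v (Γ i + Γ v)) i {(v, w)}

theorem attach_left (Γ : N → Multiset (N × ℕ)) (i v : N) (w : ℕ) :
    attach Γ i v w i = {(v, w)} := Function.update_self _ _ _

theorem attach_vertex (Γ : N → Multiset (N × ℕ)) {i v : N} (h : i ≠ v) (w : ℕ) :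
    attach Γ i v w v = Γ i + Γ v := by
  rw [attach, Function.update_of_ne h.symm, Function.update_self]

theorem attach_of_ne (Γ : N → Multiset (N × ℕ)) {i v s : N} (hi : s ≠ i) (hv : s ≠ v) (w : ℕ) :
    attach Γ i v w s = Γ s := by
  rw [attach, Function.update_of_ne hi, Function.update_of_ne hv]

/-- The edges with end `v`, in a graph that is given by the edges `(end, weight)` starting at each
node. -/
def inEdges [Fintype N] (Γ : N → Multiset (N × ℕ)) (v : N) : Multiset (N × ℕ) :=
  ∑ s, (Γ s).filter fun e => e.1 = v

/-- Left labels, inner vertices and right labels, ordered from left to right. -/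
structure NodeSets (I U R : Finset N) : Prop where
  left_lt : ∀ i ∈ I, ∀ u ∈ U, i < u
  left_lt_right : ∀ i ∈ I, ∀ r ∈ R, i < r
  lt_right : ∀ u ∈ U, ∀ r ∈ R, u < r

/-- The facts about a new leftmost vertex. -/
theorem NodeSets.new_vertex {I U R : Finset N} {v : N} (hN : NodeSets I (insert v U) R)
    (hv : ∀ u ∈ U, v < u) :
    v ∉ I ∧ v ∉ U ∧ v ∉ R ∧ ∀ i ∈ I, i ≠ v ∧ i ∉ U :=
  ⟨fun h => lt_irrefl _ (hN.left_lt v h v (Finset.mem_insert_self _ _)),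
    fun h => lt_irrefl _ (hv v h),
    fun h => lt_irrefl _ (hN.lt_right v (Finset.mem_insert_self _ _) v h),
    fun i hi => ⟨(hN.left_lt i hi v (Finset.mem_insert_self _ _)).ne,
      fun h => lt_irrefl _ (hN.left_lt i hi i (Finset.mem_insert_of_mem h))⟩⟩

/-- The left ends at the vertex `v`. -/
def leftEndsAt (I : Finset N) (m : N → ℕ) (Γ : N → Multiset (N × ℕ)) (v : N) : Finset N :=
  I.filter fun i => Γ i = {(v, m i)}

variable [Fintype N]

theorem mem_inEdges {Γ : N → Multiset (N × ℕ)} {v : N} {e : N × ℕ} :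
    e ∈ inEdges Γ v ↔ e.1 = v ∧ ∃ s, e ∈ Γ s := by
  rw [inEdges, Multiset.mem_sum]
  simp only [Finset.mem_univ, true_and, Multiset.mem_filter]
  tauto

/-- The replaced edges are added on the left side, which avoids subtraction of multisets. -/
theorem inEdges_update (Γ : N → Multiset (N × ℕ)) (i : N) (X : Multiset (N × ℕ)) (v : N) :
    inEdges (Function.update Γ i X) v + (Γ i).filter (fun e => e.1 = v) =
      inEdges Γ v + X.filter fun e => e.1 = v := by
  rw [inEdges, inEdges, ← Finset.add_sum_erase _ _ (Finset.mem_univ i),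
    ← Finset.add_sum_erase Finset.univ (fun s => (Γ s).filter fun e => e.1 = v)
      (Finset.mem_univ i), Function.update_self,
    Finset.sum_congr rfl (g := fun s => (Γ s).filter fun e => e.1 = v)]
  · abel
  · intro s hs
    rw [Function.update_of_ne (Finset.ne_of_mem_erase hs)]

/-- The total weight of a multiset of edges. -/
def wsum (s : Multiset (N × ℕ)) : ℕ := (s.map Prod.snd).sum

/-- Tropical covers, not necessarily connected, with left ends `I` of weights `m`, inner vertices
`U` and right ends `R` of weight one. -/
structure IsNodeCover (I U R : Finset N) (m : N → ℕ) (Γ : N → Multiset (N × ℕ)) : Prop where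
  eq_zero : ∀ s, s ∉ I → s ∉ U → Γ s = 0
  mem : ∀ s, ∀ e ∈ Γ s, e.1 ∈ U ∨ e.1 ∈ R
  lt : ∀ s, ∀ e ∈ Γ s, s < e.1
  pos : ∀ s, ∀ e ∈ Γ s, 0 < e.2
  left : ∀ i ∈ I, ∃ t, Γ i = {(t, m i)}
  right : ∀ j ∈ R, inEdges Γ j = {(j, 1)}
  valence : ∀ v ∈ U, ((inEdges Γ v).card = 1 ∧ (Γ v).card = 1) ∨
    ((inEdges Γ v).card = 1 ∧ (Γ v).card = 2) ∨ ((inEdges Γ v).card = 2 ∧ (Γ v).card = 1)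
  balanced : ∀ v ∈ U, wsum (inEdges Γ v) = wsum (Γ v)

/-- Two nodes are linked by edges with starting points in `S`. -/
def Linked (Γ : N → Multiset (N × ℕ)) (S : Set N) : N → N → Prop :=
  Relation.EqvGen fun x y => x ∈ S ∧ ∃ w, (y, w) ∈ Γ x

/-- Connectedness; the left ends do not matter. -/
def NodeConnected (U R : Finset N) (Γ : N → Multiset (N × ℕ)) : Prop :=
  ∀ x ∈ U ∪ R, ∀ y ∈ U ∪ R, Linked Γ U x y

theorem inEdges_attach (Γ : N → Multiset (N × ℕ)) {i v : N} (h : i ≠ v) (w : ℕ) (x : N) :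
    inEdges (attach Γ i v w) x = inEdges Γ x + ({(v, w)} : Multiset (N × ℕ)).filter
      fun e => e.1 = x := by
  have h1 := inEdges_update (Function.update Γ v (Γ i + Γ v)) i {(v, w)} x
  have h2 := inEdges_update Γ v (Γ i + Γ v) x
  rw [Function.update_of_ne h] at h1
  rw [Multiset.filter_add, ← add_assoc] at h2
  have h3 := add_right_cancel h2
  rw [h3, add_right_comm] at h1
  exact add_right_cancel h1

theorem inEdges_attach_of_ne (Γ : N → Multiset (N × ℕ)) {i v x : N} (h : i ≠ v) (w : ℕ)
    (hx : x ≠ v) : inEdges (attach Γ i v w) x = inEdges Γ x := by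
  rw [inEdges_attach Γ h, Multiset.filter_singleton, if_neg (Ne.symm hx)]
  exact add_zero _

theorem inEdges_update_zero {Γ : N → Multiset (N × ℕ)} {j : N} (hj : Γ j = 0) (v : N) (w : ℕ)
    (x : N) : inEdges (Function.update Γ j {(v, w)}) x = inEdges Γ x +
      ({(v, w)} : Multiset (N × ℕ)).filter fun e => e.1 = x := by
  have h := inEdges_update Γ j {(v, w)} x
  rwa [hj, Multiset.filter_zero, add_zero] at h

theorem IsNodeCover.notMem_of_new {I U R : Finset N} {m : N → ℕ} {Γ : N → Multiset (N × ℕ)}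
    (h : IsNodeCover I U R m Γ) {v : N} (hU : v ∉ U) (hR : v ∉ R) : inEdges Γ v = 0 := by
  rw [Multiset.eq_zero_iff_forall_notMem]
  intro e he
  rw [mem_inEdges] at he
  obtain ⟨rfl, s, hs⟩ := he
  rcases h.mem s e hs with h1 | h1
  · exact hU h1
  · exact hR h1

variable {I U R : Finset N} {m : N → ℕ} {v : N}

/-- Adding a new leftmost vertex to a cover. -/
theorem IsNodeCover.insert_vertex {I' : Finset N} {m' : N → ℕ} {Γ Γ' : N → Multiset (N × ℕ)}
    (hN : NodeSets I (insert v U) R) (hv : ∀ u ∈ U, v < u) (h : IsNodeCover I' U R m' Γ')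
    (hU : ∀ u ∈ U, Γ u = Γ' u) (hin : ∀ x, x ≠ v → inEdges Γ x = inEdges Γ' x)
    (hI : ∀ j ∈ I, (Γ j = {(v, m j)} ∧ 0 < m j) ∨ (j ∈ I' ∧ Γ j = Γ' j ∧ m j = m' j))
    (hz : ∀ s, s ∉ I → s ∉ insert v U → Γ s = 0) (hvΓ : ∀ e ∈ Γ v, ∃ s, e ∈ Γ' s)
    (hval : ((inEdges Γ v).card = 1 ∧ (Γ v).card = 1) ∨
      ((inEdges Γ v).card = 1 ∧ (Γ v).card = 2) ∨ ((inEdges Γ v).card = 2 ∧ (Γ v).card = 1))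
    (hbal : wsum (inEdges Γ v) = wsum (Γ v)) : IsNodeCover I (insert v U) R m Γ := by
  have hvU : ∀ u ∈ U, u ≠ v := fun u hu => (hv u hu).ne'
  have hvR : ∀ r ∈ R, v < r := fun r hr => hN.lt_right v (Finset.mem_insert_self _ _) r hr
  have hall : ∀ s, ∀ e ∈ Γ s, (e.1 ∈ insert v U ∨ e.1 ∈ R) ∧ s < e.1 ∧ 0 < e.2 := by
    intro s e he
    have hold : e ∈ Γ' s → (e.1 ∈ insert v U ∨ e.1 ∈ R) ∧ s < e.1 ∧ 0 < e.2 := fun h' =>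
      ⟨(h.mem s e h').imp_left Finset.mem_insert_of_mem, h.lt s e h', h.pos s e h'⟩
    by_cases hsI : s ∈ I
    · rcases hI s hsI with ⟨h1, h2⟩ | ⟨_, h1, _⟩
      · rw [h1, Multiset.mem_singleton] at he
        subst he
        exact ⟨Or.inl (Finset.mem_insert_self _ _),
          hN.left_lt s hsI v (Finset.mem_insert_self _ _), h2⟩
      · exact hold (h1 ▸ he)
    by_cases hsU : s ∈ insert v U
    · rcases Finset.mem_insert.mp hsU with rfl | hsU
      · obtain ⟨s', hs'⟩ := hvΓ e he
        refine ⟨(h.mem s' e hs').imp_left Finset.mem_insert_of_mem, ?_, h.pos s' e hs'⟩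
        rcases h.mem s' e hs' with h1 | h1
        · exact hv _ h1
        · exact hvR _ h1
      · exact hold (hU s hsU ▸ he)
    · rw [hz s hsI hsU] at he
      exact absurd he (Multiset.notMem_zero _)
  refine ⟨hz, fun s e he => (hall s e he).1, fun s e he => (hall s e he).2.1,
    fun s e he => (hall s e he).2.2, ?_, ?_, ?_, ?_⟩
  · intro j hj
    rcases hI j hj with ⟨h1, _⟩ | ⟨h1, h2, h3⟩
    · exact ⟨v, h1⟩
    · rw [h2, h3]
      exact h.left j h1
  · intro r hr
    rw [hin r (hvR r hr).ne']
    exact h.right r hr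
  · intro u hu
    rcases Finset.mem_insert.mp hu with rfl | hu
    · exact hval
    · rw [hU u hu, hin u (hvU u hu)]
      exact h.valence u hu
  · intro u hu
    rcases Finset.mem_insert.mp hu with rfl | hu
    · exact hbal
    · rw [hU u hu, hin u (hvU u hu)]
      exact h.balanced u hu

/-- Removing the leftmost vertex from a cover. -/
theorem IsNodeCover.remove_vertex {I' : Finset N} {m' : N → ℕ} {Γ Γ' : N → Multiset (N × ℕ)}
    (hN : NodeSets I (insert v U) R) (hv : ∀ u ∈ U, v < u)
    (h : IsNodeCover I (insert v U) R m Γ)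
    (hU : ∀ u ∈ U, Γ u = Γ' u) (hin : ∀ x, x ≠ v → inEdges Γ x = inEdges Γ' x)
    (hI : ∀ j ∈ I', (j ≤ v ∧ ∃ t, Γ' j = {(t, m' j)} ∧ (t, m' j) ∈ Γ v) ∨
      (j ∈ I ∧ Γ' j = Γ j ∧ m' j = m j ∧ (v, m j) ∉ Γ j))
    (hz : ∀ s, s ∉ I' → s ∉ U → Γ' s = 0) : IsNodeCover I' U R m' Γ' := by
  have hvR : ∀ r ∈ R, v < r := fun r hr => hN.lt_right v (Finset.mem_insert_self _ _) r hr
  have hall : ∀ s, ∀ e ∈ Γ' s, (e.1 ∈ U ∨ e.1 ∈ R) ∧ s < e.1 ∧ 0 < e.2 := by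
    intro s e he
    have hold : e ∈ Γ s → e.1 ≠ v → (e.1 ∈ U ∨ e.1 ∈ R) ∧ s < e.1 ∧ 0 < e.2 := fun h' hne =>
      ⟨(h.mem s e h').imp_left fun h1 => (Finset.mem_insert.mp h1).resolve_left hne, h.lt s e h',
        h.pos s e h'⟩
    by_cases hsI : s ∈ I'
    · rcases hI s hsI with ⟨hsv, t, ht, htv⟩ | ⟨h1, h2, h3, h4⟩
      · rw [ht, Multiset.mem_singleton] at he
        subst he
        have hlt := h.lt v _ htv
        refine ⟨(h.mem v _ htv).imp_left fun h1 => (Finset.mem_insert.mp h1).resolve_left hlt.ne',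
          hsv.trans_lt hlt, h.pos v _ htv⟩
      · rw [h2] at he
        refine hold he fun he1 => h4 ?_
        obtain ⟨t, ht⟩ := h.left s h1
        rw [ht, Multiset.mem_singleton] at he
        rw [ht, Multiset.mem_singleton, ← he1, he]
    by_cases hsU : s ∈ U
    · rw [← hU s hsU] at he
      exact hold he ((hv s hsU).trans (h.lt s e he)).ne'
    · rw [hz s hsI hsU] at he
      exact absurd he (Multiset.notMem_zero _)
  refine ⟨hz, fun s e he => (hall s e he).1, fun s e he => (hall s e he).2.1,
    fun s e he => (hall s e he).2.2, ?_, ?_, ?_, ?_⟩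
  · intro j hj
    rcases hI j hj with ⟨_, t, ht, _⟩ | ⟨h1, h2, h3, _⟩
    · exact ⟨t, ht⟩
    · rw [h2, h3]
      exact h.left j h1
  · intro r hr
    rw [← hin r (hvR r hr).ne']
    exact h.right r hr
  · intro u hu
    rw [← hU u hu, ← hin u (hv u hu).ne']
    exact h.valence u (Finset.mem_insert_of_mem hu)
  · intro u hu
    rw [← hU u hu, ← hin u (hv u hu).ne']
    exact h.balanced u (Finset.mem_insert_of_mem hu)

/-- Edges go from left to right and `v` is the leftmost vertex, so whatever enters `v` comes from a
left end. -/
theorem IsNodeCover.inEdges_min (hN : NodeSets I (insert v U) R) (hv : ∀ u ∈ U, v < u)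
    {Γ : N → Multiset (N × ℕ)} (h : IsNodeCover I (insert v U) R m Γ) :
    inEdges Γ v = (leftEndsAt I m Γ v).val.map fun i => (v, m i) := by
  have h1 : ∀ s, (Γ s).filter (fun e => e.1 = v) =
      if s ∈ leftEndsAt I m Γ v then {(v, m s)} else 0 := by
    intro s
    simp only [leftEndsAt, Finset.mem_filter]
    by_cases hs : s ∈ I
    · obtain ⟨t, ht⟩ := h.left s hs
      rw [ht, Multiset.filter_singleton]
      by_cases htv : t = v
      · rw [if_pos htv, htv, if_pos ⟨hs, rfl⟩]
      · rw [if_neg htv, if_neg]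
        · rfl
        · rintro ⟨_, h2⟩
          exact htv (by simpa using h2)
    · rw [if_neg fun h => hs h.1, Multiset.filter_eq_nil]
      rintro e he rfl
      by_cases hsU : s ∈ insert e.1 U
      · rcases Finset.mem_insert.mp hsU with h2 | h2
        · exact lt_irrefl _ (h2 ▸ h.lt s e he)
        · exact lt_asymm (hv s h2) (h.lt s e he)
      · rw [h.eq_zero s hs hsU] at he
        exact Multiset.notMem_zero _ he
  rw [inEdges]
  simp only [h1]
  rw [Finset.sum_ite_mem, Finset.univ_inter, Finset.sum_eq_multiset_sum]
  conv_rhs => rw [← Multiset.sum_map_singleton (Multiset.map _ _), Multiset.map_map]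
  rfl

end NodeCover

end BHurwitz

/-! ### Adding and removing a leftmost vertex: twists, joins and splits -/

namespace BHurwitz

section NodeCover

variable {N : Type*} [LinearOrder N]

theorem attach_detach {Γ : N → Multiset (N × ℕ)} {i v : N} {w : ℕ} {X Y : Multiset (N × ℕ)}
    (hiv : i ≠ v) (hi : Γ i = {(v, w)}) (hXY : X + Y = Γ v) :
    attach (Function.update (Function.update Γ i X) v Y) i v w = Γ := by
  funext s
  by_cases hs : s = i
  · rw [hs, attach_left, hi]
  by_cases hsv : s = v
  · rw [hsv, attach_vertex _ hiv, Function.update_of_ne hiv, Function.update_self,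
      Function.update_self, hXY]
  · rw [attach_of_ne _ hs hsv, Function.update_of_ne hsv, Function.update_of_ne hs]

theorem detach_attach (Γ : N → Multiset (N × ℕ)) {i v : N} (w : ℕ) :
    Function.update (Function.update (attach Γ i v w) i (Γ i)) v (Γ v) = Γ := by
  funext s
  by_cases hsv : s = v
  · rw [hsv, Function.update_self]
  by_cases hs : s = i
  · rw [hs, Function.update_of_ne (hs ▸ hsv), Function.update_self]
  · rw [Function.update_of_ne hsv, Function.update_of_ne hs, attach_of_ne _ hs hsv]

variable [Fintype N] {I U R : Finset N} {m : N → ℕ} {v : N}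

/-- A `2`-valent leftmost vertex subdivides the left end `i`; in the smaller cover this end is the
edge that leaves `v`. -/
theorem IsNodeCover.attach_twist (hN : NodeSets I (insert v U) R) (hv : ∀ u ∈ U, v < u)
    {Γ : N → Multiset (N × ℕ)} (h : IsNodeCover I U R m Γ) {i : N} (hi : i ∈ I) :
    IsNodeCover I (insert v U) R m (attach Γ i v (m i)) := by
  obtain ⟨hvI, hvU, hvR, hIv⟩ := hN.new_vertex hv
  obtain ⟨hiv, hiU⟩ := hIv i hi
  have hΓv : Γ v = 0 := h.eq_zero v hvI hvU
  obtain ⟨t, ht⟩ := h.left i hi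
  have hmem : (t, m i) ∈ Γ i := by rw [ht]; exact Multiset.mem_singleton_self _
  have hin : inEdges (attach Γ i v (m i)) v = {(v, m i)} := by
    rw [inEdges_attach Γ hiv, h.notMem_of_new hvU hvR, zero_add, Multiset.filter_singleton,
      if_pos rfl]
  have hout : attach Γ i v (m i) v = {(t, m i)} := by
    rw [attach_vertex Γ hiv, hΓv, add_zero, ht]
  refine h.insert_vertex hN hv ?_ (fun x hx => inEdges_attach_of_ne Γ hiv _ hx) ?_ ?_ ?_ ?_ ?_
  · intro u hu
    exact attach_of_ne Γ (ne_of_mem_of_not_mem hu hiU) (ne_of_mem_of_not_mem hu hvU) _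
  · intro j hj
    by_cases hji : j = i
    · subst hji
      exact Or.inl ⟨attach_left _ _ _ _, h.pos j _ hmem⟩
    · exact Or.inr ⟨hj, attach_of_ne Γ hji (hIv j hj).1 _, rfl⟩
  · intro s hsI hsU
    rw [Finset.mem_insert, not_or] at hsU
    rw [attach_of_ne Γ (ne_of_mem_of_not_mem hi hsI).symm hsU.1, h.eq_zero s hsI hsU.2]
  · intro e he
    rw [hout, ← ht] at he
    exact ⟨i, he⟩
  · rw [hin, hout]
    simp
  · rw [hin, hout]
    simp [wsum]

theorem IsNodeCover.detach_twist (hN : NodeSets I (insert v U) R) (hv : ∀ u ∈ U, v < u)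
    {Γ : N → Multiset (N × ℕ)} (h : IsNodeCover I (insert v U) R m Γ) {i : N}
    (hi : leftEndsAt I m Γ v = {i}) (hout : (Γ v).card = 1) :
    IsNodeCover I U R m (Function.update (Function.update Γ i (Γ v)) v 0) := by
  obtain ⟨hvI, hvU, hvR, hIv⟩ := hN.new_vertex hv
  have hi' : i ∈ leftEndsAt I m Γ v := by rw [hi]; exact Finset.mem_singleton_self _
  rw [leftEndsAt, Finset.mem_filter] at hi'
  obtain ⟨hiI, hΓi⟩ := hi'
  obtain ⟨hiv, hiU⟩ := hIv i hiI
  have hΓ := attach_detach hiv hΓi (add_zero (Γ v))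
  obtain ⟨⟨t, w⟩, ht⟩ := Multiset.card_eq_one.mp hout
  have hw : w = m i := by
    have := h.balanced v (Finset.mem_insert_self _ _)
    rw [h.inEdges_min hN hv, hi, ht] at this
    simpa [wsum] using this.symm
  subst hw
  refine h.remove_vertex hN hv ?_ (fun x hx => ?_) ?_ ?_
  · intro u hu
    rw [Function.update_of_ne (ne_of_mem_of_not_mem hu hvU), Function.update_of_ne
      (ne_of_mem_of_not_mem hu hiU)]
  · conv_lhs => rw [← hΓ]
    exact inEdges_attach_of_ne _ hiv _ hx
  · intro j hj
    by_cases hji : j = i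
    · subst hji
      refine Or.inl ⟨(hN.left_lt j hj v (Finset.mem_insert_self _ _)).le, t, ?_, ?_⟩
      · rw [Function.update_of_ne hiv, Function.update_self, ht]
      · rw [ht]
        exact Multiset.mem_singleton_self _
    · refine Or.inr ⟨hj, ?_, rfl, fun hm => hji ?_⟩
      · rw [Function.update_of_ne (hIv j hj).1, Function.update_of_ne hji]
      · rw [← Finset.mem_singleton, ← hi, leftEndsAt, Finset.mem_filter]
        refine ⟨hj, ?_⟩
        obtain ⟨t', ht'⟩ := h.left j hj
        rw [ht', Multiset.mem_singleton] at hm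
        rw [ht', hm]
  · intro s hsI hsU
    by_cases hsv : s = v
    · rw [hsv, Function.update_self]
    · rw [Function.update_of_ne hsv, Function.update_of_ne (ne_of_mem_of_not_mem hiI hsI).symm]
      exact h.eq_zero s hsI (by simp [hsv, hsU])

/-- In the smaller cover the joined end keeps the label `i` with the sum of the weights, and the
label `j` is free. -/
theorem IsNodeCover.attach_join (hN : NodeSets I (insert v U) R) (hv : ∀ u ∈ U, v < u)
    (hm : ∀ i ∈ I, 0 < m i) {i j : N} (hi : i ∈ I) (hj : j ∈ I) (hij : i ≠ j)
    {Γ : N → Multiset (N × ℕ)}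
    (h : IsNodeCover (I.erase j) U R (Function.update m i (m i + m j)) Γ) :
    IsNodeCover I (insert v U) R m (Function.update (attach Γ i v (m i)) j {(v, m j)}) := by
  obtain ⟨hvI, hvU, hvR, hIv⟩ := hN.new_vertex hv
  obtain ⟨hiv, hiU⟩ := hIv i hi
  obtain ⟨hjv, hjU⟩ := hIv j hj
  have hΓv : Γ v = 0 := h.eq_zero v (fun h => hvI (Finset.mem_of_mem_erase h)) hvU
  have hΓj : Γ j = 0 := h.eq_zero j (Finset.notMem_erase _ _) hjU
  have hΓj' : attach Γ i v (m i) j = 0 := by rw [attach_of_ne _ hij.symm hjv, hΓj]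
  obtain ⟨t, ht⟩ := h.left i (Finset.mem_erase.mpr ⟨hij, hi⟩)
  rw [Function.update_self] at ht
  have hin : inEdges (Function.update (attach Γ i v (m i)) j {(v, m j)}) v =
      {(v, m i)} + {(v, m j)} := by
    rw [inEdges_update_zero hΓj', inEdges_attach Γ hiv, h.notMem_of_new hvU hvR, zero_add,
      Multiset.filter_singleton, if_pos rfl, Multiset.filter_singleton, if_pos rfl]
  have hout : Function.update (attach Γ i v (m i)) j {(v, m j)} v = {(t, m i + m j)} := by
    rw [Function.update_of_ne hjv.symm, attach_vertex Γ hiv, hΓv, add_zero, ht]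
  refine h.insert_vertex hN hv ?_ (fun x hx => ?_) ?_ ?_ ?_ ?_ ?_
  · intro u hu
    rw [Function.update_of_ne (ne_of_mem_of_not_mem hu hjU),
      attach_of_ne Γ (ne_of_mem_of_not_mem hu hiU) (ne_of_mem_of_not_mem hu hvU) _]
  · rw [inEdges_update_zero hΓj', inEdges_attach_of_ne Γ hiv _ hx, Multiset.filter_singleton,
      if_neg (Ne.symm hx)]
    exact add_zero _
  · intro l hl
    by_cases hlj : l = j
    · subst hlj
      exact Or.inl ⟨Function.update_self _ _ _, hm l hl⟩
    rw [Function.update_of_ne hlj]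
    by_cases hli : l = i
    · subst hli
      exact Or.inl ⟨attach_left _ _ _ _, hm l hl⟩
    · refine Or.inr ⟨Finset.mem_erase.mpr ⟨hlj, hl⟩, attach_of_ne Γ hli (hIv l hl).1 _, ?_⟩
      rw [Function.update_of_ne hli]
  · intro s hsI hsU
    rw [Finset.mem_insert, not_or] at hsU
    rw [Function.update_of_ne (ne_of_mem_of_not_mem hj hsI).symm,
      attach_of_ne Γ (ne_of_mem_of_not_mem hi hsI).symm hsU.1,
      h.eq_zero s (fun h => hsI (Finset.mem_of_mem_erase h)) hsU.2]
  · intro e he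
    rw [hout, ← ht] at he
    exact ⟨i, he⟩
  · rw [hin, hout]
    simp
  · rw [hin, hout]
    simp [wsum]

theorem IsNodeCover.detach_join (hN : NodeSets I (insert v U) R) (hv : ∀ u ∈ U, v < u)
    {Γ : N → Multiset (N × ℕ)} (h : IsNodeCover I (insert v U) R m Γ) {i j : N} (hij : i ≠ j)
    (hi : leftEndsAt I m Γ v = {i, j}) :
    IsNodeCover (I.erase j) U R (Function.update m i (m i + m j))
      (Function.update (Function.update (Function.update Γ j 0) i (Γ v)) v 0) ∧
    Function.update (attach (Function.update (Function.update (Function.update Γ j 0) i (Γ v)) v 0)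
      i v (m i)) j {(v, m j)} = Γ := by
  obtain ⟨hvI, hvU, hvR, hIv⟩ := hN.new_vertex hv
  have hi' : i ∈ leftEndsAt I m Γ v := by rw [hi]; simp
  have hj' : j ∈ leftEndsAt I m Γ v := by rw [hi]; simp
  rw [leftEndsAt, Finset.mem_filter] at hi' hj'
  obtain ⟨hiI, hΓi⟩ := hi'
  obtain ⟨hjI, hΓj⟩ := hj'
  obtain ⟨hiv, hiU⟩ := hIv i hiI
  obtain ⟨hjv, hjU⟩ := hIv j hjI
  have hΓ0 := attach_detach (Γ := Function.update Γ j 0) (X := Γ v) (Y := 0) (w := m i) hiv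
    (by rw [Function.update_of_ne hij, hΓi]) (by rw [add_zero, Function.update_of_ne hjv.symm])
  have hΓ : Function.update (attach (Function.update (Function.update (Function.update Γ j 0) i
      (Γ v)) v 0) i v (m i)) j {(v, m j)} = Γ := by
    rw [hΓ0, Function.update_idem, ← hΓj, Function.update_eq_self]
  refine ⟨?_, hΓ⟩
  have hin : inEdges Γ v = {(v, m i), (v, m j)} := by
    rw [h.inEdges_min hN hv, hi, Finset.insert_val_of_notMem (by simpa using hij)]
    rfl
  have hout : (Γ v).card = 1 := by
    rcases h.valence v (Finset.mem_insert_self _ _) with h1 | h1 | h1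
    · exact h1.2
    · rw [hin] at h1
      simp at h1
    · exact h1.2
  obtain ⟨⟨t, w⟩, ht⟩ := Multiset.card_eq_one.mp hout
  have hw : w = m i + m j := by
    have := h.balanced v (Finset.mem_insert_self _ _)
    rw [hin, ht] at this
    simpa [wsum] using this.symm
  subst hw
  refine h.remove_vertex hN hv ?_ (fun x hx => ?_) ?_ ?_
  · intro u hu
    rw [Function.update_of_ne (ne_of_mem_of_not_mem hu hvU), Function.update_of_ne
      (ne_of_mem_of_not_mem hu hiU),
      Function.update_of_ne (ne_of_mem_of_not_mem hu hjU)]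
  · conv_lhs => rw [← hΓ]
    rw [inEdges_update_zero (by rw [hΓ0, Function.update_self]), inEdges_attach_of_ne _ hiv _ hx,
      Multiset.filter_singleton, if_neg (Ne.symm hx)]
    exact add_zero _
  · intro l hl
    rw [Finset.mem_erase] at hl
    by_cases hli : l = i
    · subst hli
      refine Or.inl ⟨(hN.left_lt l hl.2 v (Finset.mem_insert_self _ _)).le, t, ?_, ?_⟩
      · rw [Function.update_of_ne hiv, Function.update_self, Function.update_self, ht]
      · rw [ht, Function.update_self]
        exact Multiset.mem_singleton_self _
    · refine Or.inr ⟨hl.2, ?_, Function.update_of_ne hli _ _, fun hm => ?_⟩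
      · rw [Function.update_of_ne (hIv l hl.2).1, Function.update_of_ne hli,
          Function.update_of_ne hl.1]
      · have : l ∈ leftEndsAt I m Γ v := by
          rw [leftEndsAt, Finset.mem_filter]
          refine ⟨hl.2, ?_⟩
          obtain ⟨t', ht'⟩ := h.left l hl.2
          rw [ht', Multiset.mem_singleton] at hm
          rw [ht', hm]
        rw [hi, Finset.mem_insert, Finset.mem_singleton] at this
        exact this.elim hli hl.1
  · intro s hsI hsU
    by_cases hsv : s = v
    · rw [hsv, Function.update_self]
    rw [Function.update_of_ne hsv]
    by_cases hsj : s = j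
    · rw [hsj, Function.update_of_ne hij.symm, Function.update_self]
    · rw [Finset.mem_erase, not_and] at hsI
      rw [Function.update_of_ne (ne_of_mem_of_not_mem hiI (hsI hsj)).symm,
        Function.update_of_ne hsj]
      exact h.eq_zero s (hsI hsj) (by simp [hsv, hsU])

/-- The two edges leaving `v` become left ends of the smaller cover. One keeps the label `i`, and
the node `v`, no longer a vertex, serves as the label of the other one. This is why `attach` puts `Γ
i + Γ v` at the vertex. -/
theorem IsNodeCover.attach_split (hN : NodeSets I (insert v U) R) (hv : ∀ u ∈ U, v < u)
    {i : N} (hi : i ∈ I) {x y : ℕ} (hm : m i = x + y) {Γ : N → Multiset (N × ℕ)}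
    (h : IsNodeCover (insert v I) U R (Function.update (Function.update m i x) v y) Γ) :
    IsNodeCover I (insert v U) R m (attach Γ i v (m i)) := by
  obtain ⟨hvI, hvU, hvR, hIv⟩ := hN.new_vertex hv
  obtain ⟨hiv, hiU⟩ := hIv i hi
  obtain ⟨t, ht⟩ := h.left i (Finset.mem_insert_of_mem hi)
  obtain ⟨t', ht'⟩ := h.left v (Finset.mem_insert_self _ _)
  rw [Function.update_of_ne hiv, Function.update_self] at ht
  rw [Function.update_self] at ht'
  have hin : inEdges (attach Γ i v (m i)) v = {(v, m i)} := by
    rw [inEdges_attach Γ hiv, h.notMem_of_new hvU hvR, zero_add, Multiset.filter_singleton,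
      if_pos rfl]
  have hout : attach Γ i v (m i) v = {(t, x)} + {(t', y)} := by
    rw [attach_vertex Γ hiv, ht, ht']
  have hpos : 0 < x := h.pos i (t, x) (by rw [ht]; exact Multiset.mem_singleton_self _)
  refine h.insert_vertex hN hv ?_ (fun x hx => inEdges_attach_of_ne Γ hiv _ hx) ?_ ?_ ?_ ?_ ?_
  · intro u hu
    exact attach_of_ne Γ (ne_of_mem_of_not_mem hu hiU) (ne_of_mem_of_not_mem hu hvU) _
  · intro j hj
    by_cases hji : j = i
    · subst hji
      exact Or.inl ⟨attach_left _ _ _ _, by omega⟩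
    · refine Or.inr ⟨Finset.mem_insert_of_mem hj, attach_of_ne Γ hji (hIv j hj).1 _, ?_⟩
      rw [Function.update_of_ne (hIv j hj).1, Function.update_of_ne hji]
  · intro s hsI hsU
    rw [Finset.mem_insert, not_or] at hsU
    rw [attach_of_ne Γ (ne_of_mem_of_not_mem hi hsI).symm hsU.1,
      h.eq_zero s (by simp [hsU.1, hsI]) hsU.2]
  · intro e he
    rw [hout, ← ht, ← ht', Multiset.mem_add] at he
    exact he.elim (fun h => ⟨i, h⟩) fun h => ⟨v, h⟩
  · rw [hin, hout]
    simp
  · rw [hin, hout]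
    simp [wsum, hm]

theorem IsNodeCover.detach_split (hN : NodeSets I (insert v U) R) (hv : ∀ u ∈ U, v < u)
    {Γ : N → Multiset (N × ℕ)} (h : IsNodeCover I (insert v U) R m Γ) {i : N}
    (hi : leftEndsAt I m Γ v = {i}) {p q : N × ℕ} (hout : Γ v = {p, q}) :
    m i = p.2 + q.2 ∧ IsNodeCover (insert v I) U R
      (Function.update (Function.update m i p.2) v q.2)
      (Function.update (Function.update Γ i {p}) v {q}) := by
  obtain ⟨hvI, hvU, hvR, hIv⟩ := hN.new_vertex hv
  have hi' : i ∈ leftEndsAt I m Γ v := by rw [hi]; exact Finset.mem_singleton_self _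
  rw [leftEndsAt, Finset.mem_filter] at hi'
  obtain ⟨hiI, hΓi⟩ := hi'
  obtain ⟨hiv, hiU⟩ := hIv i hiI
  have hΓ := attach_detach (X := {p}) (Y := {q}) hiv hΓi (by rw [hout]; rfl)
  have hw : m i = p.2 + q.2 := by
    have := h.balanced v (Finset.mem_insert_self _ _)
    rw [h.inEdges_min hN hv, hi, hout] at this
    simpa [wsum] using this
  refine ⟨hw, h.remove_vertex hN hv ?_ (fun x hx => ?_) ?_ ?_⟩
  · intro u hu
    rw [Function.update_of_ne (ne_of_mem_of_not_mem hu hvU), Function.update_of_ne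
      (ne_of_mem_of_not_mem hu hiU)]
  · conv_lhs => rw [← hΓ]
    exact inEdges_attach_of_ne _ hiv _ hx
  · intro j hj
    rcases Finset.mem_insert.mp hj with rfl | hj
    · refine Or.inl ⟨le_rfl, q.1, ?_, ?_⟩
      · rw [Function.update_self, Function.update_self]
      · rw [hout, Function.update_self]
        simp
    by_cases hji : j = i
    · subst hji
      refine Or.inl ⟨(hN.left_lt j hj v (Finset.mem_insert_self _ _)).le, p.1, ?_, ?_⟩
      · rw [Function.update_of_ne hiv, Function.update_self, Function.update_of_ne hiv,
          Function.update_self]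
      · rw [hout, Function.update_of_ne hiv, Function.update_self]
        simp
    · refine Or.inr ⟨hj, ?_, ?_, fun hm => hji ?_⟩
      · rw [Function.update_of_ne (hIv j hj).1, Function.update_of_ne hji]
      · rw [Function.update_of_ne (hIv j hj).1, Function.update_of_ne hji]
      · rw [← Finset.mem_singleton, ← hi, leftEndsAt, Finset.mem_filter]
        refine ⟨hj, ?_⟩
        obtain ⟨t', ht'⟩ := h.left j hj
        rw [ht', Multiset.mem_singleton] at hm
        rw [ht', hm]
  · intro s hsI hsU
    rw [Finset.mem_insert, not_or] at hsI
    rw [Function.update_of_ne hsI.1, Function.update_of_ne (ne_of_mem_of_not_mem hiI hsI.2).symm]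
    exact h.eq_zero s hsI.2 (by simp [hsI.1, hsU])

end NodeCover

end BHurwitz

/-! ### Connectedness, finiteness and weights of covers -/

namespace BHurwitz

open Finset.HasAntidiagonal

section NodeCover

variable {N : Type*}

/-- This is the tool for showing that nodes are not linked: a property that is invariant along all
available edges separates them. -/
theorem Linked.iff_of_closed {Γ : N → Multiset (N × ℕ)} {S : Set N} (P : N → Prop)
    (hP : ∀ x ∈ S, ∀ e ∈ Γ x, (P x ↔ P e.1)) {x y : N} (h : Linked Γ S x y) : P x ↔ P y := by
  induction h with
  | rel x y h =>
    obtain ⟨hx, w, hw⟩ := h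
    exact hP x hx _ hw
  | refl x => rfl
  | symm x y _ ih => exact ih.symm
  | trans x y z _ _ h1 h2 => exact h1.trans h2

theorem Linked.refl (Γ : N → Multiset (N × ℕ)) (S : Set N) (x : N) : Linked Γ S x x :=
  Relation.EqvGen.refl x

theorem Linked.symm {Γ : N → Multiset (N × ℕ)} {S : Set N} {x y : N} (h : Linked Γ S x y) :
    Linked Γ S y x := Relation.EqvGen.symm _ _ h

theorem Linked.trans {Γ : N → Multiset (N × ℕ)} {S : Set N} {x y z : N} (h : Linked Γ S x y)
    (h' : Linked Γ S y z) : Linked Γ S x z := Relation.EqvGen.trans _ _ _ h h'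

theorem Linked.edge {Γ : N → Multiset (N × ℕ)} {S : Set N} {x : N} {e : N × ℕ} (hx : x ∈ S)
    (he : e ∈ Γ x) : Linked Γ S x e.1 := Relation.EqvGen.rel _ _ ⟨hx, e.2, he⟩

theorem Linked.mono {Γ Γ' : N → Multiset (N × ℕ)} {S S' : Set N} (hS : S ⊆ S')
    (h : ∀ x ∈ S, ∀ e ∈ Γ x, e ∈ Γ' x) {x y : N} (hxy : Linked Γ S x y) : Linked Γ' S' x y :=
  Relation.EqvGen.mono (fun x _ ⟨hx, w, hw⟩ => ⟨hS hx, w, h x hx _ hw⟩) x y hxy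

theorem linked_congr {Γ Γ' : N → Multiset (N × ℕ)} {S : Set N} (h : ∀ x ∈ S, Γ x = Γ' x)
    (x y : N) : Linked Γ S x y ↔ Linked Γ' S x y :=
  ⟨Linked.mono subset_rfl fun x hx _ he => h x hx ▸ he,
    Linked.mono subset_rfl fun x hx _ he => (h x hx).symm ▸ he⟩

variable [LinearOrder N]

/-- No edge of the old vertices leads to `v`, so `v` meets the rest only through its outgoing edges.
-/
theorem nodeConnected_insert_iff {U R : Finset N} {v : N} {Γ Γ' : N → Multiset (N × ℕ)}
    (hvR : v ∉ R) (hvU : v ∉ U) (hU : ∀ u ∈ U, Γ u = Γ' u) (hne : ∃ e, e ∈ Γ v)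
    (ht : ∀ e ∈ Γ v, e.1 ∈ U ∪ R) (hUv : ∀ u ∈ U, ∀ e ∈ Γ u, e.1 ≠ v) :
    NodeConnected (insert v U) R Γ ↔ ∀ x ∈ U ∪ R, ∃ e ∈ Γ v, Linked Γ' U x e.1 := by
  have hvS : v ∈ (↑(insert v U) : Set N) := by simp
  have hmono : ∀ x y, Linked Γ' U x y → Linked Γ ↑(insert v U) x y := fun x y h =>
    Linked.mono (by simp) (fun x hx e he => (hU x hx).symm ▸ he) h
  constructor
  · intro h x hx
    have hx' : x ∈ insert v U ∪ R := by
      rw [Finset.insert_union]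
      exact Finset.mem_insert_of_mem hx
    have h1 := h x hx' v (by simp)
    have h2 := Linked.iff_of_closed (fun z => z = v ∨ ∃ e ∈ Γ v, Linked Γ' U z e.1) ?_ h1
    · rcases h2.mpr (Or.inl rfl) with rfl | h3
      · rw [Finset.mem_union] at hx
        exact absurd hx (by simp [hvU, hvR])
      · exact h3
    · intro z hz e he
      rw [Finset.coe_insert, Set.mem_insert_iff] at hz
      rcases hz with rfl | hz
      · exact ⟨fun _ => Or.inr ⟨e, he, Linked.refl _ _ _⟩, fun _ => Or.inl rfl⟩
      · have hz' : z ∈ U := hz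
        have hzv : z ≠ v := fun h => hvU (h ▸ hz')
        have hl : Linked Γ' U z e.1 := Linked.edge hz (by rw [← hU z hz']; exact he)
        simp only [hzv, hUv z hz' e he, false_or]
        exact ⟨fun ⟨e', he', h'⟩ => ⟨e', he', hl.symm.trans h'⟩,
          fun ⟨e', he', h'⟩ => ⟨e', he', hl.trans h'⟩⟩
  · intro h
    have key : ∀ x ∈ insert v U ∪ R, Linked Γ ↑(insert v U) x v := by
      intro x hx
      rw [Finset.insert_union, Finset.mem_insert] at hx
      rcases hx with rfl | hx
      · exact Linked.refl _ _ _
      · obtain ⟨e, he, hl⟩ := h x hx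
        exact (hmono _ _ hl).trans (Linked.edge hvS he).symm
    exact fun x hx y hy => (key x hx).trans (key y hy).symm

variable {I U R : Finset N} {m : N → ℕ} {v : N}

theorem NodeSets.mono (hN : NodeSets I U R) {I' U' R' : Finset N} (hI : I' ⊆ I) (hU : U' ⊆ U)
    (hR : R' ⊆ R) : NodeSets I' U' R' :=
  ⟨fun i hi u hu => hN.left_lt i (hI hi) u (hU hu),
    fun i hi r hr => hN.left_lt_right i (hI hi) r (hR hr),
    fun u hu r hr => hN.lt_right u (hU hu) r (hR hr)⟩

theorem NodeSets.insert_left (hN : NodeSets I (insert v U) R) (hv : ∀ u ∈ U, v < u) :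
    NodeSets (insert v I) U R := by
  refine ⟨fun i hi u hu => ?_, fun i hi r hr => ?_,
    fun u hu r hr => hN.lt_right u (Finset.mem_insert_of_mem hu) r hr⟩
  · rcases Finset.mem_insert.mp hi with rfl | hi
    · exact hv u hu
    · exact hN.left_lt i hi u (Finset.mem_insert_of_mem hu)
  · rcases Finset.mem_insert.mp hi with rfl | hi
    · exact hN.lt_right i (Finset.mem_insert_self _ _) r hr
    · exact hN.left_lt_right i hi r hr

theorem mem_leftEndsAt {Γ : N → Multiset (N × ℕ)} {i : N} :
    i ∈ leftEndsAt I m Γ v ↔ i ∈ I ∧ Γ i = {(v, m i)} := by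
  rw [leftEndsAt, Finset.mem_filter]

variable [Fintype N]

theorem IsNodeCover.vertex_cases (hN : NodeSets I (insert v U) R) (hv : ∀ u ∈ U, v < u)
    {Γ : N → Multiset (N × ℕ)} (h : IsNodeCover I (insert v U) R m Γ) :
    (∃ i, leftEndsAt I m Γ v = {i} ∧ (Γ v).card = 1) ∨
    (∃ i j, i ≠ j ∧ leftEndsAt I m Γ v = {i, j} ∧ (Γ v).card = 1) ∨
    (∃ i, leftEndsAt I m Γ v = {i} ∧ (Γ v).card = 2) := by
  have hc : (inEdges Γ v).card = (leftEndsAt I m Γ v).card := by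
    rw [h.inEdges_min hN hv, Multiset.card_map]
    rfl
  have h1 := h.valence v (Finset.mem_insert_self _ _)
  rw [hc, Finset.card_eq_one, Finset.card_eq_two] at h1
  rcases h1 with ⟨⟨i, hi⟩, h1⟩ | ⟨⟨i, hi⟩, h1⟩ | ⟨⟨i, j, hij, hi⟩, h1⟩
  · exact Or.inl ⟨i, hi, h1⟩
  · exact Or.inr (Or.inr ⟨i, hi, h1⟩)
  · exact Or.inr (Or.inl ⟨i, j, hij, hi, h1⟩)

/-- Every cover arises from a cover with one vertex less by one of the three attachments, and each
of them leaves finitely many choices. -/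
theorem finite_isNodeCover (hN : NodeSets I U R) : {Γ | IsNodeCover I U R m Γ}.Finite := by
  classical
  induction U using Finset.induction_on_min generalizing I m with
  | empty =>
    refine (Set.finite_range fun (f : N → N) (s : N) =>
      if s ∈ I then ({(f s, m s)} : Multiset (N × ℕ)) else 0).subset ?_
    intro Γ h
    have h1 : ∀ i, ∃ t, i ∈ I → Γ i = {(t, m i)} := by
      intro i
      by_cases hi : i ∈ I
      · obtain ⟨t, ht⟩ := h.left i hi
        exact ⟨t, fun _ => ht⟩
      · exact ⟨i, fun h => absurd h hi⟩
    choose f hf using h1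
    refine ⟨f, ?_⟩
    funext s
    dsimp only
    split_ifs with hs
    · exact (hf s hs).symm
    · exact (h.eq_zero s hs (Finset.notMem_empty s)).symm
  | insert v U hv ih =>
    have hN' : ∀ I', I' ⊆ I → NodeSets I' U R := fun I' h =>
      hN.mono h (Finset.subset_insert _ _) subset_rfl
    have f1 : (⋃ i : N, (fun Γ => attach Γ i v (m i)) '' {Γ | IsNodeCover I U R m Γ}).Finite :=
      Set.finite_iUnion fun i => (ih (hN' I subset_rfl)).image _
    have f2 : (⋃ i : N, ⋃ j : N, (fun Γ => Function.update (attach Γ i v (m i)) j {(v, m j)}) ''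
        {Γ | IsNodeCover (I.erase j) U R (Function.update m i (m i + m j)) Γ}).Finite :=
      Set.finite_iUnion fun i => Set.finite_iUnion fun j =>
        (ih (hN' _ (Finset.erase_subset _ _))).image _
    have f3 : (⋃ i : N, ⋃ x ∈ antidiagonal (m i),
        (fun Γ => attach Γ i v (m i)) '' {Γ | IsNodeCover (insert v I) U R
          (Function.update (Function.update m i x.1) v x.2) Γ}).Finite :=
      Set.finite_iUnion fun i => Set.Finite.biUnion (Finset.finite_toSet _) fun x _ =>
        (ih (hN.insert_left hv)).image _
    refine ((f1.union f2).union f3).subset fun Γ h => ?_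
    have h : IsNodeCover I (insert v U) R m Γ := h
    obtain ⟨hvI, hvU, hvR, hIv⟩ := hN.new_vertex hv
    rcases h.vertex_cases hN hv with ⟨i, hi, h1⟩ | ⟨i, j, hij, hi, h1⟩ | ⟨i, hi, h1⟩
    · have hi' := mem_leftEndsAt.mp (hi.symm ▸ Finset.mem_singleton_self i)
      refine Or.inl (Or.inl (Set.mem_iUnion.mpr ⟨i, _, h.detach_twist hN hv hi h1, ?_⟩))
      exact attach_detach (hIv i hi'.1).1 hi'.2 (add_zero _)
    · refine Or.inl (Or.inr (Set.mem_iUnion.mpr ⟨i, Set.mem_iUnion.mpr ⟨j, _,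
        (h.detach_join hN hv hij hi).1, (h.detach_join hN hv hij hi).2⟩⟩))
    · have hi' := mem_leftEndsAt.mp (hi.symm ▸ Finset.mem_singleton_self i)
      obtain ⟨p, q, hpq⟩ := Multiset.card_eq_two.mp h1
      obtain ⟨h2, h3⟩ := h.detach_split hN hv hi hpq
      refine Or.inr (Set.mem_iUnion.mpr ⟨i, Set.mem_biUnion (x := (p.2, q.2)) ?_
        ⟨_, h3, attach_detach (hIv i hi'.1).1 hi'.2 (by rw [hpq]; rfl)⟩⟩)
      exact mem_antidiagonal.mpr h2.symm

open Classical in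
/-- The finite set of covers. -/
noncomputable def coverFinset (I U R : Finset N) (m : N → ℕ) :
    Finset (N → Multiset (N × ℕ)) :=
  if h : {Γ | IsNodeCover I U R m Γ}.Finite then h.toFinset else ∅

theorem mem_coverFinset (hN : NodeSets I U R) {Γ : N → Multiset (N × ℕ)} :
    Γ ∈ coverFinset I U R m ↔ IsNodeCover I U R m Γ := by
  rw [coverFinset, dif_pos (finite_isNodeCover hN), Set.Finite.mem_toFinset]
  rfl

variable {K : Type*} [Field K]

open Classical in
/-- The weight of a vertex of a cover: edges going out, vertex multiplicity, wiener at the vertex,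
and the quotient of the numbers of vertices and right ends of the component to its right. -/
noncomputable def nodeFactor (b : K) (U R : Finset N) (Γ : N → Multiset (N × ℕ)) (v : N) : K :=
  ((Γ v).map fun e => (e.2 : K)).prod *
    (if (Γ v).card = 2 then 2 * (1 + b) else
      if (inEdges Γ v).card = 2 then 2 else b * ((wsum (Γ v) : K) - 1)) *
    (if ∃ x, Γ v = {x, x} then 1 / 2 else 1) *
    (((U.filter fun x => Linked Γ {u | u ∈ U ∧ v ≤ u} v x).card : K) /
      ((R.filter fun x => Linked Γ {u | u ∈ U ∧ v ≤ u} v x).card : K))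

/-- The weight of a cover. -/
noncomputable def coverWeight (b : K) (U R : Finset N) (Γ : N → Multiset (N × ℕ)) : K :=
  ∏ v ∈ U, nodeFactor b U R Γ v

-- In a connected cover the leftmost vertex reaches all vertices and all right ends, so its quotient
-- is `(|U| + 1) / |R|`. The factors of the other vertices look only to the right and do not notice
-- `v`.
open Classical in
theorem coverWeight_insert (b : K) {I' : Finset N} {m' : N → ℕ} {Γ Γ' : N → Multiset (N × ℕ)}
    (hN : NodeSets I (insert v U) R) (hv : ∀ u ∈ U, v < u) (h : IsNodeCover I' U R m' Γ')
    (hU : ∀ u ∈ U, Γ u = Γ' u) (hin : ∀ x, x ≠ v → inEdges Γ x = inEdges Γ' x)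
    (hc : NodeConnected (insert v U) R Γ) :
    coverWeight b (insert v U) R Γ = ((Γ v).map fun e => (e.2 : K)).prod *
      (if (Γ v).card = 2 then 2 * (1 + b) else
        if (inEdges Γ v).card = 2 then 2 else b * ((wsum (Γ v) : K) - 1)) *
      (if ∃ x, Γ v = {x, x} then 1 / 2 else 1) * (((U.card : K) + 1) / R.card) *
      coverWeight b U R Γ' := by
  obtain ⟨hvI, hvU, hvR, hIv⟩ := hN.new_vertex hv
  rw [coverWeight, Finset.prod_insert hvU]
  congr 1
  · have hS : {u | u ∈ insert v U ∧ v ≤ u} = (↑(insert v U) : Set N) := by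
      ext u
      simp only [Set.mem_ofPred_eq, Finset.mem_coe, and_iff_left_iff_imp, Finset.mem_insert]
      rintro (rfl | hu)
      · exact le_rfl
      · exact (hv u hu).le
    have h1 : (insert v U).filter (fun x => Linked Γ ↑(insert v U) v x) = insert v U :=
      Finset.filter_true_of_mem fun x hx => hc v (by simp) x (Finset.mem_union_left _ hx)
    have h2 : R.filter (fun x => Linked Γ ↑(insert v U) v x) = R :=
      Finset.filter_true_of_mem fun x hx => hc v (by simp) x (Finset.mem_union_right _ hx)
    rw [nodeFactor, hS, h1, h2, Finset.card_insert_of_notMem hvU]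
    push_cast
    rfl
  · refine Finset.prod_congr rfl fun u hu => ?_
    have hS : {x | x ∈ insert v U ∧ u ≤ x} = {x | x ∈ U ∧ u ≤ x} := by
      ext x
      simp only [Set.mem_ofPred_eq, Finset.mem_insert]
      constructor
      · rintro ⟨rfl | hx, hux⟩
        · exact absurd hux (hv u hu).not_ge
        · exact ⟨hx, hux⟩
      · exact fun ⟨hx, hux⟩ => ⟨Or.inr hx, hux⟩
    have hl : ∀ x, Linked Γ {x | x ∈ U ∧ u ≤ x} u x ↔ Linked Γ' {x | x ∈ U ∧ u ≤ x} u x :=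
      linked_congr (fun x hx => hU x hx.1) u
    -- All edges used start to the right of `v` and lead further right, so being equal to `v` is
    -- invariant along them.
    have huv : ¬ Linked Γ' {x | x ∈ U ∧ u ≤ x} u v := by
      intro hlv
      have := Linked.iff_of_closed (fun z => z = v) ?_ hlv
      · exact (hv u hu).ne' (this.mpr rfl)
      · intro x hx e he
        have h1 := hv x hx.1
        have h2 := h1.trans (h.lt x e he)
        exact ⟨fun h => absurd h h1.ne', fun h => absurd h h2.ne'⟩
    rw [nodeFactor, nodeFactor, hS, hU u hu, hin u (hv u hu).ne']
    simp only [hl]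
    rw [Finset.filter_insert, if_neg huv]

end NodeCover

end BHurwitz

/-! ### The contributions of the three types of leftmost vertices -/

namespace BHurwitz

open Finset.HasAntidiagonal

section NodeCover

open Classical in
/-- The ways to write a multiset as a pair. -/
noncomputable def splittings {α : Type*} (s : Multiset α) : Finset (α × α) :=
  (s.toFinset ×ˢ s.toFinset).filter fun p => s = {p.1, p.2}

theorem mem_splittings {α : Type*} {s : Multiset α} {p : α × α} :
    p ∈ splittings s ↔ s = {p.1, p.2} := by
  classical
  rw [splittings, Finset.mem_filter, and_iff_right_iff_imp]
  intro h
  rw [Finset.mem_product, Multiset.mem_toFinset, Multiset.mem_toFinset, h]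
  simp

-- Two equal edges can be ordered in one way, two different edges in two ways. Hence the wiener
-- factor is half the number of orderings.
open Classical in
theorem ite_eq_card_splittings {K α : Type*} [Field K] [CharZero K] {s : Multiset α}
    (h : s.card = 2) :
    (if ∃ x, s = {x, x} then (1 / 2 : K) else 1) = ((splittings s).card : K) / 2 := by
  obtain ⟨p, q, rfl⟩ := Multiset.card_eq_two.mp h
  have key : ∀ x y : α, ({p, q} : Multiset α) = {x, y} ↔ (p = x ∧ q = y) ∨ (p = y ∧ q = x) := by
    intro x y
    rw [Multiset.insert_eq_cons, Multiset.insert_eq_cons, Multiset.cons_eq_cons]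
    constructor
    · rintro (⟨h1, h2⟩ | ⟨h1, cs, h2, h3⟩)
      · exact Or.inl ⟨h1, by simpa using h2⟩
      · have hc : cs = 0 := by
          have := congrArg Multiset.card h2
          simpa using this
        subst hc
        exact Or.inr ⟨by simpa [eq_comm] using h3, by simpa using h2⟩
    · rintro (⟨rfl, rfl⟩ | ⟨rfl, rfl⟩)
      · simp
      · by_cases hpq : p = q
        · subst hpq
          simp
        · exact Or.inr ⟨hpq, 0, by simp, by simp⟩
  by_cases hpq : p = q
  · subst hpq
    have : splittings ({p, p} : Multiset α) = {(p, p)} := by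
      ext x
      rw [mem_splittings, key, Finset.mem_singleton, Prod.ext_iff]
      tauto
    rw [this, if_pos ⟨p, rfl⟩]
    simp
  · have : splittings ({p, q} : Multiset α) = {(p, q), (q, p)} := by
      ext x
      rw [mem_splittings, key, Finset.mem_insert, Finset.mem_singleton, Prod.ext_iff, Prod.ext_iff]
      tauto
    rw [this, if_neg, Finset.card_insert_of_notMem]
    · simp
    · simp [hpq]
    · rintro ⟨x, hx⟩
      rw [key] at hx
      exact hpq (by rcases hx with ⟨rfl, rfl⟩ | ⟨rfl, rfl⟩ <;> rfl)

variable {N : Type*} [LinearOrder N] {I U R : Finset N} {m : N → ℕ} {v : N}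

theorem nodeConnected_iff_single {Γ : N → Multiset (N × ℕ)} {t : N} (ht : t ∈ U ∪ R) :
    NodeConnected U R Γ ↔ ∀ x ∈ U ∪ R, Linked Γ U x t :=
  ⟨fun h x hx => h x hx t ht, fun h x hx y hy => (h x hx).trans (h y hy).symm⟩

variable [Fintype N] {K : Type*} [Field K]

open Classical in
/-- The finite set of connected covers. -/
noncomputable def connFinset (I U R : Finset N) (m : N → ℕ) :
    Finset (N → Multiset (N × ℕ)) :=
  (coverFinset I U R m).filter fun Γ => NodeConnected U R Γ

theorem mem_connFinset (hN : NodeSets I U R) {Γ : N → Multiset (N × ℕ)} :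
    Γ ∈ connFinset I U R m ↔ IsNodeCover I U R m Γ ∧ NodeConnected U R Γ := by
  classical
  simp only [connFinset, Finset.mem_filter, mem_coverFinset hN]

/-- The weighted number of connected covers. -/
noncomputable def coverSum (b : K) (I U R : Finset N) (m : N → ℕ) : K :=
  ∑ Γ ∈ connFinset I U R m, coverWeight b U R Γ

theorem IsNodeCover.nodeConnected_insert_iff {Γ Γ' : N → Multiset (N × ℕ)}
    (hN : NodeSets I (insert v U) R) (hv : ∀ u ∈ U, v < u)
    (h : IsNodeCover I (insert v U) R m Γ) (hU : ∀ u ∈ U, Γ u = Γ' u) :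
    NodeConnected (insert v U) R Γ ↔ ∀ x ∈ U ∪ R, ∃ e ∈ Γ v, Linked Γ' U x e.1 := by
  obtain ⟨hvI, hvU, hvR, hIv⟩ := hN.new_vertex hv
  refine BHurwitz.nodeConnected_insert_iff hvR hvU hU ?_ ?_ ?_
  · have h1 : 0 < (Γ v).card := by
      rcases h.valence v (Finset.mem_insert_self _ _) with h1 | h1 | h1 <;> omega
    exact Multiset.card_pos_iff_exists_mem.mp h1
  · intro e he
    rw [Finset.mem_union]
    exact (h.mem v e he).imp_left fun h1 =>
      (Finset.mem_insert.mp h1).resolve_left (h.lt v e he).ne'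
  · intro u hu e he
    exact ((hv u hu).trans (h.lt u e he)).ne'

theorem sum_twist (b : K) (hN : NodeSets I (insert v U) R) (hv : ∀ u ∈ U, v < u) {i : N}
    (hi : i ∈ I) : ∑ Γ ∈ connFinset I (insert v U) R m with
        leftEndsAt I m Γ v = {i} ∧ (Γ v).card = 1, coverWeight b (insert v U) R Γ =
      (m i : K) * (b * ((m i : K) - 1)) * (((U.card : K) + 1) / R.card) * coverSum b I U R m := by
  classical
  obtain ⟨hvI, hvU, hvR, hIv⟩ := hN.new_vertex hv
  obtain ⟨hiv, hiU⟩ := hIv i hi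
  have hN' : NodeSets I U R := hN.mono subset_rfl (Finset.subset_insert _ _) subset_rfl
  have hsame : ∀ Γ : N → Multiset (N × ℕ), ∀ u ∈ U, attach Γ i v (m i) u = Γ u := fun Γ u hu =>
    attach_of_ne Γ (ne_of_mem_of_not_mem hu hiU) (ne_of_mem_of_not_mem hu hvU) _
  have hout : ∀ Γ, IsNodeCover I U R m Γ → ∃ t, t ∈ U ∪ R ∧ Γ i = {(t, m i)} ∧
      attach Γ i v (m i) v = {(t, m i)} := by
    intro Γ h
    obtain ⟨t, ht⟩ := h.left i hi
    refine ⟨t, ?_, ht, ?_⟩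
    · rw [Finset.mem_union]
      exact h.mem i (t, m i) (by rw [ht]; exact Multiset.mem_singleton_self _)
    · rw [attach_vertex Γ hiv, h.eq_zero v hvI hvU, add_zero, ht]
  have hconn : ∀ Γ, IsNodeCover I U R m Γ →
      (NodeConnected (insert v U) R (attach Γ i v (m i)) ↔ NodeConnected U R Γ) := by
    intro Γ h
    obtain ⟨t, htU, _, ht⟩ := hout Γ h
    rw [(h.attach_twist hN hv hi).nodeConnected_insert_iff hN hv (hsame Γ), ht,
      nodeConnected_iff_single htU]
    simp
  rw [coverSum, Finset.mul_sum]
  symm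
  refine Finset.sum_bij' (fun Γ _ => attach Γ i v (m i))
    (fun Γ _ => Function.update (Function.update Γ i (Γ v)) v 0) ?_ ?_ ?_ ?_ ?_
  · intro Γ h
    rw [mem_connFinset hN'] at h
    have h1 := h.1.attach_twist hN hv hi
    obtain ⟨t, htU, _, ht⟩ := hout Γ h.1
    rw [Finset.mem_filter, mem_connFinset hN, hconn Γ h.1, ht]
    refine ⟨⟨h1, h.2⟩, ?_, rfl⟩
    have hmem : i ∈ leftEndsAt I m (attach Γ i v (m i)) v :=
      mem_leftEndsAt.mpr ⟨hi, attach_left _ _ _ _⟩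
    ext j
    rw [Finset.mem_singleton]
    constructor
    · intro hj
      by_contra hji
      rw [mem_leftEndsAt, attach_of_ne Γ hji] at hj
      · have := h.1.mem j (v, m j) (by rw [hj.2]; exact Multiset.mem_singleton_self _)
        exact this.elim hvU hvR
      · rintro rfl
        exact hvI hj.1
    · rintro rfl
      exact hmem
  · intro Γ h
    rw [Finset.mem_filter, mem_connFinset hN] at h
    obtain ⟨⟨h1, h2⟩, h3, h4⟩ := h
    have h5 := h1.detach_twist hN hv h3 h4
    rw [mem_connFinset hN']
    refine ⟨h5, ?_⟩
    rw [← hconn _ h5, attach_detach hiv (mem_leftEndsAt.mp (h3 ▸ Finset.mem_singleton_self i)).2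
      (add_zero _)]
    exact h2
  · intro Γ h
    rw [mem_connFinset hN'] at h
    have := detach_attach Γ (i := i) (v := v) (m i)
    rw [h.1.eq_zero v hvI hvU] at this
    rwa [attach_vertex Γ hiv, h.1.eq_zero v hvI hvU, add_zero]
  · intro Γ h
    rw [Finset.mem_filter] at h
    exact attach_detach hiv (mem_leftEndsAt.mp (h.2.1 ▸ Finset.mem_singleton_self i)).2
      (add_zero _)
  · intro Γ h
    rw [mem_connFinset hN'] at h
    obtain ⟨t, htU, _, ht⟩ := hout Γ h.1
    rw [coverWeight_insert b hN hv h.1 (hsame Γ) (fun x hx => inEdges_attach_of_ne Γ hiv _ hx)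
      ((hconn Γ h.1).mpr h.2), ht, inEdges_attach Γ hiv, h.1.notMem_of_new hvU hvR]
    have hne : ¬ ∃ x : N × ℕ, ({(t, m i)} : Multiset (N × ℕ)) = {x, x} := by
      rintro ⟨x, hx⟩
      simpa using congrArg Multiset.card hx
    rw [if_neg hne]
    simp [wsum, Multiset.filter_singleton]

/-- The number of outgoing edges need not be prescribed: by the valence condition two incoming edges
leave room for only one. -/
theorem sum_join (b : K) (hN : NodeSets I (insert v U) R) (hv : ∀ u ∈ U, v < u)
    (hm : ∀ i ∈ I, 0 < m i) {i j : N} (hi : i ∈ I) (hj : j ∈ I) (hij : i ≠ j) :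
    ∑ Γ ∈ connFinset I (insert v U) R m with leftEndsAt I m Γ v = {i, j},
        coverWeight b (insert v U) R Γ =
      ((m i : K) + m j) * 2 * (((U.card : K) + 1) / R.card) *
        coverSum b (I.erase j) U R (Function.update m i (m i + m j)) := by
  classical
  obtain ⟨hvI, hvU, hvR, hIv⟩ := hN.new_vertex hv
  obtain ⟨hiv, hiU⟩ := hIv i hi
  obtain ⟨hjv, hjU⟩ := hIv j hj
  have hN' : NodeSets (I.erase j) U R :=
    hN.mono (Finset.erase_subset _ _) (Finset.subset_insert _ _) subset_rfl
  set m' := Function.update m i (m i + m j) with hm'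
  set att : (N → Multiset (N × ℕ)) → N → Multiset (N × ℕ) := fun Γ =>
    Function.update (attach Γ i v (m i)) j {(v, m j)} with hatt
  have hsame : ∀ Γ : N → Multiset (N × ℕ), ∀ u ∈ U, att Γ u = Γ u := fun Γ u hu => by
    rw [hatt]
    dsimp only
    rw [Function.update_of_ne (ne_of_mem_of_not_mem hu hjU),
      attach_of_ne Γ (ne_of_mem_of_not_mem hu hiU) (ne_of_mem_of_not_mem hu hvU) _]
  have hz : ∀ Γ, IsNodeCover (I.erase j) U R m' Γ → Γ v = 0 ∧ Γ j = 0 := fun Γ h =>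
    ⟨h.eq_zero v (fun h => hvI (Finset.mem_of_mem_erase h)) hvU,
      h.eq_zero j (Finset.notMem_erase _ _) hjU⟩
  have hout : ∀ Γ, IsNodeCover (I.erase j) U R m' Γ → ∃ t, t ∈ U ∪ R ∧
      Γ i = {(t, m i + m j)} ∧ att Γ v = {(t, m i + m j)} := by
    intro Γ h
    obtain ⟨t, ht⟩ := h.left i (Finset.mem_erase.mpr ⟨hij, hi⟩)
    rw [hm', Function.update_self] at ht
    refine ⟨t, ?_, ht, ?_⟩
    · rw [Finset.mem_union]
      exact h.mem i (t, m i + m j) (by rw [ht]; exact Multiset.mem_singleton_self _)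
    · rw [hatt]
      dsimp only
      rw [Function.update_of_ne hjv.symm, attach_vertex Γ hiv, (hz Γ h).1, add_zero, ht]
  have hcov : ∀ Γ, IsNodeCover (I.erase j) U R m' Γ → IsNodeCover I (insert v U) R m (att Γ) :=
    fun Γ h => h.attach_join hN hv hm hi hj hij
  have hconn : ∀ Γ, IsNodeCover (I.erase j) U R m' Γ →
      (NodeConnected (insert v U) R (att Γ) ↔ NodeConnected U R Γ) := by
    intro Γ h
    obtain ⟨t, htU, _, ht⟩ := hout Γ h
    rw [(hcov Γ h).nodeConnected_insert_iff hN hv (hsame Γ), ht,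
      nodeConnected_iff_single htU]
    simp
  have hin : ∀ Γ, IsNodeCover (I.erase j) U R m' Γ → ∀ x, inEdges (att Γ) x =
      inEdges Γ x + ({(v, m i)} : Multiset (N × ℕ)).filter (fun e => e.1 = x) +
        ({(v, m j)} : Multiset (N × ℕ)).filter (fun e => e.1 = x) := by
    intro Γ h x
    rw [hatt]
    dsimp only
    rw [inEdges_update_zero (by rw [attach_of_ne _ hij.symm hjv, (hz Γ h).2]), inEdges_attach Γ hiv]
  rw [coverSum, Finset.mul_sum]
  symm
  refine Finset.sum_bij' (fun Γ _ => att Γ) (fun Γ _ =>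
    Function.update (Function.update (Function.update Γ j 0) i (Γ v)) v 0) ?_ ?_ ?_ ?_ ?_
  · intro Γ h
    rw [mem_connFinset hN'] at h
    obtain ⟨t, htU, _, ht⟩ := hout Γ h.1
    rw [Finset.mem_filter, mem_connFinset hN, hconn Γ h.1]
    refine ⟨⟨hcov Γ h.1, h.2⟩, ?_⟩
    ext l
    rw [Finset.mem_insert, Finset.mem_singleton, mem_leftEndsAt]
    constructor
    · rintro ⟨hl, hl2⟩
      by_contra hne
      rw [not_or] at hne
      rw [hatt] at hl2
      dsimp only at hl2
      rw [Function.update_of_ne hne.2, attach_of_ne Γ hne.1 (hIv l hl).1] at hl2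
      have := h.1.mem l (v, m l) (by rw [hl2]; exact Multiset.mem_singleton_self _)
      exact this.elim hvU hvR
    · rintro (rfl | rfl)
      · refine ⟨hi, ?_⟩
        rw [hatt]
        dsimp only
        rw [Function.update_of_ne hij, attach_left]
      · exact ⟨hj, Function.update_self _ _ _⟩
  · intro Γ h
    rw [Finset.mem_filter, mem_connFinset hN] at h
    obtain ⟨⟨h1, h2⟩, h3⟩ := h
    obtain ⟨h5, h6⟩ := h1.detach_join hN hv hij h3
    rw [mem_connFinset hN']
    refine ⟨h5, ?_⟩
    rw [← hconn _ h5, hatt]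
    dsimp only
    rw [h6]
    exact h2
  · intro Γ h
    rw [mem_connFinset hN'] at h
    obtain ⟨t, htU, hti, ht⟩ := hout Γ h.1
    rw [ht, ← hti]
    funext s
    by_cases hsv : s = v
    · rw [hsv, Function.update_self, (hz Γ h.1).1]
    rw [Function.update_of_ne hsv]
    by_cases hsi : s = i
    · rw [hsi, Function.update_self]
    rw [Function.update_of_ne hsi]
    by_cases hsj : s = j
    · rw [hsj, Function.update_self, (hz Γ h.1).2]
    rw [Function.update_of_ne hsj, hatt]
    dsimp only
    rw [Function.update_of_ne hsj, attach_of_ne Γ hsi hsv]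
  · intro Γ h
    rw [Finset.mem_filter, mem_connFinset hN] at h
    exact (h.1.1.detach_join hN hv hij h.2).2
  · intro Γ h
    rw [mem_connFinset hN'] at h
    obtain ⟨t, htU, _, ht⟩ := hout Γ h.1
    rw [coverWeight_insert b hN hv h.1 (hsame Γ) (fun x hx => ?_)
      ((hconn Γ h.1).mpr h.2), ht, hin Γ h.1, h.1.notMem_of_new hvU hvR]
    · have hne : ¬ ∃ x : N × ℕ, ({(t, m i + m j)} : Multiset (N × ℕ)) = {x, x} := by
        rintro ⟨x, hx⟩
        simpa using congrArg Multiset.card hx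
      rw [if_neg hne]
      simp [Multiset.filter_singleton]
    · rw [hin Γ h.1, Multiset.filter_singleton, if_neg (Ne.symm hx), Multiset.filter_singleton,
        if_neg (Ne.symm hx)]
      exact (add_zero _).trans (add_zero _)

open Classical in
/-- The covers that become connected by joining the left ends `i` and `v` at a new vertex. -/
noncomputable def splitFinset (I U R : Finset N) (m : N → ℕ) (i v : N) :
    Finset (N → Multiset (N × ℕ)) :=
  (coverFinset I U R m).filter fun Γ => ∀ x ∈ U ∪ R, ∃ e ∈ Γ i + Γ v, Linked Γ U x e.1

/-- The smaller cover depends on an ordering of the two outgoing edges, since they receive different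
labels. Summing over the orderings absorbs the wiener factor and the factor `2` of the vertex. The
smaller cover need not be connected. -/
theorem sum_split [CharZero K] (b : K) (hN : NodeSets I (insert v U) R) (hv : ∀ u ∈ U, v < u)
    {i : N} (hi : i ∈ I) : ∑ Γ ∈ connFinset I (insert v U) R m with
        leftEndsAt I m Γ v = {i} ∧ (Γ v).card = 2, coverWeight b (insert v U) R Γ =
      ∑ x ∈ antidiagonal (m i), (x.1 * x.2 : K) * (1 + b) *
        (((U.card : K) + 1) / R.card) * ∑ Γ ∈ splitFinset (insert v I) U R
          (Function.update (Function.update m i x.1) v x.2) i v, coverWeight b U R Γ := by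
  classical
  obtain ⟨hvI, hvU, hvR, hIv⟩ := hN.new_vertex hv
  obtain ⟨hiv, hiU⟩ := hIv i hi
  have hN' : NodeSets (insert v I) U R := hN.insert_left hv
  have hsame : ∀ Γ : N → Multiset (N × ℕ), ∀ u ∈ U, attach Γ i v (m i) u = Γ u := fun Γ u hu =>
    attach_of_ne Γ (ne_of_mem_of_not_mem hu hiU) (ne_of_mem_of_not_mem hu hvU) _
  set mm : ℕ × ℕ → N → ℕ := fun x => Function.update (Function.update m i x.1) v x.2 with hmm
  have hmem : ∀ (x : ℕ × ℕ) Γ, Γ ∈ splitFinset (insert v I) U R (mm x) i v ↔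
      IsNodeCover (insert v I) U R (mm x) Γ ∧
        ∀ y ∈ U ∪ R, ∃ e ∈ Γ i + Γ v, Linked Γ U y e.1 := by
    intro x Γ
    rw [splitFinset, Finset.mem_filter, mem_coverFinset hN']
  have hconn : ∀ (x : ℕ × ℕ) Γ, m i = x.1 + x.2 → IsNodeCover (insert v I) U R (mm x) Γ →
      (NodeConnected (insert v U) R (attach Γ i v (m i)) ↔
        ∀ y ∈ U ∪ R, ∃ e ∈ Γ i + Γ v, Linked Γ U y e.1) := by
    intro x Γ hx h
    rw [(h.attach_split hN hv hi hx).nodeConnected_insert_iff hN hv (hsame Γ),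
      attach_vertex Γ hiv]
  have hends : ∀ (x : ℕ × ℕ) Γ, IsNodeCover (insert v I) U R (mm x) Γ →
      leftEndsAt I m (attach Γ i v (m i)) v = {i} := by
    intro x Γ h
    ext j
    rw [Finset.mem_singleton, mem_leftEndsAt]
    constructor
    · rintro ⟨hjI, hj⟩
      by_contra hji
      rw [attach_of_ne Γ hji (hIv j hjI).1] at hj
      have := h.mem j (v, m j) (by rw [hj]; exact Multiset.mem_singleton_self _)
      exact this.elim hvU hvR
    · rintro rfl
      exact ⟨hi, attach_left _ _ _ _⟩
  simp only [Finset.mul_sum]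
  rw [Finset.sum_sigma']
  -- The weight of a cover is distributed over the orderings of the pair of edges leaving `v`.
  have h1 : ∑ Γ ∈ connFinset I (insert v U) R m with
      leftEndsAt I m Γ v = {i} ∧ (Γ v).card = 2, coverWeight b (insert v U) R Γ =
      ∑ Γ ∈ connFinset I (insert v U) R m with leftEndsAt I m Γ v = {i} ∧ (Γ v).card = 2,
        ∑ p ∈ splittings (Γ v), (p.1.2 * p.2.2 : K) * (1 + b) * (((U.card : K) + 1) / R.card) *
          coverWeight b U R (Function.update (Function.update Γ i {p.1}) v {p.2}) := by
    refine Finset.sum_congr rfl fun Γ h => ?_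
    rw [Finset.mem_filter, mem_connFinset hN] at h
    obtain ⟨⟨h1, h2⟩, h3, h4⟩ := h
    -- The summand does not depend on the ordering, because its right side only involves the
    -- original cover.
    have h5 : ∀ p ∈ splittings (Γ v), (p.1.2 * p.2.2 : K) * (1 + b) *
        (((U.card : K) + 1) / R.card) *
        coverWeight b U R (Function.update (Function.update Γ i {p.1}) v {p.2}) =
        coverWeight b (insert v U) R Γ / (if ∃ x, Γ v = {x, x} then 1 / 2 else 1) / 2 := by
      intro p hp
      rw [mem_splittings] at hp
      obtain ⟨h6, h7⟩ := h1.detach_split hN hv h3 hp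
      have h8 : attach (Function.update (Function.update Γ i {p.1}) v {p.2}) i v (m i) = Γ :=
        attach_detach hiv (mem_leftEndsAt.mp (h3 ▸ Finset.mem_singleton_self i)).2
          (by rw [hp]; rfl)
      have h9 := hsame (Function.update (Function.update Γ i {p.1}) v {p.2})
      have h10 : ∀ x, x ≠ v → inEdges Γ x =
          inEdges (Function.update (Function.update Γ i {p.1}) v {p.2}) x := by
        intro x hx
        conv_lhs => rw [← h8]
        rw [inEdges_attach_of_ne _ hiv _ hx]
      rw [h8] at h9
      rw [coverWeight_insert b hN hv h7 h9 h10 h2, if_pos h4]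
      have hpr : ((Γ v).map fun e => (e.2 : K)).prod = p.1.2 * p.2.2 := by
        rw [hp]
        simp
      rw [hpr]
      split_ifs <;> field_simp
    rw [Finset.sum_congr rfl h5, Finset.sum_const, nsmul_eq_mul, ite_eq_card_splittings h4]
    have h6 : ((splittings (Γ v)).card : K) ≠ 0 := by
      rw [Nat.cast_ne_zero]
      obtain ⟨p, q, hpq⟩ := Multiset.card_eq_two.mp h4
      exact Finset.card_ne_zero_of_mem (mem_splittings (p := (p, q)).mpr hpq)
    field_simp
  rw [h1, Finset.sum_sigma']
  refine Finset.sum_bij (fun a _ => ⟨(a.2.1.2, a.2.2.2),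
    Function.update (Function.update a.1 i {a.2.1}) v {a.2.2}⟩) ?_ ?_ ?_ ?_
  · rintro ⟨Γ, p⟩ h
    rw [Finset.mem_sigma, Finset.mem_filter, mem_connFinset hN, mem_splittings] at h
    obtain ⟨⟨⟨h1, h2⟩, h3, h4⟩, hp⟩ := h
    dsimp only at *
    obtain ⟨h6, h7⟩ := h1.detach_split hN hv h3 hp
    rw [Finset.mem_sigma]
    dsimp only
    rw [mem_antidiagonal]
    refine ⟨h6.symm, ?_⟩
    rw [hmem (p.1.2, p.2.2)]
    refine ⟨h7, ?_⟩
    rw [← hconn (p.1.2, p.2.2) _ h6 h7, attach_detach hiv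
      (mem_leftEndsAt.mp (h3 ▸ Finset.mem_singleton_self i)).2 (by rw [hp]; rfl)]
    exact h2
  · rintro ⟨Γ, p, q⟩ h ⟨Γ', p', q'⟩ h' heq
    rw [Finset.mem_sigma, Finset.mem_filter, mem_connFinset hN, mem_splittings] at h h'
    obtain ⟨⟨⟨h1, h2⟩, h3, h4⟩, hp⟩ := h
    obtain ⟨⟨⟨h1', h2'⟩, h3', h4'⟩, hp'⟩ := h'
    dsimp only at *
    rw [Sigma.mk.injEq] at heq
    have h5 := eq_of_heq heq.2
    have h6 := congrArg (fun Γ => attach Γ i v (m i)) h5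
    rw [attach_detach hiv (mem_leftEndsAt.mp (h3 ▸ Finset.mem_singleton_self i)).2
        (by rw [hp]; rfl),
      attach_detach hiv (mem_leftEndsAt.mp (h3' ▸ Finset.mem_singleton_self i)).2
        (by rw [hp']; rfl)] at h6
    subst h6
    have h7 := congrFun h5 v
    have h8 := congrFun h5 i
    rw [Function.update_self, Function.update_self, Multiset.singleton_inj] at h7
    rw [Function.update_of_ne hiv, Function.update_of_ne hiv, Function.update_self,
      Function.update_self, Multiset.singleton_inj] at h8
    rw [h7, h8]
  · rintro ⟨x, Γ⟩ h
    rw [Finset.mem_sigma, mem_antidiagonal, hmem] at h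
    obtain ⟨hx, h1, h2⟩ := h
    dsimp only at hx h1 h2
    obtain ⟨t, ht⟩ := h1.left i (Finset.mem_insert_of_mem hi)
    obtain ⟨t', ht'⟩ := h1.left v (Finset.mem_insert_self _ _)
    rw [hmm] at ht ht'
    dsimp only at ht ht'
    rw [Function.update_of_ne hiv, Function.update_self] at ht
    rw [Function.update_self] at ht'
    have h3 : attach Γ i v (m i) v = {(t, x.1), (t', x.2)} := by
      rw [attach_vertex Γ hiv, ht, ht']
      rfl
    refine ⟨⟨attach Γ i v (m i), (t, x.1), (t', x.2)⟩, ?_, ?_⟩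
    · rw [Finset.mem_sigma, Finset.mem_filter, mem_connFinset hN, mem_splittings]
      refine ⟨⟨⟨h1.attach_split hN hv hi hx.symm, (hconn x Γ hx.symm h1).mpr h2⟩,
        hends x Γ h1, ?_⟩, h3⟩
      dsimp only
      rw [h3]
      rfl
    · dsimp only
      rw [← ht, ← ht', detach_attach]
  · rintro ⟨Γ, p⟩ _
    rfl

end NodeCover

end BHurwitz

/-! ### Disjoint unions of covers -/

namespace BHurwitz

section NodeCover

variable {N : Type*}

open Classical in
/-- The part of a graph formed by the edges that start at nodes with property `P`. -/
noncomputable def restrictTo (P : N → Prop) (Γ : N → Multiset (N × ℕ)) : N → Multiset (N × ℕ) :=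
  fun s => if P s then Γ s else 0

theorem restrictTo_of {P : N → Prop} {s : N} (h : P s) (Γ : N → Multiset (N × ℕ)) :
    restrictTo P Γ s = Γ s := if_pos h

theorem restrictTo_of_not {P : N → Prop} {s : N} (h : ¬ P s) (Γ : N → Multiset (N × ℕ)) :
    restrictTo P Γ s = 0 := if_neg h

theorem restrictTo_add_not (P : N → Prop) (Γ : N → Multiset (N × ℕ)) :
    restrictTo P Γ + restrictTo (fun s => ¬ P s) Γ = Γ := by
  funext s
  by_cases h : P s
  · rw [Pi.add_apply, restrictTo_of h, restrictTo_of_not (P := fun s => ¬ P s) (not_not.mpr h),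
      add_zero]
  · rw [Pi.add_apply, restrictTo_of_not h, restrictTo_of (P := fun s => ¬ P s) h, zero_add]

variable [LinearOrder N] [Fintype N] {I U R I₁ U₁ R₁ I₂ U₂ R₂ : Finset N} {m : N → ℕ}

theorem inEdges_add (Γ₁ Γ₂ : N → Multiset (N × ℕ)) (v : N) :
    inEdges (Γ₁ + Γ₂) v = inEdges Γ₁ v + inEdges Γ₂ v := by
  simp only [inEdges, Pi.add_apply, Multiset.filter_add, Finset.sum_add_distrib]

theorem inEdges_restrictTo {P : N → Prop} {Γ : N → Multiset (N × ℕ)}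
    (hP : ∀ s, ∀ e ∈ Γ s, (P s ↔ P e.1)) {v : N} (hv : P v) :
    inEdges (restrictTo P Γ) v = inEdges Γ v := by
  refine Finset.sum_congr rfl fun s _ => ?_
  by_cases hs : P s
  · rw [restrictTo_of hs]
  · rw [restrictTo_of_not hs, Multiset.filter_zero, eq_comm, Multiset.filter_eq_nil]
    rintro e he rfl
    exact hs ((hP s e he).mpr hv)

/-- If a property is constant along all edges, every node on the chosen side keeps all its incoming
and outgoing edges. -/
theorem IsNodeCover.restrictTo {P : N → Prop} [DecidablePred P] {Γ : N → Multiset (N × ℕ)}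
    (h : IsNodeCover I U R m Γ) (hP : ∀ s, ∀ e ∈ Γ s, (P s ↔ P e.1)) :
    IsNodeCover (I.filter P) (U.filter P) (R.filter P) m (restrictTo P Γ) := by
  have hmem : ∀ s, ∀ e ∈ BHurwitz.restrictTo P Γ s, P s ∧ e ∈ Γ s := by
    intro s e he
    by_cases hs : P s
    · rw [restrictTo_of hs] at he
      exact ⟨hs, he⟩
    · rw [restrictTo_of_not hs] at he
      exact absurd he (Multiset.notMem_zero _)
  refine ⟨?_, ?_, fun s e he => h.lt s e (hmem s e he).2, fun s e he => h.pos s e (hmem s e he).2,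
    ?_, ?_, ?_, ?_⟩
  · intro s hI hU
    by_cases hs : P s
    · rw [restrictTo_of hs]
      rw [Finset.mem_filter] at hI hU
      exact h.eq_zero s (fun h => hI ⟨h, hs⟩) (fun h => hU ⟨h, hs⟩)
    · exact restrictTo_of_not hs _
  · intro s e he
    obtain ⟨hs, he⟩ := hmem s e he
    rw [Finset.mem_filter, Finset.mem_filter]
    have h1 := (hP s e he).mp hs
    exact (h.mem s e he).imp (fun h => ⟨h, h1⟩) fun h => ⟨h, h1⟩
  · intro i hi
    rw [Finset.mem_filter] at hi
    rw [restrictTo_of hi.2]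
    exact h.left i hi.1
  · intro i hi
    rw [Finset.mem_filter] at hi
    rw [inEdges_restrictTo hP hi.2]
    exact h.right i hi.1
  · intro i hi
    rw [Finset.mem_filter] at hi
    rw [inEdges_restrictTo hP hi.2, restrictTo_of hi.2]
    exact h.valence i hi.1
  · intro i hi
    rw [Finset.mem_filter] at hi
    rw [inEdges_restrictTo hP hi.2, restrictTo_of hi.2]
    exact h.balanced i hi.1

theorem IsNodeCover.add_left {Γ₁ Γ₂ : N → Multiset (N × ℕ)} (h₂ : IsNodeCover I₂ U₂ R₂ m Γ₂)
    (hS : Disjoint (I₁ ∪ U₁) (I₂ ∪ U₂)) {s : N} (hs : s ∈ I₁ ∪ U₁) :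
    (Γ₁ + Γ₂) s = Γ₁ s := by
  have h := Finset.disjoint_left.mp hS hs
  rw [Finset.mem_union, not_or] at h
  rw [Pi.add_apply, h₂.eq_zero s h.1 h.2, add_zero]

theorem IsNodeCover.inEdges_add_left {Γ₁ Γ₂ : N → Multiset (N × ℕ)}
    (h₂ : IsNodeCover I₂ U₂ R₂ m Γ₂)
    (hT : Disjoint (U₁ ∪ R₁) (U₂ ∪ R₂)) {s : N} (hs : s ∈ U₁ ∪ R₁) :
    inEdges (Γ₁ + Γ₂) s = inEdges Γ₁ s := by
  have h := Finset.disjoint_left.mp hT hs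
  rw [Finset.mem_union, not_or] at h
  rw [inEdges_add, h₂.notMem_of_new h.1 h.2, add_zero]

theorem IsNodeCover.add {Γ₁ Γ₂ : N → Multiset (N × ℕ)} (h₁ : IsNodeCover I₁ U₁ R₁ m Γ₁)
    (h₂ : IsNodeCover I₂ U₂ R₂ m Γ₂) (hS : Disjoint (I₁ ∪ U₁) (I₂ ∪ U₂))
    (hT : Disjoint (U₁ ∪ R₁) (U₂ ∪ R₂)) :
    IsNodeCover (I₁ ∪ I₂) (U₁ ∪ U₂) (R₁ ∪ R₂) m (Γ₁ + Γ₂) := by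
  have hs1 : ∀ s ∈ I₁ ∪ U₁, (Γ₁ + Γ₂) s = Γ₁ s := fun s hs => h₂.add_left hS hs
  have hs2 : ∀ s ∈ I₂ ∪ U₂, (Γ₁ + Γ₂) s = Γ₂ s := fun s hs => by
    rw [add_comm]
    exact h₁.add_left hS.symm hs
  have ht1 : ∀ s ∈ U₁ ∪ R₁, inEdges (Γ₁ + Γ₂) s = inEdges Γ₁ s :=
    fun s hs => h₂.inEdges_add_left hT hs
  have ht2 : ∀ s ∈ U₂ ∪ R₂, inEdges (Γ₁ + Γ₂) s = inEdges Γ₂ s := fun s hs => by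
    rw [add_comm]
    exact h₁.inEdges_add_left hT.symm hs
  have hU1 : ∀ s ∈ U₁, s ∈ I₁ ∪ U₁ ∧ s ∈ U₁ ∪ R₁ := fun s hs =>
    ⟨Finset.mem_union_right _ hs, Finset.mem_union_left _ hs⟩
  have hU2 : ∀ s ∈ U₂, s ∈ I₂ ∪ U₂ ∧ s ∈ U₂ ∪ R₂ := fun s hs =>
    ⟨Finset.mem_union_right _ hs, Finset.mem_union_left _ hs⟩
  have hmem : ∀ s, ∀ e ∈ (Γ₁ + Γ₂) s, e ∈ Γ₁ s ∨ e ∈ Γ₂ s := fun s e he =>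
    Multiset.mem_add.mp he
  refine ⟨?_, ?_, ?_, ?_, ?_, ?_, ?_, ?_⟩
  · intro s hI hU
    rw [Finset.mem_union, not_or] at hI hU
    rw [Pi.add_apply, h₁.eq_zero s hI.1 hU.1, h₂.eq_zero s hI.2 hU.2, add_zero]
  · intro s e he
    rw [Finset.mem_union, Finset.mem_union]
    rcases hmem s e he with h | h
    · exact (h₁.mem s e h).imp Or.inl Or.inl
    · exact (h₂.mem s e h).imp Or.inr Or.inr
  · intro s e he
    exact (hmem s e he).elim (h₁.lt s e) (h₂.lt s e)
  · intro s e he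
    exact (hmem s e he).elim (h₁.pos s e) (h₂.pos s e)
  · intro s hs
    rcases Finset.mem_union.mp hs with hs | hs
    · rw [hs1 s (Finset.mem_union_left _ hs)]
      exact h₁.left s hs
    · rw [hs2 s (Finset.mem_union_left _ hs)]
      exact h₂.left s hs
  · intro s hs
    rcases Finset.mem_union.mp hs with hs | hs
    · rw [ht1 s (Finset.mem_union_right _ hs)]
      exact h₁.right s hs
    · rw [ht2 s (Finset.mem_union_right _ hs)]
      exact h₂.right s hs
  · intro s hs
    rcases Finset.mem_union.mp hs with hs | hs
    · rw [hs1 s (hU1 s hs).1, ht1 s (hU1 s hs).2]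
      exact h₁.valence s hs
    · rw [hs2 s (hU2 s hs).1, ht2 s (hU2 s hs).2]
      exact h₂.valence s hs
  · intro s hs
    rcases Finset.mem_union.mp hs with hs | hs
    · rw [hs1 s (hU1 s hs).1, ht1 s (hU1 s hs).2]
      exact h₁.balanced s hs
    · rw [hs2 s (hU2 s hs).1, ht2 s (hU2 s hs).2]
      exact h₂.balanced s hs

/-- Nodes of the first part of a cover are linked in the whole cover iff they are linked in the
first part. -/
theorem IsNodeCover.linked_add_iff {Γ₁ Γ₂ : N → Multiset (N × ℕ)} (h₁ : IsNodeCover I₁ U₁ R₁ m Γ₁)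
    (h₂ : IsNodeCover I₂ U₂ R₂ m Γ₂) (hS : Disjoint (I₁ ∪ U₁) (I₂ ∪ U₂))
    (hT : Disjoint (U₁ ∪ R₁) (U₂ ∪ R₂)) (Q : N → Prop) {x y : N} (hx : x ∈ U₁ ∪ R₁) :
    Linked (Γ₁ + Γ₂) {u | u ∈ U₁ ∪ U₂ ∧ Q u} x y ↔
      y ∈ U₁ ∪ R₁ ∧ Linked Γ₁ {u | u ∈ U₁ ∧ Q u} x y := by
  constructor
  · intro h
    have := Linked.iff_of_closed (fun z => z ∈ U₁ ∪ R₁ ∧ Linked Γ₁ {u | u ∈ U₁ ∧ Q u} x z) ?_ h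
    · exact this.mp ⟨hx, Linked.refl _ _ _⟩
    · rintro s ⟨hs, hQ⟩ e he
      rcases Finset.mem_union.mp hs with hs | hs
      · rw [h₂.add_left hS (Finset.mem_union_right _ hs)] at he
        have hl : Linked Γ₁ {u | u ∈ U₁ ∧ Q u} s e.1 := Linked.edge ⟨hs, hQ⟩ he
        have he' := Finset.mem_union.mpr (h₁.mem s e he)
        exact ⟨fun h => ⟨he', h.2.trans hl⟩,
          fun h => ⟨Finset.mem_union_left _ hs, h.2.trans hl.symm⟩⟩
      · rw [add_comm, h₁.add_left hS.symm (Finset.mem_union_right _ hs)] at he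
        have h3 := Finset.disjoint_right.mp hT (Finset.mem_union_left _ hs)
        have h4 := Finset.disjoint_right.mp hT (Finset.mem_union.mpr (h₂.mem s e he))
        exact ⟨fun h => absurd h.1 h3, fun h => absurd h.1 h4⟩
  · rintro ⟨_, h⟩
    have hsub : {u | u ∈ U₁ ∧ Q u} ⊆ {u | u ∈ U₁ ∪ U₂ ∧ Q u} := fun u hu =>
      ⟨Finset.mem_union_left _ hu.1, hu.2⟩
    refine Linked.mono hsub ?_ h
    intro u hu e he
    rw [h₂.add_left hS (Finset.mem_union_right _ hu.1)]
    exact he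

variable {K : Type*} [Field K]

/-- Valence, weights, wieners and the component to the right of a vertex are all seen inside its own
part of the union. -/
theorem IsNodeCover.nodeFactor_add {Γ₁ Γ₂ : N → Multiset (N × ℕ)} (b : K)
    (h₁ : IsNodeCover I₁ U₁ R₁ m Γ₁)
    (h₂ : IsNodeCover I₂ U₂ R₂ m Γ₂) (hS : Disjoint (I₁ ∪ U₁) (I₂ ∪ U₂))
    (hT : Disjoint (U₁ ∪ R₁) (U₂ ∪ R₂)) {v : N} (hv : v ∈ U₁) :
    nodeFactor b (U₁ ∪ U₂) (R₁ ∪ R₂) (Γ₁ + Γ₂) v = nodeFactor b U₁ R₁ Γ₁ v := by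
  classical
  have hl := fun y => h₁.linked_add_iff h₂ hS hT (fun u => v ≤ u) (y := y)
    (Finset.mem_union_left R₁ hv)
  have hU : (U₁ ∪ U₂).filter (fun y => Linked (Γ₁ + Γ₂) {u | u ∈ U₁ ∪ U₂ ∧ v ≤ u} v y) =
      U₁.filter fun y => Linked Γ₁ {u | u ∈ U₁ ∧ v ≤ u} v y := by
    ext y
    rw [Finset.mem_filter, Finset.mem_filter, hl]
    constructor
    · rintro ⟨h3, h4, h5⟩
      refine ⟨(Finset.mem_union.mp h3).resolve_right fun h => ?_, h5⟩
      exact Finset.disjoint_left.mp hT h4 (Finset.mem_union_left _ h)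
    · exact fun ⟨h3, h4⟩ => ⟨Finset.mem_union_left _ h3, Finset.mem_union_left _ h3, h4⟩
  have hR : (R₁ ∪ R₂).filter (fun y => Linked (Γ₁ + Γ₂) {u | u ∈ U₁ ∪ U₂ ∧ v ≤ u} v y) =
      R₁.filter fun y => Linked Γ₁ {u | u ∈ U₁ ∧ v ≤ u} v y := by
    ext y
    rw [Finset.mem_filter, Finset.mem_filter, hl]
    constructor
    · rintro ⟨h3, h4, h5⟩
      refine ⟨(Finset.mem_union.mp h3).resolve_right fun h => ?_, h5⟩
      exact Finset.disjoint_left.mp hT h4 (Finset.mem_union_right _ h)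
    · exact fun ⟨h3, h4⟩ => ⟨Finset.mem_union_left _ h3, Finset.mem_union_right _ h3, h4⟩
  simp only [nodeFactor]
  rw [h₂.add_left hS (Finset.mem_union_right _ hv),
    h₂.inEdges_add_left hT (Finset.mem_union_left _ hv)]
  congr! 3
  · convert congrArg Finset.card hU
  · convert congrArg Finset.card hR

theorem IsNodeCover.coverWeight_add {Γ₁ Γ₂ : N → Multiset (N × ℕ)} (b : K)
    (h₁ : IsNodeCover I₁ U₁ R₁ m Γ₁)
    (h₂ : IsNodeCover I₂ U₂ R₂ m Γ₂) (hS : Disjoint (I₁ ∪ U₁) (I₂ ∪ U₂))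
    (hT : Disjoint (U₁ ∪ R₁) (U₂ ∪ R₂)) :
    coverWeight b (U₁ ∪ U₂) (R₁ ∪ R₂) (Γ₁ + Γ₂) =
      coverWeight b U₁ R₁ Γ₁ * coverWeight b U₂ R₂ Γ₂ := by
  have hU : Disjoint U₁ U₂ := hS.mono Finset.subset_union_right Finset.subset_union_right
  rw [coverWeight, Finset.prod_union hU]
  congr 1
  · exact Finset.prod_congr rfl fun v hv => h₁.nodeFactor_add b h₂ hS hT hv
  · refine Finset.prod_congr rfl fun v hv => ?_
    rw [Finset.union_comm U₁, Finset.union_comm R₁, add_comm]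
    exact h₂.nodeFactor_add b h₁ hS.symm hT.symm hv

/-- The node `s` belongs to the component of the target of the left end `i`. -/
def MeetsEnd (I U : Finset N) (Γ : N → Multiset (N × ℕ)) (i s : N) : Prop :=
  ∃ e₀ ∈ Γ i, if s ∈ I then ∃ e ∈ Γ s, Linked Γ U e.1 e₀.1 else Linked Γ U s e₀.1

/-- `Linked` ignores the edges of left ends, so `MeetsEnd` treats a left end through its target.
This makes it constant along all edges, and a cover can be restricted to it and to its complement.
-/
theorem IsNodeCover.meetsEnd_closed (hN : NodeSets I U R) {Γ : N → Multiset (N × ℕ)}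
    (h : IsNodeCover I U R m Γ) (i s : N) (e : N × ℕ) (he : e ∈ Γ s) :
    MeetsEnd I U Γ i s ↔ MeetsEnd I U Γ i e.1 := by
  have hI : e.1 ∉ I := fun hI => by
    rcases h.mem s e he with h1 | h1
    · exact lt_irrefl _ (hN.left_lt _ hI _ h1)
    · exact lt_irrefl _ (hN.left_lt_right _ hI _ h1)
  simp only [MeetsEnd, if_neg hI]
  by_cases hs : s ∈ I
  · simp only [if_pos hs]
    obtain ⟨t, ht⟩ := h.left s hs
    rw [ht, Multiset.mem_singleton] at he
    subst he
    simp only [ht, Multiset.mem_singleton, exists_eq_left]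
  · simp only [if_neg hs]
    have hsU : s ∈ U := by
      by_contra hsU
      rw [h.eq_zero s hs hsU] at he
      exact Multiset.notMem_zero _ he
    have hl : Linked Γ U s e.1 := Linked.edge hsU he
    exact ⟨fun ⟨e₀, h1, h2⟩ => ⟨e₀, h1, hl.symm.trans h2⟩,
      fun ⟨e₀, h1, h2⟩ => ⟨e₀, h1, hl.trans h2⟩⟩

theorem IsNodeCover.linked_add_left_iff {Γ₁ Γ₂ : N → Multiset (N × ℕ)}
    (h₁ : IsNodeCover I₁ U₁ R₁ m Γ₁) (h₂ : IsNodeCover I₂ U₂ R₂ m Γ₂)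
    (hS : Disjoint (I₁ ∪ U₁) (I₂ ∪ U₂)) (hT : Disjoint (U₁ ∪ R₁) (U₂ ∪ R₂)) {x y : N}
    (hx : x ∈ U₁ ∪ R₁) :
    Linked (Γ₁ + Γ₂) ↑(U₁ ∪ U₂) x y ↔ y ∈ U₁ ∪ R₁ ∧ Linked Γ₁ U₁ x y := by
  have h := h₁.linked_add_iff h₂ hS hT (fun _ => True) (y := y) hx
  have h3 : {u | u ∈ U₁ ∪ U₂ ∧ True} = (↑(U₁ ∪ U₂) : Set N) := by
    ext u
    simp
  have h4 : {u | u ∈ U₁ ∧ True} = (↑U₁ : Set N) := by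
    ext u
    simp
  rwa [h3, h4] at h

/-- In a union of two covers, the first of which is connected, the component of a left end of the
first one. -/
theorem IsNodeCover.meetsEnd_add_iff (hN : NodeSets (I₁ ∪ I₂) (U₁ ∪ U₂) (R₁ ∪ R₂))
    {Γ₁ Γ₂ : N → Multiset (N × ℕ)}
    (h₁ : IsNodeCover I₁ U₁ R₁ m Γ₁) (h₂ : IsNodeCover I₂ U₂ R₂ m Γ₂)
    (hS : Disjoint (I₁ ∪ U₁) (I₂ ∪ U₂)) (hT : Disjoint (U₁ ∪ R₁) (U₂ ∪ R₂))
    (hc : NodeConnected U₁ R₁ Γ₁) {i s : N} (hi : i ∈ I₁) :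
    MeetsEnd (I₁ ∪ I₂) (U₁ ∪ U₂) (Γ₁ + Γ₂) i s ↔ s ∈ I₁ ∪ (U₁ ∪ R₁) := by
  obtain ⟨t, ht⟩ := h₁.left i hi
  have htU : t ∈ U₁ ∪ R₁ := by
    rw [Finset.mem_union]
    exact h₁.mem i (t, m i) (by rw [ht]; exact Multiset.mem_singleton_self _)
  have hl : ∀ x, Linked (Γ₁ + Γ₂) ↑(U₁ ∪ U₂) x t ↔ x ∈ U₁ ∪ R₁ := by
    intro x
    constructor
    · exact fun h => ((h₁.linked_add_left_iff h₂ hS hT htU).mp h.symm).1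
    · exact fun h => (h₁.linked_add_left_iff h₂ hS hT h).mpr ⟨htU, hc x h t htU⟩
  rw [MeetsEnd, h₂.add_left hS (Finset.mem_union_left _ hi), ht]
  simp only [Multiset.mem_singleton, exists_eq_left, hl]
  by_cases hsI : s ∈ I₁ ∪ I₂
  · rw [if_pos hsI]
    have hnot : s ∉ U₁ ∪ R₁ := by
      intro h
      rcases Finset.mem_union.mp h with h | h
      · exact lt_irrefl _ (hN.left_lt s hsI s (Finset.mem_union_left _ h))
      · exact lt_irrefl _ (hN.left_lt_right s hsI s (Finset.mem_union_left _ h))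
    by_cases hs1 : s ∈ I₁
    · refine iff_of_true ?_ (Finset.mem_union_left _ hs1)
      obtain ⟨t', ht'⟩ := h₁.left s hs1
      rw [h₂.add_left hS (Finset.mem_union_left _ hs1)]
      refine ⟨(t', m s), by rw [ht']; exact Multiset.mem_singleton_self _, ?_⟩
      rw [Finset.mem_union]
      exact h₁.mem s (t', m s) (by rw [ht']; exact Multiset.mem_singleton_self _)
    · have hs2 := (Finset.mem_union.mp hsI).resolve_left hs1
      refine iff_of_false ?_ ?_
      · rintro ⟨e, he, hl'⟩
        rw [add_comm, h₁.add_left hS.symm (Finset.mem_union_left _ hs2)] at he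
        exact Finset.disjoint_left.mp hT hl' (Finset.mem_union.mpr (h₂.mem s e he))
      · rw [Finset.mem_union, not_or]
        exact ⟨hs1, hnot⟩
  · rw [if_neg hsI, Finset.mem_union (s := I₁)]
    have hs1 : s ∉ I₁ := fun h => hsI (Finset.mem_union_left _ h)
    simp only [hs1, false_or]

end NodeCover

end BHurwitz

/-! ### Decomposition of a cover that is disconnected by a cut -/

namespace BHurwitz

section NodeCover

variable {N : Type*} [LinearOrder N] {I U R I₁ U₁ R₁ I₂ U₂ R₂ : Finset N} {m : N → ℕ}

theorem NodeSets.disjoint_sources (hN : NodeSets (I₁ ∪ I₂) (U₁ ∪ U₂) (R₁ ∪ R₂))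
    (hI : Disjoint I₁ I₂) (hU : Disjoint U₁ U₂) : Disjoint (I₁ ∪ U₁) (I₂ ∪ U₂) := by
  rw [Finset.disjoint_left]
  intro s h h'
  rw [Finset.mem_union] at h h'
  rcases h with h | h <;> rcases h' with h' | h'
  · exact Finset.disjoint_left.mp hI h h'
  · exact lt_irrefl _ (hN.left_lt s (Finset.mem_union_left _ h) s (Finset.mem_union_right _ h'))
  · exact lt_irrefl _ (hN.left_lt s (Finset.mem_union_right _ h') s (Finset.mem_union_left _ h))
  · exact Finset.disjoint_left.mp hU h h'

theorem NodeSets.disjoint_targets (hN : NodeSets (I₁ ∪ I₂) (U₁ ∪ U₂) (R₁ ∪ R₂))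
    (hU : Disjoint U₁ U₂) (hR : Disjoint R₁ R₂) : Disjoint (U₁ ∪ R₁) (U₂ ∪ R₂) := by
  rw [Finset.disjoint_left]
  intro s h h'
  rw [Finset.mem_union] at h h'
  rcases h with h | h <;> rcases h' with h' | h'
  · exact Finset.disjoint_left.mp hU h h'
  · exact lt_irrefl _ (hN.lt_right s (Finset.mem_union_left _ h) s (Finset.mem_union_right _ h'))
  · exact lt_irrefl _ (hN.lt_right s (Finset.mem_union_right _ h') s (Finset.mem_union_left _ h))
  · exact Finset.disjoint_left.mp hR h h'

variable [Fintype N] {K : Type*} [Field K]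

theorem mem_splitFinset (hN : NodeSets I U R) {Γ : N → Multiset (N × ℕ)} {i v : N} :
    Γ ∈ splitFinset I U R m i v ↔ IsNodeCover I U R m Γ ∧
      ∀ x ∈ U ∪ R, ∃ e ∈ Γ i + Γ v, Linked Γ U x e.1 := by
  classical
  simp only [splitFinset, Finset.mem_filter, mem_coverFinset hN]

theorem IsNodeCover.exists_left {Γ : N → Multiset (N × ℕ)} (h : IsNodeCover I U R m Γ) {i : N}
    (hi : i ∈ I) : ∃ t, t ∈ U ∪ R ∧ Γ i = {(t, m i)} := by
  obtain ⟨t, ht⟩ := h.left i hi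
  refine ⟨t, ?_, ht⟩
  rw [Finset.mem_union]
  exact h.mem i (t, m i) (by rw [ht]; exact Multiset.mem_singleton_self _)

/-- The union of two connected covers is not connected, but becomes connected by joining a left end
of the first one and a left end of the second one. -/
theorem add_mem_splitFinset (hN : NodeSets (I₁ ∪ I₂) (U₁ ∪ U₂) (R₁ ∪ R₂))
    (hI : Disjoint I₁ I₂) (hU : Disjoint U₁ U₂) (hR : Disjoint R₁ R₂)
    {Γ₁ Γ₂ : N → Multiset (N × ℕ)} (h₁ : IsNodeCover I₁ U₁ R₁ m Γ₁)
    (h₂ : IsNodeCover I₂ U₂ R₂ m Γ₂) (hc₁ : NodeConnected U₁ R₁ Γ₁)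
    (hc₂ : NodeConnected U₂ R₂ Γ₂) {i v : N} (hi : i ∈ I₁) (hv : v ∈ I₂) :
    Γ₁ + Γ₂ ∈ splitFinset (I₁ ∪ I₂) (U₁ ∪ U₂) (R₁ ∪ R₂) m i v ∧
      ¬ NodeConnected (U₁ ∪ U₂) (R₁ ∪ R₂) (Γ₁ + Γ₂) := by
  have hS := hN.disjoint_sources hI hU
  have hT := hN.disjoint_targets hU hR
  obtain ⟨t, htU, ht⟩ := h₁.exists_left hi
  obtain ⟨t', htU', ht'⟩ := h₂.exists_left hv
  have hl : ∀ {x y}, x ∈ U₂ ∪ R₂ → (Linked (Γ₁ + Γ₂) ↑(U₁ ∪ U₂) x y ↔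
      y ∈ U₂ ∪ R₂ ∧ Linked Γ₂ U₂ x y) := by
    intro x y hx
    rw [add_comm, Finset.union_comm]
    exact h₂.linked_add_left_iff h₁ hS.symm hT.symm hx
  have hun : U₁ ∪ U₂ ∪ (R₁ ∪ R₂) = (U₁ ∪ R₁) ∪ (U₂ ∪ R₂) := Finset.union_union_union_comm _ _ _ _
  constructor
  · rw [mem_splitFinset hN]
    refine ⟨h₁.add h₂ hS hT, fun x hx => ?_⟩
    rw [h₂.add_left hS (Finset.mem_union_left _ hi), ht, add_comm Γ₁,
      h₁.add_left hS.symm (Finset.mem_union_left _ hv), ht', add_comm Γ₂]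
    rw [hun, Finset.mem_union] at hx
    rcases hx with hx | hx
    · exact ⟨(t, m i), by simp, (h₁.linked_add_left_iff h₂ hS hT hx).mpr ⟨htU, hc₁ x hx t htU⟩⟩
    · exact ⟨(t', m v), by simp, (hl hx).mpr ⟨htU', hc₂ x hx t' htU'⟩⟩
  · intro h
    rw [NodeConnected, hun] at h
    have h3 := h t (Finset.mem_union_left _ htU) t' (Finset.mem_union_right _ htU')
    exact Finset.disjoint_left.mp hT ((h₁.linked_add_left_iff h₂ hS hT htU).mp h3).1 htU'

open Classical in
/-- A disconnected cover that becomes connected by joining two left ends is the union of two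
connected covers. -/
theorem restrictTo_connected (hN : NodeSets I U R) {Γ : N → Multiset (N × ℕ)} {i v : N}
    (hi : i ∈ I) (hv : v ∈ I) (h : Γ ∈ splitFinset I U R m i v) (hc : ¬ NodeConnected U R Γ)
    (P : N → Prop) (hP : P = MeetsEnd I U Γ i) :
    P i ∧ ¬ P v ∧ restrictTo P Γ ∈ connFinset (I.filter P) (U.filter P) (R.filter P) m ∧
      restrictTo (fun s => ¬ P s) Γ ∈ connFinset (I.filter fun s => ¬ P s)
        (U.filter fun s => ¬ P s) (R.filter fun s => ¬ P s) m := by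
  rw [mem_splitFinset hN] at h
  obtain ⟨h, hl⟩ := h
  have hcl : ∀ s, ∀ e ∈ Γ s, (P s ↔ P e.1) := by
    rw [hP]
    exact h.meetsEnd_closed hN i
  obtain ⟨t, htU, ht⟩ := h.exists_left hi
  obtain ⟨t', htU', ht'⟩ := h.exists_left hv
  -- Every node is linked to the target of `i` or to that of `v`; if these were linked, the cover
  -- would be connected.
  have htt : Linked Γ U t' t → False := by
    intro h1
    refine hc ((nodeConnected_iff_single htU).mpr fun x hx => ?_)
    obtain ⟨e, he, h2⟩ := hl x hx
    rw [ht, ht', Multiset.mem_add, Multiset.mem_singleton, Multiset.mem_singleton] at he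
    rcases he with rfl | rfl
    · exact h2
    · exact h2.trans h1
  have hPI : ∀ x ∈ U ∪ R, (P x ↔ Linked Γ U x t) := by
    intro x hx
    have hxI : x ∉ I := by
      intro hxI
      rcases Finset.mem_union.mp hx with h1 | h1
      · exact lt_irrefl _ (hN.left_lt _ hxI _ h1)
      · exact lt_irrefl _ (hN.left_lt_right _ hxI _ h1)
    rw [hP, MeetsEnd, ht]
    simp only [Multiset.mem_singleton, exists_eq_left, if_neg hxI]
  have hPt : P t := (hPI t htU).mpr (Linked.refl _ _ _)
  have hPi : P i := (hcl i (t, m i) (by rw [ht]; exact Multiset.mem_singleton_self _)).mpr hPt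
  have hPt' : ¬ P t' := fun h1 => htt ((hPI t' htU').mp h1)
  have hPv : ¬ P v := fun h1 =>
    hPt' ((hcl v (t', m v) (by rw [ht']; exact Multiset.mem_singleton_self _)).mp h1)
  have h₁ := h.restrictTo hcl
  have h₂ := h.restrictTo (P := fun s => ¬ P s) fun s e he => not_congr (hcl s e he)
  have hNN : NodeSets (I.filter P ∪ I.filter fun s => ¬ P s) (U.filter P ∪ U.filter fun s => ¬ P s)
      (R.filter P ∪ R.filter fun s => ¬ P s) := by
    rwa [Finset.filter_union_filter_not_eq, Finset.filter_union_filter_not_eq,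
      Finset.filter_union_filter_not_eq]
  have hS := hNN.disjoint_sources (Finset.disjoint_filter_filter_not _ _ _)
    (Finset.disjoint_filter_filter_not _ _ _)
  have hT := hNN.disjoint_targets (Finset.disjoint_filter_filter_not _ _ _)
    (Finset.disjoint_filter_filter_not _ _ _)
  have hl₁ := fun x y => h₁.linked_add_left_iff h₂ hS hT (x := x) (y := y)
  have hl₂ := fun x y => h₂.linked_add_left_iff h₁ hS.symm hT.symm (x := x) (y := y)
  rw [restrictTo_add_not, Finset.filter_union_filter_not_eq, ← Finset.filter_union] at hl₁
  rw [add_comm, restrictTo_add_not, Finset.union_comm (U.filter fun s => ¬ P s) (U.filter P),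
    Finset.filter_union_filter_not_eq,
    ← Finset.filter_union] at hl₂
  refine ⟨hPi, hPv, ?_, ?_⟩
  · rw [mem_connFinset (hN.mono (Finset.filter_subset _ _) (Finset.filter_subset _ _)
      (Finset.filter_subset _ _))]
    refine ⟨h₁, ?_⟩
    rw [nodeConnected_iff_single (t := t), ← Finset.filter_union]
    · intro x hx
      have hx' := Finset.mem_filter.mp hx
      exact ((hl₁ x t hx).mp ((hPI x hx'.1).mp hx'.2)).2
    · rw [← Finset.filter_union]
      exact Finset.mem_filter.mpr ⟨htU, hPt⟩
  · rw [mem_connFinset (hN.mono (Finset.filter_subset _ _) (Finset.filter_subset _ _)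
      (Finset.filter_subset _ _))]
    refine ⟨h₂, ?_⟩
    rw [nodeConnected_iff_single (t := t'), ← Finset.filter_union]
    · intro x hx
      have hx' := Finset.mem_filter.mp hx
      refine ((hl₂ x t' hx).mp ?_).2
      obtain ⟨e, he, h3⟩ := hl x hx'.1
      rw [ht, ht', Multiset.mem_add, Multiset.mem_singleton, Multiset.mem_singleton] at he
      rcases he with rfl | rfl
      · exact absurd ((hPI x hx'.1).mpr h3) hx'.2
      · exact h3
    · rw [← Finset.filter_union]
      exact Finset.mem_filter.mpr ⟨htU', hPt'⟩

/-- The covers counted on the left are connected, or they consist of a component with the end `i`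
and another one with the end `v`. In the second case the remaining left ends, the vertices and the
right ends are distributed over the components, and the weight is multiplicative. -/
theorem sum_splitFinset (b : K) (hN : NodeSets I U R) {i v : N} (hi : i ∈ I) (hv : v ∈ I)
    (hiv : i ≠ v) : ∑ Γ ∈ splitFinset I U R m i v, coverWeight b U R Γ = coverSum b I U R m +
      ∑ p ∈ ((I.erase i).erase v).powerset ×ˢ (U.powerset ×ˢ R.powerset),
        coverSum b (insert i p.1) p.2.1 p.2.2 m *
          coverSum b (I \ insert i p.1) (U \ p.2.1) (R \ p.2.2) m := by
  classical
  rw [← Finset.sum_filter_add_sum_filter_not _ fun Γ => NodeConnected U R Γ]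
  congr 1
  · rw [coverSum]
    refine Finset.sum_congr ?_ fun _ _ => rfl
    ext Γ
    rw [Finset.mem_filter, mem_splitFinset hN, mem_connFinset hN]
    refine ⟨fun h => ⟨h.1.1, h.2⟩, fun h => ⟨⟨h.1, fun x hx => ?_⟩, h.2⟩⟩
    obtain ⟨t, htU, ht⟩ := h.1.exists_left hi
    exact ⟨(t, m i), by rw [ht]; simp, h.2 x hx t htU⟩
  · simp only [coverSum, Finset.sum_mul_sum]
    simp only [← Finset.sum_product']
    rw [Finset.sum_sigma']
    have hsub : ∀ p ∈ ((I.erase i).erase v).powerset ×ˢ (U.powerset ×ˢ R.powerset),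
        insert i p.1 ∪ (I \ insert i p.1) = I ∧ p.2.1 ∪ (U \ p.2.1) = U ∧
          p.2.2 ∪ (R \ p.2.2) = R ∧ i ∉ p.1 ∧ v ∈ I \ insert i p.1 := by
      intro p hp
      rw [Finset.mem_product, Finset.mem_product, Finset.mem_powerset, Finset.mem_powerset,
        Finset.mem_powerset] at hp
      refine ⟨Finset.union_sdiff_of_subset ?_, Finset.union_sdiff_of_subset hp.2.1,
        Finset.union_sdiff_of_subset hp.2.2, ?_, ?_⟩
      · exact Finset.insert_subset hi (hp.1.trans ((Finset.erase_subset _ _).trans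
          (Finset.erase_subset _ _)))
      · intro h
        have := hp.1 h
        simp at this
      · rw [Finset.mem_sdiff, Finset.mem_insert, not_or]
        refine ⟨hv, hiv.symm, fun h => ?_⟩
        have := hp.1 h
        simp at this
    have key : ∀ p ∈ ((I.erase i).erase v).powerset ×ˢ (U.powerset ×ˢ R.powerset),
        ∀ Γ₁ ∈ connFinset (insert i p.1) p.2.1 p.2.2 m,
        ∀ Γ₂ ∈ connFinset (I \ insert i p.1) (U \ p.2.1) (R \ p.2.2) m,
        Γ₁ + Γ₂ ∈ splitFinset I U R m i v ∧ ¬ NodeConnected U R (Γ₁ + Γ₂) ∧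
        (∀ s, MeetsEnd I U (Γ₁ + Γ₂) i s ↔ s ∈ insert i p.1 ∪ (p.2.1 ∪ p.2.2)) ∧
        coverWeight b U R (Γ₁ + Γ₂) = coverWeight b p.2.1 p.2.2 Γ₁ *
          coverWeight b (U \ p.2.1) (R \ p.2.2) Γ₂ ∧
        (∀ s, s ∈ insert i p.1 ∪ p.2.1 → (Γ₁ + Γ₂) s = Γ₁ s) ∧
        (∀ s, s ∉ insert i p.1 ∪ p.2.1 → Γ₁ s = 0) := by
      intro p hp Γ₁ h₁ Γ₂ h₂
      obtain ⟨hI, hU, hR, hip, hvp⟩ := hsub p hp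
      have hN' := hN
      rw [← hI, ← hU, ← hR] at hN'
      rw [mem_connFinset (hN'.mono Finset.subset_union_left Finset.subset_union_left
        Finset.subset_union_left)] at h₁
      rw [mem_connFinset (hN'.mono Finset.subset_union_right Finset.subset_union_right
        Finset.subset_union_right)] at h₂
      have hS := hN'.disjoint_sources Finset.disjoint_sdiff Finset.disjoint_sdiff
      have hT := hN'.disjoint_targets Finset.disjoint_sdiff Finset.disjoint_sdiff
      have h3 := add_mem_splitFinset hN' Finset.disjoint_sdiff Finset.disjoint_sdiff
        Finset.disjoint_sdiff h₁.1 h₂.1 h₁.2 h₂.2 (Finset.mem_insert_self i p.1) hvp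
      have h4 := fun s => h₁.1.meetsEnd_add_iff (s := s) hN' h₂.1 hS hT h₁.2
        (Finset.mem_insert_self i p.1)
      have h5 := h₁.1.coverWeight_add b h₂.1 hS hT
      rw [hI, hU, hR] at h3
      rw [hI, hU] at h4
      rw [hU, hR] at h5
      refine ⟨h3.1, h3.2, h4, h5, fun s hs => h₂.1.add_left hS hs, fun s hs => ?_⟩
      rw [Finset.mem_union, not_or] at hs
      exact h₁.1.eq_zero s hs.1 hs.2
    symm
    refine Finset.sum_bij (fun a _ => a.2.1 + a.2.2) ?_ ?_ ?_ ?_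
    · rintro ⟨p, Γ₁, Γ₂⟩ h
      replace h := (Finset.mem_sigma.mp h).imp_right Finset.mem_product.mp
      obtain ⟨h1, h2, _⟩ := key p h.1 Γ₁ h.2.1 Γ₂ h.2.2
      exact Finset.mem_filter.mpr ⟨h1, h2⟩
    · rintro ⟨⟨p, q, r⟩, Γ₁, Γ₂⟩ h ⟨⟨p', q', r'⟩, Γ₁', Γ₂'⟩ h' heq
      replace h := (Finset.mem_sigma.mp h).imp_right Finset.mem_product.mp
      replace h' := (Finset.mem_sigma.mp h').imp_right Finset.mem_product.mp
      dsimp only at h h' heq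
      obtain ⟨_, _, h3, _, h5, h6⟩ := key _ h.1 Γ₁ h.2.1 Γ₂ h.2.2
      obtain ⟨_, _, h3', _, h5', h6'⟩ := key _ h'.1 Γ₁' h'.2.1 Γ₂' h'.2.2
      obtain ⟨_, _, _, hip, _⟩ := hsub _ h.1
      obtain ⟨_, _, _, hip', _⟩ := hsub _ h'.1
      have hp := Finset.mem_product.mp h.1
      have hp' := Finset.mem_product.mp h'.1
      rw [Finset.mem_product, Finset.mem_powerset, Finset.mem_powerset, Finset.mem_powerset]
        at hp hp'
      dsimp only at *
      -- The node set of the first component is read off from the union through `MeetsEnd`, so the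
      -- distribution of the nodes is determined by the union.
      have hmem : ∀ s, s ∈ insert i p ∪ (q ∪ r) ↔ s ∈ insert i p' ∪ (q' ∪ r') := by
        intro s
        rw [← h3, ← h3', heq]
      have hpart : ∀ {p : Finset N} {q r : Finset N}, p ⊆ (I.erase i).erase v → q ⊆ U → r ⊆ R →
          p = (((I.erase i).erase v).filter fun s => s ∈ insert i p ∪ (q ∪ r)) ∧
          q = U.filter (fun s => s ∈ insert i p ∪ (q ∪ r)) ∧
          r = R.filter (fun s => s ∈ insert i p ∪ (q ∪ r)) := by
        intro p q r hp hq hr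
        have hpI : ∀ s ∈ p, s ∈ I := fun s hs =>
          Finset.mem_of_mem_erase (Finset.mem_of_mem_erase (hp hs))
        have a1 : ∀ s ∈ I, s ∉ U := fun s h h' => lt_irrefl _ (hN.left_lt s h s h')
        have a2 : ∀ s ∈ I, s ∉ R := fun s h h' => lt_irrefl _ (hN.left_lt_right s h s h')
        have a3 : ∀ s ∈ U, s ∉ R := fun s h h' => lt_irrefl _ (hN.lt_right s h s h')
        refine ⟨?_, ?_, ?_⟩
        · ext s
          rw [Finset.mem_filter, Finset.mem_union, Finset.mem_union, Finset.mem_insert]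
          refine ⟨fun h => ⟨hp h, Or.inl (Or.inr h)⟩, ?_⟩
          rintro ⟨h1, (rfl | h2) | h2 | h2⟩
          · simp at h1
          · exact h2
          · exact absurd (hq h2) (a1 s (Finset.mem_of_mem_erase (Finset.mem_of_mem_erase h1)))
          · exact absurd (hr h2) (a2 s (Finset.mem_of_mem_erase (Finset.mem_of_mem_erase h1)))
        · ext s
          rw [Finset.mem_filter, Finset.mem_union, Finset.mem_union, Finset.mem_insert]
          refine ⟨fun h => ⟨hq h, Or.inr (Or.inl h)⟩, ?_⟩
          rintro ⟨h1, (rfl | h2) | h2 | h2⟩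
          · exact absurd h1 (a1 _ hi)
          · exact absurd h1 (a1 _ (hpI s h2))
          · exact h2
          · exact absurd (hr h2) (a3 s h1)
        · ext s
          rw [Finset.mem_filter, Finset.mem_union, Finset.mem_union, Finset.mem_insert]
          refine ⟨fun h => ⟨hr h, Or.inr (Or.inr h)⟩, ?_⟩
          rintro ⟨h1, (rfl | h2) | h2 | h2⟩
          · exact absurd h1 (a2 _ hi)
          · exact absurd h1 (a2 _ (hpI s h2))
          · exact absurd h1 (a3 _ (hq h2))
          · exact h2
      obtain ⟨e1, e2, e3⟩ := hpart hp.1 hp.2.1 hp.2.2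
      obtain ⟨e1', e2', e3'⟩ := hpart hp'.1 hp'.2.1 hp'.2.2
      simp only [hmem] at e1 e2 e3
      replace e1 := e1.trans e1'.symm
      replace e2 := e2.trans e2'.symm
      replace e3 := e3.trans e3'.symm
      clear e1' e2' e3'
      subst e1 e2 e3
      have hΓ : Γ₁ = Γ₁' := by
        funext s
        by_cases hs : s ∈ insert i p ∪ q
        · rw [← h5 s hs, ← h5' s hs, heq]
        · rw [h6 s hs, h6' s hs]
      subst hΓ
      rw [add_left_cancel heq]
    · intro Γ h
      rw [Finset.mem_filter] at h
      obtain ⟨hPi, hPv, h1, h2⟩ := restrictTo_connected hN hi hv h.1 h.2 _ rfl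
      set P := MeetsEnd I U Γ i with hP
      have hins : insert i (((I.erase i).erase v).filter P) = I.filter P := by
        ext s
        simp only [Finset.mem_insert, Finset.mem_filter, Finset.mem_erase]
        constructor
        · rintro (rfl | ⟨⟨_, _, h3⟩, h4⟩)
          · exact ⟨hi, hPi⟩
          · exact ⟨h3, h4⟩
        · rintro ⟨h3, h4⟩
          by_cases hsi : s = i
          · exact Or.inl hsi
          · refine Or.inr ⟨⟨?_, hsi, h3⟩, h4⟩
            rintro rfl
            exact hPv h4
      refine ⟨⟨(((I.erase i).erase v).filter P, U.filter P, R.filter P),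
        (restrictTo P Γ, restrictTo (fun s => ¬ P s) Γ)⟩, ?_, restrictTo_add_not P Γ⟩
      rw [Finset.mem_sigma, Finset.mem_product, Finset.mem_product, Finset.mem_product]
      dsimp only
      rw [hins, ← Finset.filter_not, ← Finset.filter_not, ← Finset.filter_not]
      simp only [Finset.mem_powerset, Finset.filter_subset, true_and]
      exact ⟨h1, h2⟩
    · rintro ⟨p, Γ₁, Γ₂⟩ h
      replace h := (Finset.mem_sigma.mp h).imp_right Finset.mem_product.mp
      obtain ⟨_, _, _, h4, _⟩ := key p h.1 Γ₁ h.2.1 Γ₂ h.2.2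
      exact h4.symm

end NodeCover

end BHurwitz

/-! ### The recursion for the weighted number of covers -/

namespace BHurwitz

open Finset.HasAntidiagonal MvPolynomial

/-- Grouping subsets by size, the binomial coefficient times the two factorials is `|s|!`. So sums
over set partitions become ordinary convolutions once values carry a factorial. -/
theorem sum_powerset_factorial_smul {α M : Type*} [DecidableEq α] [AddCommMonoid M] (s : Finset α)
    (g : ℕ → ℕ → M) :
    ∑ t ∈ s.powerset, (t.card.factorial * (s \ t).card.factorial) • g t.card (s \ t).card =
      s.card.factorial • ∑ j ∈ antidiagonal s.card, g j.1 j.2 := by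
  have h := Finset.sum_powerset_apply_card (fun n =>
    (n.factorial * (s.card - n).factorial) • g n (s.card - n)) (x := s)
  rw [Finset.sum_congr rfl (g := fun t : Finset α => (t.card.factorial *
    (s.card - t.card).factorial) • g t.card (s.card - t.card))]
  · rw [h, Finset.Nat.sum_antidiagonal_eq_sum_range_succ_mk, Finset.smul_sum]
    refine Finset.sum_congr rfl fun m hm => ?_
    rw [smul_smul, ← mul_assoc, Nat.choose_mul_factorial_mul_factorial]
    exact Nat.lt_succ_iff.mp (Finset.mem_range.mp hm)
  · intro t ht
    rw [Finset.card_sdiff_of_subset (Finset.mem_powerset.mp ht)]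

theorem sum_powerset_factorial {α K : Type*} [DecidableEq α] [Field K] (s : Finset α)
    (g : ℕ → ℕ → K) :
    ∑ t ∈ s.powerset, (t.card.factorial * (s \ t).card.factorial : K) * g t.card (s \ t).card =
      s.card.factorial * ∑ j ∈ antidiagonal s.card, g j.1 j.2 := by
  simpa only [nsmul_eq_mul, Nat.cast_mul] using sum_powerset_factorial_smul s g

section NodeCover

variable {N : Type*} [LinearOrder N] {I U R : Finset N} {m : N → ℕ} {v : N}
variable {K : Type*} [Field K]

theorem partCoeff_one (I : Finset N) (m : N → ℕ) :
    partCoeff I m (1 : MvPolynomial ℕ K) = if I = ∅ then 1 else 0 := by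
  split_ifs with h
  · rw [h, partCoeff_empty, map_one]
  · obtain ⟨i, hi⟩ := Finset.nonempty_iff_ne_empty.mpr h
    rw [← partCoeff_erase hi, pderiv_one]
    simpa using partCoeff_smul (I.erase i) m (0 : K) 0

theorem partCoeff_update_of_notMem {i : N} (hi : i ∉ I) (m : N → ℕ) (x : ℕ)
    (f : MvPolynomial ℕ K) : partCoeff I (Function.update m i x) f = partCoeff I m f :=
  partCoeff_congr (fun _ hj => Function.update_of_ne (ne_of_mem_of_not_mem hj hi) _ _) f

variable [Fintype N]

/-- Every cover is charged to the left ends at its leftmost vertex. Summing over all left ends is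
what makes this a total recursion. -/
theorem coverSum_insert [CharZero K] (b : K) (hN : NodeSets I (insert v U) R)
    (hv : ∀ u ∈ U, v < u) (hm : ∀ i ∈ I, 0 < m i) :
    coverSum b I (insert v U) R m = ((U.card : K) + 1) / R.card * ∑ i ∈ I,
      ((m i : K) * (b * ((m i : K) - 1)) * coverSum b I U R m +
        ∑ j ∈ I.erase i, ((m i : K) + m j) *
          coverSum b (I.erase j) U R (Function.update m i (m i + m j)) +
        ∑ x ∈ antidiagonal (m i), (x.1 * x.2 : K) * (1 + b) *
          ∑ Γ ∈ splitFinset (insert v I) U R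
            (Function.update (Function.update m i x.1) v x.2) i v, coverWeight b U R Γ) := by
  classical
  -- A join of `p` and `q` shows up for both ordered pairs, whence the factor `1/2`; it later
  -- cancels the `2` of the `3`-valent vertex.
  have hsplit : ∀ Γ ∈ connFinset I (insert v U) R m, coverWeight b (insert v U) R Γ =
      ∑ i ∈ I, ((if leftEndsAt I m Γ v = {i} ∧ (Γ v).card = 1 then
          coverWeight b (insert v U) R Γ else 0) +
        (1 / 2) * ∑ j ∈ I.erase i, (if leftEndsAt I m Γ v = {i, j} then
          coverWeight b (insert v U) R Γ else 0) +
        (if leftEndsAt I m Γ v = {i} ∧ (Γ v).card = 2 then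
          coverWeight b (insert v U) R Γ else 0)) := by
    intro Γ h
    rw [mem_connFinset hN] at h
    have hpair : ∀ p i j : N, i ≠ j → ({p} : Finset N) ≠ {i, j} := by
      intro p i j hij h
      have := congrArg Finset.card h
      rw [Finset.card_singleton, Finset.card_pair hij] at this
      omega
    have hz : ∀ p i, ∑ j ∈ I.erase i, (if ({p} : Finset N) = {i, j} then
        coverWeight b (insert v U) R Γ else 0) = 0 := fun p i =>
      Finset.sum_eq_zero fun j hj => if_neg (hpair p i j (Finset.ne_of_mem_erase hj).symm)
    rcases h.1.vertex_cases hN hv with ⟨p, hp, h1⟩ | ⟨p, q, hpq, hp, h1⟩ | ⟨p, hp, h1⟩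
    · have hpI := (mem_leftEndsAt.mp (hp.symm ▸ Finset.mem_singleton_self p)).1
      rw [hp, h1]
      simp only [hz, Finset.singleton_inj, and_true, mul_zero, add_zero, OfNat.one_ne_ofNat,
        and_false, if_false, Finset.sum_ite_eq, hpI, if_true]
    · have hpI := (mem_leftEndsAt.mp (hp.symm ▸ Finset.mem_insert_self p _)).1
      have hqI := (mem_leftEndsAt.mp
        (hp.symm ▸ Finset.mem_insert_of_mem (Finset.mem_singleton_self q))).1
      have h2 : ∀ i, ({p, q} : Finset N) ≠ {i} := fun i h => hpair i p q hpq h.symm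
      have h3 : ∀ i, ∑ j ∈ I.erase i, (if ({p, q} : Finset N) = {i, j} then
          coverWeight b (insert v U) R Γ else 0) =
          (if p = i then coverWeight b (insert v U) R Γ else 0) +
            (if q = i then coverWeight b (insert v U) R Γ else 0) := by
        have hne : ∀ i j, i ≠ j → (({p, q} : Finset N) = {i, j} ↔
            (p = i ∧ q = j) ∨ (q = i ∧ p = j)) := by
          intro i j hij
          constructor
          · intro h
            have hi : i ∈ ({p, q} : Finset N) := h ▸ Finset.mem_insert_self i _
            have hj : j ∈ ({p, q} : Finset N) :=
              h ▸ Finset.mem_insert_of_mem (Finset.mem_singleton_self j)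
            rw [Finset.mem_insert, Finset.mem_singleton] at hi hj
            rcases hi with rfl | rfl <;> rcases hj with rfl | rfl
            · exact absurd rfl hij
            · exact Or.inl ⟨rfl, rfl⟩
            · exact Or.inr ⟨rfl, rfl⟩
            · exact absurd rfl hij
          · rintro (⟨rfl, rfl⟩ | ⟨rfl, rfl⟩)
            · rfl
            · exact Finset.pair_comm _ _
        intro i
        by_cases hpi : p = i
        · subst hpi
          rw [Finset.sum_eq_single q, if_pos rfl, if_pos rfl, if_neg hpq.symm, add_zero]
          · intro j hj hjq
            rw [if_neg]
            rw [hne p j (Finset.ne_of_mem_erase hj).symm]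
            rintro (⟨_, rfl⟩ | ⟨h4, _⟩)
            · exact hjq rfl
            · exact hpq h4.symm
          · intro h4
            exact absurd (Finset.mem_erase.mpr ⟨hpq.symm, hqI⟩) h4
        · by_cases hqi : q = i
          · subst hqi
            rw [Finset.sum_eq_single p, if_pos (Finset.pair_comm _ _), if_neg hpi, if_pos rfl,
              zero_add]
            · intro j hj hjp
              rw [if_neg]
              rw [hne q j (Finset.ne_of_mem_erase hj).symm]
              rintro (⟨h4, _⟩ | ⟨_, rfl⟩)
              · exact hpq h4
              · exact hjp rfl
            · intro h4
              exact absurd (Finset.mem_erase.mpr ⟨hpq, hpI⟩) h4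
          · rw [if_neg hpi, if_neg hqi, add_zero]
            refine Finset.sum_eq_zero fun j hj => if_neg ?_
            rw [hne i j (Finset.ne_of_mem_erase hj).symm]
            rintro (⟨h4, _⟩ | ⟨h4, _⟩)
            · exact hpi h4
            · exact hqi h4
      rw [hp]
      simp only [h2, h3, false_and, if_false, zero_add, add_zero]
      rw [← Finset.mul_sum, Finset.sum_add_distrib, Finset.sum_ite_eq, Finset.sum_ite_eq,
        if_pos hpI, if_pos hqI]
      ring
    · have hpI := (mem_leftEndsAt.mp (hp.symm ▸ Finset.mem_singleton_self p)).1
      rw [hp, h1]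
      simp only [hz, Finset.singleton_inj, and_true, mul_zero, zero_add, OfNat.ofNat_ne_one,
        and_false, if_false, Finset.sum_ite_eq, hpI, if_true]
  rw [coverSum, Finset.sum_congr rfl hsplit, Finset.sum_comm, Finset.mul_sum]
  refine Finset.sum_congr rfl fun i hi => ?_
  rw [Finset.sum_add_distrib, Finset.sum_add_distrib, ← Finset.mul_sum, Finset.sum_comm,
    ← Finset.sum_filter, ← Finset.sum_filter, sum_twist b hN hv hi, sum_split b hN hv hi,
    mul_add, mul_add, Finset.mul_sum, Finset.mul_sum, Finset.mul_sum]
  congr 1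
  · congr 1
    · ring
    · refine Finset.sum_congr rfl fun j hj => ?_
      rw [← Finset.sum_filter, sum_join b hN hv hm hi (Finset.mem_of_mem_erase hj)
        (Finset.ne_of_mem_erase hj).symm]
      ring
  · exact Finset.sum_congr rfl fun x _ => by ring

end NodeCover

end BHurwitz

/-! ### Evaluation of the weighted number of covers -/

namespace BHurwitz

open Finset.HasAntidiagonal MvPolynomial

section NodeCover

variable {N : Type*} [LinearOrder N] {I U R : Finset N} {m : N → ℕ} {v : N}
variable {K : Type*} [Field K]

/-- The predicted value of `coverSum`. -/
noncomputable def coverValue (b : K) (I U R : Finset N) (m : N → ℕ) : K :=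
  if ∑ i ∈ I, m i = R.card then
    U.card.factorial * R.card.factorial * (1 + b) ^ R.card *
      partCoeff I m (hurwitzPoly b (1 / (1 + b)) U.card) else 0

/-- The convolution of two values. -/
theorem sum_coverValue_mul (b : K) {I' : Finset N} {i v : N} (hi : i ∉ I') (hv : v ∉ I')
    {x : ℕ × ℕ} (hmi : m i = x.1) (hmv : m v = x.2) :
    ∑ p ∈ I'.powerset ×ˢ (U.powerset ×ˢ R.powerset),
        coverValue b (insert i p.1) p.2.1 p.2.2 m *
          coverValue b (insert v (I' \ p.1)) (U \ p.2.1) (R \ p.2.2) m =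
      if ∑ j ∈ I', m j + (x.1 + x.2) = R.card then
        U.card.factorial * R.card.factorial * (1 + b) ^ R.card *
          partCoeff I' m (∑ j ∈ antidiagonal U.card,
            pderiv x.1 (hurwitzPoly b (1 / (1 + b)) j.1) *
              pderiv x.2 (hurwitzPoly b (1 / (1 + b)) j.2)) else 0 := by
  classical
  set F := hurwitzPoly b (1 / (1 + b)) with hF
  have h1 : ∀ p ∈ I'.powerset, ∀ q ∈ U.powerset, ∑ r ∈ R.powerset,
      coverValue b (insert i p) q r m *
        coverValue b (insert v (I' \ p)) (U \ q) (R \ r) m =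
      (if ∑ j ∈ I', m j + (x.1 + x.2) = R.card then (R.card.factorial : K) * (1 + b) ^ R.card
        else 0) * ((q.card.factorial * (U \ q).card.factorial : K) *
          (partCoeff p m (pderiv x.1 (F q.card)) *
            partCoeff (I' \ p) m (pderiv x.2 (F (U \ q).card)))) := by
    intro p hp q hq
    rw [Finset.mem_powerset] at hp hq
    have hip : i ∉ p := fun h => hi (hp h)
    have hvp : v ∉ I' \ p := fun h => hv (Finset.sdiff_subset h)
    have hs : ∑ j ∈ I', m j = ∑ j ∈ p, m j + ∑ j ∈ I' \ p, m j := by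
      rw [add_comm, Finset.sum_sdiff hp]
    set s₁ := x.1 + ∑ j ∈ p, m j with hs1
    set s₂ := x.2 + ∑ j ∈ I' \ p, m j with hs2
    -- Each component is balanced, so the weights of its left ends prescribe the number of its right
    -- ends. The choices of the right ends combine with the factorials to `|R|!` if the total
    -- weights fit, and to zero otherwise.
    have hsum := sum_powerset_factorial (K := K) R fun a c => if s₁ = a ∧ s₂ = c then 1 else 0
    have h2 : ∑ j ∈ antidiagonal R.card,
        (if s₁ = j.1 ∧ s₂ = j.2 then (1 : K) else 0) =
        if ∑ j ∈ I', m j + (x.1 + x.2) = R.card then 1 else 0 := by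
      have h3 : ∑ j ∈ I', m j + (x.1 + x.2) = s₁ + s₂ := by
        rw [hs]
        ring
      rw [h3]
      split_ifs with h4
      · rw [Finset.sum_eq_single (s₁, s₂)]
        · simp
        · intro j _ hj
          rw [if_neg]
          rintro ⟨h5, h6⟩
          exact hj (Prod.ext h5.symm h6.symm)
        · intro h5
          exact absurd (mem_antidiagonal.mpr h4) h5
      · refine Finset.sum_eq_zero fun j hj => if_neg ?_
        rintro ⟨h5, h6⟩
        rw [mem_antidiagonal] at hj
        omega
    rw [h2] at hsum
    have h6 : (if ∑ j ∈ I', m j + (x.1 + x.2) = R.card then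
        (R.card.factorial : K) * (1 + b) ^ R.card else 0) = (1 + b) ^ R.card *
        ((R.card.factorial : K) * if ∑ j ∈ I', m j + (x.1 + x.2) = R.card then 1 else 0) := by
      split_ifs <;> ring
    rw [h6, ← hsum, Finset.mul_sum, Finset.sum_mul]
    refine Finset.sum_congr rfl fun r hr => ?_
    rw [Finset.mem_powerset] at hr
    rw [coverValue, coverValue, Finset.sum_insert hip, Finset.sum_insert hvp,
      partCoeff_insert hip, partCoeff_insert hvp, hmi, hmv, ← hF, ← hs1, ← hs2]
    have h4 : (1 + b) ^ R.card = (1 + b) ^ r.card * (1 + b) ^ (R \ r).card := by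
      rw [← pow_add, Nat.add_comm, Finset.card_sdiff_add_card_eq_card hr]
    rw [h4]
    by_cases h5 : s₁ = r.card
    · by_cases h6 : s₂ = (R \ r).card
      · rw [if_pos h5, if_pos h6, if_pos ⟨h5, h6⟩]
        ring
      · rw [if_neg h6, if_neg (c := s₁ = r.card ∧ s₂ = (R \ r).card) fun h => h6 h.2]
        ring
    · rw [if_neg h5, if_neg (c := s₁ = r.card ∧ s₂ = (R \ r).card) fun h => h5 h.1]
      ring
  rw [Finset.sum_product]
  simp only [Finset.sum_product]
  rw [Finset.sum_congr rfl fun p hp => Finset.sum_congr rfl (h1 p hp)]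
  simp only [← Finset.mul_sum]
  rw [Finset.sum_comm]
  simp only [← Finset.mul_sum, ← partCoeff_mul]
  rw [sum_powerset_factorial U fun a c => partCoeff I' m (pderiv x.1 (F a) * pderiv x.2 (F c)),
    partCoeff_sum]
  split_ifs <;> ring

variable [Fintype N]

/-- A connected cover without vertices is a single edge of weight one from a left end to a right
end. Its weight `1` equals `(1 + b) · 1 / (1 + b)`, which explains the initial value of
`hurwitzPoly`. -/
theorem coverSum_empty (b : K) (hb : 1 + b ≠ 0) (hN : NodeSets I ∅ R) (hI : I.Nonempty) :
    coverSum b I ∅ R m = coverValue b I ∅ R m := by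
  classical
  have hlink : ∀ {Γ : N → Multiset (N × ℕ)} {x y : N}, Linked Γ ↑(∅ : Finset N) x y → y = x := by
    intro Γ x y h
    exact (Linked.iff_of_closed (fun z => z = x) (fun z hz => by simp at hz) h).mp rfl
  have hval : coverValue b I ∅ R m = if ∑ i ∈ I, m i = R.card then
      (R.card.factorial : K) * (1 + b) ^ R.card * (1 / (1 + b)) *
        ((∑ i ∈ I with m i = 1, if I.erase i = ∅ then 1 else 0)) else 0 := by
    rw [coverValue, Finset.card_empty, hurwitzPoly_zero, partCoeff_smul,
      ← mul_one (X 1 : MvPolynomial ℕ K), partCoeff_X_mul]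
    simp only [partCoeff_one]
    split_ifs
    · rw [Nat.factorial_zero]
      push_cast
      ring
    · rfl
  have hstruct : ∀ Γ ∈ connFinset I ∅ R m, ∃ i j, I = {i} ∧ R = {j} ∧ m i = 1 ∧
      Γ = fun s => if s = i then {(j, 1)} else 0 := by
    intro Γ h
    rw [mem_connFinset hN] at h
    obtain ⟨h, hc⟩ := h
    obtain ⟨i, hi⟩ := hI
    obtain ⟨t, htU, ht⟩ := h.exists_left hi
    rw [Finset.empty_union] at htU
    have hR : ∀ x ∈ R, x = t := fun x hx =>
      hlink (hc t (Finset.mem_union_right _ htU) x (Finset.mem_union_right _ hx))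
    have hin := h.right t htU
    have hmem : (t, m i) ∈ inEdges Γ t :=
      mem_inEdges.mpr ⟨rfl, i, by rw [ht]; exact Multiset.mem_singleton_self _⟩
    rw [hin, Multiset.mem_singleton, Prod.mk.injEq] at hmem
    have hI' : ∀ x ∈ I, x = i := by
      intro x hx
      by_contra hxi
      obtain ⟨t', htU', ht'⟩ := h.exists_left hx
      rw [Finset.empty_union] at htU'
      rw [hR t' htU'] at ht'
      have hle : (Γ i).filter (fun e => e.1 = t) + (Γ x).filter (fun e => e.1 = t) ≤
          inEdges Γ t := by
        rw [inEdges, ← Finset.sum_pair (Ne.symm hxi) (f := fun s => (Γ s).filter fun e => e.1 = t)]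
        exact Finset.sum_le_sum_of_subset (Finset.subset_univ _)
      have hcard := Multiset.card_le_card hle
      rw [hin, ht, ht', Multiset.filter_singleton, if_pos rfl, Multiset.filter_singleton,
        if_pos rfl] at hcard
      simp at hcard
    refine ⟨i, t, Finset.eq_singleton_iff_unique_mem.mpr ⟨hi, hI'⟩,
      Finset.eq_singleton_iff_unique_mem.mpr ⟨htU, hR⟩, hmem.2, ?_⟩
    funext s
    split_ifs with hs
    · rw [hs, ht, hmem.2]
    · exact h.eq_zero s (fun hsI => hs (hI' s hsI)) (Finset.notMem_empty s)
  rw [hval]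
  by_cases hex : ∃ i j, I = {i} ∧ R = {j} ∧ m i = 1
  · obtain ⟨i, j, rfl, rfl, hm1⟩ := hex
    have hij : i < j := hN.left_lt_right i (Finset.mem_singleton_self i) j
      (Finset.mem_singleton_self j)
    have hset : connFinset {i} ∅ {j} m = {fun s => if s = i then {(j, 1)} else 0} := by
      ext Γ
      rw [Finset.mem_singleton]
      constructor
      · intro h
        obtain ⟨i', j', h1, h2, _, h3⟩ := hstruct Γ h
        rw [Finset.singleton_inj] at h1 h2
        rw [h3, h1, h2]
      · intro h
        have hmem : ∀ s, ∀ e ∈ Γ s, s = i ∧ e = (j, 1) := by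
          intro s e he
          rw [h] at he
          dsimp only at he
          split_ifs at he with hs
          · exact ⟨hs, Multiset.mem_singleton.mp he⟩
          · exact absurd he (Multiset.notMem_zero _)
        rw [mem_connFinset hN]
        refine ⟨⟨?_, ?_, ?_, ?_, ?_, ?_, ?_, ?_⟩, ?_⟩
        · intro s hs _
          rw [h]
          dsimp only
          rw [if_neg]
          rintro rfl
          exact hs (Finset.mem_singleton_self _)
        · intro s e he
          rw [(hmem s e he).2]
          exact Or.inr (Finset.mem_singleton_self _)
        · intro s e he
          rw [(hmem s e he).2, (hmem s e he).1]
          exact hij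
        · intro s e he
          rw [(hmem s e he).2]
          exact one_pos
        · intro s hs
          rw [Finset.mem_singleton] at hs
          refine ⟨j, ?_⟩
          rw [h, hs, hm1]
          exact if_pos rfl
        · intro s hs
          rw [Finset.mem_singleton] at hs
          subst hs
          rw [inEdges, Finset.sum_eq_single i, h]
          · dsimp only
            rw [if_pos rfl, Multiset.filter_singleton, if_pos rfl]
          · intro s _ hs
            rw [h]
            dsimp only
            rw [if_neg hs, Multiset.filter_zero]
          · intro h
            exact absurd (Finset.mem_univ _) h
        · intro s hs
          exact absurd hs (Finset.notMem_empty _)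
        · intro s hs
          exact absurd hs (Finset.notMem_empty _)
        · intro x hx y hy
          rw [Finset.empty_union, Finset.mem_singleton] at hx hy
          rw [hx, hy]
          exact Linked.refl _ _ _
    rw [coverSum, hset, Finset.sum_singleton, coverWeight, Finset.prod_empty, Finset.sum_singleton,
      Finset.card_singleton, if_pos hm1, Finset.filter_singleton, if_pos hm1,
      Finset.sum_singleton, if_pos (Finset.erase_singleton i)]
    simp [hb]
  · have hset : connFinset I ∅ R m = ∅ := by
      rw [Finset.eq_empty_iff_forall_notMem]
      intro Γ h
      obtain ⟨i, j, h1, h2, h3, _⟩ := hstruct Γ h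
      exact hex ⟨i, j, h1, h2, h3⟩
    rw [coverSum, hset, Finset.sum_empty]
    split_ifs with h
    · rw [Finset.sum_eq_zero, mul_zero]
      intro i hi
      rw [Finset.mem_filter] at hi
      refine if_neg fun h1 => hex ?_
      have hI' : I = {i} := by
        rw [← Finset.insert_erase hi.1, h1]
        rfl
      rw [hI', Finset.sum_singleton, hi.2] at h
      obtain ⟨j, hj⟩ := Finset.card_eq_one.mp h.symm
      exact ⟨i, j, hI', hj, hi.2⟩
    · rfl

/-- Induction on the number of vertices: `coverSum_insert` turns into the total recursion
`partCoeff_hurwitzPoly_succ`. The refined recursion plays no role on the tropical side. -/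
theorem coverSum_eq [CharZero K] (b : K) (hb : 1 + b ≠ 0) (n : ℕ) (hn : U.card = n)
    (hN : NodeSets I U R) (hI : I.Nonempty) (hm : ∀ i ∈ I, 0 < m i) :
    coverSum b I U R m = coverValue b I U R m := by
  classical
  induction n using Nat.strong_induction_on generalizing I U R m with
  | _ n ih =>
  rcases U.eq_empty_or_nonempty with rfl | hU
  · exact coverSum_empty b hb hN hI
  obtain ⟨v, U, hvU', hU', hv⟩ : ∃ v U', v ∉ U' ∧ U = insert v U' ∧ ∀ u ∈ U', v < u :=
    ⟨U.min' hU, U.erase (U.min' hU), Finset.notMem_erase _ _,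
      (Finset.insert_erase (U.min'_mem hU)).symm, fun u hu => U.min'_lt_of_mem_erase_min' hU hu⟩
  subst hU'
  obtain ⟨hvI, hvU, hvR, hIv⟩ := hN.new_vertex hv
  rw [Finset.card_insert_of_notMem hvU] at hn
  have hN' : NodeSets I U R := hN.mono subset_rfl (Finset.subset_insert _ _) subset_rfl
  set F := hurwitzPoly b (1 / (1 + b)) with hF
  set k := U.card with hk
  set c : K := k.factorial * R.card.factorial * (1 + b) ^ R.card with hc
  have hval : ∀ I' m', coverValue b I' U R m' =
      if ∑ i ∈ I', m' i = R.card then c * partCoeff I' m' (F k) else 0 := fun _ _ => rfl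
  have htwist : coverSum b I U R m = if ∑ i ∈ I, m i = R.card then
      c * partCoeff I m (F k) else 0 := ih k (by omega) hk.symm hN' hI hm
  -- A join keeps the total left weight, so the balancing condition in `coverValue` is the same for
  -- the smaller cover.
  have hjoin : ∀ i ∈ I, ∀ j ∈ I.erase i,
      coverSum b (I.erase j) U R (Function.update m i (m i + m j)) =
        if ∑ i ∈ I, m i = R.card then c * partCoeff ((I.erase i).erase j) m
          (pderiv (m j + m i) (F k)) else 0 := by
    intro i hi j hj
    have hij : i ≠ j := (Finset.ne_of_mem_erase hj).symm
    have hji := Finset.mem_of_mem_erase hj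
    have hi' : i ∈ I.erase j := Finset.mem_erase.mpr ⟨hij, hi⟩
    rw [ih k (by omega) hk.symm (hN'.mono (Finset.erase_subset _ _) subset_rfl subset_rfl)
      ⟨i, hi'⟩, hval]
    · have h1 : ∑ l ∈ I.erase j, Function.update m i (m i + m j) l = ∑ i ∈ I, m i := by
        rw [← Finset.add_sum_erase _ _ hi', Function.update_self, ← Finset.add_sum_erase _ m hji,
          ← Finset.add_sum_erase _ m hi', Finset.sum_congr rfl (g := m)]
        · ring
        · intro l hl
          exact Function.update_of_ne (Finset.ne_of_mem_erase hl) _ _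
      rw [h1, ← partCoeff_erase hi', Function.update_self,
        partCoeff_update_of_notMem (Finset.notMem_erase _ _), Finset.erase_right_comm,
        add_comm (m i)]
    · intro l hl
      by_cases hli : l = i
      · rw [hli, Function.update_self]
        exact Nat.add_pos_left (hm i hi) _
      · rw [Function.update_of_ne hli]
        exact hm l (Finset.mem_of_mem_erase hl)
  have hsplit : ∀ i ∈ I, ∀ x ∈ antidiagonal (m i),
      (x.1 * x.2 : K) * (1 + b) * ∑ Γ ∈ splitFinset (insert v I) U R
        (Function.update (Function.update m i x.1) v x.2) i v, coverWeight b U R Γ =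
      (x.1 * x.2 : K) * (1 + b) * if ∑ i ∈ I, m i = R.card then c * partCoeff (I.erase i) m
        (pderiv x.1 (pderiv x.2 (F k)) + ∑ j ∈ antidiagonal k,
          pderiv x.1 (F j.1) * pderiv x.2 (F j.2)) else 0 := by
    intro i hi x hx
    rw [mem_antidiagonal] at hx
    rcases Nat.eq_zero_or_pos x.1 with hx1 | hx1
    · simp [hx1]
    rcases Nat.eq_zero_or_pos x.2 with hx2 | hx2
    · simp [hx2]
    congr 1
    obtain ⟨hiv, hiU⟩ := hIv i hi
    set m' := Function.update (Function.update m i x.1) v x.2 with hm'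
    have hm'i : m' i = x.1 := by rw [hm', Function.update_of_ne hiv, Function.update_self]
    have hm'v : m' v = x.2 := by rw [hm', Function.update_self]
    have hm's : ∀ s ∈ I.erase i, m' s = m s := by
      intro s hs
      rw [hm', Function.update_of_ne (ne_of_mem_of_not_mem (Finset.mem_of_mem_erase hs) hvI),
        Function.update_of_ne (Finset.ne_of_mem_erase hs)]
    have hsm : ∑ s ∈ I.erase i, m' s = ∑ s ∈ I.erase i, m s := Finset.sum_congr rfl hm's
    have hm'pos : ∀ s ∈ insert v I, 0 < m' s := by
      intro s hs
      rcases Finset.mem_insert.mp hs with rfl | hs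
      · rwa [hm'v]
      · by_cases hsi : s = i
        · rwa [hsi, hm'i]
        · rw [hm's s (Finset.mem_erase.mpr ⟨hsi, hs⟩)]
          exact hm s hs
    have hNv := hN.insert_left hv
    have hsum : ∑ s ∈ insert v I, m' s = ∑ s ∈ I, m s := by
      rw [Finset.sum_insert hvI, ← Finset.add_sum_erase _ _ hi, hm'i, hm'v,
        hsm, ← Finset.add_sum_erase I (fun s => m s) hi]
      omega
    have hsum' : ∑ s ∈ I.erase i, m' s + (x.1 + x.2) = ∑ s ∈ I, m s := by
      rw [hsm, ← Finset.add_sum_erase I (fun s => m s) hi]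
      omega
    have her : ((insert v I).erase i).erase v = I.erase i := by
      rw [Finset.erase_right_comm, Finset.erase_insert hvI]
    rw [sum_splitFinset b hNv (Finset.mem_insert_of_mem hi) (Finset.mem_insert_self _ _) hiv, her,
      ih k (by omega) hk.symm hNv ⟨v, Finset.mem_insert_self _ _⟩ hm'pos, hval, hsum]
    have hprod : ∀ p ∈ (I.erase i).powerset ×ˢ (U.powerset ×ˢ R.powerset),
        coverSum b (insert i p.1) p.2.1 p.2.2 m' *
          coverSum b (insert v I \ insert i p.1) (U \ p.2.1) (R \ p.2.2) m' =
        coverValue b (insert i p.1) p.2.1 p.2.2 m' *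
          coverValue b (insert v (I.erase i \ p.1)) (U \ p.2.1) (R \ p.2.2) m' := by
      intro p hp
      rw [Finset.mem_product, Finset.mem_product, Finset.mem_powerset, Finset.mem_powerset,
        Finset.mem_powerset] at hp
      have hpI : insert i p.1 ⊆ insert v I := Finset.insert_subset (Finset.mem_insert_of_mem hi)
        (hp.1.trans ((Finset.erase_subset _ _).trans (Finset.subset_insert _ _)))
      have hset : insert v I \ insert i p.1 = insert v (I.erase i \ p.1) := by
        have hvp : v ∉ insert i p.1 := by
          rw [Finset.mem_insert, not_or]
          exact ⟨hiv.symm, fun h => hvI (Finset.mem_of_mem_erase (hp.1 h))⟩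
        rw [Finset.insert_sdiff_of_notMem _ hvp, Finset.sdiff_insert, Finset.erase_sdiff_comm]
      have hsub : insert v (I.erase i \ p.1) ⊆ insert v I :=
        Finset.insert_subset_insert _ (Finset.sdiff_subset.trans (Finset.erase_subset _ _))
      rw [hset, ih p.2.1.card ((Finset.card_le_card hp.2.1).trans_lt (by omega)) rfl
          (hNv.mono hpI hp.2.1 hp.2.2) ⟨i, Finset.mem_insert_self _ _⟩
          fun s hs => hm'pos s (hpI hs),
        ih (U \ p.2.1).card ((Finset.card_le_card Finset.sdiff_subset).trans_lt (by omega)) rfl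
          (hNv.mono hsub Finset.sdiff_subset Finset.sdiff_subset) ⟨v, Finset.mem_insert_self _ _⟩
          fun s hs => hm'pos s (hsub hs)]
    rw [Finset.sum_congr rfl hprod, sum_coverValue_mul b (Finset.notMem_erase _ _)
      (fun h => hvI (Finset.mem_of_mem_erase h)) hm'i hm'v, hsum']
    split_ifs with h
    · rw [partCoeff_add, mul_add, partCoeff_insert hvI, ← partCoeff_erase hi, hm'i, hm'v,
        partCoeff_congr hm's, partCoeff_congr hm's]
    · exact add_zero _
  rw [coverSum_insert b hN hv hm, coverValue, Finset.card_insert_of_notMem hvU, ← hk, ← hF]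
  by_cases hs : ∑ i ∈ I, m i = R.card
  · rw [if_pos hs]
    simp only [if_pos hs] at htwist hjoin hsplit
    have hpos : 0 < R.card := by
      rw [← hs]
      exact Finset.sum_pos hm hI
    have hR0 : (R.card : K) ≠ 0 := Nat.cast_ne_zero.mpr hpos.ne'
    -- The total recursion carries the factor `∑ m i`, which equals `|R|` and cancels the degree in
    -- the factor of the leftmost vertex.
    have hrec := partCoeff_hurwitzPoly_succ b (1 / (1 + b)) I m hm k
    rw [← hF, ← Nat.cast_sum, hs] at hrec
    have hterm : ∀ i ∈ I, (m i : K) * (b * ((m i : K) - 1)) * coverSum b I U R m +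
        ∑ j ∈ I.erase i, ((m i : K) + m j) *
          coverSum b (I.erase j) U R (Function.update m i (m i + m j)) +
        ∑ x ∈ antidiagonal (m i), (x.1 * x.2 : K) * (1 + b) *
          ∑ Γ ∈ splitFinset (insert v I) U R
            (Function.update (Function.update m i x.1) v x.2) i v, coverWeight b U R Γ =
        c * partCoeff (I.erase i) m (recTerm b F k (m i)) := by
      intro i hi
      rw [htwist, Finset.sum_congr rfl fun j hj => by rw [hjoin i hi j hj],
        Finset.sum_congr rfl (hsplit i hi), recTerm, partCoeff_add, partCoeff_add, partCoeff_smul,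
        partCoeff_erase hi, partCoeff_mergeDer _ _ fun j hj => hm j (Finset.mem_of_mem_erase hj),
        partCoeff_smul, partCoeff_sum, mul_add, mul_add, Finset.mul_sum, Finset.mul_sum,
        Finset.mul_sum]
      congr 1
      · congr 1
        · ring
        · exact Finset.sum_congr rfl fun j _ => by ring
      · refine Finset.sum_congr rfl fun x _ => ?_
        rw [partCoeff_smul]
        ring
    rw [Finset.sum_congr rfl hterm, ← Finset.mul_sum, ← hrec, hc, Nat.factorial_succ]
    push_cast
    field_simp
  · rw [if_neg hs]
    simp only [if_neg hs] at htwist hjoin hsplit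
    rw [Finset.sum_eq_zero, mul_zero]
    intro i hi
    rw [htwist, Finset.sum_congr rfl fun j hj => by rw [hjoin i hi j hj],
      Finset.sum_congr rfl (hsplit i hi)]
    simp

end NodeCover

end BHurwitz

/-! ### Moving the vertices of a cover by admissible permutations -/

namespace BHurwitz

namespace CoverData

variable {k q d : ℕ}

/-- Move the vertices of a cover by a permutation. -/
def relabel (φ : Equiv.Perm (Fin k)) (Γ : CoverData k q d) : CoverData k q d where
  edges := Γ.edges.map fun e => (φ e.1, φ e.2.1, e.2.2)
  left := fun a => φ (Γ.left a)
  right := fun a => φ (Γ.right a)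

theorem relabel_mul (ψ φ : Equiv.Perm (Fin k)) (Γ : CoverData k q d) :
    relabel (ψ * φ) Γ = relabel ψ (relabel φ Γ) := by
  simp only [relabel, Multiset.map_map, Function.comp_def, Equiv.Perm.mul_apply]

theorem relabel_one (Γ : CoverData k q d) : relabel 1 Γ = Γ := by
  simp only [relabel, Equiv.Perm.one_apply, Prod.mk.eta, Multiset.map_id']

/-- The permutation keeps the order of each vertex and the vertices that remain connected with it
after a cut to its left. -/
def Admissible (Γ : CoverData k q d) (φ : Equiv.Perm (Fin k)) : Prop :=
  ∀ u v, u < v → Γ.SameCompFrom u u v → φ u < φ v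

variable {Γ : CoverData k q d} {φ ψ : Equiv.Perm (Fin k)}

theorem AdjFrom.symm {i u v : Fin k} (h : Γ.AdjFrom i u v) : Γ.AdjFrom i v u := by
  obtain ⟨h1, h2, e, he, h3⟩ := h
  exact ⟨h2, h1, e, he, h3.symm⟩

theorem AdjFrom.mono {i j u v : Fin k} (hij : j ≤ i) (h : Γ.AdjFrom i u v) : Γ.AdjFrom j u v :=
  ⟨hij.trans h.1, hij.trans h.2.1, h.2.2⟩

theorem sameCompFrom_refl (Γ : CoverData k q d) (v : Fin k) : Γ.SameCompFrom v v v :=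
  ⟨le_rfl, le_rfl, Relation.ReflTransGen.refl⟩

theorem SameCompFrom.symm {i u v : Fin k} (h : Γ.SameCompFrom i u v) : Γ.SameCompFrom i v u := by
  refine ⟨h.2.1, h.1, ?_⟩
  have := h.2.2
  rw [← Relation.reflTransGen_swap] at this
  exact Relation.ReflTransGen.mono (fun _ _ h => AdjFrom.symm h) _ _ this

theorem SameCompFrom.trans {i u v w : Fin k} (h : Γ.SameCompFrom i u v)
    (h' : Γ.SameCompFrom i v w) : Γ.SameCompFrom i u w :=
  ⟨h.1, h'.2.1, h.2.2.trans h'.2.2⟩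

theorem SameCompFrom.mono {i j u v : Fin k} (hij : j ≤ i) (h : Γ.SameCompFrom i u v) :
    Γ.SameCompFrom j u v :=
  ⟨hij.trans h.1, hij.trans h.2.1, Relation.ReflTransGen.mono
    (fun _ _ h => AdjFrom.mono hij h) _ _ h.2.2⟩

theorem SameCompFrom.of_edge {e : Edge k} (he : e ∈ Γ.edges) (h : e.1 ≤ e.2.1) :
    Γ.SameCompFrom e.1 e.1 e.2.1 :=
  ⟨le_rfl, h, Relation.ReflTransGen.single ⟨le_rfl, h, e, he, Or.inl ⟨rfl, rfl⟩⟩⟩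

theorem exists_edge_relabel (φ : Equiv.Perm (Fin k)) (u v : Fin k) :
    (∃ e ∈ (relabel φ Γ).edges, (e.1 = φ u ∧ e.2.1 = φ v) ∨ (e.1 = φ v ∧ e.2.1 = φ u)) ↔
      ∃ e ∈ Γ.edges, (e.1 = u ∧ e.2.1 = v) ∨ (e.1 = v ∧ e.2.1 = u) := by
  simp only [relabel, Multiset.mem_map]
  constructor
  · rintro ⟨_, ⟨e, he, rfl⟩, h⟩
    exact ⟨e, he, by simpa using h⟩
  · rintro ⟨e, he, h⟩
    exact ⟨_, ⟨e, he, rfl⟩, by simpa using h⟩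

/-- The components to the right of a vertex move along with an admissible permutation. This makes
hooks, component degrees and multiplicities invariant, and admissible permutations can be inverted
and composed. -/
theorem Admissible.sameCompFrom_relabel (h : Γ.Admissible φ) (v u : Fin k) :
    (relabel φ Γ).SameCompFrom (φ v) (φ v) (φ u) ↔ Γ.SameCompFrom v v u := by
  have hle : ∀ x, Γ.SameCompFrom v v x → φ v ≤ φ x := by
    intro x hx
    rcases hx.2.1.eq_or_lt with rfl | h1
    · exact le_rfl
    · exact (h v x h1 hx).le
  constructor
  · intro hu
    have key : ∀ y, Relation.ReflTransGen ((relabel φ Γ).AdjFrom (φ v)) (φ v) y →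
        Γ.SameCompFrom v v (φ.symm y) := by
      intro y hy
      induction hy with
      | refl => rw [Equiv.symm_apply_apply]; exact Γ.sameCompFrom_refl v
      | tail _ hadj ih =>
        rename_i y z _
        obtain ⟨_, hz, hex⟩ := hadj
        rw [← φ.apply_symm_apply y, ← φ.apply_symm_apply z, exists_edge_relabel] at hex
        rcases le_or_gt v (φ.symm z) with h1 | h1
        · exact ih.trans ⟨ih.2.1, h1, Relation.ReflTransGen.single ⟨ih.2.1, h1, hex⟩⟩
        -- Suppose the preimage of the path passes to the left of `v`. The vertex reached is then in
        -- the component of `v` after a cut to its own left, and admissibility puts its image to the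
        -- left of `φ v`, where the path does not go.
        · have h2 : Γ.SameCompFrom (φ.symm z) (φ.symm z) v := by
            refine SameCompFrom.symm ((ih.mono h1.le).trans ⟨h1.le.trans ih.2.1, le_rfl, ?_⟩)
            exact Relation.ReflTransGen.single ⟨h1.le.trans ih.2.1, le_rfl, hex⟩
          have h3 := h _ _ h1 h2
          rw [Equiv.apply_symm_apply] at h3
          exact absurd h3 hz.not_gt
    have := key _ hu.2.2
    rwa [Equiv.symm_apply_apply] at this
  · intro hu
    have key : ∀ y, Relation.ReflTransGen (Γ.AdjFrom v) v y → Γ.SameCompFrom v v y ∧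
        Relation.ReflTransGen ((relabel φ Γ).AdjFrom (φ v)) (φ v) (φ y) := by
      intro y hy
      induction hy with
      | refl => exact ⟨Γ.sameCompFrom_refl v, Relation.ReflTransGen.refl⟩
      | tail _ hadj ih =>
        rename_i y z _
        have h1 : Γ.SameCompFrom v v z := ⟨le_rfl, hadj.2.1, ih.1.2.2.tail hadj⟩
        exact ⟨h1, ih.2.tail ⟨hle y ih.1, hle z h1, (exists_edge_relabel φ y z).mpr hadj.2.2⟩⟩
    exact ⟨le_rfl, hle u hu, (key u hu.2.2).2⟩

theorem Admissible.symm (h : Γ.Admissible φ) : (relabel φ Γ).Admissible φ⁻¹ := by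
  intro u v huv hs
  have h1 : Γ.SameCompFrom (φ⁻¹ u) (φ⁻¹ u) (φ⁻¹ v) := by
    rw [← h.sameCompFrom_relabel]
    simpa using hs
  exact lt_of_le_of_ne h1.2.1 fun h2 => huv.ne (φ⁻¹.injective h2)

theorem Admissible.mul (h : Γ.Admissible φ) (h' : (relabel φ Γ).Admissible ψ) :
    Γ.Admissible (ψ * φ) := by
  intro u v huv hs
  exact h' _ _ (h u v huv hs) ((h.sameCompFrom_relabel u v).mpr hs)

theorem admissible_one (Γ : CoverData k q d) : Γ.Admissible 1 := fun _ _ h _ => h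

theorem relabel_inv_relabel (φ : Equiv.Perm (Fin k)) (Γ : CoverData k q d) :
    relabel φ⁻¹ (relabel φ Γ) = Γ := by
  rw [← relabel_mul, inv_mul_cancel, relabel_one]

theorem inDeg_relabel (φ : Equiv.Perm (Fin k)) (v : Fin k) :
    (relabel φ Γ).inDeg (φ v) = Γ.inDeg v := by
  simp only [inDeg, relabel, Multiset.filter_map, Multiset.card_map, Function.comp_def,
    EmbeddingLike.apply_eq_iff_eq]

theorem outDeg_relabel (φ : Equiv.Perm (Fin k)) (v : Fin k) :
    (relabel φ Γ).outDeg (φ v) = Γ.outDeg v := by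
  simp only [outDeg, relabel, Multiset.filter_map, Multiset.card_map, Function.comp_def,
    EmbeddingLike.apply_eq_iff_eq]

theorem inWeight_relabel (φ : Equiv.Perm (Fin k)) (m : Fin q → ℕ) (v : Fin k) :
    (relabel φ Γ).inWeight m (φ v) = Γ.inWeight m v := by
  simp only [inWeight, relabel, Multiset.filter_map, Multiset.map_map, Function.comp_def,
    EmbeddingLike.apply_eq_iff_eq]

theorem outWeight_relabel (φ : Equiv.Perm (Fin k)) (v : Fin k) :
    (relabel φ Γ).outWeight (φ v) = Γ.outWeight v := by
  simp only [outWeight, relabel, Multiset.filter_map, Multiset.map_map, Function.comp_def,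
    EmbeddingLike.apply_eq_iff_eq]

theorem IsQuotientCover.isQuotientCover_relabel {m : Fin q → ℕ} (h : Γ.IsQuotientCover m)
    (hφ : Γ.Admissible φ) :
    (relabel φ Γ).IsQuotientCover m where
  lt := by
    intro e he
    obtain ⟨e', he', rfl⟩ := Multiset.mem_map.mp he
    exact hφ _ _ (h.lt e' he') (SameCompFrom.of_edge he' (h.lt e' he').le)
  weight_pos := by
    intro e he
    obtain ⟨e', he', rfl⟩ := Multiset.mem_map.mp he
    exact h.weight_pos e' he'
  valence := by
    intro v
    obtain ⟨v, rfl⟩ := φ.surjective v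
    rw [inDeg_relabel, outDeg_relabel]
    exact h.valence v
  balanced := by
    intro v
    obtain ⟨v, rfl⟩ := φ.surjective v
    rw [inWeight_relabel, outWeight_relabel]
    exact h.balanced v
  connected := by
    intro u v
    obtain ⟨u, rfl⟩ := φ.surjective u
    obtain ⟨v, rfl⟩ := φ.surjective v
    exact Relation.ReflTransGen.lift φ (fun x y hxy => (exists_edge_relabel φ x y).mpr hxy) _ _
      (h.connected u v)

theorem Admissible.compDegree_relabel (h : Γ.Admissible φ) (v : Fin k) :
    (relabel φ Γ).compDegree (φ v) = Γ.compDegree v := by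
  refine Nat.card_congr (Equiv.subtypeEquivRight fun j => ?_)
  exact h.sameCompFrom_relabel v (Γ.right j)

theorem wieners_relabel (φ : Equiv.Perm (Fin k)) : (relabel φ Γ).wieners = Γ.wieners := by
  have hinj : Function.Injective fun e : Edge k => ((φ e.1, φ e.2.1, e.2.2) : Edge k) := by
    rintro ⟨a, b, c⟩ ⟨a', b', c'⟩ h
    simpa using h
  rw [wieners, wieners]
  conv_rhs => rw [← Finset.card_image_of_injective _ hinj]
  congr 1
  ext e
  rw [Finset.mem_filter, Multiset.mem_toFinset, Finset.mem_image]
  simp only [Finset.mem_filter, Multiset.mem_toFinset]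
  constructor
  · rintro ⟨h0, h⟩
    obtain ⟨a, ha, rfl⟩ := Multiset.mem_map.mp h0
    rw [relabel, Multiset.count_map_eq_count' _ _ hinj] at h
    exact ⟨a, ⟨ha, h⟩, rfl⟩
  · rintro ⟨a, ⟨ha, h⟩, rfl⟩
    refine ⟨Multiset.mem_map_of_mem _ ha, ?_⟩
    rwa [relabel, Multiset.count_map_eq_count' _ _ hinj]

theorem Admissible.mult_relabel {K : Type*} [Field K] (b : K) (h : Γ.Admissible φ)
    (m : Fin q → ℕ) : (relabel φ Γ).mult b m = Γ.mult b m := by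
  rw [mult, mult, wieners_relabel]
  congr 1
  · congr 2
    · rw [genus, genus, relabel, Multiset.card_map]
    · rw [relabel, Multiset.map_map]
      rfl
  · rw [← Equiv.prod_comp φ]
    refine Finset.prod_congr rfl fun v _ => ?_
    rw [vertexMult, vertexMult, inDeg_relabel, outDeg_relabel, inWeight_relabel,
      h.compDegree_relabel]

/-- An admissible permutation that preserves a quotient cover is trivial. -/
theorem IsQuotientCover.eq_one_of_relabel_eq {m : Fin q → ℕ} (hΓ : Γ.IsQuotientCover m)
    (h : Γ.Admissible φ) (heq : relabel φ Γ = Γ) : φ = 1 := by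
  by_contra hne
  have hex : (Finset.univ.filter fun v => φ v ≠ v).Nonempty := by
    by_contra h1
    rw [Finset.not_nonempty_iff_eq_empty, Finset.filter_eq_empty_iff] at h1
    exact hne (Equiv.ext fun v => not_not.mp (h1 (Finset.mem_univ v)))
  -- The rightmost moved vertex `v` is moved to the left, and the targets of its outgoing edges are
  -- fixed.
  set v := (Finset.univ.filter fun v => φ v ≠ v).max' hex with hv
  have hvφ : φ v ≠ v := (Finset.mem_filter.mp (Finset.max'_mem _ hex)).2
  have hfix : ∀ w, v < w → φ w = w := by
    intro w hw
    by_contra h1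
    exact hw.not_ge (Finset.le_max' _ w (Finset.mem_filter.mpr ⟨Finset.mem_univ _, h1⟩))
  have hlt : φ v < v := by
    rcases lt_trichotomy (φ v) v with h1 | h1 | h1
    · exact h1
    · exact absurd h1 hvφ
    · exact absurd (φ.injective (hfix _ h1)) hvφ
  have hedge : ∀ e ∈ Γ.edges, (φ e.1, φ e.2.1, e.2.2) ∈ Γ.edges := by
    intro e he
    have : (φ e.1, φ e.2.1, e.2.2) ∈ (relabel φ Γ).edges := Multiset.mem_map_of_mem
      (fun e : Edge k => ((φ e.1, φ e.2.1, e.2.2) : Edge k)) he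
    rwa [heq] at this
  have hout : 0 < Γ.outDeg v := by
    rcases hΓ.valence v with h1 | h1 | h1 <;> omega
  rw [outDeg, Nat.add_pos_iff_pos_or_pos, Multiset.card_pos_iff_exists_mem,
    Finset.card_pos] at hout
  rcases hout with ⟨e, he⟩ | ⟨j, hj⟩
  · rw [Multiset.mem_filter] at he
    obtain ⟨he, hev⟩ := he
    have hw := hΓ.lt e he
    rw [hev] at hw
    have h1 := hedge e he
    have h2 := hedge _ h1
    dsimp only at h1 h2
    rw [hev, hfix _ hw] at h1
    rw [hev, hfix _ hw, hfix _ hw] at h2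
    -- The target of an edge leaving `v` also receives the images of this edge, which start at `φ v`
    -- and `φ (φ v)`. By the valence condition at most two edges enter it.
    have hφφ : φ (φ v) = v := by
      by_contra hne'
      have hle : ({e, (φ v, e.2.1, e.2.2), (φ (φ v), e.2.1, e.2.2)} : Multiset (Edge k)) ≤
          Γ.edges.filter fun x => x.2.1 = e.2.1 := by
        rw [Multiset.le_iff_subset]
        · intro x hx
          simp only [Multiset.insert_eq_cons, Multiset.mem_cons, Multiset.mem_singleton] at hx
          rw [Multiset.mem_filter]
          rcases hx with rfl | rfl | rfl
          · exact ⟨he, rfl⟩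
          · exact ⟨h1, rfl⟩
          · exact ⟨h2, rfl⟩
        · have e1 : e ≠ (φ v, e.2.1, e.2.2) := fun h3 => hvφ (by
            rw [← hev]; nth_rewrite 2 [h3]; rw [hev])
          have e2 : e ≠ (φ (φ v), e.2.1, e.2.2) := fun h3 => hne' (by
            nth_rewrite 2 [← hev]; rw [h3])
          simp only [Multiset.insert_eq_cons, Multiset.nodup_cons, Multiset.mem_cons,
            Multiset.mem_singleton, not_or, Multiset.nodup_singleton, and_true]
          refine ⟨⟨e1, e2⟩, fun h3 => hvφ ?_⟩
          rw [Prod.mk.injEq] at h3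
          exact (φ.injective h3.1).symm
      have hc := Multiset.card_le_card hle
      have hin := hΓ.valence e.2.1
      have hin' : Multiset.card (Γ.edges.filter fun x => x.2.1 = e.2.1) ≤ Γ.inDeg e.2.1 :=
        Nat.le_add_right _ _
      simp only [Multiset.insert_eq_cons, Multiset.card_cons, Multiset.card_singleton] at hc
      omega
    -- Both vertices are adjacent to the fixed target, so admissibility does not allow `φ` to
    -- exchange them.
    have hs : Γ.SameCompFrom (φ v) (φ v) v := by
      have hvw : Γ.SameCompFrom v v e.2.1 := by
        have := SameCompFrom.of_edge he (hΓ.lt e he).le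
        rwa [hev] at this
      exact (SameCompFrom.of_edge h1 (hlt.trans hw).le).trans (hvw.symm.mono hlt.le)
    have := h _ _ hlt hs
    rw [hφφ] at this
    exact absurd this hlt.not_gt
  -- Right ends are labelled, so a vertex with a right end cannot move.
  · rw [Finset.mem_filter] at hj
    have h1 : (relabel φ Γ).right j = Γ.right j := by rw [heq]
    rw [relabel] at h1
    dsimp only at h1
    rw [hj.2] at h1
    exact hvφ h1

end CoverData

end BHurwitz

/-! ### The hook length formula and the sum over equivalence classes -/

namespace BHurwitz

/-- The hook length formula for forests. The lists are the linear extensions of the forest on `S`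
in which the nodes below `v` are the elements of `H v`. -/
theorem exists_linearExtensions {α : Type*} [DecidableEq α] (H : α → Finset α)
    (hself : ∀ v, v ∈ H v) (htrans : ∀ v, ∀ w ∈ H v, H w ⊆ H v)
    (hanti : ∀ v w, w ∈ H v → v ∈ H w → v = w)
    (hforest : ∀ u v w, w ∈ H u → w ∈ H v → v ∈ H u ∨ u ∈ H v) (n : ℕ) (S : Finset α)
    (hn : S.card = n) (hS : ∀ v ∈ S, H v ⊆ S) :
    ∃ T : Finset (List α), (∀ l, l ∈ T ↔ l.Nodup ∧ l.toFinset = S ∧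
      l.Pairwise fun x y => x ∉ H y) ∧ T.card * ∏ v ∈ S, (H v).card = n.factorial := by
  induction n generalizing S with
  | zero =>
    rw [Finset.card_eq_zero] at hn
    subst hn
    refine ⟨{[]}, fun l => ?_, by simp⟩
    rw [Finset.mem_singleton, List.toFinset_eq_empty_iff]
    constructor
    · rintro rfl
      simp
    · exact fun h => h.2.1
  | succ n ih =>
    -- These are the roots of the forest. A linear extension starts with a root `r` and goes on with
    -- a linear extension of the forest without `r`, in which the other hooks are unchanged.
    set Q := S.filter fun r => ∀ v ∈ S, r ∈ H v → v = r with hQ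
    have hQS : ∀ r ∈ Q, r ∈ S := fun r hr => Finset.mem_of_mem_filter r hr
    have hex : ∀ r, ∃ T : Finset (List α), r ∈ Q → ((∀ l, l ∈ T ↔ l.Nodup ∧
        l.toFinset = S.erase r ∧ l.Pairwise fun x y => x ∉ H y) ∧
          T.card * ∏ v ∈ S.erase r, (H v).card = n.factorial) := by
      intro r
      by_cases hr : r ∈ Q
      · obtain ⟨T, hT⟩ := ih (S.erase r)
          (by rw [Finset.card_erase_of_mem (hQS r hr), hn, Nat.add_sub_cancel]) (by
            intro v hv w hw
            rw [Finset.mem_erase] at hv ⊢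
            refine ⟨?_, hS v hv.2 hw⟩
            rintro rfl
            exact hv.1 ((Finset.mem_filter.mp hr).2 v hv.2 hw))
        exact ⟨T, fun _ => hT⟩
      · exact ⟨∅, fun h => absurd h hr⟩
    choose T hT using hex
    refine ⟨Q.biUnion fun r => (T r).image (List.cons r), ?_, ?_⟩
    · intro l
      rw [Finset.mem_biUnion]
      constructor
      · rintro ⟨r, hr, hl⟩
        obtain ⟨l', hl', rfl⟩ := Finset.mem_image.mp hl
        obtain ⟨h1, h2, h3⟩ := ((hT r hr).1 l').mp hl'
        have hmem : ∀ y, y ∈ l' ↔ y ∈ S.erase r := fun y => by rw [← h2, List.mem_toFinset]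
        refine ⟨List.nodup_cons.mpr ⟨fun h => ?_, h1⟩, ?_, List.pairwise_cons.mpr ⟨?_, h3⟩⟩
        · exact Finset.notMem_erase r S ((hmem r).mp h)
        · rw [List.toFinset_cons, h2, Finset.insert_erase (hQS r hr)]
        · intro y hy h
          have hy' := Finset.mem_erase.mp ((hmem y).mp hy)
          exact hy'.1 ((Finset.mem_filter.mp hr).2 y hy'.2 h)
      · rintro ⟨h1, h2, h3⟩
        cases l with
        | nil =>
          rw [List.toFinset_nil] at h2
          rw [← h2] at hn
          simp at hn
        | cons r l =>
          rw [List.nodup_cons] at h1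
          rw [List.pairwise_cons] at h3
          rw [List.toFinset_cons] at h2
          have hr : r ∈ Q := by
            refine Finset.mem_filter.mpr ⟨h2 ▸ Finset.mem_insert_self _ _, fun v hv hrv => ?_⟩
            rw [← h2, Finset.mem_insert, List.mem_toFinset] at hv
            exact hv.resolve_right fun h => h3.1 v h hrv
          refine ⟨r, hr, Finset.mem_image_of_mem _ (((hT r hr).1 l).mpr ⟨h1.2, ?_, h3.2⟩)⟩
          rw [← h2, Finset.erase_insert (by rw [List.mem_toFinset]; exact h1.1)]
    · have hc : (Q.biUnion fun r => (T r).image (List.cons r)).card = ∑ r ∈ Q, (T r).card := by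
        rw [Finset.card_biUnion]
        · exact Finset.sum_congr rfl fun r _ =>
            Finset.card_image_of_injective _ (List.cons_injective)
        · intro r _ r' _ hrr'
          rw [Function.onFun, Finset.disjoint_left]
          intro l hl hl'
          obtain ⟨l₁, _, rfl⟩ := Finset.mem_image.mp hl
          obtain ⟨l₂, _, h⟩ := Finset.mem_image.mp hl'
          exact hrr' (List.cons.inj h).1.symm
      have hU : Q.biUnion H = S := by
        ext v
        rw [Finset.mem_biUnion]
        constructor
        · rintro ⟨r, hr, hv⟩
          exact hS r (hQS r hr) hv
        · intro hv
          obtain ⟨u, hu, hmax⟩ := (S.filter fun u => v ∈ H u).exists_max_image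
            (fun u => (H u).card) ⟨v, Finset.mem_filter.mpr ⟨hv, hself v⟩⟩
          rw [Finset.mem_filter] at hu
          refine ⟨u, Finset.mem_filter.mpr ⟨hu.1, fun w hw huw => ?_⟩, hu.2⟩
          by_contra hne
          have h1 := hmax w (Finset.mem_filter.mpr ⟨hw, htrans w u huw hu.2⟩)
          have h2 : H u ⊂ H w := by
            refine Finset.ssubset_iff_subset_ne.mpr ⟨htrans w u huw, fun h => hne ?_⟩
            exact (hanti u w (h ▸ hself w) huw).symm
          exact (Finset.card_lt_card h2).not_ge h1
      -- The hooks of the roots partition `S`. This identity is what turns the recursion over the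
      -- first element into `(n + 1)! = (n + 1) · n!`.
      have hcard : ∑ r ∈ Q, (H r).card = n + 1 := by
        rw [← Finset.card_biUnion, hU, hn]
        intro r hr r' hr' hrr'
        rw [Function.onFun, Finset.disjoint_left]
        intro w hw hw'
        have hr := Finset.mem_filter.mp hr
        have hr' := Finset.mem_filter.mp hr'
        rcases hforest r r' w hw hw' with h | h
        · exact hrr' (hr'.2 r hr.1 h)
        · exact hrr' (hr.2 r' hr'.1 h).symm
      rw [hc, Finset.sum_mul, Nat.factorial_succ, ← hcard, Finset.sum_mul]
      refine Finset.sum_congr rfl fun r hr => ?_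
      rw [← Finset.mul_prod_erase S _ (hQS r hr), ← (hT r hr).2]
      ring

namespace CoverData

variable {k q d : ℕ} {Γ Γ' : CoverData k q d} {φ : Equiv.Perm (Fin k)} {m : Fin q → ℕ}

theorem Reorder.exists_admissible (h : Γ.Reorder Γ') :
    ∃ φ, Γ.Admissible φ ∧ Γ' = relabel φ Γ := by
  obtain ⟨i, φ, h1, h2, h3, h4, h5⟩ := h
  refine ⟨φ, fun u v huv hs => ?_, ?_⟩
  · rcases le_or_gt i u with hu | hu
    · exact h2 u v huv (hs.mono hu)
    · rw [h1 u hu]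
      rcases lt_or_ge v i with hv | hv
      · rwa [h1 v hv]
      -- A permutation that fixes everything to the left of the cut cannot move a vertex from the
      -- right of the cut to its left.
      · refine hu.trans_le (not_lt.mp fun h => ?_)
        have h6 := φ.injective (h1 _ h)
        rw [h6] at h
        exact h.not_ge hv
  · obtain ⟨e, l, r⟩ := Γ'
    rw [relabel, mk.injEq]
    exact ⟨h3, funext h4, funext h5⟩

/-- Exchanging neighbouring branch points is a single move if a cut just before them leaves their
vertices in different components. -/
theorem reorder_swap {a c : Fin k} (hac : (c : ℕ) = a + 1) (h : ¬ Γ.SameCompFrom a a c) :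
    Γ.Reorder (relabel (Equiv.swap a c) Γ) := by
  have hval : ∀ u, ((Equiv.swap a c u : Fin k) : ℕ) =
      if (u : ℕ) = a then c.val else if (u : ℕ) = c then a.val else u := by
    intro u
    rw [Equiv.swap_apply_def]
    simp only [Fin.ext_iff]
    split_ifs <;> rfl
  refine ⟨a, Equiv.swap a c, ?_, ?_, rfl, fun _ => rfl, fun _ => rfl⟩
  · intro v hv
    rw [Fin.ext_iff, hval, if_neg, if_neg]
    · rw [Fin.lt_def] at hv
      omega
    · rw [Fin.lt_def] at hv
      omega
  · intro u v huv hs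
    have hne : ¬ ((u : ℕ) = a ∧ (v : ℕ) = c) := by
      rintro ⟨h1, h2⟩
      rw [← Fin.ext_iff] at h1 h2
      rw [h1, h2] at hs
      exact h hs
    have h1 := hs.1
    rw [Fin.lt_def, hval, hval]
    rw [Fin.lt_def] at huv
    rw [Fin.le_def] at h1
    split_ifs <;> omega

theorem eq_one_of_forall_lt (h : ∀ a c : Fin k, (c : ℕ) = a + 1 → φ a < φ c) : φ = 1 := by
  have hmono : StrictMono φ := by
    intro a c hac
    obtain ⟨n, hn⟩ : ∃ n, (c : ℕ) = a + 1 + n := ⟨c - a - 1, by rw [Fin.lt_def] at hac; omega⟩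
    induction n generalizing c with
    | zero => exact h a c (by omega)
    | succ n ih =>
      have hlt : (c : ℕ) - 1 < k := by omega
      have h1 : a < ⟨c - 1, hlt⟩ := by
        rw [Fin.lt_def]
        dsimp only
        omega
      exact (ih h1 (by dsimp only; omega)).trans (h _ c (by dsimp only; omega))
  exact Equiv.ext fun v => congrFun hmono.eq_id v

/-- This sum decreases when an inversion of neighbours is removed, so it serves as the measure in a
bubble sort argument. -/
theorem sum_swap_lt {a c : Fin k} (hac : (c : ℕ) = a + 1) (h : φ c < φ a) :
    ∑ v : Fin k, (v : ℤ) * (k - (φ * Equiv.swap a c) v) < ∑ v : Fin k, (v : ℤ) * (k - φ v) := by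
  have hne : a ≠ c := by
    rintro rfl
    omega
  rw [← sub_pos, ← Finset.sum_sub_distrib]
  have h1 : ∀ v : Fin k, (v : ℤ) * (k - φ v) - (v : ℤ) * (k - (φ * Equiv.swap a c) v) =
      (if v = a then (a : ℤ) * ((φ c : ℤ) - φ a) else 0) +
        if v = c then (c : ℤ) * ((φ a : ℤ) - φ c) else 0 := by
    intro v
    rw [Equiv.Perm.mul_apply]
    by_cases hva : v = a
    · rw [if_pos hva, if_neg (by rw [hva]; exact hne), hva, Equiv.swap_apply_left]
      ring
    · by_cases hvc : v = c
      · rw [if_neg hva, if_pos hvc, hvc, Equiv.swap_apply_right]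
        ring
      · rw [if_neg hva, if_neg hvc, Equiv.swap_apply_of_ne_of_ne hva hvc]
        ring
  rw [Finset.sum_congr rfl fun v _ => h1 v, Finset.sum_add_distrib, Finset.sum_ite_eq',
    Finset.sum_ite_eq', if_pos (Finset.mem_univ _), if_pos (Finset.mem_univ _), hac]
  rw [Fin.lt_def] at h
  push_cast
  have : ((φ c : ℕ) : ℤ) < (φ a : ℕ) := by exact_mod_cast h
  linarith

/-- Bubble sort: unless an admissible permutation is trivial it inverts two neighbours, and
exchanging them first is a move that leaves a permutation with a smaller measure. -/
theorem eqvGen_relabel (Γ : QuotientCover k d m) (φ : Equiv.Perm (Fin k))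
    (hφ : Γ.1.Admissible φ) : Relation.EqvGen (fun Γ Γ' : QuotientCover k d m => Γ.1.Reorder Γ'.1)
      Γ ⟨relabel φ Γ.1, Γ.2.isQuotientCover_relabel hφ⟩ := by
  obtain ⟨n, hn⟩ : ∃ n : ℕ, ∑ v : Fin k, (v : ℤ) * (k - φ v) < n :=
    ⟨(∑ v : Fin k, (v : ℤ) * (k - φ v)).toNat + 1, by push_cast; omega⟩
  induction n generalizing Γ φ with
  | zero =>
    refine absurd hn (not_lt.mpr ?_)
    push_cast
    refine Finset.sum_nonneg fun v _ => mul_nonneg (by positivity) ?_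
    have := (φ v).2
    omega
  | succ n ih =>
    by_cases h1 : ∀ a c : Fin k, (c : ℕ) = a + 1 → φ a < φ c
    · have := eq_one_of_forall_lt h1
      subst this
      have h2 : (⟨relabel 1 Γ.1, Γ.2.isQuotientCover_relabel hφ⟩ : QuotientCover k d m) = Γ :=
        Subtype.ext (relabel_one Γ.1)
      rw [h2]
      exact Relation.EqvGen.refl _
    · push Not at h1
      obtain ⟨a, c, hac, h1⟩ := h1
      have hne : a ≠ c := by
        rintro rfl
        omega
      have hlt : φ c < φ a := lt_of_le_of_ne h1 fun h => hne (φ.injective h).symm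
      -- If the neighbours were in one component, admissibility would keep their order.
      have hs : ¬ Γ.1.SameCompFrom a a c := fun h =>
        hlt.not_gt (hφ a c (by rw [Fin.lt_def]; omega) h)
      have hr := reorder_swap hac hs
      have hsw : Γ.1.Admissible (Equiv.swap a c) := by
        intro u v huv hsc
        have hval : ∀ u, ((Equiv.swap a c u : Fin k) : ℕ) =
            if (u : ℕ) = a then c.val else if (u : ℕ) = c then a.val else u := by
          intro u
          rw [Equiv.swap_apply_def]
          simp only [Fin.ext_iff]
          split_ifs <;> rfl
        have hne' : ¬ ((u : ℕ) = a ∧ (v : ℕ) = c) := by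
          rintro ⟨h1, h2⟩
          rw [← Fin.ext_iff] at h1 h2
          rw [h1, h2] at hsc
          exact hs hsc
        rw [Fin.lt_def, hval, hval]
        rw [Fin.lt_def] at huv
        split_ifs <;> omega
      have hinv : (Equiv.swap a c)⁻¹ = Equiv.swap a c := Equiv.swap_inv a c
      have hadm : (relabel (Equiv.swap a c) Γ.1).Admissible (φ * Equiv.swap a c) := by
        have h2 := hsw.symm
        rw [hinv] at h2
        refine h2.mul ?_
        rw [← relabel_mul, Equiv.swap_mul_self, relabel_one]
        exact hφ
      have h3 := ih ⟨_, Γ.2.isQuotientCover_relabel hsw⟩ (φ * Equiv.swap a c) hadm (by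
        have := sum_swap_lt hac hlt
        push_cast at hn
        omega)
      have h4 : relabel (φ * Equiv.swap a c) (relabel (Equiv.swap a c) Γ.1) = relabel φ Γ.1 := by
        rw [← relabel_mul, mul_assoc, Equiv.swap_mul_self, mul_one]
      refine Relation.EqvGen.trans _ _ _ (Relation.EqvGen.rel _
        ⟨_, Γ.2.isQuotientCover_relabel hsw⟩ hr) ?_
      have h5 : (⟨_, Γ.2.isQuotientCover_relabel hφ⟩ : QuotientCover k d m) =
          ⟨_, (Γ.2.isQuotientCover_relabel hsw).isQuotientCover_relabel hadm⟩ :=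
        Subtype.ext h4.symm
      rw [h5]
      exact h3

theorem coverSetoid_iff (Γ Γ' : QuotientCover k d m) :
    (coverSetoid k d m) Γ Γ' ↔ ∃ φ, Γ.1.Admissible φ ∧ Γ'.1 = relabel φ Γ.1 := by
  constructor
  · intro h
    change Relation.EqvGen _ Γ Γ' at h
    induction h with
    | rel _ _ h => exact h.exists_admissible
    | refl Γ => exact ⟨1, admissible_one _, (relabel_one _).symm⟩
    | symm Γ Γ' _ ih =>
      obtain ⟨φ, h1, h2⟩ := ih
      refine ⟨φ⁻¹, ?_, ?_⟩
      · rw [h2]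
        exact h1.symm
      · rw [h2, relabel_inv_relabel]
    | trans Γ Γ' Γ'' _ _ ih1 ih2 =>
      obtain ⟨φ, h1, h2⟩ := ih1
      obtain ⟨ψ, h3, h4⟩ := ih2
      rw [h2] at h3 h4
      exact ⟨ψ * φ, h1.mul h3, by rw [h4, relabel_mul]⟩
  · rintro ⟨φ, h1, h2⟩
    have := eqvGen_relabel Γ φ h1
    have h3 : (⟨relabel φ Γ.1, Γ.2.isQuotientCover_relabel h1⟩ : QuotientCover k d m) = Γ' :=
      Subtype.ext h2.symm
    rwa [h3] at this

open Classical in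
/-- The vertices in the component of `v` after a cut to the left of `v`. -/
noncomputable def hook (Γ : CoverData k q d) (v : Fin k) : Finset (Fin k) :=
  Finset.univ.filter fun u => Γ.SameCompFrom v v u

theorem mem_hook {u v : Fin k} : u ∈ Γ.hook v ↔ Γ.SameCompFrom v v u := by
  simp only [hook, Finset.mem_filter, Finset.mem_univ, true_and]

theorem Admissible.card_hook_relabel (h : Γ.Admissible φ) (v : Fin k) :
    ((relabel φ Γ).hook (φ v)).card = (Γ.hook v).card := by
  refine (Finset.card_bij (fun u _ => φ u) ?_ (fun _ _ _ _ h => φ.injective h) ?_).symm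
  · intro u hu
    rw [mem_hook] at hu ⊢
    rwa [h.sameCompFrom_relabel]
  · intro u hu
    refine ⟨φ.symm u, ?_, φ.apply_symm_apply u⟩
    rw [mem_hook] at hu ⊢
    rwa [← h.sameCompFrom_relabel, Equiv.apply_symm_apply]

-- Components to the right of two cuts are nested or disjoint, so the hooks are those of a forest.
-- An admissible permutation arranges the vertices in an order compatible with this forest.
open Classical in
theorem card_admissible (Γ : CoverData k q d) :
    (Finset.univ.filter fun φ => Γ.Admissible φ).card * ∏ v, (Γ.hook v).card = k.factorial := by
  obtain ⟨T, hT, hcard⟩ := exists_linearExtensions Γ.hook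
    (fun v => mem_hook.mpr (Γ.sameCompFrom_refl v))
    (fun v w hw u hu => by
      rw [mem_hook] at hw hu ⊢
      exact hw.trans (hu.mono hw.2.1))
    (fun v w hw hv => le_antisymm (mem_hook.mp hw).2.1 (mem_hook.mp hv).2.1)
    (fun u v w hu hv => by
      rw [mem_hook] at hu hv
      rw [mem_hook, mem_hook]
      rcases le_total u v with h | h
      · exact Or.inl (hu.trans (hv.symm.mono h))
      · exact Or.inr (hv.trans (hu.symm.mono h)))
    k Finset.univ (by simp) (fun _ _ => Finset.subset_univ _)
  rw [← hcard]
  congr 1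
  -- The values of `φ⁻¹` list the vertices in their new order, so inversions within a hook are
  -- excluded exactly for linear extensions.
  have hadm : ∀ φ : Equiv.Perm (Fin k), Γ.Admissible φ ↔ List.ofFn φ.symm ∈ T := by
    intro φ
    rw [hT, List.nodup_ofFn, List.pairwise_ofFn]
    have h1 : (List.ofFn φ.symm).toFinset = Finset.univ := by
      ext x
      simp only [List.mem_toFinset, List.mem_ofFn, Finset.mem_univ, iff_true]
      exact ⟨φ x, by simp⟩
    simp only [h1, φ.symm.injective, true_and, mem_hook]
    constructor
    · intro h i j hij hs
      have h2 : φ.symm j < φ.symm i :=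
        lt_of_le_of_ne hs.2.1 fun h => hij.ne (φ.symm.injective h).symm
      have h3 := h _ _ h2 hs
      rw [Equiv.apply_symm_apply, Equiv.apply_symm_apply] at h3
      exact h3.not_gt hij
    · intro h u v huv hs
      by_contra h1
      have h2 : φ v < φ u := lt_of_le_of_ne (not_lt.mp h1) fun h => huv.ne (φ.injective h).symm
      have h3 := h h2
      rw [Equiv.symm_apply_apply, Equiv.symm_apply_apply] at h3
      exact h3 hs
  refine Finset.card_bij (fun φ _ => List.ofFn φ.symm) ?_ ?_ ?_
  · intro φ hφ
    exact (hadm φ).mp (Finset.mem_filter.mp hφ).2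
  · intro φ _ ψ _ h
    have h1 := List.ofFn_injective h
    exact Equiv.symm_bijective.injective (Equiv.ext fun x => congrFun h1 x)
  · intro l hl
    have hl' := (hT l).mp hl
    have hlen : l.length = k := by
      rw [← List.toFinset_card_of_nodup hl'.1, hl'.2.1, Finset.card_univ, Fintype.card_fin]
    obtain ⟨n, f, rfl⟩ : ∃ n, ∃ f : Fin n → Fin k, l = List.ofFn f :=
      ⟨_, l.get, (List.ofFn_get l).symm⟩
    rw [List.length_ofFn] at hlen
    subst hlen
    have hinj := List.nodup_ofFn.mp hl'.1
    set e := Equiv.ofBijective f (Finite.injective_iff_bijective.mp hinj) with he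
    have h1 : List.ofFn e.symm.symm = List.ofFn f := rfl
    refine ⟨e.symm, ?_, h1⟩
    rw [Finset.mem_filter, hadm, h1]
    exact ⟨Finset.mem_univ _, hl⟩

/-- The elements of a class correspond to the admissible permutations of a representative, because
these act without fixed points. By the hook length formula a class has `k! / ∏ hooks` elements, and
both multiplicity and hooks are constant on it. -/
theorem finsum_classes {K : Type*} [Field K] [CharZero K] [Fintype (QuotientCover k d m)] (b : K) :
    ∑ᶠ c : CoverClass k d m, (Quotient.out c).1.mult b m =
      (∑ Γ : QuotientCover k d m, Γ.1.mult b m * ∏ v, ((Γ.1.hook v).card : K)) / k.factorial := by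
  classical
  have hfin : Finite (CoverClass k d m) := Quotient.finite _
  have := Fintype.ofFinite (CoverClass k d m)
  set cl : QuotientCover k d m → CoverClass k d m := Quotient.mk (coverSetoid k d m) with hcl
  rw [finsum_eq_sum_of_fintype,
    eq_div_iff (Nat.cast_ne_zero.mpr k.factorial_ne_zero),
    Finset.sum_mul, ← Finset.sum_fiberwise_of_maps_to (s := Finset.univ)
      (g := cl)
      (t := (Finset.univ : Finset (CoverClass k d m))) fun _ _ => Finset.mem_univ _]
  refine Finset.sum_congr rfl fun c _ => ?_
  set Γ₀ : QuotientCover k d m := Quotient.out c with hΓ₀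
  have hc : cl Γ₀ = c := Quotient.out_eq c
  have hmem : ∀ Γ : QuotientCover k d m, cl Γ = c ↔
      ∃ φ, Γ₀.1.Admissible φ ∧ Γ.1 = relabel φ Γ₀.1 := by
    intro Γ
    rw [← coverSetoid_iff, ← hc, eq_comm]
    exact Quotient.eq
  have hconst : ∀ Γ : QuotientCover k d m, cl Γ = c →
      Γ.1.mult b m * ∏ v, ((Γ.1.hook v).card : K) =
        Γ₀.1.mult b m * ∏ v, ((Γ₀.1.hook v).card : K) := by
    intro Γ hΓ
    obtain ⟨φ, h1, h2⟩ := (hmem Γ).mp hΓ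
    rw [h2, h1.mult_relabel, ← Equiv.prod_comp φ]
    simp only [h1.card_hook_relabel]
  rw [Finset.sum_congr rfl fun Γ hΓ => hconst Γ (Finset.mem_filter.mp hΓ).2, Finset.sum_const,
    nsmul_eq_mul, ← card_admissible Γ₀.1]
  have hcard : (Finset.univ.filter
      (fun Γ => cl Γ = c)).card =
      (Finset.univ.filter fun φ => Γ₀.1.Admissible φ).card := by
    symm
    refine Finset.card_bij (fun φ hφ => ⟨relabel φ Γ₀.1,
      Γ₀.2.isQuotientCover_relabel (Finset.mem_filter.mp hφ).2⟩) ?_ ?_ ?_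
    · intro φ hφ
      exact Finset.mem_filter.mpr ⟨Finset.mem_univ _,
        (hmem _).mpr ⟨φ, (Finset.mem_filter.mp hφ).2, rfl⟩⟩
    · intro φ hφ ψ hψ h
      have h1 : relabel φ Γ₀.1 = relabel ψ Γ₀.1 := congrArg Subtype.val h
      have hφ' := (Finset.mem_filter.mp hφ).2
      have hψ' := (Finset.mem_filter.mp hψ).2
      have h2 := hψ'.symm
      rw [← h1] at h2
      have h3 := Γ₀.2.eq_one_of_relabel_eq (hφ'.mul h2)
        (by rw [relabel_mul, h1, relabel_inv_relabel])
      rw [inv_mul_eq_one] at h3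
      exact h3.symm
    · intro Γ hΓ
      obtain ⟨φ, h1, h2⟩ := (hmem Γ).mp (Finset.mem_filter.mp hΓ).2
      exact ⟨φ, Finset.mem_filter.mpr ⟨Finset.mem_univ _, h1⟩, Subtype.ext h2.symm⟩
  rw [hcard]
  push_cast
  ring

end CoverData

end BHurwitz

/-! ### Translation of quotient covers into covers on an ordered set of nodes -/

namespace BHurwitz

/-- Left ends, vertices and right ends as nodes. -/
abbrev Node (q k d : ℕ) : Type := Fin q ⊕ₗ (Fin k ⊕ₗ Fin d)

namespace Node

variable {q k d : ℕ}

/-- The node of a left end. -/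
def leftEnd (a : Fin q) : Node q k d := toLex (Sum.inl a)

/-- The node of a vertex. -/
def vertex (v : Fin k) : Node q k d := toLex (Sum.inr (toLex (Sum.inl v)))

/-- The node of a right end. -/
def rightEnd (j : Fin d) : Node q k d := toLex (Sum.inr (toLex (Sum.inr j)))

/-- Functions on nodes by cases. -/
def elim {α : Sort*} (f : Fin q → α) (g : Fin k → α) (h : Fin d → α) (x : Node q k d) : α :=
  Sum.elim f (fun y => Sum.elim g h (ofLex y)) (ofLex x)

variable {α : Sort*} {f : Fin q → α} {g : Fin k → α} {h : Fin d → α}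

@[simp] theorem elim_left (a : Fin q) : elim f g h (leftEnd a) = f a := rfl

@[simp] theorem elim_vertex (v : Fin k) : elim f g h (vertex v) = g v := rfl

@[simp] theorem elim_right (j : Fin d) : elim f g h (rightEnd j) = h j := rfl

theorem exists_eq (x : Node q k d) : (∃ a, x = leftEnd a) ∨ (∃ v, x = vertex v) ∨ ∃ j, x =
    rightEnd j := by
  rcases x with a | y
  · exact Or.inl ⟨a, rfl⟩
  · rcases y with v | j
    · exact Or.inr (Or.inl ⟨v, rfl⟩)
    · exact Or.inr (Or.inr ⟨j, rfl⟩)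

theorem left_injective : Function.Injective (leftEnd : Fin q → Node q k d) := fun a b h => by
  simpa [leftEnd] using h

theorem vertex_injective : Function.Injective (vertex : Fin k → Node q k d) := fun a b h => by
  simpa [vertex] using h

theorem right_injective : Function.Injective (rightEnd : Fin d → Node q k d) := fun a b h => by
  simpa [rightEnd] using h

@[simp] theorem vertex_inj {u v : Fin k} : (vertex u : Node q k d) = vertex v ↔ u = v :=
  vertex_injective.eq_iff

@[simp] theorem right_inj {u v : Fin d} : (rightEnd u : Node q k d) = rightEnd v ↔ u = v :=
  right_injective.eq_iff

@[simp] theorem left_ne_vertex (a : Fin q) (v : Fin k) : (leftEnd a : Node q k d) ≠ vertex v := by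
  simp [leftEnd, vertex]

@[simp] theorem left_ne_right (a : Fin q) (j : Fin d) : (leftEnd a : Node q k d) ≠ rightEnd j := by
  simp [leftEnd, rightEnd]

@[simp] theorem vertex_ne_right (v : Fin k) (j : Fin d) : (vertex v : Node q k d) ≠ rightEnd j := by
  simp [vertex, rightEnd]

@[simp] theorem vertex_ne_left (v : Fin k) (a : Fin q) : (vertex v : Node q k d) ≠ leftEnd a :=
  (left_ne_vertex a v).symm

@[simp] theorem right_ne_left (j : Fin d) (a : Fin q) : (rightEnd j : Node q k d) ≠ leftEnd a :=
  (left_ne_right a j).symm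

@[simp] theorem right_ne_vertex (j : Fin d) (v : Fin k) : (rightEnd j : Node q k d) ≠ vertex v :=
  (vertex_ne_right v j).symm

theorem left_lt_vertex (a : Fin q) (v : Fin k) : (leftEnd a : Node q k d) < vertex v :=
  Sum.Lex.inl_lt_inr _ _

theorem left_lt_right (a : Fin q) (j : Fin d) : (leftEnd a : Node q k d) < rightEnd j :=
  Sum.Lex.inl_lt_inr _ _

theorem vertex_lt_right (v : Fin k) (j : Fin d) : (vertex v : Node q k d) < rightEnd j :=
  Sum.Lex.inr_lt_inr_iff.mpr (Sum.Lex.inl_lt_inr _ _)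

@[simp] theorem vertex_lt_vertex {u v : Fin k} : (vertex u : Node q k d) < vertex v ↔ u < v :=
  Sum.Lex.inr_lt_inr_iff.trans Sum.Lex.inl_lt_inl_iff

@[simp] theorem vertex_le_vertex {u v : Fin k} : (vertex u : Node q k d) ≤ vertex v ↔ u ≤ v := by
  rw [← not_lt, vertex_lt_vertex, not_lt]

/-- The left ends. -/
def lefts (q k d : ℕ) : Finset (Node q k d) := Finset.univ.map ⟨leftEnd, left_injective⟩

/-- The vertices. -/
def vertices (q k d : ℕ) : Finset (Node q k d) := Finset.univ.map ⟨vertex, vertex_injective⟩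

/-- The right ends. -/
def rights (q k d : ℕ) : Finset (Node q k d) := Finset.univ.map ⟨rightEnd, right_injective⟩

theorem mem_lefts {x : Node q k d} : x ∈ lefts q k d ↔ ∃ a, x = leftEnd a := by
  simp [lefts, eq_comm]

theorem mem_vertices {x : Node q k d} : x ∈ vertices q k d ↔ ∃ a, x = vertex a := by
  simp [vertices, eq_comm]

theorem mem_rights {x : Node q k d} : x ∈ rights q k d ↔ ∃ a, x = rightEnd a := by
  simp [rights, eq_comm]

theorem nodeSets (q k d : ℕ) : NodeSets (lefts q k d) (vertices q k d) (rights q k d) := by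
  refine ⟨fun i hi u hu => ?_, fun i hi u hu => ?_, fun i hi u hu => ?_⟩
  · obtain ⟨a, rfl⟩ := mem_lefts.mp hi
    obtain ⟨b, rfl⟩ := mem_vertices.mp hu
    exact left_lt_vertex a b
  · obtain ⟨a, rfl⟩ := mem_lefts.mp hi
    obtain ⟨b, rfl⟩ := mem_rights.mp hu
    exact left_lt_right a b
  · obtain ⟨a, rfl⟩ := mem_vertices.mp hi
    obtain ⟨b, rfl⟩ := mem_rights.mp hu
    exact vertex_lt_right a b

theorem sum_univ {M : Type*} [AddCommMonoid M] (f : Node q k d → M) :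
    ∑ x, f x = ∑ a, f (leftEnd a) + (∑ v, f (vertex v) + ∑ j, f (rightEnd j)) := by
  have h1 : ∑ x, f x = ∑ x : Fin q ⊕ (Fin k ⊕ₗ Fin d), f (toLex x) :=
    (Equiv.sum_comp toLex f).symm
  rw [h1, Fintype.sum_sum_type]
  congr 1
  rw [← Equiv.sum_comp toLex, Fintype.sum_sum_type]
  rfl

end Node

theorem sum_filter_eq {α β : Type*} [Fintype β] [DecidableEq β] (f : α → β) (s : Multiset α) :
    ∑ u, s.filter (fun e => f e = u) = s := by
  induction s using Multiset.induction_on with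
  | empty => simp
  | cons a s ih =>
    simp only [Multiset.filter_cons, Finset.sum_add_distrib, ih, Finset.sum_ite_eq,
      Finset.mem_univ, if_true]
    rfl

theorem sum_map_filter_eq {α β γ : Type*} [Fintype β] [DecidableEq β] (f : α → β) (g : α → γ)
    (s : Multiset α) : ∑ u, (s.filter (fun e => f e = u)).map g = s.map g := by
  conv_rhs => rw [← sum_filter_eq f s]
  exact (map_sum (Multiset.mapAddMonoidHom g) _ _).symm

theorem sum_singleton_eq_map {α γ : Type*} (g : α → γ) (s : Finset α) :
    ∑ a ∈ s, ({g a} : Multiset γ) = s.val.map g := by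
  rw [Finset.sum, ← Multiset.sum_map_singleton (s.val.map g), Multiset.map_map]
  rfl

namespace CoverData

open Node

variable {k q d : ℕ} {m : Fin q → ℕ}

/-- The graph with nodes of a cover. -/
def toNode (m : Fin q → ℕ) (Γ : CoverData k q d) : Node q k d → Multiset (Node q k d × ℕ) :=
  Node.elim (fun a => {(vertex (Γ.left a), m a)})
    (fun v => (Γ.edges.filter fun e => e.1 = v).map (fun e => (vertex e.2.1, e.2.2)) +
      (Finset.univ.filter fun j => Γ.right j = v).val.map fun j => (rightEnd j, 1))
    fun _ => 0

theorem toNode_left (Γ : CoverData k q d) (a : Fin q) :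
    toNode m Γ (leftEnd a) = {(vertex (Γ.left a), m a)} := rfl

theorem toNode_vertex (Γ : CoverData k q d) (v : Fin k) : toNode m Γ (vertex v) =
    (Γ.edges.filter fun e => e.1 = v).map (fun e => (vertex e.2.1, e.2.2)) +
      (Finset.univ.filter fun j => Γ.right j = v).val.map fun j => (rightEnd j, 1) := rfl

theorem toNode_right (Γ : CoverData k q d) (j : Fin d) : toNode m Γ (rightEnd j) = 0 := rfl

theorem mem_toNode_vertex {Γ : CoverData k q d} {v : Fin k} {x : Node q k d × ℕ} :
    x ∈ toNode m Γ (vertex v) ↔ (∃ e ∈ Γ.edges, e.1 = v ∧ x = (vertex e.2.1, e.2.2)) ∨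
      ∃ j, Γ.right j = v ∧ x = (rightEnd j, 1) := by
  rw [toNode_vertex, Multiset.mem_add, Multiset.mem_map, Multiset.mem_map]
  simp only [Multiset.mem_filter, Finset.mem_val, Finset.mem_filter, Finset.mem_univ, true_and,
    and_assoc, eq_comm (b := x)]

theorem inEdges_toNode_vertex (Γ : CoverData k q d) (v : Fin k) :
    inEdges (toNode m Γ) (vertex v) =
      (Finset.univ.filter fun a => Γ.left a = v).val.map (fun a => (vertex v, m a)) +
        (Γ.edges.filter fun e => e.2.1 = v).map fun e => (vertex v, e.2.2) := by
  rw [inEdges, Node.sum_univ]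
  simp only [toNode_left, toNode_right, toNode_vertex, Multiset.filter_zero, Finset.sum_const_zero,
    add_zero, Multiset.filter_add, Multiset.filter_map, Function.comp_def, vertex_inj,
    right_ne_vertex, Multiset.filter_false, Multiset.map_zero, Multiset.filter_filter,
    Multiset.filter_singleton]
  congr 1
  · rw [← sum_singleton_eq_map, Finset.sum_filter]
    refine Finset.sum_congr rfl fun a _ => ?_
    split_ifs with h
    · rw [h]
    · rfl
  · rw [← sum_map_filter_eq (fun e : Edge k => e.1)]
    refine Finset.sum_congr rfl fun u _ => ?_
    rw [Multiset.filter_filter, Multiset.filter_congr (p := fun e : Edge k => e.2.1 = v ∧ e.1 = u)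
      (q := fun e => e.1 = u ∧ e.2.1 = v) fun e _ => and_comm]
    refine Multiset.map_congr rfl fun e he => ?_
    rw [(Multiset.mem_filter.mp he).2.2]

theorem inEdges_toNode_right (Γ : CoverData k q d) (j : Fin d) :
    inEdges (toNode m Γ) (rightEnd j) = {(rightEnd j, 1)} := by
  rw [inEdges, Node.sum_univ]
  simp only [toNode_left, toNode_right, toNode_vertex, Multiset.filter_zero, Finset.sum_const_zero,
    add_zero, Multiset.filter_add, Multiset.filter_map, Function.comp_def, vertex_ne_right,
    right_inj, Multiset.filter_false, Multiset.map_zero, zero_add, Multiset.filter_singleton,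
    if_false, Multiset.empty_eq_zero]
  rw [Finset.sum_eq_single (Γ.right j)]
  · rw [← Finset.filter_val, Finset.filter_filter]
    have : (Finset.univ.filter fun x => Γ.right x = Γ.right j ∧ x = j) = {j} := by
      ext x
      simp only [Finset.mem_filter, Finset.mem_univ, true_and, Finset.mem_singleton]
      exact ⟨fun h => h.2, fun h => ⟨h ▸ rfl, h⟩⟩
    rw [this]
    rfl
  · intro v _ hv
    rw [← Finset.filter_val, Finset.filter_filter, Finset.filter_false_of_mem]
    · rfl
    · rintro x _ ⟨h1, rfl⟩
      exact hv h1.symm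
  · intro h
    exact absurd (Finset.mem_univ _) h

theorem card_inEdges_toNode (Γ : CoverData k q d) (v : Fin k) :
    (inEdges (toNode m Γ) (vertex v)).card = Γ.inDeg v := by
  rw [inEdges_toNode_vertex, Multiset.card_add, Multiset.card_map, Multiset.card_map, inDeg,
    add_comm]
  rfl

theorem card_toNode (Γ : CoverData k q d) (v : Fin k) :
    (toNode m Γ (vertex v)).card = Γ.outDeg v := by
  rw [toNode_vertex, Multiset.card_add, Multiset.card_map, Multiset.card_map, outDeg]
  rfl

theorem wsum_inEdges_toNode (Γ : CoverData k q d) (v : Fin k) :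
    wsum (inEdges (toNode m Γ) (vertex v)) = Γ.inWeight m v := by
  rw [inEdges_toNode_vertex, wsum, Multiset.map_add, Multiset.sum_add, Multiset.map_map,
    Multiset.map_map, inWeight, add_comm]
  rfl

theorem wsum_toNode (Γ : CoverData k q d) (v : Fin k) :
    wsum (toNode m Γ (vertex v)) = Γ.outWeight v := by
  rw [toNode_vertex, wsum, Multiset.map_add, Multiset.sum_add, Multiset.map_map,
    Multiset.map_map, outWeight]
  rfl

/-- A cover is determined by its graph with nodes. -/
theorem toNode_injective : Function.Injective (toNode m : CoverData k q d → _) := by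
  have hedges : ∀ Γ : CoverData k q d, ∑ v, (toNode m Γ (vertex v)).filterMap (fun x =>
      Node.elim (fun _ => none) (fun u => some ((v, u, x.2) : Edge k)) (fun _ => none) x.1) =
        Γ.edges := by
    intro Γ
    rw [← sum_filter_eq (fun e : Edge k => e.1) Γ.edges]
    refine Finset.sum_congr rfl fun v _ => ?_
    rw [toNode_vertex, Multiset.filterMap_add, Multiset.filterMap_map,
      Multiset.filterMap_map]
    have h1 : Multiset.filterMap ((fun x : Node q k d × ℕ => Node.elim (fun _ => none)
        (fun u => some ((v, u, x.2) : Edge k)) (fun _ => none) x.1) ∘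
          fun j : Fin d => (rightEnd j, 1)) (Finset.univ.filter fun j => Γ.right j = v).val = 0 := by
      rw [Multiset.eq_zero_iff_forall_notMem]
      intro e he
      rw [Multiset.mem_filterMap] at he
      obtain ⟨_, _, h⟩ := he
      exact absurd h (by simp)
    have h2 := congrFun (Multiset.filterMap_eq_map fun e : Edge k => ((v, e.2.1, e.2.2) : Edge k))
      (Γ.edges.filter fun e => e.1 = v)
    rw [h1, add_zero]
    refine h2.trans ((Multiset.map_congr rfl fun e he => ?_).trans (Multiset.map_id _))
    rw [← (Multiset.mem_filter.mp he).2]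
    rfl
  intro Γ Γ' h
  have h1 : Γ.edges = Γ'.edges := by rw [← hedges Γ, ← hedges Γ', h]
  have h2 : Γ.left = Γ'.left := by
    funext a
    have := congrFun h (leftEnd a)
    rw [toNode_left, toNode_left, Multiset.singleton_inj, Prod.mk.injEq, vertex_inj] at this
    exact this.1
  have h3 : Γ.right = Γ'.right := by
    funext j
    have h4 : (rightEnd j, 1) ∈ toNode m Γ (vertex (Γ.right j)) :=
      mem_toNode_vertex.mpr (Or.inr ⟨j, rfl, rfl⟩)
    rw [h, mem_toNode_vertex] at h4
    rcases h4 with ⟨e, _, _, h5⟩ | ⟨j', h5, h6⟩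
    · rw [Prod.mk.injEq] at h5
      exact absurd h5.1 (by simp)
    · rw [Prod.mk.injEq, right_inj] at h6
      rw [← h5, h6.1]
  obtain ⟨e, l, r⟩ := Γ
  obtain ⟨e', l', r'⟩ := Γ'
  rw [mk.injEq]
  exact ⟨h1, h2, h3⟩

/-- A right end is a leaf, so it belongs to the component of the vertex that carries it. With this
the two notions of components to the right of a vertex match, and both the hook and the degree can
be read off. -/
theorem linked_toNode_iff {Γ : CoverData k q d} (hlt : ∀ e ∈ Γ.edges, e.1 < e.2.1) (v : Fin k)
    (z : Node q k d) : Linked (toNode m Γ) {x | x ∈ vertices q k d ∧ vertex v ≤ x} (vertex v) z ↔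
      (∃ u, z = vertex u ∧ Γ.SameCompFrom v v u) ∨
        ∃ j, z = rightEnd j ∧ Γ.SameCompFrom v v (Γ.right j) := by
  set S : Set (Node q k d) := {x | x ∈ vertices q k d ∧ vertex v ≤ x} with hS
  have hmem : ∀ u, vertex u ∈ S ↔ v ≤ u := fun u => by
    rw [hS, Set.mem_ofPred_eq, vertex_le_vertex, mem_vertices, and_iff_right ⟨u, rfl⟩]
  have hvert : ∀ u, Γ.SameCompFrom v v u → Linked (toNode m Γ) S (vertex v) (vertex u) := by
    intro u hu
    have key := hu.2.2
    induction key with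
    | refl => exact Linked.refl _ _ _
    | tail hp hadj ih =>
      rename_i a c
      refine (ih ⟨le_rfl, hadj.1, hp⟩).trans ?_
      obtain ⟨ha, hc, e, he, h | h⟩ := hadj
      · have := Linked.edge (S := S) ((hmem a).mpr ha)
          (mem_toNode_vertex (m := m).mpr (Or.inl ⟨e, he, h.1, rfl⟩))
        rwa [h.2] at this
      · have := Linked.edge (S := S) ((hmem c).mpr hc)
          (mem_toNode_vertex (m := m).mpr (Or.inl ⟨e, he, h.1, rfl⟩))
        rw [h.2] at this
        exact this.symm
  constructor
  · intro h
    refine (Linked.iff_of_closed (fun z => (∃ u, z = vertex u ∧ Γ.SameCompFrom v v u) ∨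
      ∃ j, z = rightEnd j ∧ Γ.SameCompFrom v v (Γ.right j)) ?_ h).mp
        (Or.inl ⟨v, rfl, Γ.sameCompFrom_refl v⟩)
    rintro x hx e he
    obtain ⟨a, rfl⟩ := mem_vertices.mp hx.1
    have ha := (hmem a).mp hx
    rcases mem_toNode_vertex.mp he with ⟨e', he', rfl, rfl⟩ | ⟨j, rfl, rfl⟩
    · have hadj : Γ.SameCompFrom v e'.1 e'.2.1 :=
        (SameCompFrom.of_edge he' (hlt e' he').le).mono ha
      simp only [vertex_inj, exists_eq_left', vertex_ne_right, false_and, exists_false, or_false]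
      exact ⟨fun h => h.trans hadj, fun h => h.trans hadj.symm⟩
    · simp only [vertex_inj, right_inj, exists_eq_left', vertex_ne_right, right_ne_vertex,
        false_and, exists_false, or_false, false_or]
  · rintro (⟨u, rfl, hu⟩ | ⟨j, rfl, hj⟩)
    · exact hvert u hu
    · exact (hvert _ hj).trans (Linked.edge (S := S) ((hmem _).mpr hj.2.1)
        (mem_toNode_vertex (m := m) (x := (rightEnd j, 1)).mpr (Or.inr ⟨j, rfl, rfl⟩)))

theorem connected_iff (hk : 0 < k) (Γ : CoverData k q d) :
    Γ.Connected ↔ ∀ u, Γ.SameCompFrom ⟨0, hk⟩ ⟨0, hk⟩ u := by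
  have h0 : ∀ u : Fin k, ⟨0, hk⟩ ≤ u := fun u => by
    rw [Fin.le_def]
    exact Nat.zero_le _
  have hadj : Γ.AdjFrom ⟨0, hk⟩ =
      fun x y => ∃ e ∈ Γ.edges, (e.1 = x ∧ e.2.1 = y) ∨ (e.1 = y ∧ e.2.1 = x) := by
    funext x y
    rw [AdjFrom, eq_iff_iff]
    simp only [h0, true_and]
  rw [Connected, ← hadj]
  exact ⟨fun h u => ⟨le_rfl, h0 u, h _ u⟩, fun h u v => ((h u).symm.trans (h v)).2.2⟩

theorem nodeConnected_toNode_iff (hk : 0 < k) {Γ : CoverData k q d}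
    (hlt : ∀ e ∈ Γ.edges, e.1 < e.2.1) :
    NodeConnected (vertices q k d) (rights q k d) (toNode m Γ) ↔ Γ.Connected := by
  have hS : {x : Node q k d | x ∈ vertices q k d ∧ vertex ⟨0, hk⟩ ≤ x} =
      (↑(vertices q k d) : Set (Node q k d)) := by
    ext x
    rw [Set.mem_ofPred_eq, Finset.mem_coe, and_iff_left_iff_imp]
    intro hx
    obtain ⟨a, rfl⟩ := mem_vertices.mp hx
    rw [vertex_le_vertex, Fin.le_def]
    exact Nat.zero_le _
  have hl := linked_toNode_iff (m := m) hlt ⟨0, hk⟩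
  rw [hS] at hl
  rw [connected_iff hk, nodeConnected_iff_single (t := vertex ⟨0, hk⟩)
    (Finset.mem_union_left _ (mem_vertices.mpr ⟨_, rfl⟩))]
  constructor
  · intro h u
    have h1 := (h (vertex u) (Finset.mem_union_left _ (mem_vertices.mpr ⟨_, rfl⟩))).symm
    rw [hl] at h1
    rcases h1 with ⟨u', h2, h3⟩ | ⟨j, h2, _⟩
    · rw [vertex_inj] at h2
      rwa [h2]
    · exact absurd h2 (by simp)
  · intro h x hx
    refine Linked.symm ((hl x).mpr ?_)
    rcases Finset.mem_union.mp hx with hx | hx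
    · obtain ⟨u, rfl⟩ := mem_vertices.mp hx
      exact Or.inl ⟨u, rfl, h u⟩
    · obtain ⟨j, rfl⟩ := mem_rights.mp hx
      exact Or.inr ⟨j, rfl, h _⟩

/-- The weights of the left ends, as a function on all nodes. -/
def nodeWeight (m : Fin q → ℕ) : Node q k d → ℕ := Node.elim m (fun _ => 0) fun _ => 0

theorem isQuotientCover_iff (hk : 0 < k) (hm : ∀ a, 0 < m a) (Γ : CoverData k q d) :
    Γ.IsQuotientCover m ↔
      toNode m Γ ∈ connFinset (lefts q k d) (vertices q k d) (rights q k d) (nodeWeight m) := by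
  rw [mem_connFinset (nodeSets q k d)]
  constructor
  · intro h
    refine ⟨⟨?_, ?_, ?_, ?_, ?_, ?_, ?_, ?_⟩, (nodeConnected_toNode_iff hk h.lt).mpr h.connected⟩
    · intro s hs hs'
      rcases s.exists_eq with ⟨a, rfl⟩ | ⟨v, rfl⟩ | ⟨j, rfl⟩
      · exact absurd (mem_lefts.mpr ⟨a, rfl⟩) hs
      · exact absurd (mem_vertices.mpr ⟨v, rfl⟩) hs'
      · rfl
    · intro s e he
      rcases s.exists_eq with ⟨a, rfl⟩ | ⟨v, rfl⟩ | ⟨j, rfl⟩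
      · rw [toNode_left, Multiset.mem_singleton] at he
        rw [he]
        exact Or.inl (mem_vertices.mpr ⟨_, rfl⟩)
      · rcases mem_toNode_vertex.mp he with ⟨e', he', rfl, rfl⟩ | ⟨j, rfl, rfl⟩
        · exact Or.inl (mem_vertices.mpr ⟨_, rfl⟩)
        · exact Or.inr (mem_rights.mpr ⟨_, rfl⟩)
      · exact absurd he (Multiset.notMem_zero _)
    · intro s e he
      rcases s.exists_eq with ⟨a, rfl⟩ | ⟨v, rfl⟩ | ⟨j, rfl⟩
      · rw [toNode_left, Multiset.mem_singleton] at he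
        rw [he]
        exact left_lt_vertex _ _
      · rcases mem_toNode_vertex.mp he with ⟨e', he', rfl, rfl⟩ | ⟨j, rfl, rfl⟩
        · exact vertex_lt_vertex.mpr (h.lt e' he')
        · exact vertex_lt_right _ _
      · exact absurd he (Multiset.notMem_zero _)
    · intro s e he
      rcases s.exists_eq with ⟨a, rfl⟩ | ⟨v, rfl⟩ | ⟨j, rfl⟩
      · rw [toNode_left, Multiset.mem_singleton] at he
        rw [he]
        exact hm a
      · rcases mem_toNode_vertex.mp he with ⟨e', he', rfl, rfl⟩ | ⟨j, rfl, rfl⟩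
        · exact h.weight_pos e' he'
        · exact one_pos
      · exact absurd he (Multiset.notMem_zero _)
    · intro s hs
      obtain ⟨a, rfl⟩ := mem_lefts.mp hs
      exact ⟨_, toNode_left Γ a⟩
    · intro s hs
      obtain ⟨j, rfl⟩ := mem_rights.mp hs
      exact inEdges_toNode_right Γ j
    · intro s hs
      obtain ⟨v, rfl⟩ := mem_vertices.mp hs
      rw [card_inEdges_toNode, card_toNode]
      exact h.valence v
    · intro s hs
      obtain ⟨v, rfl⟩ := mem_vertices.mp hs
      rw [wsum_inEdges_toNode, wsum_toNode]
      exact h.balanced v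
  · rintro ⟨h, hc⟩
    have hlt : ∀ e ∈ Γ.edges, e.1 < e.2.1 := fun e he => vertex_lt_vertex.mp
      (h.lt (vertex e.1) (vertex e.2.1, e.2.2) (mem_toNode_vertex.mpr (Or.inl ⟨e, he, rfl, rfl⟩)))
    refine ⟨hlt, ?_, ?_, ?_, (nodeConnected_toNode_iff hk hlt).mp hc⟩
    · intro e he
      exact h.pos (vertex e.1) (vertex e.2.1, e.2.2)
        (mem_toNode_vertex.mpr (Or.inl ⟨e, he, rfl, rfl⟩))
    · intro v
      have := h.valence (vertex v) (mem_vertices.mpr ⟨v, rfl⟩)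
      rwa [card_inEdges_toNode, card_toNode] at this
    · intro v
      have := h.balanced (vertex v) (mem_vertices.mpr ⟨v, rfl⟩)
      rwa [wsum_inEdges_toNode, wsum_toNode] at this

end CoverData

end BHurwitz

/-! ### The translation is a bijection -/

namespace BHurwitz

section

variable {N : Type*} [LinearOrder N] [Fintype N]

theorem filter_le_inEdges (Γ : N → Multiset (N × ℕ)) (s x : N) :
    ((Γ s).filter fun e => e.1 = x) ≤ inEdges Γ x := by
  rw [inEdges]
  exact Finset.single_le_sum (f := fun s => (Γ s).filter fun e => e.1 = x)
    (fun _ _ => Multiset.zero_le _) (Finset.mem_univ s)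

theorem source_unique {Γ : N → Multiset (N × ℕ)} {x : N} (h : (inEdges Γ x).card = 1) {s s' : N}
    {e e' : N × ℕ} (he : e ∈ Γ s) (hx : e.1 = x) (he' : e' ∈ Γ s') (hx' : e'.1 = x) : s = s' := by
  by_contra hne
  have hle : (Γ s).filter (fun e => e.1 = x) + (Γ s').filter (fun e => e.1 = x) ≤
      inEdges Γ x := by
    rw [inEdges, ← Finset.sum_pair hne (f := fun s => (Γ s).filter fun e => e.1 = x)]
    exact Finset.sum_le_sum_of_subset (Finset.subset_univ _)
  have hcard := Multiset.card_le_card hle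
  have h1 : 0 < ((Γ s).filter fun e => e.1 = x).card :=
    Multiset.card_pos_iff_exists_mem.mpr ⟨e, Multiset.mem_filter.mpr ⟨he, hx⟩⟩
  have h2 : 0 < ((Γ s').filter fun e => e.1 = x).card :=
    Multiset.card_pos_iff_exists_mem.mpr ⟨e', Multiset.mem_filter.mpr ⟨he', hx'⟩⟩
  rw [h, Multiset.card_add] at hcard
  omega

theorem count_le_one_of_inEdges {Γ : N → Multiset (N × ℕ)} {e : N × ℕ}
    (h : (inEdges Γ e.1).card = 1) (s : N) : (Γ s).count e ≤ 1 := by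
  rw [← Multiset.count_filter_of_pos (p := fun x => x.1 = e.1) rfl]
  refine (Multiset.count_le_card _ _).trans ?_
  rw [← h]
  exact Multiset.card_le_card (filter_le_inEdges Γ s e.1)

end

namespace CoverData

open Node

variable {k q d : ℕ} {m : Fin q → ℕ}

/-- The edges between vertices in a graph with nodes. -/
def edgeOf (v : Fin k) (x : Node q k d × ℕ) : Option (Edge k) :=
  Node.elim (fun _ => none) (fun u => some (v, u, x.2)) (fun _ => none) x.1

open Classical in
theorem map_filterMap_edgeOf (v : Fin k) (s : Multiset (Node q k d × ℕ)) :
    (s.filterMap (edgeOf v)).map (fun e => ((vertex e.2.1, e.2.2) : Node q k d × ℕ)) =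
      s.filter fun x => ∃ u, x.1 = vertex u := by
  induction s using Multiset.induction_on with
  | empty => rfl
  | cons x s ih =>
    obtain ⟨x, w⟩ := x
    rcases x.exists_eq with ⟨a, rfl⟩ | ⟨u, rfl⟩ | ⟨j, rfl⟩
    · rw [Multiset.filterMap_cons_none _ _ rfl, ih, Multiset.filter_cons_of_neg]
      simp
    · rw [Multiset.filterMap_cons_some (edgeOf v) _ _ rfl, Multiset.map_cons, ih,
        Multiset.filter_cons_of_pos]
      exact ⟨u, rfl⟩
    · rw [Multiset.filterMap_cons_none _ _ rfl, ih, Multiset.filter_cons_of_neg]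
      simp

/-- The labels of left and right ends are recovered from the unique edge at each of these ends; the
remaining edges connect vertices. -/
theorem exists_toNode_eq (hk : 0 < k) {Γ' : Node q k d → Multiset (Node q k d × ℕ)}
    (h : Γ' ∈ connFinset (lefts q k d) (vertices q k d) (rights q k d) (nodeWeight m)) :
    ∃ Γ : CoverData k q d, toNode m Γ = Γ' := by
  classical
  rw [mem_connFinset (nodeSets q k d)] at h
  obtain ⟨h, hc⟩ := h
  have hcard : ∀ j, (inEdges Γ' (rightEnd j)).card = 1 := fun j => by
    rw [h.right _ (mem_rights.mpr ⟨j, rfl⟩)]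
    rfl
  have hleft : ∀ a, ∃ v, Γ' (leftEnd a) = {(vertex v, m a)} := by
    intro a
    obtain ⟨t, htU, ht⟩ := h.exists_left (mem_lefts.mpr ⟨a, rfl⟩)
    have hmem : (t, m a) ∈ Γ' (leftEnd a) := by
      rw [ht]
      exact Multiset.mem_singleton_self _
    rcases Finset.mem_union.mp htU with h1 | h1
    · obtain ⟨v, rfl⟩ := mem_vertices.mp h1
      exact ⟨v, ht⟩
    · obtain ⟨j, rfl⟩ := mem_rights.mp h1
      -- A left end that leads directly to a right end would use up the only edge entering it. The
      -- right end would then be separated from the vertex over the first branch point, which exists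
      -- because `k` is positive.
      have hl := hc (rightEnd j) (Finset.mem_union_right _ h1) (vertex ⟨0, hk⟩)
        (Finset.mem_union_left _ (mem_vertices.mpr ⟨_, rfl⟩))
      have := (Linked.iff_of_closed (fun z => z = rightEnd j) ?_ hl).mp rfl
      · exact absurd this (by simp)
      · intro x hx e he
        obtain ⟨u, rfl⟩ := mem_vertices.mp hx
        refine iff_of_false (by simp) fun hej => ?_
        have := source_unique (hcard j) he hej hmem rfl
        exact absurd this (by simp)
  have hright : ∀ j, ∃ v, (rightEnd j, 1) ∈ Γ' (vertex v) := by
    intro j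
    have hmem : (rightEnd j, 1) ∈ inEdges Γ' (rightEnd j) := by
      rw [h.right _ (mem_rights.mpr ⟨j, rfl⟩)]
      exact Multiset.mem_singleton_self _
    obtain ⟨s, hs⟩ := (mem_inEdges.mp hmem).2
    rcases s.exists_eq with ⟨a, rfl⟩ | ⟨v, rfl⟩ | ⟨j', rfl⟩
    · obtain ⟨v, hv⟩ := hleft a
      rw [hv, Multiset.mem_singleton, Prod.mk.injEq] at hs
      exact absurd hs.1 (by simp)
    · exact ⟨v, hs⟩
    · rw [h.eq_zero _ (by simp [mem_lefts]) (by simp [mem_vertices])] at hs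
      exact absurd hs (Multiset.notMem_zero _)
  choose l hl using hleft
  choose r hr using hright
  refine ⟨⟨∑ v, (Γ' (vertex v)).filterMap (edgeOf v), l, r⟩, ?_⟩
  have hzero : ∀ j, Γ' (rightEnd j) = 0 := fun j =>
    h.eq_zero _ (by simp [mem_lefts]) (by simp [mem_vertices])
  funext s
  rcases s.exists_eq with ⟨a, rfl⟩ | ⟨v, rfl⟩ | ⟨j, rfl⟩
  · rw [toNode_left, hl]
  · have hsrc : ∀ u, ∀ e ∈ (Γ' (vertex u)).filterMap (edgeOf u), e.1 = u := by
      intro u e he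
      obtain ⟨⟨x, w⟩, _, h1⟩ := (Multiset.mem_filterMap _ _).mp he
      rcases x.exists_eq with ⟨a, rfl⟩ | ⟨u', rfl⟩ | ⟨j, rfl⟩
      · exact absurd h1 (by simp [edgeOf])
      · simp only [edgeOf, elim_vertex, Option.some.injEq] at h1
        rw [← h1]
      · exact absurd h1 (by simp [edgeOf])
    have hedges : (∑ u, (Γ' (vertex u)).filterMap (edgeOf u)).filter (fun e => e.1 = v) =
        (Γ' (vertex v)).filterMap (edgeOf v) := by
      have h1 : (∑ u, (Γ' (vertex u)).filterMap (edgeOf u)).filter (fun e => e.1 = v) =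
          ∑ u, ((Γ' (vertex u)).filterMap (edgeOf u)).filter fun e => e.1 = v := by
        refine map_sum (⟨⟨Multiset.filter fun e : Edge k => e.1 = v, rfl⟩, ?_⟩ :
          Multiset (Edge k) →+ Multiset (Edge k)) _ _
        exact Multiset.filter_add _
      rw [h1, Finset.sum_eq_single v]
      · rw [Multiset.filter_eq_self]
        exact hsrc v
      · intro u _ huv
        rw [Multiset.filter_eq_nil]
        intro e he hev
        exact huv ((hsrc u e he).symm.trans hev)
      · intro h
        exact absurd (Finset.mem_univ _) h
    rw [toNode_vertex]
    dsimp only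
    rw [hedges, map_filterMap_edgeOf]
    conv_rhs => rw [← Multiset.filter_add_not (fun x => ∃ u, x.1 = vertex u) (Γ' (vertex v))]
    congr 1
    have hform : ∀ x ∈ Γ' (vertex v), (¬ ∃ u, x.1 = vertex u) → ∃ j, x = (rightEnd j, 1) := by
      intro x hx hxv
      rcases h.mem _ x hx with h1 | h1
      · exact absurd (mem_vertices.mp h1) hxv
      · obtain ⟨j, hj⟩ := mem_rights.mp h1
        have h2 : x ∈ inEdges Γ' (rightEnd j) := mem_inEdges.mpr ⟨hj, _, hx⟩
        rw [h.right _ (mem_rights.mpr ⟨j, rfl⟩), Multiset.mem_singleton] at h2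
        exact ⟨j, h2⟩
    -- A right end has only one incoming edge, so no edge to a right end is repeated and comparing
    -- elements suffices.
    refine (Multiset.Nodup.ext ?_ ?_).mpr ?_
    · refine Multiset.Nodup.map ?_ (Finset.nodup _)
      intro a c hac
      exact right_injective (Prod.ext_iff.mp hac).1
    · rw [Multiset.nodup_iff_count_le_one]
      intro x
      by_cases hx : x ∈ (Γ' (vertex v)).filter fun x => ¬ ∃ u, x.1 = vertex u
      · obtain ⟨hx1, hx2⟩ := Multiset.mem_filter.mp hx
        obtain ⟨j, rfl⟩ := hform x hx1 hx2
        exact (Multiset.count_le_of_le _ (Multiset.filter_le _ _)).trans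
          (count_le_one_of_inEdges (hcard j) _)
      · rw [Multiset.count_eq_zero_of_notMem hx]
        exact zero_le_one
    · intro x
      rw [Multiset.mem_map, Multiset.mem_filter]
      constructor
      · rintro ⟨j, hj, rfl⟩
        have hj := (Finset.mem_filter.mp (Finset.mem_val.mp hj)).2
        refine ⟨hj ▸ hr j, by simp⟩
      · rintro ⟨h1, h2⟩
        obtain ⟨j, rfl⟩ := hform x h1 h2
        refine ⟨j, Finset.mem_val.mpr (Finset.mem_filter.mpr ⟨Finset.mem_univ _, ?_⟩), rfl⟩
        exact vertex_injective (source_unique (hcard j) (hr j) rfl h1 rfl)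
  · rw [toNode_right, hzero]

/-- Each internal edge and each right end starts at exactly one vertex. This gives the exponent of
`1 + b` in `coverWeight_toNode`. -/
theorem sum_outDeg (Γ : CoverData k q d) : ∑ v, Γ.outDeg v = Γ.edges.card + d := by
  simp only [outDeg, Finset.sum_add_distrib]
  congr 1
  · conv_rhs => rw [← sum_filter_eq (fun e : Edge k => e.1) Γ.edges]
    exact (map_sum Multiset.cardHom _ _).symm
  · have := (Finset.card_eq_sum_card_fiberwise (f := Γ.right) (s := Finset.univ)
      (t := Finset.univ) fun _ _ => by simp).symm
    rw [Finset.card_univ, Fintype.card_fin] at this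
    exact this

end CoverData

end BHurwitz

/-! ### Multiplicities and the value of the tropical number -/

namespace BHurwitz

open MvPolynomial

namespace CoverData

open Node

variable {k q d : ℕ} {m : Fin q → ℕ}

theorem IsQuotientCover.toNode_eq_pair {Γ : CoverData k q d} (hΓ : Γ.IsQuotientCover m)
    {e : Edge k} (he : 2 ≤ Γ.edges.count e) : toNode m Γ (vertex e.1) =
      {((vertex e.2.1, e.2.2) : Node q k d × ℕ), (vertex e.2.1, e.2.2)} := by
  refine (Multiset.eq_of_le_of_card_le ?_ ?_).symm
  · have h1 : ({e, e} : Multiset (Edge k)) ≤ Γ.edges.filter fun x => x.1 = e.1 := by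
      rw [show ({e, e} : Multiset (Edge k)) = Multiset.replicate 2 e from rfl,
        ← Multiset.le_count_iff_replicate_le, Multiset.count_filter_of_pos (p :=
          fun x : Edge k => x.1 = e.1) rfl]
      exact he
    rw [toNode_vertex]
    exact (Multiset.map_le_map h1).trans (Multiset.le_add_right _ _)
  · rw [card_toNode]
    have : Γ.outDeg e.1 ≤ 2 := by rcases hΓ.valence e.1 with h | h | h <;> omega
    exact this

-- At most two edges leave a vertex, so a double edge uses up all of them and is determined by its
-- starting point. A pair of equal edges to a right end is excluded, since right ends are distinct.
open Classical in
theorem IsQuotientCover.wieners_eq {Γ : CoverData k q d} (hΓ : Γ.IsQuotientCover m) :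
    Γ.wieners = (Finset.univ.filter fun v : Fin k =>
      ∃ x : Node q k d × ℕ, toNode m Γ (vertex v) = {x, x}).card := by
  have hpair : ∀ {x y : Node q k d × ℕ}, ({x, x} : Multiset (Node q k d × ℕ)) = {y, y} → x = y := by
    intro x y h
    have : x ∈ ({y, y} : Multiset (Node q k d × ℕ)) := h ▸ Multiset.mem_cons_self _ _
    simpa using this
  refine Finset.card_bij (fun e _ => e.1) ?_ ?_ ?_
  · intro e he
    exact Finset.mem_filter.mpr ⟨Finset.mem_univ _, _,
      hΓ.toNode_eq_pair (Finset.mem_filter.mp he).2⟩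
  · intro e he e' he' h
    have h1 := hΓ.toNode_eq_pair (Finset.mem_filter.mp he).2
    rw [h, hΓ.toNode_eq_pair (Finset.mem_filter.mp he').2] at h1
    have h2 := Prod.ext_iff.mp (hpair h1)
    exact Prod.ext h (Prod.ext (vertex_injective h2.1.symm) h2.2.symm)
  · intro v hv
    obtain ⟨x, hx⟩ := (Finset.mem_filter.mp hv).2
    have hmem : x ∈ toNode m Γ (vertex v) := by rw [hx]; exact Multiset.mem_cons_self _ _
    have hall : ∀ y ∈ toNode m Γ (vertex v), y = x := by
      intro y hy
      rw [hx] at hy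
      simpa using hy
    rcases mem_toNode_vertex.mp hmem with ⟨e, he, hev, rfl⟩ | ⟨j, hj, rfl⟩
    · have hcard : (Γ.edges.filter fun e => e.1 = v).card = 2 := by
        have h1 := congrArg Multiset.card hx
        rw [card_toNode, outDeg] at h1
        have h2 : (Finset.univ.filter fun j => Γ.right j = v) = ∅ := by
          rw [Finset.filter_eq_empty_iff]
          intro j _ hj
          have := hall _ (mem_toNode_vertex.mpr (Or.inr ⟨j, hj, rfl⟩))
          exact absurd (Prod.ext_iff.mp this).1 (by simp)
        rw [h2, Finset.card_empty, add_zero] at h1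
        exact h1
      have hrep : (Γ.edges.filter fun e => e.1 = v) = Multiset.replicate 2 e := by
        rw [Multiset.eq_replicate]
        refine ⟨hcard, fun e' he' => ?_⟩
        obtain ⟨h1, h2⟩ := Multiset.mem_filter.mp he'
        have := Prod.ext_iff.mp (hall _ (mem_toNode_vertex.mpr (Or.inl ⟨e', h1, h2, rfl⟩)))
        exact Prod.ext (h2.trans hev.symm) (Prod.ext (vertex_injective this.1) this.2)
      refine ⟨e, Finset.mem_filter.mpr ⟨Multiset.mem_toFinset.mpr he, ?_⟩, hev⟩
      rw [← Multiset.count_filter_of_pos (p := fun e => e.1 = v) hev, hrep,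
        Multiset.count_replicate_self]
    · have h1 := count_le_one_of_inEdges (Γ := toNode m Γ) (e := ((rightEnd j, 1) : Node q k d × ℕ))
        (by rw [inEdges_toNode_right]; rfl) (vertex v)
      rw [hx] at h1
      exact absurd h1 (by simp [Multiset.insert_eq_cons])

theorem card_filter_vertices (p : Node q k d → Prop) [DecidablePred p] :
    ((vertices q k d).filter p).card = (Finset.univ.filter fun v => p (vertex v)).card := by
  rw [vertices, Finset.filter_map, Finset.card_map]
  rfl

theorem card_filter_rights (p : Node q k d → Prop) [DecidablePred p] :
    ((rights q k d).filter p).card = (Finset.univ.filter fun v => p (rightEnd v)).card := by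
  rw [rights, Finset.filter_map, Finset.card_map]
  rfl

variable {K : Type*} [Field K]

open Classical in
theorem IsQuotientCover.nodeFactor_eq [CharZero K] (b : K) {Γ : CoverData k q d}
    (hΓ : Γ.IsQuotientCover m)
    (v : Fin k) : nodeFactor b (vertices q k d) (rights q k d) (toNode m Γ) (vertex v) =
      ((Γ.edges.filter fun e => e.1 = v).map fun e => (e.2.2 : K)).prod *
      (1 + b) ^ (Γ.outDeg v - 1) *
      (if ∃ x : Node q k d × ℕ, toNode m Γ (vertex v) = {x, x} then 1 / 2 else 1) *
      (Γ.vertexMult b m v * ((Γ.hook v).card : K)) := by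
  have hU : ((vertices q k d).filter fun x =>
      Linked (toNode m Γ) {u | u ∈ vertices q k d ∧ vertex v ≤ u} (vertex v) x).card =
      (Γ.hook v).card := by
    rw [card_filter_vertices, hook]
    congr 1
    refine Finset.filter_congr fun u _ => ?_
    rw [linked_toNode_iff hΓ.lt]
    simp
  have hR : ((rights q k d).filter fun x =>
      Linked (toNode m Γ) {u | u ∈ vertices q k d ∧ vertex v ≤ u} (vertex v) x).card =
      Γ.compDegree v := by
    rw [card_filter_rights, compDegree, Nat.card_eq_fintype_card, Fintype.card_subtype]
    congr 1
    refine Finset.filter_congr fun u _ => ?_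
    rw [linked_toNode_iff hΓ.lt]
    simp
  have hprod : ((toNode m Γ (vertex v)).map fun e => (e.2 : K)).prod =
      ((Γ.edges.filter fun e => e.1 = v).map fun e => (e.2.2 : K)).prod := by
    rw [toNode_vertex, Multiset.map_add, Multiset.prod_add, Multiset.map_map, Multiset.map_map]
    simp [Function.comp_def]
  rw [nodeFactor, hU, hR, hprod, card_toNode, card_inEdges_toNode, wsum_toNode, ← hΓ.balanced v,
    vertexMult]
  rcases hΓ.valence v with h | h | h
  · simp only [h.1, h.2]
    norm_num
    ring_nf
  · simp only [h.1, h.2]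
    norm_num
    ring_nf
  · simp only [h.1, h.2]
    norm_num
    ring_nf

/-- The factors are the same vertex by vertex, apart from `1 + b`, which the weight has once for
every split while the multiplicity has it to the power `genus - 1`. -/
theorem IsQuotientCover.coverWeight_toNode [CharZero K] (b : K) (hb : 1 + b ≠ 0)
    {Γ : CoverData k q d}
    (hΓ : Γ.IsQuotientCover m) :
    coverWeight b (vertices q k d) (rights q k d) (toNode m Γ) =
      (1 + b) ^ d * (Γ.mult b m * ∏ v, ((Γ.hook v).card : K)) := by
  classical
  -- The number of splits is `∑ (outDeg v - 1) = |E| + d - k = d + (genus - 1)`.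
  have hpow : (∏ v, (1 + b) ^ (Γ.outDeg v - 1) : K) = (1 + b) ^ d * (1 + b) ^ (Γ.genus - 1) := by
    rw [Finset.prod_pow_eq_pow_sum, ← zpow_natCast, ← zpow_natCast (1 + b) d, ← zpow_add₀ hb]
    congr 1
    have h1 := sum_outDeg Γ
    have h2 : ∑ v, Γ.outDeg v = ∑ v, (Γ.outDeg v - 1) + k := by
      have h3 : ∑ _v : Fin k, 1 = k := by simp
      refine (?_ : _ = ∑ v, (Γ.outDeg v - 1) + ∑ _v : Fin k, 1).trans (congrArg _ h3)
      rw [← Finset.sum_add_distrib]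
      refine Finset.sum_congr rfl fun v _ => ?_
      rcases hΓ.valence v with h | h | h <;> omega
    rw [genus]
    omega
  have hedge : (∏ v, ((Γ.edges.filter fun e => e.1 = v).map fun e => (e.2.2 : K)).prod) =
      (Γ.edges.map fun e => (e.2.2 : K)).prod := by
    rw [← sum_map_filter_eq (fun e : Edge k => e.1) (fun e => (e.2.2 : K)) Γ.edges,
      Multiset.prod_sum]
  rw [coverWeight, vertices, Finset.prod_map]
  have hterm := fun v => hΓ.nodeFactor_eq b v
  rw [vertices] at hterm
  refine (Finset.prod_congr rfl fun v _ => hterm v).trans ?_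
  rw [Finset.prod_mul_distrib, Finset.prod_mul_distrib, Finset.prod_mul_distrib, hpow, hedge,
    Finset.prod_mul_distrib, Finset.prod_ite, Finset.prod_const_one, mul_one, Finset.prod_const,
    ← hΓ.wieners_eq, mult]
  ring

theorem finite_quotientCover (hq : 0 < q) (hm : ∀ a, 0 < m a) : Finite (QuotientCover k d m) := by
  rcases Nat.eq_zero_or_pos k with rfl | hk
  -- Without vertices there is nowhere to attach a left end, so the case `k = 0` is not represented
  -- by these data.
  · have : IsEmpty (QuotientCover 0 d m) := ⟨fun Γ => (Γ.1.left ⟨0, hq⟩).elim0⟩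
    infer_instance
  · refine Finite.of_injective (β := connFinset (lefts q k d) (vertices q k d) (rights q k d)
      (nodeWeight m)) (fun Γ => ⟨toNode m Γ.1, (isQuotientCover_iff hk hm Γ.1).mp Γ.2⟩) ?_
    intro Γ Γ' h
    exact Subtype.ext (toNode_injective (Subtype.ext_iff.mp h))

theorem sum_quotientCover [CharZero K] [Fintype (QuotientCover k d m)] (b : K) (hb : 1 + b ≠ 0)
    (hk : 0 < k)
    (hm : ∀ a, 0 < m a) :
    (1 + b) ^ d * ∑ Γ : QuotientCover k d m, Γ.1.mult b m * ∏ v, ((Γ.1.hook v).card : K) =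
      coverSum b (lefts q k d) (vertices q k d) (rights q k d) (nodeWeight m) := by
  rw [Finset.mul_sum, coverSum]
  refine Finset.sum_bij (fun Γ _ => toNode m Γ.1) ?_ ?_ ?_ ?_
  · exact fun Γ _ => (isQuotientCover_iff hk hm Γ.1).mp Γ.2
  · exact fun Γ _ Γ' _ h => Subtype.ext (toNode_injective h)
  · intro Γ' h
    obtain ⟨Γ, rfl⟩ := exists_toNode_eq hk h
    exact ⟨⟨Γ, (isQuotientCover_iff hk hm Γ).mpr h⟩, Finset.mem_univ _, rfl⟩
  · exact fun Γ _ => (IsQuotientCover.coverWeight_toNode b hb Γ.2).symm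

theorem sum_lefts (f : Node q k d → ℕ) : ∑ i ∈ lefts q k d, f i = ∑ a, f (leftEnd a) := by
  rw [lefts, Finset.sum_map]
  rfl

theorem partCoeff_lefts (m : Fin q → ℕ) (f : MvPolynomial ℕ K) :
    partCoeff (lefts q k d) (nodeWeight m) f = partCoeff Finset.univ m f := by
  rw [partCoeff, partCoeff, lefts, Finset.map_val, Multiset.map_map]
  rfl

end CoverData

open CoverData Node

theorem tropicalMonotone_eq {K : Type*} [Field K] [CharZero K] (b : K) (hb : 1 + b ≠ 0) (G : ℕ)
    {d : ℕ} (hd : 0 < d) (m : Composition d) : tropicalMonotone b G m =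
      d.factorial * partCoeff Finset.univ m.blocksFun
        (hurwitzPoly b (1 / (1 + b)) (numTransp G m.length d)) := by
  have hl : 0 < m.length := m.length_pos_of_pos hd
  have hm : ∀ a, 0 < m.blocksFun a := fun a => m.one_le_blocksFun a
  rw [tropicalMonotone]
  split_ifs with hk
  -- Since `q` and `d` are positive, `G + q + d - 2 = 0` leaves only `G = 0` and `q = d = 1`; the
  -- value `1 / (1 + b)` is then the coefficient of `X 1` in the initial polynomial.
  · have hd1 : d = 1 := by rw [numTransp] at hk; omega
    have hl1 : m.length = 1 := by rw [numTransp] at hk; omega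
    have hsum := m.sum_blocksFun
    have huniv : (Finset.univ : Finset (Fin m.length)) = {⟨0, hl⟩} := by
      ext a
      have := a.2
      simp only [Finset.mem_univ, Finset.mem_singleton, true_iff, Fin.ext_iff]
      omega
    rw [huniv] at hsum ⊢
    rw [Finset.sum_singleton] at hsum
    have hsum := hsum.trans hd1
    rw [hk, hurwitzPoly_zero, partCoeff, Finset.singleton_val, Multiset.map_singleton, hsum, hd1]
    rw [show ({1} : Multiset ℕ) = 1 ::ₘ 0 from rfl, labCoeff_cons, labCoeff_zero]
    simp
  · have hk := Nat.pos_of_ne_zero hk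
    have := finite_quotientCover (k := numTransp G m.length d) (d := d) hl hm
    have := Fintype.ofFinite (QuotientCover (numTransp G m.length d) d m.blocksFun)
    have hsum : ∑ i ∈ lefts m.length (numTransp G m.length d) d, nodeWeight m.blocksFun i =
        (rights m.length (numTransp G m.length d) d).card := by
      rw [sum_lefts, rights, Finset.card_map, Finset.card_univ, Fintype.card_fin]
      exact m.sum_blocksFun
    rw [finsum_classes, div_eq_iff (Nat.cast_ne_zero.mpr (Nat.factorial_ne_zero _))]
    refine mul_left_cancel₀ (pow_ne_zero d hb) ?_
    rw [sum_quotientCover b hb hk hm, coverSum_eq b hb _ rfl (nodeSets _ _ _)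
      ⟨leftEnd ⟨0, hl⟩, mem_lefts.mpr ⟨_, rfl⟩⟩, coverValue, if_pos hsum, partCoeff_lefts]
    · rw [rights, vertices, Finset.card_map, Finset.card_map, Finset.card_univ, Finset.card_univ,
        Fintype.card_fin, Fintype.card_fin]
      ring
    · intro i hi
      obtain ⟨a, rfl⟩ := mem_lefts.mp hi
      exact hm a

end BHurwitz

/-! ### The cycles of the union of two perfect matchings -/

namespace BHurwitz

open Equiv Function

section

variable {α : Type*}

/-- To determine a cycle it is enough to exhibit a closed walk along the permutation. The cycles
after a cut, a twist or a join are all found in this way. -/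
theorem sameCycle_iff_of_cyclic [Finite α] {g : Perm α} {a : ℕ → α} {x : ℕ} {s : α} (h0 : a 0 = s)
    (hx : 0 < x) (hsucc : ∀ i, i + 1 < x → g (a i) = a (i + 1)) (hlast : g (a (x - 1)) =
      s) {y : α} :
    g.SameCycle s y ↔ ∃ i < x, a i = y := by
  subst h0
  constructor
  · intro h
    obtain ⟨k, rfl⟩ := h.exists_nat_pow_eq
    induction k with
    | zero => exact ⟨0, hx, rfl⟩
    | succ k ih =>
      obtain ⟨i, hi, hik⟩ := ih (Perm.sameCycle_pow_right.mpr (Perm.SameCycle.refl _ _))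
      rw [pow_succ', Perm.mul_apply, ← hik]
      rcases Nat.lt_or_ge (i + 1) x with h1 | h1
      · exact ⟨i + 1, h1, (hsucc i h1).symm⟩
      · obtain rfl : i = x - 1 := by omega
        exact ⟨0, hx, hlast.symm⟩
  · rintro ⟨i, hi, rfl⟩
    induction i with
    | zero => rfl
    | succ i ih =>
      rw [← hsucc i hi, Perm.sameCycle_apply_right]
      exact ih (by omega)

theorem minimalPeriod_pos [Finite α] (g : Perm α) (x : α) : 0 < minimalPeriod g x :=
  minimalPeriod_pos_of_mem_periodicPts (g.injective.mem_periodicPts x)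

theorem sameCycle_iff_iterate [Finite α] {g : Perm α} {x y : α} :
    g.SameCycle x y ↔ ∃ i < minimalPeriod g x, g^[i] x = y := by
  refine sameCycle_iff_of_cyclic (g := g) (a := fun i => g^[i] x) rfl (minimalPeriod_pos g x) ?_ ?_
  · intro i _
    exact (iterate_succ_apply' g i x).symm
  · change g (g^[minimalPeriod g x - 1] x) = x
    rw [← iterate_succ_apply' g, Nat.succ_eq_add_one, Nat.sub_add_cancel (minimalPeriod_pos g x),
      iterate_minimalPeriod]

theorem sameCycle_iterate (g : Perm α) (i : ℕ) (x : α) : g.SameCycle x (g^[i] x) := by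
  induction i with
  | zero => rfl
  | succ i ih => rwa [iterate_succ_apply', Perm.sameCycle_apply_right]

theorem iterate_ne_self {g : Perm α} {x : α} {i : ℕ} (hi : 0 < i) (h : i < minimalPeriod g x) :
    g^[i] x ≠ x := fun h' =>
  not_isPeriodicPt_of_pos_of_lt_minimalPeriod hi.ne' h h'

theorem iterate_inj {g : Perm α} {x : α} {i j : ℕ} (hi : i < minimalPeriod g x)
    (hj : j < minimalPeriod g x) : g^[i] x = g^[j] x ↔ i = j :=
  iterate_eq_iterate_iff_of_lt_minimalPeriod hi hj

end

section

variable {n : ℕ} {ρ : Perm (Pt n)}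

/-- Fixed point-free involutions. -/
structure IsMatching (ρ : Perm (Pt n)) : Prop where
  invol : ∀ x, ρ (ρ x) = x
  ne : ∀ x, ρ x ≠ x

theorem tau_apply (x : Pt n) : tau n x = (x.1, !x.2) := rfl

@[simp] theorem tau_tau (x : Pt n) : tau n (tau n x) = x := by simp [tau_apply]

@[simp] theorem tau_fst (x : Pt n) : (tau n x).1 = x.1 := rfl

theorem tau_ne (x : Pt n) : tau n x ≠ x := fun h => by
  have := congrArg Prod.snd h
  simp [tau_apply] at this

theorem tau_inv : (tau n)⁻¹ = tau n := by
  rw [inv_eq_iff_mul_eq_one]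
  ext1 x
  exact tau_tau x

theorem eq_or_eq_tau {x y : Pt n} (h : x.1 = y.1) : x = y ∨ x = tau n y := by
  obtain ⟨i, b⟩ := x
  obtain ⟨j, c⟩ := y
  obtain rfl : i = j := h
  cases b <;> cases c <;> simp [tau_apply]

theorem isMatching_tau : IsMatching (tau n) := ⟨tau_tau, tau_ne⟩

theorem IsMatching.inv_eq (h : IsMatching ρ) : ρ⁻¹ = ρ := by
  rw [inv_eq_iff_mul_eq_one]
  ext1 x
  exact h.invol x

theorem act_swap_apply (p e x : Pt n) : act (swap p e) ρ x = swap p e (ρ (swap p e x)) := by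
  rw [act, swap_inv]
  rfl

theorem IsMatching.act_swap (h : IsMatching ρ) (p e : Pt n) : IsMatching (act (swap p e) ρ) := by
  constructor
  · intro x
    rw [act_swap_apply, act_swap_apply, swap_apply_self, h.invol, swap_apply_self]
  · intro x hx
    rw [act_swap_apply] at hx
    exact h.ne (swap p e x) ((swap p e).injective (by rw [hx, swap_apply_self]))

/-- The permutation whose cycles are the halves of the cycles of `ρ ∪ τ`. -/
def flow (ρ : Perm (Pt n)) : Perm (Pt n) := ρ * tau n

theorem flow_apply (ρ : Perm (Pt n)) (x : Pt n) : flow ρ x = ρ (tau n x) := rfl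

/-- Both `ρ` and `τ` are involutions, so conjugating `ρ τ` with `τ` gives `τ ρ`, the inverse. Hence
`τ` maps cycles of the flow to cycles, with reversed direction. -/
theorem IsMatching.tau_conj (h : IsMatching ρ) : tau n * flow ρ * (tau n)⁻¹ = (flow ρ)⁻¹ := by
  rw [flow, tau_inv, mul_inv_rev, tau_inv, h.inv_eq, mul_assoc, mul_assoc]
  congr 1
  ext1 x
  simp

theorem IsMatching.flow_tau_flow (h : IsMatching ρ) (x : Pt n) :
    flow ρ (tau n (flow ρ x)) = tau n x := by
  rw [flow_apply, flow_apply, tau_tau, h.invol]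

theorem IsMatching.iterate_tau_iterate (h : IsMatching ρ) (i : ℕ) (x : Pt n) :
    (flow ρ)^[i] (tau n ((flow ρ)^[i] x)) = tau n x := by
  induction i generalizing x with
  | zero => rfl
  | succ i ih =>
    rw [iterate_succ_apply, iterate_succ_apply' _ i x, h.flow_tau_flow, ih]

theorem IsMatching.sameCycle_tau (h : IsMatching ρ) {x y : Pt n} :
    (flow ρ).SameCycle (tau n x) (tau n y) ↔ (flow ρ).SameCycle x y := by
  rw [← Perm.sameCycle_inv, ← h.tau_conj, Perm.sameCycle_conj, tau_inv, tau_tau, tau_tau]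

theorem IsMatching.sameCycle_tau_left (h : IsMatching ρ) {x y : Pt n} :
    (flow ρ).SameCycle (tau n x) y ↔ (flow ρ).SameCycle x (tau n y) := by
  rw [← h.sameCycle_tau, tau_tau]

/-- If `τ x` were reached from `x` after `k` steps, then halfway along the path `τ` (for even `k`)
or `ρ` (for odd `k`) would have a fixed point. Consequently each cycle of `ρ ∪ τ` consists of two
different cycles of the flow, exchanged by `τ`. -/
theorem IsMatching.not_sameCycle_tau (h : IsMatching ρ) (x : Pt n) :
    ¬ (flow ρ).SameCycle x (tau n x) := by
  intro hx
  obtain ⟨k, -, hk⟩ := sameCycle_iff_iterate.mp hx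
  obtain ⟨j, rfl | rfl⟩ : ∃ j, k = j + j ∨ k = j + 1 + j := by
    obtain ⟨j, hj | hj⟩ := Nat.even_or_odd' k
    · exact ⟨j, Or.inl (by omega)⟩
    · exact ⟨j, Or.inr (by omega)⟩
  · rw [iterate_add_apply, ← h.iterate_tau_iterate j x] at hk
    exact tau_ne _ ((flow ρ).injective.iterate j hk).symm
  · rw [add_comm, iterate_add_apply, ← h.iterate_tau_iterate j x] at hk
    have h1 := (flow ρ).injective.iterate j hk
    rw [iterate_succ_apply', flow_apply] at h1
    exact h.ne _ h1

/-- The block of `i`: the cycle of `ρ ∪ τ` that contains `i` consists of the elements `j` and `j̄`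
with `j` in the block. -/
def blk (ρ : Perm (Pt n)) (i : Fin n) : Finset (Fin n) :=
  (Finset.univ.filter fun y => (flow ρ).SameCycle (i, false) y).image Prod.fst

theorem IsMatching.mem_blk' (h : IsMatching ρ) {x : Pt n} {j : Fin n} :
    j ∈ blk ρ x.1 ↔ ∃ y, (flow ρ).SameCycle x y ∧ y.1 = j := by
  simp only [blk, Finset.mem_image, Finset.mem_filter, Finset.mem_univ, true_and]
  rcases eq_or_eq_tau (x := (x.1, false)) (y := x) rfl with hx | hx
  · rw [hx]
  · rw [hx]
    constructor
    · rintro ⟨y, hy, rfl⟩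
      exact ⟨tau n y, h.sameCycle_tau_left.mp hy, rfl⟩
    · rintro ⟨y, hy, rfl⟩
      exact ⟨tau n y, h.sameCycle_tau.mpr hy, rfl⟩

theorem IsMatching.mem_blk (h : IsMatching ρ) {x y : Pt n} :
    y.1 ∈ blk ρ x.1 ↔ (flow ρ).SameCycle x y ∨ (flow ρ).SameCycle x (tau n y) := by
  rw [h.mem_blk']
  constructor
  · rintro ⟨z, hz, hzy⟩
    rcases eq_or_eq_tau hzy with rfl | rfl
    · exact Or.inl hz
    · exact Or.inr hz
  · rintro (h1 | h1)
    · exact ⟨_, h1, rfl⟩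
    · exact ⟨_, h1, rfl⟩

theorem IsMatching.mem_blk_self (h : IsMatching ρ) (i : Fin n) : i ∈ blk ρ i :=
  (h.mem_blk (x := (i, false)) (y := (i, false))).mpr (Or.inl (Perm.SameCycle.refl _ _))

theorem IsMatching.mem_blk_comm (h : IsMatching ρ) {i j : Fin n} : j ∈ blk ρ i ↔ i ∈ blk ρ j := by
  have h1 := h.mem_blk (x := (i, false)) (y := (j, false))
  have h2 := h.mem_blk (x := (j, false)) (y := (i, false))
  dsimp only at h1 h2
  rw [h1, h2, Perm.sameCycle_comm, ← h.sameCycle_tau_left,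
    Perm.sameCycle_comm (x := tau n (i, false))]

theorem IsMatching.blk_eq (h : IsMatching ρ) {i j : Fin n} (hj : j ∈ blk ρ i) :
    blk ρ j = blk ρ i := by
  have key : ∀ {a c d : Fin n}, c ∈ blk ρ a → d ∈ blk ρ c → d ∈ blk ρ a := by
    intro a c d hc hd
    obtain ⟨y, hy, rfl⟩ := (h.mem_blk' (x := (a, false))).mp hc
    obtain ⟨z, hz, rfl⟩ := h.mem_blk'.mp hd
    exact (h.mem_blk' (x := (a, false))).mpr ⟨z, hy.trans hz, rfl⟩
  ext l
  exact ⟨key hj, key (h.mem_blk_comm.mp hj)⟩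

theorem IsMatching.blk_eq_iff (h : IsMatching ρ) {i j : Fin n} : blk ρ j = blk ρ i ↔ j ∈ blk ρ i :=
  ⟨fun h' => h' ▸ h.mem_blk_self j, h.blk_eq⟩

/-- A cycle of the flow contains at most one of `i` and `ī`, so its length is the size of the block,
that is, the half-length of the cycle of `ρ ∪ τ`. -/
theorem IsMatching.injOn_fst (h : IsMatching ρ) {x y z : Pt n} (hy : (flow ρ).SameCycle x y)
    (hz : (flow ρ).SameCycle x z) (hyz : y.1 = z.1) : y = z := by
  rcases eq_or_eq_tau hyz with rfl | rfl
  · rfl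
  · exact absurd (hz.symm.trans hy) (h.not_sameCycle_tau z)

theorem IsMatching.blk_eq_image (h : IsMatching ρ) {x : Pt n} {a : ℕ → Pt n} {k : ℕ}
    (ha : ∀ y, (flow ρ).SameCycle x y ↔ ∃ i < k, a i = y) :
    blk ρ x.1 = (Finset.range k).image fun i => (a i).1 := by
  ext j
  rw [h.mem_blk', Finset.mem_image]
  constructor
  · rintro ⟨y, hy, rfl⟩
    obtain ⟨i, hi, rfl⟩ := (ha y).mp hy
    exact ⟨i, Finset.mem_range.mpr hi, rfl⟩
  · rintro ⟨i, hi, rfl⟩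
    exact ⟨a i, (ha _).mpr ⟨i, Finset.mem_range.mp hi, rfl⟩, rfl⟩

theorem IsMatching.card_blk (h : IsMatching ρ) {x : Pt n} {a : ℕ → Pt n} {k : ℕ}
    (ha : ∀ y, (flow ρ).SameCycle x y ↔ ∃ i < k, a i = y)
    (hinj : ∀ i < k, ∀ j < k, a i = a j → i = j) : (blk ρ x.1).card = k := by
  rw [h.blk_eq_image ha, Finset.card_image_of_injOn, Finset.card_range]
  intro i hi j hj hij
  have hi := Finset.mem_range.mp hi
  have hj := Finset.mem_range.mp hj
  exact hinj i hi j hj (h.injOn_fst ((ha _).mpr ⟨i, hi, rfl⟩) ((ha _).mpr ⟨j, hj, rfl⟩) hij)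

theorem IsMatching.card_blk_eq (h : IsMatching ρ) (x : Pt n) :
    (blk ρ x.1).card = minimalPeriod (flow ρ) x :=
  h.card_blk (a := fun i => (flow ρ)^[i] x) (fun _ => sameCycle_iff_iterate) fun _ hi _ hj hij =>
    (iterate_inj hi hj).mp hij

end

end BHurwitz

/-! ### The effect of a transposition on the blocks -/

namespace BHurwitz

open Equiv Function

variable {n : ℕ} {ρ : Perm (Pt n)} {p e : Pt n}

/-- Conjugation applies the transposition before and after `ρ`; the inner application is felt only
at `τ p` and `τ e`. -/
theorem flow_act_swap {y : Pt n} (hp : y ≠ tau n p) (he : y ≠ tau n e) :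
    flow (act (swap p e) ρ) y = swap p e (flow ρ y) := by
  rw [flow_apply, act_swap_apply, flow_apply, swap_apply_of_ne_of_ne (x := tau n y)]
  · rintro h
    exact hp (by rw [← h, tau_tau])
  · rintro h
    exact he (by rw [← h, tau_tau])

theorem flow_act_swap_tau (p e : Pt n) :
    flow (act (swap p e) ρ) (tau n p) = swap p e (flow ρ (tau n e)) := by
  rw [flow_apply, act_swap_apply, flow_apply, tau_tau, tau_tau, swap_apply_left]

namespace IsMatching

variable (h : IsMatching ρ)

include h

theorem ne_tau_of_sameCycle {x y : Pt n} (hy : (flow ρ).SameCycle x y) : y ≠ tau n x := by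
  rintro rfl
  exact h.not_sameCycle_tau x hy

/-- Blocks that do not contain `p` or `e` are not changed. -/
theorem blk_act_swap_of_notMem {k : Fin n} (hp : k ∉ blk ρ p.1) (he : k ∉ blk ρ e.1) :
    blk (act (swap p e) ρ) k = blk ρ k := by
  have hne : ∀ x : Pt n, k ∉ blk ρ x.1 → ∀ i, (flow ρ)^[i] (k, false) ≠ x ∧
      (flow ρ)^[i] (k, false) ≠ tau n x := by
    intro x hx i
    constructor
    · rintro rfl
      exact hx (h.mem_blk_comm.mp ((h.mem_blk (x := (k, false))).mpr
        (Or.inl (sameCycle_iterate _ _ _))))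
    · intro h1
      refine hx (h.mem_blk_comm.mp ((h.mem_blk (x := (k, false))).mpr (Or.inr ?_)))
      rw [← h1]
      exact sameCycle_iterate _ _ _
  have hstep : ∀ i, flow (act (swap p e) ρ) ((flow ρ)^[i] (k, false)) =
      (flow ρ)^[i + 1] (k, false) := by
    intro i
    rw [flow_act_swap (hne p hp i).2 (hne e he i).2, ← iterate_succ_apply' (flow ρ),
      swap_apply_of_ne_of_ne (hne p hp _).1 (hne e he _).1]
  refine (h.act_swap p e).blk_eq_image (x := (k, false)) (a := fun i => (flow ρ)^[i] (k, false))
    (k := minimalPeriod (flow ρ) (k, false)) (fun y => ?_) |>.trans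
      (h.blk_eq_image (x := (k, false)) (fun y => sameCycle_iff_iterate)).symm
  refine sameCycle_iff_of_cyclic (a := fun i => (flow ρ)^[i] (k, false)) rfl
    (minimalPeriod_pos _ _) (fun i _ => hstep i) ?_
  rw [hstep, Nat.sub_add_cancel (minimalPeriod_pos _ _), iterate_minimalPeriod]
  rfl

section cut

variable {j : ℕ} (hj : 0 < j) (hlt : j < minimalPeriod (flow ρ) e) (hp : (flow ρ)^[j] e = p)

include hj hlt hp

/-- When `p` is reached from `e` after `j` steps, the step that led to `p` now leads back to `e`,
and the step that led to `e` leads to `p`. The cycle falls apart into pieces of lengths `j` and the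
rest. -/
theorem sameCycle_cut_left {y : Pt n} : (flow (act (swap p e) ρ)).SameCycle e y ↔
    ∃ i < j, (flow ρ)^[i] e = y := by
  have hps : (flow ρ).SameCycle e p := hp ▸ sameCycle_iterate _ _ _
  have hstep : ∀ i, flow (act (swap p e) ρ) ((flow ρ)^[i] e) = swap p e ((flow ρ)^[i + 1] e) := by
    intro i
    rw [iterate_succ_apply', flow_act_swap (h.ne_tau_of_sameCycle ?_)
      (h.ne_tau_of_sameCycle (sameCycle_iterate _ _ _))]
    exact hps.symm.trans (sameCycle_iterate _ _ _)
  refine sameCycle_iff_of_cyclic (a := fun i => (flow ρ)^[i] e) rfl hj ?_ ?_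
  · intro i hi
    rw [hstep, swap_apply_of_ne_of_ne]
    · rw [← hp, Ne, iterate_inj (by omega) hlt]
      omega
    · exact iterate_ne_self (by omega) (by omega)
  · rw [hstep, Nat.sub_add_cancel hj, hp, swap_apply_left]
    rfl

theorem sameCycle_cut_right {y : Pt n} : (flow (act (swap p e) ρ)).SameCycle p y ↔
    ∃ i < minimalPeriod (flow ρ) e - j, (flow ρ)^[i + j] e = y := by
  have hps : (flow ρ).SameCycle e p := hp ▸ sameCycle_iterate _ _ _
  have hstep : ∀ i, flow (act (swap p e) ρ) ((flow ρ)^[i] e) = swap p e ((flow ρ)^[i + 1] e) := by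
    intro i
    rw [iterate_succ_apply', flow_act_swap (h.ne_tau_of_sameCycle ?_)
      (h.ne_tau_of_sameCycle (sameCycle_iterate _ _ _))]
    exact hps.symm.trans (sameCycle_iterate _ _ _)
  refine sameCycle_iff_of_cyclic (a := fun i => (flow ρ)^[i + j] e) (by rw [zero_add,
    hp]) (by omega)
    ?_ ?_
  · intro i hi
    rw [hstep, show i + 1 + j = i + j + 1 by ring, swap_apply_of_ne_of_ne]
    · rw [← hp, Ne, iterate_inj (by omega) hlt]
      omega
    · exact iterate_ne_self (by omega) (by omega)
  · rw [hstep, show minimalPeriod (flow ρ) e - j - 1 + j + 1 = minimalPeriod (flow ρ) e by omega,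
      iterate_minimalPeriod, swap_apply_right]

theorem card_blk_cut : (blk (act (swap p e) ρ) e.1).card = j :=
  (h.act_swap p e).card_blk (fun _ => h.sameCycle_cut_left hj hlt hp) fun _ hi _ hk hik =>
    (iterate_inj (hi.trans hlt) (hk.trans hlt)).mp hik

theorem card_blk_cut_right : (blk (act (swap p e) ρ) p.1).card = minimalPeriod (flow ρ) e - j :=
  (h.act_swap p e).card_blk (fun _ => h.sameCycle_cut_right hj hlt hp) fun i hi k hk hik => by
    have := (iterate_inj (by omega) (by omega)).mp hik
    omega

theorem blk_cut_union : blk (act (swap p e) ρ) e.1 ∪ blk (act (swap p e) ρ) p.1 = blk ρ e.1 := by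
  rw [(h.act_swap p e).blk_eq_image fun _ => h.sameCycle_cut_left hj hlt hp,
    (h.act_swap p e).blk_eq_image fun _ => h.sameCycle_cut_right hj hlt hp,
    h.blk_eq_image fun _ => sameCycle_iff_iterate]
  ext k
  simp only [Finset.mem_union, Finset.mem_image, Finset.mem_range]
  constructor
  · rintro (⟨i, hi, rfl⟩ | ⟨i, hi, rfl⟩)
    · exact ⟨i, by omega, rfl⟩
    · exact ⟨i + j, by omega, rfl⟩
  · rintro ⟨i, hi, rfl⟩
    rcases Nat.lt_or_ge i j with h1 | h1
    · exact Or.inl ⟨i, h1, rfl⟩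
    · exact Or.inr ⟨i - j, by omega, by rw [Nat.sub_add_cancel h1]⟩

theorem notMem_blk_cut : p.1 ∉ blk (act (swap p e) ρ) e.1 := by
  have hps : (flow ρ).SameCycle e p := hp ▸ sameCycle_iterate _ _ _
  rw [(h.act_swap p e).mem_blk, h.sameCycle_cut_left hj hlt hp, h.sameCycle_cut_left hj hlt hp]
  rintro (⟨i, hi, h1⟩ | ⟨i, hi, h1⟩)
  · rw [← hp, iterate_inj (hi.trans hlt) hlt] at h1
    omega
  · refine h.not_sameCycle_tau p (hps.symm.trans ?_)
    rw [← h1]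
    exact sameCycle_iterate _ _ _

end cut

section twist

variable {j : ℕ} (hj : 0 < j) (hlt : j < minimalPeriod (flow ρ) e) (hp : (flow ρ)^[j] e = tau n p)

include hj hlt hp

/-- A twist does not change the block of `e`. -/
theorem blk_twist : blk (act (swap p e) ρ) e.1 = blk ρ e.1 := by
  set z := minimalPeriod (flow ρ) e with hz
  have hps : (flow ρ).SameCycle e (tau n p) := hp ▸ sameCycle_iterate _ _ _
  have hzt : minimalPeriod (flow ρ) (tau n e) = z := by rw [← h.card_blk_eq, hz, ← h.card_blk_eq,
    tau_fst]
  -- The mirror image of the path from `e` to `τ p` leads from `p` to `τ e` in `j` steps, so `z - j`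
  -- further steps complete the cycle.
  have hpt : (flow ρ)^[z - j] (tau n e) = p := by
    have h1 := h.iterate_tau_iterate j e
    rw [hp, tau_tau] at h1
    rw [← h1, ← iterate_add_apply, Nat.sub_add_cancel hlt.le]
    have h2 : minimalPeriod (flow ρ) p = z := by
      rw [← hzt, ← h1, minimalPeriod_apply_iterate ((flow ρ).injective.mem_periodicPts p)]
    rw [← h2, iterate_minimalPeriod]
  have hnot : ∀ i l, (flow ρ)^[i] (tau n e) ≠ (flow ρ)^[l] e := by
    intro i l h1
    refine h.not_sameCycle_tau e ((sameCycle_iterate (flow ρ) l e).trans ?_)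
    rw [← h1]
    exact (sameCycle_iterate _ _ _).symm
  have hpe : ∀ i, (flow ρ)^[i] e ≠ p := fun i => by
    rw [← hpt]
    exact (hnot _ _).symm
  -- The new cycle follows the old one from `e` to `τ p` and then runs through the rest backwards,
  -- that is, along the mirror image starting after `τ e`. When `p` would be reached it returns to
  -- `e`.
  set a : ℕ → Pt n := fun i => if i ≤ j then (flow ρ)^[i] e else (flow ρ)^[i - j] (tau n e) with ha
  have hcyc : ∀ y, (flow (act (swap p e) ρ)).SameCycle e y ↔ ∃ i < z, a i = y := by
    intro y
    have ha0 : a 0 = e := if_pos (Nat.zero_le _)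
    have hstep1 : ∀ i < j, flow (act (swap p e) ρ) ((flow ρ)^[i] e) = (flow ρ)^[i + 1] e := by
      intro i hi
      rw [flow_act_swap, ← iterate_succ_apply' (flow ρ), swap_apply_of_ne_of_ne (hpe _)
        (iterate_ne_self (by omega) (by omega))]
      · rw [← hp, Ne, iterate_inj (by omega) hlt]
        omega
      · exact (hnot 0 i).symm
    have hstep2 : flow (act (swap p e) ρ) ((flow ρ)^[j] e) =
        swap p e ((flow ρ)^[1] (tau n e)) := by
      rw [hp, flow_act_swap_tau]
      rfl
    have hstep3 : ∀ i, 0 < i → i < z - j → flow (act (swap p e) ρ) ((flow ρ)^[i] (tau n e)) =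
        swap p e ((flow ρ)^[i + 1] (tau n e)) := by
      intro i hi hij
      rw [flow_act_swap, ← iterate_succ_apply' (flow ρ)]
      · rw [← hp]
        exact hnot _ _
      · exact iterate_ne_self hi (by omega)
    have hswap : ∀ i, 0 < i → i < z - j →
        swap p e ((flow ρ)^[i] (tau n e)) = (flow ρ)^[i] (tau n e) := by
      intro i hi hij
      rw [swap_apply_of_ne_of_ne]
      · rw [← hpt, Ne, iterate_inj (by omega) (by omega)]
        omega
      · exact hnot i 0
    have hlast : swap p e ((flow ρ)^[z - j] (tau n e)) = e := by
      rw [hpt, swap_apply_left]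
    refine sameCycle_iff_of_cyclic ha0 (hj.trans hlt) ?_ ?_
    · intro i hi
      simp only [ha]
      split_ifs with h1 h2 h2
      · exact hstep1 i h2
      · obtain rfl : i = j := by omega
        rw [hstep2, show i + 1 - i = 1 by omega]
        exact hswap 1 Nat.one_pos (by omega)
      · omega
      · rw [hstep3 _ (by omega) (by omega), show i - j + 1 = i + 1 - j by omega]
        exact hswap _ (by omega) (by omega)
    · rcases Nat.lt_or_ge j (z - 1) with h1 | h1
      · simp only [ha]
        rw [if_neg (by omega), hstep3 _ (by omega) (by omega)]
        convert hlast using 3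
        omega
      · simp only [ha]
        rw [if_pos (by omega), show z - 1 = j by omega, hstep2]
        convert hlast using 3
        omega
  have hcard : (blk (act (swap p e) ρ) e.1).card = z := by
    refine (h.act_swap p e).card_blk hcyc ?_
    intro i hi l hl hil
    simp only [ha] at hil
    split_ifs at hil with h1 h2 h2
    · exact (iterate_inj hi hl).mp hil
    · exact absurd hil.symm (hnot _ _)
    · exact absurd hil (hnot _ _)
    · have := (iterate_inj (by omega) (by omega)).mp hil
      omega
  refine Finset.eq_of_subset_of_card_le ?_ (by rw [hcard, h.card_blk_eq])
  intro k hk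
  obtain ⟨y, hy, rfl⟩ := (h.act_swap p e).mem_blk'.mp hk
  obtain ⟨i, hi, rfl⟩ := (hcyc y).mp hy
  rw [h.mem_blk]
  simp only [ha]
  split_ifs
  · exact Or.inl (sameCycle_iterate _ _ _)
  · rw [← h.sameCycle_tau_left]
    exact Or.inr (sameCycle_iterate _ _ _)

end twist

/-- A join merges the blocks of `p` and `e`. -/
theorem blk_join (hpe : p.1 ∉ blk ρ e.1) :
    blk (act (swap p e) ρ) e.1 = blk ρ e.1 ∪ blk ρ p.1 := by
  have hne : ∀ i, (flow ρ)^[i] e ≠ p ∧ (flow ρ)^[i] e ≠ tau n p := by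
    intro i
    rw [h.mem_blk, not_or] at hpe
    constructor
    · rintro rfl
      exact hpe.1 (sameCycle_iterate _ _ _)
    · intro h1
      exact hpe.2 (h1 ▸ sameCycle_iterate _ _ _)
  have hne' : ∀ i, (flow ρ)^[i] p ≠ e ∧ (flow ρ)^[i] p ≠ tau n e := by
    intro i
    rw [h.mem_blk_comm, h.mem_blk, not_or] at hpe
    constructor
    · rintro rfl
      exact hpe.1 (sameCycle_iterate _ _ _)
    · intro h1
      exact hpe.2 (h1 ▸ sameCycle_iterate _ _ _)
  set z := minimalPeriod (flow ρ) e with hz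
  set w := minimalPeriod (flow ρ) p with hw
  have hz0 : 0 < z := minimalPeriod_pos _ _
  have hw0 : 0 < w := minimalPeriod_pos _ _
  -- The new cycle goes around the cycle of `e` and then around that of `p`; the transposition
  -- exchanges the two closing steps.
  set a : ℕ → Pt n := fun i => if i < z then (flow ρ)^[i] e else (flow ρ)^[i - z] p with ha
  have ha0 : a 0 = e := if_pos hz0
  have hstep1 : ∀ i, flow (act (swap p e) ρ) ((flow ρ)^[i] e) = swap p e ((flow ρ)^[i + 1] e) := by
    intro i
    rw [flow_act_swap (hne i).2 (h.ne_tau_of_sameCycle (sameCycle_iterate _ _ _)),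
      ← iterate_succ_apply' (flow ρ)]
  have hstep2 : ∀ i, flow (act (swap p e) ρ) ((flow ρ)^[i] p) = swap p e ((flow ρ)^[i + 1] p) := by
    intro i
    rw [flow_act_swap (h.ne_tau_of_sameCycle (sameCycle_iterate _ _ _)) (hne' i).2,
      ← iterate_succ_apply' (flow ρ)]
  have hcyc : ∀ y, (flow (act (swap p e) ρ)).SameCycle e y ↔ ∃ i < z + w, a i = y := by
    intro y
    refine sameCycle_iff_of_cyclic ha0 (by omega) ?_ ?_
    · intro i hi
      simp only [ha]
      split_ifs with h1 h2 h2
      · rw [hstep1, swap_apply_of_ne_of_ne (hne _).1 (iterate_ne_self (by omega) h2)]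
      · rw [hstep1, show i + 1 = z by omega, hz, iterate_minimalPeriod, swap_apply_right,
          Nat.sub_self]
        rfl
      · omega
      · rw [hstep2, show i - z + 1 = i + 1 - z by omega,
          swap_apply_of_ne_of_ne (iterate_ne_self (by omega) (by omega)) (hne' _).1]
    · simp only [ha]
      rw [if_neg (by omega), hstep2, show z + w - 1 - z + 1 = w by omega, hw,
        iterate_minimalPeriod, swap_apply_left]
  rw [(h.act_swap p e).blk_eq_image hcyc, h.blk_eq_image fun _ => sameCycle_iff_iterate,
    h.blk_eq_image (x := p) fun _ => sameCycle_iff_iterate]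
  ext k
  simp only [Finset.mem_union, Finset.mem_image, Finset.mem_range, ha]
  constructor
  · rintro ⟨i, hi, rfl⟩
    split_ifs with h1
    · exact Or.inl ⟨i, h1, rfl⟩
    · exact Or.inr ⟨i - z, by omega, rfl⟩
  · rintro (⟨i, hi, rfl⟩ | ⟨i, hi, rfl⟩)
    · exact ⟨i, by omega, by rw [if_pos hi]⟩
    · exact ⟨i + z, by omega, by rw [if_neg (by omega), Nat.add_sub_cancel]⟩

end IsMatching

end BHurwitz

/-! ### Products over blocks, and the weights of cuts, joins and twists -/

namespace BHurwitz

open Equiv Function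

variable {n : ℕ} {ρ : Perm (Pt n)} {p e : Pt n}

/-- The product over the blocks that have their smallest element in `S` of a function of their
sizes. -/
def blockProd {M : Type*} [CommMonoid M] (φ : ℕ → M) (ρ : Perm (Pt n)) (S : Finset (Fin n)) : M :=
  ∏ i ∈ S, if ∀ j ∈ blk ρ i, i ≤ j then φ (blk ρ i).card else 1

section

variable {M : Type*} [CommMonoid M] (φ : ℕ → M)

theorem blockProd_congr {ρ ρ' : Perm (Pt n)} {S : Finset (Fin n)}
    (h : ∀ i ∈ S, blk ρ i = blk ρ' i) : blockProd φ ρ S = blockProd φ ρ' S :=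
  Finset.prod_congr rfl fun i hi => by rw [h i hi]

theorem blockProd_union {S S' : Finset (Fin n)} (h : Disjoint S S') :
    blockProd φ ρ (S ∪ S') = blockProd φ ρ S * blockProd φ ρ S' :=
  Finset.prod_union h

/-- Only the smallest element of the block contributes a factor. -/
theorem IsMatching.blockProd_eq_mul (h : IsMatching ρ) {S : Finset (Fin n)} {i : Fin n}
    (hi : blk ρ i ⊆ S) :
    blockProd φ ρ S = φ (blk ρ i).card * blockProd φ ρ (S \ blk ρ i) := by
  rw [blockProd, ← Finset.prod_sdiff hi, mul_comm]
  congr 1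
  have hne : (blk ρ i).Nonempty := ⟨i, h.mem_blk_self i⟩
  rw [Finset.prod_eq_single_of_mem _ (Finset.min'_mem _ hne)]
  · have hb := h.blk_eq (Finset.min'_mem _ hne)
    rw [hb, if_pos]
    exact fun j hj => Finset.min'_le _ _ hj
  · intro j hj hne'
    rw [if_neg]
    intro h1
    rw [h.blk_eq hj] at h1
    exact hne' (le_antisymm (h1 _ (Finset.min'_mem _ hne)) (Finset.min'_le _ _ hj))

end

namespace IsMatching

section

variable (h : IsMatching ρ)
include h

theorem card_parts : Multiset.card (flow ρ).partition.parts =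
    2 * (Finset.univ.filter fun i : Fin n => ∀ j ∈ blk ρ i, i ≤ j).card := by
  set A : Finset (Pt n) := Finset.univ.filter fun x => ∀ j ∈ blk ρ x.1, x.1 ≤ j with hA
  have hmemA : ∀ x, x ∈ A ↔ ∀ j ∈ blk ρ x.1, x.1 ≤ j := fun x => by
    rw [hA, Finset.mem_filter, and_iff_right (Finset.mem_univ _)]
  have hcard : A.card = 2 * (Finset.univ.filter fun i : Fin n => ∀ j ∈ blk ρ i, i ≤ j).card := by
    have : A = (Finset.univ.filter fun i : Fin n => ∀ j ∈ blk ρ i, i ≤ j) ×ˢ Finset.univ := by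
      ext x
      rw [hmemA, Finset.mem_product, Finset.mem_filter]
      simp only [Finset.mem_univ, true_and, and_true]
    rw [this, Finset.card_product, mul_comm]
    rfl
  have hfix : A \ (flow ρ).support = Finset.univ \ (flow ρ).support := by
    ext x
    rw [Finset.mem_sdiff, Finset.mem_sdiff, and_congr_left_iff]
    intro hx
    refine iff_of_true ((hmemA x).mpr fun j hj => ?_) (Finset.mem_univ _)
    obtain ⟨y, hy, rfl⟩ := h.mem_blk'.mp hj
    rw [hy.eq_of_left (Perm.notMem_support.mp hx)]
  have hsupp : (A ∩ (flow ρ).support).card = (flow ρ).cycleFactorsFinset.card := by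
    refine Finset.card_bij (fun x _ => (flow ρ).cycleOf x) ?_ ?_ ?_
    · intro x hx
      exact Perm.cycleOf_mem_cycleFactorsFinset_iff.mpr (Finset.mem_inter.mp hx).2
    · intro x hx y hy hxy
      obtain ⟨hx1, hx2⟩ := Finset.mem_inter.mp hx
      obtain ⟨hy1, hy2⟩ := Finset.mem_inter.mp hy
      have hs := (Perm.sameCycle_iff_cycleOf_eq_of_mem_support hx2 hy2).mpr hxy
      have h1 : y.1 ∈ blk ρ x.1 := h.mem_blk'.mpr ⟨y, hs, rfl⟩
      have h2 : x.1 ∈ blk ρ y.1 := h.mem_blk'.mpr ⟨x, hs.symm, rfl⟩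
      exact h.injOn_fst (Perm.SameCycle.refl _ _) hs
        (le_antisymm ((hmemA x).mp hx1 _ h1) ((hmemA y).mp hy1 _ h2))
    · intro c hc
      obtain ⟨x, hx⟩ : c.support.Nonempty := by
        have := ((Perm.mem_cycleFactorsFinset_iff.mp hc).1).nonempty_support
        exact this
      have hcx := Perm.cycle_is_cycleOf hx hc
      have hxs : x ∈ (flow ρ).support := Perm.mem_cycleFactorsFinset_support_le hc hx
      have hne : (blk ρ x.1).Nonempty := ⟨x.1, h.mem_blk_self _⟩
      obtain ⟨y, hy, hy1⟩ := h.mem_blk'.mp (Finset.min'_mem _ hne)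
      refine ⟨y, Finset.mem_inter.mpr ⟨(hmemA y).mpr ?_, ?_⟩, ?_⟩
      · intro j hj
        rw [h.blk_eq (h.mem_blk'.mpr ⟨y, hy, rfl⟩)] at hj
        rw [hy1]
        exact Finset.min'_le _ _ hj
      · rw [Perm.mem_support] at hxs ⊢
        exact fun h' => hxs (hy.apply_eq_self_iff.mpr h')
      · rw [hcx]
        exact hy.symm.cycleOf_eq
  rw [← hcard, Perm.parts_partition, Multiset.card_add, Multiset.card_replicate, Perm.cycleType_def,
    Multiset.card_map, Finset.card_val, ← hsupp, ← Finset.card_univ,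
    ← Finset.card_sdiff_of_subset (Finset.subset_univ _), ← hfix, Finset.card_inter_add_card_sdiff]

theorem two_pow_numParts : 2 ^ numParts ρ = blockProd (fun _ => 2) ρ Finset.univ := by
  have h1 := h.card_parts
  rw [numParts, ← flow, h1, Nat.mul_div_cancel_left _ Nat.two_pos, blockProd, Finset.prod_ite,
    Finset.prod_const, Finset.prod_const_one, mul_one]

end

section

variable {M : Type*} [CommMonoid M] (φ : ℕ → M) (h : IsMatching ρ)
include h

theorem blockProd_cut {j : ℕ} (hj : 0 < j) (hlt : j < (blk ρ e.1).card)
    (hp : (flow ρ)^[j] e = p) {S : Finset (Fin n)} (hS : blk ρ e.1 ⊆ S) :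
    blockProd φ (act (swap p e) ρ) (S \ blk (act (swap p e) ρ) e.1) =
      φ ((blk ρ e.1).card - j) * blockProd φ ρ (S \ blk ρ e.1) := by
  rw [h.card_blk_eq] at hlt ⊢
  have hU := h.blk_cut_union hj hlt hp
  have h' := h.act_swap p e
  have hpe := h.notMem_blk_cut hj hlt hp
  have hd : Disjoint (blk (act (swap p e) ρ) p.1) (blk (act (swap p e) ρ) e.1) := by
    rw [Finset.disjoint_left]
    intro i hi hi'
    refine hpe ?_
    rw [← h'.blk_eq hi', h'.blk_eq hi]
    exact h'.mem_blk_self _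
  have hsub : blk (act (swap p e) ρ) p.1 ⊆ S \ blk (act (swap p e) ρ) e.1 := by
    rw [Finset.subset_sdiff]
    exact ⟨(Finset.subset_union_right.trans hU.le).trans hS, hd⟩
  rw [h'.blockProd_eq_mul φ hsub, h.card_blk_cut_right hj hlt hp, sdiff_sdiff_left,
    Finset.sup_eq_union, hU]
  congr 1
  refine blockProd_congr φ fun i hi => ?_
  have hie := (Finset.mem_sdiff.mp hi).2
  refine h.blk_act_swap_of_notMem (fun hip => hie ?_) hie
  have hpm : p.1 ∈ blk ρ e.1 := h.mem_blk'.mpr ⟨p, hp ▸ sameCycle_iterate _ _ _, rfl⟩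
  rwa [← h.blk_eq hpm]

theorem blk_twist' {j : ℕ} (hj : 0 < j) (hlt : j < (blk ρ e.1).card)
    (hp : (flow ρ)^[j] e = tau n p) : blk (act (swap p e) ρ) e.1 = blk ρ e.1 := by
  rw [h.card_blk_eq] at hlt
  exact h.blk_twist hj hlt hp

theorem blockProd_twist {j : ℕ} (hp : (flow ρ)^[j] e = tau n p) (S : Finset (Fin n)) :
    blockProd φ (act (swap p e) ρ) (S \ blk ρ e.1) = blockProd φ ρ (S \ blk ρ e.1) := by
  refine blockProd_congr φ fun i hi => ?_
  have hie := (Finset.mem_sdiff.mp hi).2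
  refine h.blk_act_swap_of_notMem (fun hip => hie ?_) hie
  have hpm : (tau n p).1 ∈ blk ρ e.1 := h.mem_blk'.mpr ⟨tau n p, hp ▸ sameCycle_iterate _ _ _, rfl⟩
  rw [tau_fst] at hpm
  rwa [← h.blk_eq hpm]

theorem disjoint_blk (hpe : p.1 ∉ blk ρ e.1) : Disjoint (blk ρ p.1) (blk ρ e.1) := by
  rw [Finset.disjoint_left]
  intro i hi hi'
  refine hpe ?_
  rw [← h.blk_eq hi', h.blk_eq hi]
  exact h.mem_blk_self _

theorem blockProd_join (hpe : p.1 ∉ blk ρ e.1) (S : Finset (Fin n)) :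
    blockProd φ (act (swap p e) ρ) (S \ blk (act (swap p e) ρ) e.1) =
      blockProd φ ρ ((S \ blk ρ e.1) \ blk ρ p.1) := by
  rw [h.blk_join hpe, ← Finset.sup_eq_union, ← sdiff_sdiff_left]
  refine blockProd_congr φ fun i hi => ?_
  obtain ⟨h1, h2⟩ := Finset.mem_sdiff.mp hi
  exact h.blk_act_swap_of_notMem h2 (Finset.mem_sdiff.mp h1).2

end

section

variable {K : Type*} (C J T : K) (h : IsMatching ρ)
include h

theorem cjtWeight_cut {j : ℕ} (hj : 0 < j) (hlt : j < (blk ρ e.1).card)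
    (hp : (flow ρ)^[j] e = p) : cjtWeight C J T ρ (swap p e) = C := by
  have h' := h.act_swap p e
  refine if_pos ?_
  refine Nat.pow_right_injective le_rfl ?_
  dsimp only
  rw [pow_succ, h.two_pow_numParts, h'.two_pow_numParts,
    h'.blockProd_eq_mul _ (Finset.subset_univ (blk (act (swap p e) ρ) e.1)),
    h.blockProd_cut _ hj hlt hp (Finset.subset_univ _),
    h.blockProd_eq_mul _ (Finset.subset_univ (blk ρ e.1))]
  ring

theorem cjtWeight_twist {j : ℕ} (hj : 0 < j) (hlt : j < (blk ρ e.1).card)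
    (hp : (flow ρ)^[j] e = tau n p) : cjtWeight C J T ρ (swap p e) = T := by
  have h' := h.act_swap p e
  have : numParts (act (swap p e) ρ) = numParts ρ := by
    refine Nat.pow_right_injective le_rfl ?_
    dsimp only
    rw [h.two_pow_numParts, h'.two_pow_numParts,
      h'.blockProd_eq_mul _ (Finset.subset_univ (blk (act (swap p e) ρ) e.1)),
      h.blk_twist' hj hlt hp, h.blockProd_twist _ hp,
      h.blockProd_eq_mul _ (Finset.subset_univ (blk ρ e.1))]
  rw [cjtWeight, this, if_neg (Nat.succ_ne_self _).symm, if_neg (Nat.succ_ne_self _).symm]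

theorem cjtWeight_join (hpe : p.1 ∉ blk ρ e.1) : cjtWeight C J T ρ (swap p e) = J := by
  have h' := h.act_swap p e
  have : numParts ρ = numParts (act (swap p e) ρ) + 1 := by
    refine Nat.pow_right_injective le_rfl ?_
    dsimp only
    rw [pow_succ, h.two_pow_numParts, h'.two_pow_numParts,
      h'.blockProd_eq_mul _ (Finset.subset_univ (blk (act (swap p e) ρ) e.1)),
      h.blockProd_join _ hpe, h.blockProd_eq_mul _ (Finset.subset_univ (blk ρ e.1)),
      h.blockProd_eq_mul _ (Finset.subset_sdiff.mpr ⟨Finset.subset_univ _, h.disjoint_blk hpe⟩)]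
    ring
  rw [cjtWeight, if_neg (by omega), if_pos this]

end

/-- The points of the block of `x`, other than those over `x`. -/
theorem sum_blk {M : Type*} [AddCommMonoid M] (h : IsMatching ρ) (x : Pt n) (G : Pt n → M) :
    ∑ y with y.1 ∈ blk ρ x.1 ∧ y.1 ≠ x.1, G y =
      ∑ j ∈ Finset.Ico 1 (blk ρ x.1).card, (G ((flow ρ)^[j] x) + G (tau n ((flow ρ)^[j] x))) := by
  have hz := h.card_blk_eq x
  have hne : ∀ j ∈ Finset.Ico 1 (blk ρ x.1).card, (flow ρ)^[j] x ≠ x := fun j hj => by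
    rw [Finset.mem_Ico, hz] at hj
    exact iterate_ne_self hj.1 hj.2
  have hinj : ∀ j ∈ Finset.Ico 1 (blk ρ x.1).card, ∀ k ∈ Finset.Ico 1 (blk ρ x.1).card,
      (flow ρ)^[j] x = (flow ρ)^[k] x → j = k := fun j hj k hk => by
    rw [Finset.mem_Ico, hz] at hj hk
    exact (iterate_inj hj.2 hk.2).mp
  rw [Finset.sum_add_distrib]
  have h1 : ∑ j ∈ Finset.Ico 1 (blk ρ x.1).card, G ((flow ρ)^[j] x) =
      ∑ y ∈ (Finset.Ico 1 (blk ρ x.1).card).image fun j => (flow ρ)^[j] x, G y :=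
    (Finset.sum_image fun j hj k hk => hinj j hj k hk).symm
  have h2 : ∑ j ∈ Finset.Ico 1 (blk ρ x.1).card, G (tau n ((flow ρ)^[j] x)) =
      ∑ y ∈ (Finset.Ico 1 (blk ρ x.1).card).image fun j => tau n ((flow ρ)^[j] x), G y :=
    (Finset.sum_image fun j hj k hk hjk => hinj j hj k hk ((tau n).injective hjk)).symm
  rw [h1, h2, ← Finset.sum_union]
  · refine Finset.sum_congr ?_ fun _ _ => rfl
    ext y
    simp only [Finset.mem_filter, Finset.mem_univ, true_and, Finset.mem_union, Finset.mem_image]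
    constructor
    · rintro ⟨hy, hyx⟩
      obtain ⟨w, hw, hwy⟩ := h.mem_blk'.mp hy
      obtain ⟨j, hj, rfl⟩ := sameCycle_iff_iterate.mp hw
      have hj0 : j ∈ Finset.Ico 1 (blk ρ x.1).card := by
        rw [Finset.mem_Ico, hz]
        refine ⟨Nat.one_le_iff_ne_zero.mpr ?_, hj⟩
        rintro rfl
        exact hyx hwy.symm
      rcases eq_or_eq_tau hwy.symm with h1 | h1
      · exact Or.inl ⟨j, hj0, h1.symm⟩
      · exact Or.inr ⟨j, hj0, h1.symm⟩
    · have hmem : ∀ j ∈ Finset.Ico 1 (blk ρ x.1).card, ((flow ρ)^[j] x).1 ∈ blk ρ x.1 ∧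
          ((flow ρ)^[j] x).1 ≠ x.1 := fun j hj =>
        ⟨h.mem_blk'.mpr ⟨_, sameCycle_iterate _ _ _, rfl⟩, fun h' =>
          hne j hj (h.injOn_fst (sameCycle_iterate _ _ _) (Perm.SameCycle.refl _ _) h')⟩
      rintro (⟨j, hj, rfl⟩ | ⟨j, hj, rfl⟩)
      · exact hmem j hj
      · exact hmem j hj
  · rw [Finset.disjoint_left]
    intro y hy hy'
    obtain ⟨j, -, rfl⟩ := Finset.mem_image.mp hy
    obtain ⟨k, -, hk⟩ := Finset.mem_image.mp hy'
    refine h.not_sameCycle_tau ((flow ρ)^[k] x) ?_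
    rw [hk]
    exact (sameCycle_iterate _ _ _).symm.trans (sameCycle_iterate _ _ _)

end IsMatching

end BHurwitz

/-! ### Homogeneous components with respect to the weight -/

namespace BHurwitz

open Finset.HasAntidiagonal MvPolynomial

variable {K : Type*} [Field K]

/-- The algebra map that marks the weight by the variable of the power series. -/
noncomputable def markWeight (K : Type*) [Field K] :
    MvPolynomial ℕ K →ₐ[K] PowerSeries (MvPolynomial ℕ K) :=
  aeval fun a => PowerSeries.X ^ a * PowerSeries.C (X a)

/-- The component of weight `s`, where `X_a` has weight `a`. -/
noncomputable def homPart (s : ℕ) (f : MvPolynomial ℕ K) : MvPolynomial ℕ K :=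
  PowerSeries.coeff s (markWeight K f)

/-- The derivation lowers the weight by `x`. Multiplying by a power of the series variable expresses
this without negative exponents, and the variables suffice for the check. -/
theorem X_pow_mul_markWeight_derivation (D : Derivation K (MvPolynomial ℕ K) (MvPolynomial ℕ K))
    (x : ℕ)
    (h : ∀ a, PowerSeries.X ^ x * markWeight K (D (X a)) = liftDer D (markWeight K (X a)))
    (f : MvPolynomial ℕ K) :
    PowerSeries.X ^ x * markWeight K (D f) = liftDer D (markWeight K f) := by
  induction f using MvPolynomial.induction_on with
  | C c =>
    rw [show (C c : MvPolynomial ℕ K) = algebraMap K _ c from rfl, Derivation.map_algebraMap,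
      map_zero, AlgHom.commutes, Derivation.map_algebraMap, mul_zero]
  | add p q hp hq => rw [map_add, map_add, mul_add, hp, hq, map_add, map_add]
  | mul_X p i hp =>
    rw [Derivation.leibniz, map_add, mul_add, smul_eq_mul, smul_eq_mul, map_mul, map_mul, map_mul,
      Derivation.leibniz, ← hp, ← h, smul_eq_mul, smul_eq_mul]
    ring

theorem liftDer_X_pow_mul (D : Derivation K (MvPolynomial ℕ K) (MvPolynomial ℕ K)) (a : ℕ)
    (g : PowerSeries (MvPolynomial ℕ K)) :
    liftDer D (PowerSeries.X ^ a * g) = PowerSeries.X ^ a * liftDer D g := by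
  rw [Derivation.leibniz, Derivation.leibniz_pow, liftDer_X]
  simp

theorem liftDer_X_pow_mul_C (D : Derivation K (MvPolynomial ℕ K) (MvPolynomial ℕ K)) (a : ℕ)
    (f : MvPolynomial ℕ K) : liftDer D (PowerSeries.X ^ a * PowerSeries.C f) =
      PowerSeries.X ^ a * PowerSeries.C (D f) := by
  have h : liftDer D (PowerSeries.C f) = PowerSeries.C (D f) := by
    ext1 n
    rw [coeff_liftDer, PowerSeries.coeff_C, PowerSeries.coeff_C]
    split_ifs <;> simp
  rw [liftDer_X_pow_mul, h]

theorem markWeight_X (a : ℕ) :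
    markWeight K (X a) = PowerSeries.X ^ a * PowerSeries.C (X a) := aeval_X _ _

theorem markWeight_pderiv (x : ℕ) (f : MvPolynomial ℕ K) :
    PowerSeries.X ^ x * markWeight K (pderiv x f) = liftDer (pderiv x) (markWeight K f) := by
  refine X_pow_mul_markWeight_derivation _ x (fun a => ?_) f
  rw [markWeight_X, liftDer_X_pow_mul_C, pderiv_X, Pi.single_apply]
  split_ifs with h
  · rw [h, map_one, map_one]
  · rw [map_zero, map_zero, mul_zero, mul_zero]

theorem markWeight_mergeDer (x : ℕ) (f : MvPolynomial ℕ K) :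
    PowerSeries.X ^ x * markWeight K (mergeDer K x f) = liftDer (mergeDer K x) (markWeight K f) := by
  refine X_pow_mul_markWeight_derivation _ x (fun a => ?_) f
  rw [markWeight_X, liftDer_X_pow_mul_C, mergeDer, mkDerivation_X]
  split_ifs with h
  · have h1 : (PowerSeries.C ((a : K) • (X (a - x) : MvPolynomial ℕ K))) =
        (a : K) • PowerSeries.C (X (a - x) : MvPolynomial ℕ K) := by
      ext1 n
      rw [coeff_smul_field, PowerSeries.coeff_C, PowerSeries.coeff_C]
      split_ifs <;> simp
    rw [map_smul, markWeight_X, h1, mul_smul_comm, mul_smul_comm, ← mul_assoc, ← pow_add,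
      Nat.add_sub_cancel' h.le]
  · rw [map_zero, map_zero, mul_zero, mul_zero]

theorem coeff_markWeight_pderiv (s x : ℕ) (f : MvPolynomial ℕ K) :
    PowerSeries.coeff s (PowerSeries.X ^ x * markWeight K (pderiv x f)) = pderiv x (homPart s f) := by
  rw [markWeight_pderiv, coeff_liftDer, homPart]

/-- The components of a solution of the recursion. -/
theorem homPart_recursion {b : K} {F : ℕ → MvPolynomial ℕ K} {k x : ℕ}
    (h : (x : K) • pderiv x (F (k + 1)) = recTerm b F k x) (s : ℕ) :
    (x : K) • pderiv x (homPart s (F (k + 1))) =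
      (b * x * (x - 1)) • pderiv x (homPart s (F k)) + mergeDer K x (homPart s (F k)) +
      (1 + b) • ∑ a ∈ antidiagonal x, ((a.1 : K) * a.2) •
        (pderiv a.1 (pderiv a.2 (homPart s (F k))) +
          ∑ j ∈ antidiagonal k, ∑ t ∈ antidiagonal s,
            pderiv a.1 (homPart t.1 (F j.1)) * pderiv a.2 (homPart t.2 (F j.2))) := by
  have key : ∀ a ∈ antidiagonal x, PowerSeries.coeff s (PowerSeries.X ^ x *
      markWeight K (pderiv a.1 (pderiv a.2 (F k)) + ∑ j ∈ antidiagonal k,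
        pderiv a.1 (F j.1) * pderiv a.2 (F j.2))) =
      pderiv a.1 (pderiv a.2 (homPart s (F k))) +
        ∑ j ∈ antidiagonal k, ∑ t ∈ antidiagonal s,
          pderiv a.1 (homPart t.1 (F j.1)) * pderiv a.2 (homPart t.2 (F j.2)) := by
    intro a ha
    rw [mem_antidiagonal] at ha
    rw [← ha, map_add, mul_add, map_add]
    congr 1
    · rw [pow_add, mul_comm (PowerSeries.X ^ a.1), mul_assoc, markWeight_pderiv,
        ← liftDer_X_pow_mul, markWeight_pderiv, coeff_liftDer, coeff_liftDer, homPart]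
    · rw [map_sum, Finset.mul_sum, map_sum]
      refine Finset.sum_congr rfl fun j _ => ?_
      rw [map_mul (markWeight K), pow_add, mul_mul_mul_comm, markWeight_pderiv, markWeight_pderiv,
        PowerSeries.coeff_mul]
      simp only [coeff_liftDer]
      rfl
  have h1 := congrArg (fun f => PowerSeries.coeff s (PowerSeries.X ^ x * markWeight K f)) h
  simp only [recTerm, map_add, map_smul, mul_add, mul_smul_comm, coeff_smul_field,
    coeff_markWeight_pderiv, markWeight_mergeDer, coeff_liftDer] at h1
  rw [h1]
  rw [map_sum, Finset.mul_sum, map_sum]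
  congr 2
  refine Finset.sum_congr rfl fun a ha => ?_
  rw [map_smul, mul_smul_comm, coeff_smul_field, key a ha]

theorem homPart_smul (s : ℕ) (c : K) (f : MvPolynomial ℕ K) :
    homPart s (c • f) = c • homPart s f := by
  rw [homPart, map_smul, coeff_smul_field, homPart]

theorem homPart_X (s a : ℕ) : homPart s (X a : MvPolynomial ℕ K) = if s = a then X a else 0 := by
  rw [homPart, markWeight_X, PowerSeries.coeff_X_pow_mul', PowerSeries.coeff_C]
  split_ifs <;> first | rfl | omega

theorem pderiv_homPart (s x : ℕ) (f : MvPolynomial ℕ K) :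
    pderiv x (homPart (s + x) f) = homPart s (pderiv x f) := by
  rw [← coeff_markWeight_pderiv, PowerSeries.coeff_X_pow_mul, homPart]

theorem constantCoeff_homPart_zero (f : MvPolynomial ℕ K) :
    constantCoeff (homPart 0 f) = constantCoeff f := by
  have h : (((constantCoeff (σ := ℕ) (R := K)).comp
      (PowerSeries.constantCoeff (R := MvPolynomial ℕ K))).comp
        (markWeight K : MvPolynomial ℕ K →+* _)) = constantCoeff := by
    refine MvPolynomial.ringHom_ext (fun c => ?_) fun a => ?_
    · rw [show (C c : MvPolynomial ℕ K) = algebraMap K _ c from rfl]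
      simp only [RingHom.comp_apply, RingHom.coe_coe, AlgHom.commutes]
      rfl
    · simp only [RingHom.comp_apply, RingHom.coe_coe, markWeight_X]
      simp
  have := congrArg (fun g => g f) h
  simpa [homPart] using this

/-- A monomial survives the derivatives and the evaluation at zero only if its variables are exactly
the prescribed parts, so only the component of that weight matters. -/
theorem labCoeff_homPart (M : Multiset ℕ) (f : MvPolynomial ℕ K) :
    labCoeff M (homPart M.sum f) = labCoeff M f := by
  induction M using Multiset.induction_on generalizing f with
  | empty => exact constantCoeff_homPart_zero f
  | cons x M ih =>
    rw [labCoeff_cons, labCoeff_cons, Multiset.sum_cons, add_comm, pderiv_homPart, ih]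

theorem mergeDer_eq_sum {x n : ℕ} {f : MvPolynomial ℕ K} (h : ∀ z, n < z → pderiv z f = 0) :
    mergeDer K x f = ∑ z ∈ Finset.Ioc x n, (z : K) • (X (z - x) * pderiv z f) := by
  obtain ⟨N, hN⟩ : ∃ N, ∀ i ∈ f.vars, i ≤ N :=
    ⟨f.vars.sup id, fun i hi => Finset.le_sup (f := id) hi⟩
  have h1 : mergeDer K x f = ∑ z ∈ Finset.Ioc x (n + N), (z : K) • (X (z - x) * pderiv z f) := by
    have h2 : mergeDer K x f = (∑ z ∈ Finset.Ioc x (n + N), ((z : K) •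
        (X (z - x) : MvPolynomial ℕ K)) • pderiv (R := K) z) f := by
      refine derivation_eq_of_forall_mem_vars fun i hi => ?_
      have := hN i hi
      rw [mergeDer, mkDerivation_X, coe_sum_derivation, Finset.sum_apply]
      simp only [Derivation.smul_apply, pderiv_X, Pi.single_apply, smul_eq_mul, mul_ite, mul_one,
        mul_zero]
      rw [Finset.sum_ite_eq]
      refine if_congr ?_ rfl rfl
      rw [Finset.mem_Ioc]
      omega
    rw [h2, coe_sum_derivation, Finset.sum_apply]
    simp only [Derivation.smul_apply, smul_eq_mul, smul_mul_assoc]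
  rw [h1]
  refine (Finset.sum_subset (Finset.Ioc_subset_Ioc_right (Nat.le_add_right _ _)) ?_).symm
  intro z hz hz'
  rw [h z, mul_zero, smul_zero]
  rw [Finset.mem_Ioc] at hz hz'
  omega

end BHurwitz

/-! ### Generating functions for a single transposition -/

namespace BHurwitz

open Finset.HasAntidiagonal MvPolynomial Equiv

variable {K : Type*} [Field K] {n : ℕ} {ρ : Perm (Pt n)}

/-- The monomial of the sizes of the blocks in `S`, with a factor `c` for each block. -/
noncomputable def blockMon (c : K) (ρ : Perm (Pt n)) (S : Finset (Fin n)) : MvPolynomial ℕ K :=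
  blockProd (fun a => c • X a) ρ S

/-- The same without the variable of the block of `i`, if this block has size `x`. -/
noncomputable def markedMon (c : K) (i : Fin n) (S : Finset (Fin n)) (x : ℕ) (ρ : Perm (Pt n)) :
    MvPolynomial ℕ K :=
  if (blk ρ i).card = x then c • blockMon c ρ (S \ blk ρ i) else 0

/-- `S` is a union of blocks. -/
def BlockClosed (ρ : Perm (Pt n)) (S : Finset (Fin n)) : Prop := ∀ i ∈ S, blk ρ i ⊆ S

theorem blockMon_empty (c : K) (ρ : Perm (Pt n)) : blockMon c ρ ∅ = 1 := rfl

namespace IsMatching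

variable (h : IsMatching ρ)
include h

theorem blockClosed_sdiff {S : Finset (Fin n)} (hS : BlockClosed ρ S) (i : Fin n) :
    BlockClosed ρ (S \ blk ρ i) := by
  intro j hj
  obtain ⟨h1, h2⟩ := Finset.mem_sdiff.mp hj
  exact Finset.subset_sdiff.mpr ⟨hS j h1, h.disjoint_blk (p := (j, false)) (e := (i, false)) h2⟩

theorem blockMon_eq_mul (c : K) {S : Finset (Fin n)} {i : Fin n} (hi : blk ρ i ⊆ S) :
    blockMon c ρ S = (c • X (blk ρ i).card) * blockMon c ρ (S \ blk ρ i) :=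
  h.blockProd_eq_mul _ hi

theorem pderiv_blockMon (c : K) (β : ℕ) {S : Finset (Fin n)} (hS : BlockClosed ρ S) :
    (β : K) • pderiv β (blockMon c ρ S) =
      ∑ i ∈ S with (blk ρ i).card = β, c • blockMon c ρ (S \ blk ρ i) := by
  induction S using Finset.strongInduction with
  | H S ih =>
  rcases S.eq_empty_or_nonempty with rfl | ⟨i, hi⟩
  · rw [blockMon_empty, Derivation.map_one_eq_zero, smul_zero, Finset.filter_empty,
      Finset.sum_empty]
  have hsub := hS i hi
  have hlt : S \ blk ρ i ⊂ S := Finset.sdiff_ssubset hsub ⟨i, h.mem_blk_self i⟩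
  have hcl := h.blockClosed_sdiff hS i
  have ih := ih _ hlt hcl
  have h1 : ∑ j ∈ S with (blk ρ j).card = β, c • blockMon c ρ (S \ blk ρ j) =
      ∑ j ∈ S \ blk ρ i with (blk ρ j).card = β, c • blockMon c ρ (S \ blk ρ j) +
        ∑ j ∈ blk ρ i with (blk ρ j).card = β, c • blockMon c ρ (S \ blk ρ j) := by
    rw [Finset.sum_filter, Finset.sum_filter, Finset.sum_filter, Finset.sum_sdiff hsub]
  have h2 : ∑ j ∈ blk ρ i with (blk ρ j).card = β, c • blockMon c ρ (S \ blk ρ j) =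
      (if (blk ρ i).card = β then (β : K) else 0) • (c • blockMon c ρ (S \ blk ρ i)) := by
    rw [Finset.sum_filter]
    have h3 : ∀ j ∈ blk ρ i,
        (if (blk ρ j).card = β then c • blockMon c ρ (S \ blk ρ j) else 0) =
          if (blk ρ i).card = β then c • blockMon c ρ (S \ blk ρ i) else 0 := fun j hj => by
      rw [h.blk_eq hj]
    rw [Finset.sum_congr rfl h3, Finset.sum_const]
    split_ifs with h4
    · rw [h4, Nat.cast_smul_eq_nsmul]
    · rw [smul_zero, zero_smul]
  have h3 : ∑ j ∈ S \ blk ρ i with (blk ρ j).card = β, c • blockMon c ρ (S \ blk ρ j) =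
      (c • X (blk ρ i).card) *
        ∑ j ∈ S \ blk ρ i with (blk ρ j).card = β, c • blockMon c ρ ((S \ blk ρ i) \ blk ρ j) := by
    rw [Finset.mul_sum]
    refine Finset.sum_congr rfl fun j hj => ?_
    have hj := (Finset.mem_filter.mp hj).1
    have hj' := (Finset.mem_sdiff.mp hj).2
    rw [mul_smul_comm, h.blockMon_eq_mul c (S := S \ blk ρ j) (i := i)]
    · rw [sdiff_right_comm]
    · exact Finset.subset_sdiff.mpr ⟨hsub,
        (h.disjoint_blk (p := (j, false)) (e := (i, false)) hj').symm⟩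
  rw [h1, h2, h3, ← ih, h.blockMon_eq_mul c hsub, Derivation.leibniz, Derivation.map_smul, pderiv_X,
    Pi.single_apply]
  split_ifs with h4
  · simp only [smul_eq_mul, smul_add, mul_smul_comm, mul_one]
  · simp only [smul_eq_mul, mul_smul_comm, mul_zero, smul_zero, add_zero, zero_smul]

/-- The contribution of the cuts and twists at the block of `e`. -/
theorem sum_cut_twist [CharZero K] {C : K} (hC : C ≠ 0) (J T : K) (e : Pt n) {S : Finset (Fin n)}
    (hS : blk ρ e.1 ⊆ S) {x : ℕ} (hx : 1 ≤ x) :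
    ∑ p with p.1 ∈ blk ρ e.1 ∧ p.1 ≠ e.1, cjtWeight C J T ρ (swap p e) •
        markedMon C⁻¹ e.1 S x (act (swap p e) ρ) =
      (T * (x - 1)) • markedMon C⁻¹ e.1 S x ρ +
        ∑ z ∈ Finset.Ioc x n, X (z - x) * markedMon C⁻¹ e.1 S z ρ := by
  rw [h.sum_blk e, Finset.sum_add_distrib, add_comm]
  set z := (blk ρ e.1).card with hz
  have hzn : z ≤ n := (Finset.card_le_univ _).trans (Fintype.card_fin n).le
  congr 1
  -- The points `τ (flow^j e)` give twists. There are `x - 1` of them if the block has size `x`, and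
  -- the blocks stay the same.
  · have h1 : ∀ j ∈ Finset.Ico 1 z, cjtWeight C J T ρ (swap (tau n ((flow ρ)^[j] e)) e) •
        markedMon C⁻¹ e.1 S x (act (swap (tau n ((flow ρ)^[j] e)) e) ρ) =
        T • markedMon C⁻¹ e.1 S x ρ := by
      intro j hj
      rw [Finset.mem_Ico] at hj
      have hp : (flow ρ)^[j] e = tau n (tau n ((flow ρ)^[j] e)) := (tau_tau _).symm
      rw [h.cjtWeight_twist C J T hj.1 hj.2 hp, markedMon, h.blk_twist' hj.1 hj.2 hp, blockMon,
        h.blockProd_twist _ hp, markedMon, blockMon]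
    rw [Finset.sum_congr rfl h1, Finset.sum_const, Nat.card_Ico, markedMon, ← hz]
    split_ifs with hzx
    · rw [← Nat.cast_smul_eq_nsmul K, smul_smul, hzx, Nat.cast_sub hx, mul_comm T, Nat.cast_one]
    · simp
  -- The points `flow^j e` give cuts, with `e` in the piece of size `j`; so exactly one point leads
  -- to size `x`. The factor `C` of the cut cancels the `C⁻¹` of the additional block.
  · have h1 : ∀ j ∈ Finset.Ico 1 z, cjtWeight C J T ρ (swap ((flow ρ)^[j] e) e) •
        markedMon C⁻¹ e.1 S x (act (swap ((flow ρ)^[j] e) e) ρ) =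
        if j = x then X (z - x) * (C⁻¹ • blockMon C⁻¹ ρ (S \ blk ρ e.1)) else 0 := by
      intro j hj
      rw [Finset.mem_Ico] at hj
      rw [h.cjtWeight_cut C J T hj.1 hj.2 rfl, markedMon, blockMon,
        h.blockProd_cut _ hj.1 hj.2 rfl hS, h.card_blk_cut hj.1
          (by rw [← h.card_blk_eq]; exact hj.2) rfl]
      split_ifs with hjx
      · rw [smul_smul, mul_inv_cancel₀ hC, one_smul, smul_mul_assoc, mul_smul_comm, hjx]
        rfl
      · rw [smul_zero]
    rw [Finset.sum_congr rfl h1, Finset.sum_ite_eq']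
    simp only [markedMon, ← hz, mul_ite, mul_zero]
    rw [Finset.sum_ite_eq]
    refine if_congr ?_ rfl rfl
    rw [Finset.mem_Ico, Finset.mem_Ioc]
    omega

theorem sum_join_aux [CharZero K] {C : K} (hC : C ≠ 0) (J T : K) (e : Pt n) {S S' : Finset (Fin n)}
    (hS' : BlockClosed ρ S') (hsub : S' ⊆ S \ blk ρ e.1) (x : ℕ) :
    ∑ p with p.1 ∈ S', cjtWeight C J T ρ (swap p e) •
        markedMon C⁻¹ e.1 S x (act (swap p e) ρ) =
      ∑ a ∈ antidiagonal x, (2 * (C * J) * a.2) •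
        if (blk ρ e.1).card = a.1 then (C⁻¹ • blockMon C⁻¹ ρ ((S \ blk ρ e.1) \ S')) *
          pderiv a.2 (blockMon C⁻¹ ρ S') else 0 := by
  have hprod : (Finset.univ.filter fun p : Pt n => p.1 ∈ S') = S' ×ˢ Finset.univ := by
    ext p
    simp
  have hterm : ∀ p : Pt n, p.1 ∈ S' → cjtWeight C J T ρ (swap p e) •
      markedMon C⁻¹ e.1 S x (act (swap p e) ρ) =
      if (blk ρ e.1).card + (blk ρ p.1).card = x then J • (C⁻¹ • blockMon C⁻¹ ρ
        ((S \ blk ρ e.1) \ S')) * blockMon C⁻¹ ρ (S' \ blk ρ p.1) else 0 := by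
    intro p hp
    have hpe : p.1 ∉ blk ρ e.1 := (Finset.mem_sdiff.mp (hsub hp)).2
    have hd := h.disjoint_blk hpe
    rw [h.cjtWeight_join C J T hpe, markedMon, blockMon, h.blockProd_join _ hpe, h.blk_join hpe,
      Finset.card_union_of_disjoint hd.symm]
    split_ifs with hx
    · have hun : (S \ blk ρ e.1) \ blk ρ p.1 = ((S \ blk ρ e.1) \ S') ∪ (S' \ blk ρ p.1) := by
        have h1 := hS' _ hp
        ext i
        have h2 := @hsub i
        have h3 := @h1 i
        simp only [Finset.mem_sdiff, Finset.mem_union] at h2 ⊢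
        tauto
      rw [hun, blockProd_union, ← blockMon, ← blockMon, smul_mul_assoc, smul_mul_assoc]
      exact Finset.disjoint_of_subset_right Finset.sdiff_subset Finset.sdiff_disjoint
    · rw [smul_zero]
  rw [Finset.sum_congr rfl fun p hp => hterm p (Finset.mem_filter.mp hp).2, hprod,
    Finset.sum_product]
  simp only [Finset.sum_const, Finset.card_univ, Fintype.card_bool]
  rw [← Finset.smul_sum]
  have hz : ∀ a ∈ antidiagonal x, ((2 * (C * J) * a.2) •
        if (blk ρ e.1).card = a.1 then (C⁻¹ • blockMon C⁻¹ ρ ((S \ blk ρ e.1) \ S')) *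
          pderiv a.2 (blockMon C⁻¹ ρ S') else 0) = ∑ i ∈ S', if (blk ρ e.1).card = a.1 ∧
            (blk ρ i).card = a.2 then (2 : K) • (J • (C⁻¹ • blockMon C⁻¹ ρ
        ((S \ blk ρ e.1) \ S')) * blockMon C⁻¹ ρ (S' \ blk ρ i)) else 0 := by
    intro a _
    split_ifs with h1
    · have h2 := h.pderiv_blockMon C⁻¹ a.2 hS'
      rw [mul_smul, ← mul_smul_comm, h2, Finset.sum_filter, Finset.mul_sum, Finset.smul_sum]
      refine Finset.sum_congr rfl fun i _ => ?_
      by_cases h3 : (blk ρ i).card = a.2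
      · rw [if_pos h3, if_pos ⟨h1, h3⟩]
        simp only [mul_smul_comm, smul_mul_assoc, smul_smul]
        congr 1
        field_simp
      · rw [if_neg h3, if_neg (not_and_of_not_right _ h3), mul_zero, smul_zero]
    · rw [smul_zero]
      exact (Finset.sum_eq_zero fun i _ => if_neg fun h4 => h1 h4.1).symm
  rw [Finset.sum_congr rfl hz, Finset.sum_comm, Finset.smul_sum]
  refine Finset.sum_congr rfl fun i _ => ?_
  by_cases hx : (blk ρ e.1).card + (blk ρ i).card = x
  · rw [if_pos hx, Finset.sum_eq_single ((blk ρ e.1).card, (blk ρ i).card), if_pos ⟨rfl, rfl⟩,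
      ← Nat.cast_smul_eq_nsmul K, Nat.cast_two]
    · rintro ⟨a, c⟩ _ hne
      refine if_neg ?_
      rintro ⟨h1, h2⟩
      exact hne (Prod.ext h1.symm h2.symm)
    · intro hne
      exact absurd (mem_antidiagonal.mpr hx) hne
  · rw [if_neg hx, smul_zero]
    refine (Finset.sum_eq_zero fun a ha => if_neg ?_).symm
    rintro ⟨h1, h2⟩
    rw [mem_antidiagonal] at ha
    omega

/-- The contribution of the joins within `S`. -/
theorem sum_join_self [CharZero K] {C : K} (hC : C ≠ 0) (J T : K) (e : Pt n) {S : Finset (Fin n)}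
    (hS : BlockClosed ρ S) (x : ℕ) :
    ∑ p with p.1 ∈ S \ blk ρ e.1, cjtWeight C J T ρ (swap p e) •
        markedMon C⁻¹ e.1 S x (act (swap p e) ρ) =
      ∑ a ∈ antidiagonal x, (2 * (C * J) * a.2) •
        pderiv a.2 (markedMon C⁻¹ e.1 S a.1 ρ) := by
  rw [h.sum_join_aux hC J T e (h.blockClosed_sdiff hS _) (Finset.Subset.refl _)]
  refine Finset.sum_congr rfl fun a _ => ?_
  congr 1
  rw [markedMon, sdiff_self, Finset.bot_eq_empty, blockMon_empty]
  split_ifs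
  · rw [smul_mul_assoc, one_mul, Derivation.map_smul]
  · rw [map_zero]

/-- The contribution of the joins with blocks in `S₂`. -/
theorem sum_join_union [CharZero K] {C : K} (hC : C ≠ 0) (J T : K) {e : Pt n}
    {S₁ S₂ : Finset (Fin n)} (he : blk ρ e.1 ⊆ S₁) (hS₂ : BlockClosed ρ S₂) (hd : Disjoint S₁ S₂)
    (x : ℕ) :
    ∑ p with p.1 ∈ S₂, cjtWeight C J T ρ (swap p e) •
        markedMon C⁻¹ e.1 (S₁ ∪ S₂) x (act (swap p e) ρ) =
      ∑ a ∈ antidiagonal x, (2 * (C * J) * a.2) •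
        (markedMon C⁻¹ e.1 S₁ a.1 ρ * pderiv a.2 (blockMon C⁻¹ ρ S₂)) := by
  rw [h.sum_join_aux hC J T e hS₂]
  · refine Finset.sum_congr rfl fun a _ => ?_
    congr 1
    have h1 : ((S₁ ∪ S₂) \ blk ρ e.1) \ S₂ = S₁ \ blk ρ e.1 := by
      ext i
      have h2 : i ∈ S₁ → i ∉ S₂ := fun hi => Finset.disjoint_left.mp hd hi
      simp only [Finset.mem_sdiff, Finset.mem_union]
      tauto
    rw [markedMon, h1, ite_mul, zero_mul]
  · exact Finset.subset_sdiff.mpr ⟨Finset.subset_union_right,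
      (Finset.disjoint_of_subset_left he hd).symm⟩

end IsMatching

end BHurwitz

/-! ### Strings that do not connect a set with its complement -/

namespace BHurwitz

open MvPolynomial Equiv Function

variable {n : ℕ}

theorem transp_eq (a : Pt n × Fin n) : transp a = swap a.1 (a.2, false) := rfl

/-- The involution obtained from `τ` by the transpositions in the list, from right to left. -/
def listInv : List (Pt n × Fin n) → Perm (Pt n)
  | [] => tau n
  | a :: r => act (transp a) (listInv r)

theorem isMatching_listInv (r : List (Pt n × Fin n)) : IsMatching (listInv r) := by
  induction r with
  | nil => exact isMatching_tau
  | cons a r ih => exact ih.act_swap _ _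

/-- The weight of the string with the transpositions in the list, from right to left. -/
def listWeight {K : Type*} [Field K] (C J T : K) : List (Pt n × Fin n) → K
  | [] => 1
  | a :: r => cjtWeight C J T (listInv r) (transp a) * listWeight C J T r

/-- On the points over `S`, the permutations agree, and they map these points to each other. -/
def AgreeOn (S : Finset (Fin n)) (ρ ρ' : Perm (Pt n)) : Prop :=
  ∀ x : Pt n, x.1 ∈ S → ρ x = ρ' x ∧ (ρ x).1 ∈ S

namespace AgreeOn

variable {S : Finset (Fin n)} {ρ ρ' : Perm (Pt n)} (hA : AgreeOn S ρ ρ')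
include hA

theorem iterate_flow {x : Pt n} (hx : x.1 ∈ S) (i : ℕ) :
    (flow ρ)^[i] x = (flow ρ')^[i] x ∧ ((flow ρ)^[i] x).1 ∈ S := by
  induction i with
  | zero => exact ⟨rfl, hx⟩
  | succ i ih =>
    rw [iterate_succ_apply', iterate_succ_apply', ← ih.1, flow_apply, flow_apply]
    exact hA _ (by rw [tau_fst]; exact ih.2)

theorem sameCycle_iff {x y : Pt n} (hx : x.1 ∈ S) :
    (flow ρ).SameCycle x y ↔ (flow ρ').SameCycle x y := by
  constructor
  · intro h
    obtain ⟨i, -, rfl⟩ := sameCycle_iff_iterate.mp h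
    rw [(hA.iterate_flow hx i).1]
    exact sameCycle_iterate _ _ _
  · intro h
    obtain ⟨i, -, rfl⟩ := sameCycle_iff_iterate.mp h
    rw [← (hA.iterate_flow hx i).1]
    exact sameCycle_iterate _ _ _

theorem blk_eq {i : Fin n} (hi : i ∈ S) : blk ρ i = blk ρ' i := by
  simp only [blk, hA.sameCycle_iff (x := (i, false)) hi]

theorem blockClosed : BlockClosed ρ S := by
  intro i hi j hj
  obtain ⟨y, hy, rfl⟩ := Finset.mem_image.mp hj
  obtain ⟨k, -, rfl⟩ := sameCycle_iff_iterate.mp (Finset.mem_filter.mp hy).2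
  exact (hA.iterate_flow (x := (i, false)) hi k).2

theorem blockMon_eq {K : Type*} [Field K] (c : K) {S' : Finset (Fin n)} (hS' : S' ⊆ S) :
    blockMon c ρ S' = blockMon c ρ' S' :=
  blockProd_congr _ fun _ hi => hA.blk_eq (hS' hi)

theorem markedMon_eq {K : Type*} [Field K] (c : K) {i : Fin n} (hi : i ∈ S) (x : ℕ) :
    markedMon c i S x ρ = markedMon c i S x ρ' := by
  rw [markedMon, markedMon, hA.blk_eq hi, hA.blockMon_eq c Finset.sdiff_subset]

/-- The weight is defined by the total number of parts, but it is determined by the position of `p`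
relative to the cycle of `e`, and this is local. -/
theorem cjtWeight_eq {K : Type*} (C J T : K) (h : IsMatching ρ) (h' : IsMatching ρ') {p e : Pt n}
    (he : e.1 ∈ S) (hpe : p.1 ≠ e.1) :
    cjtWeight C J T ρ (swap p e) = cjtWeight C J T ρ' (swap p e) := by
  have hb := hA.blk_eq he
  by_cases hmem : p.1 ∈ blk ρ e.1
  · have hcard : ∀ y, (flow ρ).SameCycle e y → y.1 ≠ e.1 →
        ∃ j, 0 < j ∧ j < (blk ρ e.1).card ∧ (flow ρ)^[j] e = y := by
      intro y hy hye
      obtain ⟨j, hj, rfl⟩ := sameCycle_iff_iterate.mp hy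
      refine ⟨j, Nat.pos_of_ne_zero ?_, by rwa [h.card_blk_eq], rfl⟩
      rintro rfl
      exact hye rfl
    rcases h.mem_blk.mp hmem with h1 | h1
    · obtain ⟨j, h2, h3, h4⟩ := hcard _ h1 hpe
      rw [h.cjtWeight_cut C J T h2 h3 h4,
        h'.cjtWeight_cut C J T h2 (hb ▸ h3) ((hA.iterate_flow he j).1.symm.trans h4)]
    · obtain ⟨j, h2, h3, h4⟩ := hcard _ h1 hpe
      rw [h.cjtWeight_twist C J T h2 h3 h4,
        h'.cjtWeight_twist C J T h2 (hb ▸ h3) ((hA.iterate_flow he j).1.symm.trans h4)]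
  · rw [h.cjtWeight_join C J T hmem, h'.cjtWeight_join C J T (hb ▸ hmem)]

end AgreeOn

/-- No letter of `r` connects `S` with its complement. -/
def Separates (S : Finset (Fin n)) (r : List (Pt n × Fin n)) : Prop :=
  ∀ a ∈ r, a.1.1 ∈ S ↔ a.2 ∈ S

/-- The letters of `r` in `S`. -/
def restrictList (S : Finset (Fin n)) (r : List (Pt n × Fin n)) : List (Pt n × Fin n) :=
  r.filter fun a => a.2 ∈ S

theorem Separates.agreeOn {S : Finset (Fin n)} {r : List (Pt n × Fin n)} (h : Separates S r) :
    AgreeOn S (listInv r) (listInv (restrictList S r)) := by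
  induction r with
  | nil => exact fun x hx => ⟨rfl, hx⟩
  | cons a r ih =>
    have ih := ih fun c hc => h c (List.mem_cons_of_mem _ hc)
    have ha := h a List.mem_cons_self
    intro x hx
    by_cases haS : a.2 ∈ S
    · have hr : restrictList S (a :: r) = a :: restrictList S r :=
        List.filter_cons_of_pos (by simpa using haS)
      have hs : ∀ y : Pt n, y.1 ∈ S → (transp a y).1 ∈ S := by
        intro y hy
        rw [transp_eq, swap_apply_def]
        split_ifs
        · exact haS
        · exact ha.mpr haS
        · exact hy
      rw [hr, listInv, listInv, transp_eq, act_swap_apply, act_swap_apply]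
      obtain ⟨h1, h2⟩ := ih _ (hs x hx)
      rw [transp_eq] at h1 h2
      rw [← h1]
      exact ⟨rfl, hs _ h2⟩
    · have hr : restrictList S (a :: r) = restrictList S r :=
        List.filter_cons_of_neg (by simpa using haS)
      have hs : ∀ y : Pt n, y.1 ∈ S → transp a y = y := by
        intro y hy
        rw [transp_eq, swap_apply_of_ne_of_ne]
        · rintro rfl
          exact haS (ha.mp hy)
        · rintro rfl
          exact haS hy
      rw [hr, listInv, transp_eq, act_swap_apply, ← transp_eq, hs x hx]
      obtain ⟨h1, h2⟩ := ih x hx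
      rw [hs _ h2]
      exact ⟨h1, h2⟩

/-- Each transposition acts on one side only, and its weight can be computed from the letters on
that side. -/
theorem listWeight_eq_mul {K : Type*} [Field K] (C J T : K) {S S' : Finset (Fin n)}
    {r : List (Pt n × Fin n)}
    (hd : Disjoint S S') (hlt : ∀ a ∈ r, a.1.1 < a.2) (hmem : ∀ a ∈ r, a.2 ∈ S ∪ S')
    (h : Separates S r) (h' : Separates S' r) :
    listWeight C J T r = listWeight C J T (restrictList S r) * listWeight C J T
      (restrictList S' r) := by
  induction r with
  | nil => exact (one_mul _).symm
  | cons a r ih =>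
    have hr := fun c hc => h c (List.mem_cons_of_mem a hc)
    have hr' := fun c hc => h' c (List.mem_cons_of_mem a hc)
    rw [listWeight, ih (fun c hc => hlt c (List.mem_cons_of_mem _ hc))
      (fun c hc => hmem c (List.mem_cons_of_mem _ hc)) hr hr']
    have hne : a.1.1 ≠ ((a.2, false) : Pt n).1 := (hlt a List.mem_cons_self).ne
    rcases Finset.mem_union.mp (hmem a List.mem_cons_self) with haS | haS
    · have haS' : a.2 ∉ S' := Finset.disjoint_left.mp hd haS
      rw [show restrictList S (a :: r) = a :: restrictList S r from
          List.filter_cons_of_pos (by simpa using haS),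
        show restrictList S' (a :: r) = restrictList S' r from
          List.filter_cons_of_neg (by simpa using haS'), listWeight, transp_eq,
        (Separates.agreeOn hr).cjtWeight_eq C J T (isMatching_listInv _)
          (isMatching_listInv _) haS hne,
        mul_assoc]
    · have haS' : a.2 ∉ S := Finset.disjoint_right.mp hd haS
      rw [show restrictList S' (a :: r) = a :: restrictList S' r from
          List.filter_cons_of_pos (by simpa using haS),
        show restrictList S (a :: r) = restrictList S r from
          List.filter_cons_of_neg (by simpa using haS'), listWeight, transp_eq,
        (Separates.agreeOn hr').cjtWeight_eq C J T (isMatching_listInv _)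
          (isMatching_listInv _) haS hne]
      ring

end BHurwitz

/-! ### Connected strings, merging, and removal of the last transposition -/

namespace BHurwitz

open Finset.HasAntidiagonal

variable {n : ℕ}

/-- Monotone strings of transpositions within `S`, in reverse order. -/
structure IsWord (S : Finset (Fin n)) (r : List (Pt n × Fin n)) : Prop where
  lt : ∀ a ∈ r, a.1.1 < a.2
  left : ∀ a ∈ r, a.1.1 ∈ S
  right : ∀ a ∈ r, a.2 ∈ S
  sorted : r.Pairwise fun a c => c.2 ≤ a.2

/-- The equivalence relation generated by the letters of `r`. -/
def Joined (r : List (Pt n × Fin n)) : Fin n → Fin n → Prop :=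
  Relation.EqvGen fun i j => ∃ a ∈ r, a.1.1 = i ∧ a.2 = j

/-- The elements of `S` are joined by `r`. -/
def IsConn (S : Finset (Fin n)) (r : List (Pt n × Fin n)) : Prop := ∀ i ∈ S, ∀ j ∈ S, Joined r i j

theorem Joined.refl {r : List (Pt n × Fin n)} (i : Fin n) : Joined r i i := Relation.EqvGen.refl i

theorem Joined.symm {r : List (Pt n × Fin n)} {i j : Fin n} (h : Joined r i j) : Joined r j i :=
  Relation.EqvGen.symm _ _ h

theorem Joined.trans {r : List (Pt n × Fin n)} {i j k : Fin n} (h : Joined r i j)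
    (h' : Joined r j k) : Joined r i k :=
  Relation.EqvGen.trans _ _ _ h h'

theorem Joined.of_mem {r : List (Pt n × Fin n)} {a : Pt n × Fin n} (h : a ∈ r) :
    Joined r a.1.1 a.2 :=
  Relation.EqvGen.rel _ _ ⟨a, h, rfl, rfl⟩

theorem Joined.iff_of_closed {r : List (Pt n × Fin n)} {P : Fin n → Prop}
    (hP : ∀ a ∈ r, P a.1.1 ↔ P a.2) {i j : Fin n} (h : Joined r i j) : P i ↔ P j := by
  induction h with
  | rel x y h =>
    obtain ⟨a, ha, rfl, rfl⟩ := h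
    exact hP a ha
  | refl => rfl
  | symm _ _ _ ih => exact ih.symm
  | trans _ _ _ _ _ ih₁ ih₂ => exact ih₁.trans ih₂

theorem Joined.mono {r r' : List (Pt n × Fin n)} (hr : ∀ a ∈ r, a ∈ r') {i j : Fin n}
    (h : Joined r i j) : Joined r' i j :=
  Relation.EqvGen.mono (fun _ _ ⟨a, ha, h⟩ => ⟨a, hr a ha, h⟩) _ _ h

theorem joined_cons_iff {r : List (Pt n × Fin n)} {a : Pt n × Fin n} {j : Fin n} :
    Joined (a :: r) a.2 j ↔ Joined r a.2 j ∨ Joined r a.1.1 j := by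
  constructor
  · intro h
    refine (h.iff_of_closed (P := fun z => Joined r a.2 z ∨ Joined r a.1.1 z) ?_).mp
      (Or.inl (Joined.refl _))
    intro c hc
    rcases List.mem_cons.mp hc with rfl | hc
    · exact iff_of_true (Or.inr (Joined.refl _)) (Or.inl (Joined.refl _))
    · have h1 := Joined.of_mem hc
      exact or_congr ⟨fun h => h.trans h1, fun h => h.trans h1.symm⟩
        ⟨fun h => h.trans h1, fun h => h.trans h1.symm⟩
  · rintro (h | h)
    · exact h.mono fun c hc => List.mem_cons_of_mem _ hc
    · exact (Joined.of_mem List.mem_cons_self).symm.trans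
        (h.mono fun c hc => List.mem_cons_of_mem _ hc)

theorem Separates.joined_restrict {S : Finset (Fin n)} {r : List (Pt n × Fin n)}
    (h : Separates S r) {i j : Fin n} (hij : Joined r i j) :
    (i ∈ S ↔ j ∈ S) ∧ (i ∈ S → Joined (restrictList S r) i j) := by
  induction hij with
  | rel x y hxy =>
    obtain ⟨a, ha, rfl, rfl⟩ := hxy
    refine ⟨h a ha, fun haS => Joined.of_mem (List.mem_filter.mpr ⟨ha, ?_⟩)⟩
    simpa using (h a ha).mp haS
  | refl x => exact ⟨Iff.rfl, fun _ => Joined.refl x⟩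
  | symm x y _ ih => exact ⟨ih.1.symm, fun hy => (ih.2 (ih.1.mpr hy)).symm⟩
  | trans x y z _ _ ih₁ ih₂ =>
    exact ⟨ih₁.1.trans ih₂.1, fun hx => (ih₁.2 hx).trans (ih₂.2 (ih₁.1.mp hx))⟩

theorem mem_restrictList {S : Finset (Fin n)} {r : List (Pt n × Fin n)} {a : Pt n × Fin n} :
    a ∈ restrictList S r ↔ a ∈ r ∧ a.2 ∈ S := by
  rw [restrictList, List.mem_filter, decide_eq_true_iff]

theorem Separates.isConn_restrict {S : Finset (Fin n)} {r : List (Pt n × Fin n)}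
    (h : Separates S r) : IsConn S (restrictList S r) ↔ IsConn S r :=
  ⟨fun h' i hi j hj => (h' i hi j hj).mono fun _ ha => (mem_restrictList.mp ha).1,
    fun h' i hi j hj => (h.joined_restrict (h' i hi j hj)).2 hi⟩

theorem finite_words (k : ℕ) (p : List (Pt n × Fin n) → Prop) :
    {r : List (Pt n × Fin n) | r.length = k ∧ p r}.Finite :=
  (List.finite_length_eq _ k).subset fun _ h => h.1

/-- The words of length `k` in `S`. -/
noncomputable def wordsOf (S : Finset (Fin n)) (k : ℕ) : Finset (List (Pt n × Fin n)) :=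
  (finite_words k (IsWord S)).toFinset

theorem mem_wordsOf {S : Finset (Fin n)} {k : ℕ} {r : List (Pt n × Fin n)} :
    r ∈ wordsOf S k ↔ r.length = k ∧ IsWord S r := by
  rw [wordsOf, Set.Finite.mem_toFinset]
  rfl

open Classical in
/-- The connected words of length `k` in `S`. -/
noncomputable def connWords (S : Finset (Fin n)) (k : ℕ) : Finset (List (Pt n × Fin n)) :=
  (wordsOf S k).filter (IsConn S)

theorem mem_connWords {S : Finset (Fin n)} {k : ℕ} {r : List (Pt n × Fin n)} :
    r ∈ connWords S k ↔ (r.length = k ∧ IsWord S r) ∧ IsConn S r := by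
  classical
  rw [connWords, Finset.mem_filter, mem_wordsOf]

open Classical in
/-- The words of length `k` in `S₁ ∪ S₂` that join neither `S₁` with `S₂`, but the elements of `S₁`
and those of `S₂`. -/
noncomputable def splitWords (S₁ S₂ : Finset (Fin n)) (k : ℕ) : Finset (List (Pt n × Fin n)) :=
  (wordsOf (S₁ ∪ S₂) k).filter fun r => Separates S₁ r ∧ IsConn S₁ r ∧ IsConn S₂ r

theorem mem_splitWords {S₁ S₂ : Finset (Fin n)} {k : ℕ} {r : List (Pt n × Fin n)} :
    r ∈ splitWords S₁ S₂ k ↔ (r.length = k ∧ IsWord (S₁ ∪ S₂) r) ∧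
      Separates S₁ r ∧ IsConn S₁ r ∧ IsConn S₂ r := by
  classical
  rw [splitWords, Finset.mem_filter, mem_wordsOf]

section merge

variable {S₁ S₂ : Finset (Fin n)} {r r₁ r₂ : List (Pt n × Fin n)}

theorem restrictList_cons_of_mem {S : Finset (Fin n)} {a : Pt n × Fin n} (h : a.2 ∈ S) :
    restrictList S (a :: r) = a :: restrictList S r :=
  List.filter_cons_of_pos (by simpa using h)

theorem restrictList_cons_of_notMem {S : Finset (Fin n)} {a : Pt n × Fin n} (h : a.2 ∉ S) :
    restrictList S (a :: r) = restrictList S r :=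
  List.filter_cons_of_neg (by simpa using h)

theorem IsWord.restrictList_self {S : Finset (Fin n)} (h : ∀ a ∈ r, a.2 ∈ S) :
    restrictList S r = r :=
  List.filter_eq_self.mpr fun a ha => by simpa using h a ha

theorem IsWord.restrictList_eq_nil {S : Finset (Fin n)} (h : ∀ a ∈ r, a.2 ∉ S) :
    restrictList S r = [] :=
  List.filter_eq_nil_iff.mpr fun a ha => by simpa using h a ha

/-- Two monotone strings on disjoint sets have no common value of `q_i`, so sorting leaves no choice
in interleaving them. Hence no binomial coefficients in the number of transpositions appear, in
contrast to strings without monotonicity. -/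
theorem exists_merge (hd : Disjoint S₁ S₂) (h₁ : ∀ a ∈ r₁, a.2 ∈ S₁) (h₂ : ∀ a ∈ r₂, a.2 ∈ S₂)
    (hs₁ : r₁.Pairwise fun a c => c.2 ≤ a.2) (hs₂ : r₂.Pairwise fun a c => c.2 ≤ a.2) :
    ∃ r, (r.Pairwise fun a c => c.2 ≤ a.2) ∧ restrictList S₁ r = r₁ ∧ restrictList S₂ r = r₂ ∧
      ∀ a ∈ r, a ∈ r₁ ∨ a ∈ r₂ := by
  induction r₁ generalizing r₂ with
  | nil =>
    exact ⟨r₂, hs₂, IsWord.restrictList_eq_nil fun a ha => Finset.disjoint_right.mp hd (h₂ a ha),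
      IsWord.restrictList_self h₂, fun a ha => Or.inr ha⟩
  | cons a r₁ ih =>
    have ha := h₁ a List.mem_cons_self
    have hsa := List.pairwise_cons.mp hs₁
    induction r₂ with
    | nil =>
      exact ⟨a :: r₁, hs₁, IsWord.restrictList_self h₁,
        IsWord.restrictList_eq_nil fun c hc => Finset.disjoint_left.mp hd (h₁ c hc),
        fun c hc => Or.inl hc⟩
    | cons b r₂ ih' =>
      have hb := h₂ b List.mem_cons_self
      have hsb := List.pairwise_cons.mp hs₂
      rcases le_total b.2 a.2 with hab | hab
      · obtain ⟨r, h3, h4, h5, h6⟩ := ih (fun c hc => h₁ c (List.mem_cons_of_mem _ hc)) h₂ hsa.2 hs₂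
        refine ⟨a :: r, List.pairwise_cons.mpr ⟨fun c hc => ?_, h3⟩, ?_, ?_, fun c hc => ?_⟩
        · rcases h6 c hc with h7 | h7
          · exact hsa.1 c h7
          · rcases List.mem_cons.mp h7 with rfl | h7
            · exact hab
            · exact (hsb.1 c h7).trans hab
        · rw [restrictList_cons_of_mem ha, h4]
        · rw [restrictList_cons_of_notMem (Finset.disjoint_left.mp hd ha), h5]
        · rcases List.mem_cons.mp hc with rfl | hc
          · exact Or.inl List.mem_cons_self
          · exact (h6 c hc).imp_left (List.mem_cons_of_mem _)
      · obtain ⟨r, h3, h4, h5, h6⟩ := ih' (fun c hc => h₂ c (List.mem_cons_of_mem _ hc)) hsb.2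
        refine ⟨b :: r, List.pairwise_cons.mpr ⟨fun c hc => ?_, h3⟩, ?_, ?_, fun c hc => ?_⟩
        · rcases h6 c hc with h7 | h7
          · rcases List.mem_cons.mp h7 with rfl | h7
            · exact hab
            · exact (hsa.1 c h7).trans hab
          · exact hsb.1 c h7
        · rw [restrictList_cons_of_notMem (Finset.disjoint_right.mp hd hb), h4]
        · rw [restrictList_cons_of_mem hb, h5]
        · rcases List.mem_cons.mp hc with rfl | hc
          · exact Or.inr List.mem_cons_self
          · exact (h6 c hc).imp_right (List.mem_cons_of_mem _)

theorem mem_iff_of_restrictList_eq {r r' : List (Pt n × Fin n)} (hr : ∀ a ∈ r, a.2 ∈ S₁ ∪ S₂)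
    (hr' : ∀ a ∈ r', a.2 ∈ S₁ ∪ S₂) (h₁ : restrictList S₁ r = restrictList S₁ r')
    (h₂ : restrictList S₂ r = restrictList S₂ r') (a : Pt n × Fin n) : a ∈ r ↔ a ∈ r' := by
  have h3 := mem_restrictList (S := S₁) (r := r) (a := a)
  have h4 := mem_restrictList (S := S₂) (r := r) (a := a)
  rw [h₁, mem_restrictList] at h3
  rw [h₂, mem_restrictList] at h4
  have h5 := hr a
  have h6 := hr' a
  rw [Finset.mem_union] at h5 h6
  tauto

/-- The first letters have the same value of `q`, namely the largest one that occurs. This value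
lies in one of the sets, and the restriction to that set determines the letter. -/
theorem eq_of_restrictList_eq {r r' : List (Pt n × Fin n)} (hr : ∀ a ∈ r, a.2 ∈ S₁ ∪ S₂)
    (hr' : ∀ a ∈ r', a.2 ∈ S₁ ∪ S₂) (hs : r.Pairwise fun a c => c.2 ≤ a.2)
    (hs' : r'.Pairwise fun a c => c.2 ≤ a.2) (h₁ : restrictList S₁ r = restrictList S₁ r')
    (h₂ : restrictList S₂ r = restrictList S₂ r') : r = r' := by
  have hmem := mem_iff_of_restrictList_eq hr hr' h₁ h₂
  induction r generalizing r' with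
  | nil => exact (List.eq_nil_iff_forall_not_mem.mpr fun a ha => List.not_mem_nil
    ((hmem a).mpr ha)).symm
  | cons a t ih =>
    cases r' with
    | nil => exact absurd ((hmem a).mp List.mem_cons_self) List.not_mem_nil
    | cons a' t' =>
      have hsa := List.pairwise_cons.mp hs
      have hsa' := List.pairwise_cons.mp hs'
      have haa : a.2 = a'.2 := by
        refine le_antisymm ?_ ?_
        · rcases List.mem_cons.mp ((hmem a).mp List.mem_cons_self) with h | h
          · rw [h]
          · exact hsa'.1 a h
        · rcases List.mem_cons.mp ((hmem a').mpr List.mem_cons_self) with h | h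
          · rw [h]
          · exact hsa.1 a' h
      have hcons : ∀ S : Finset (Fin n), restrictList S (a :: t) = restrictList S (a' :: t') →
          restrictList S t = restrictList S t' ∧ (a.2 ∈ S → a = a') := by
        intro S h
        by_cases haS : a.2 ∈ S
        · rw [restrictList_cons_of_mem haS, restrictList_cons_of_mem (haa ▸ haS)] at h
          exact ⟨(List.cons.inj h).2, fun _ => (List.cons.inj h).1⟩
        · rw [restrictList_cons_of_notMem haS, restrictList_cons_of_notMem (haa ▸ haS)] at h
          exact ⟨h, fun h => absurd h haS⟩
      have heq : a = a' := by
        rcases Finset.mem_union.mp (hr a List.mem_cons_self) with h | h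
        · exact (hcons S₁ h₁).2 h
        · exact (hcons S₂ h₂).2 h
      subst heq
      congr 1
      have hrt := fun c hc => hr c (List.mem_cons_of_mem a hc)
      have hrt' := fun c hc => hr' c (List.mem_cons_of_mem a hc)
      exact ih hrt hrt' hsa.2 hsa'.2 (hcons S₁ h₁).1 (hcons S₂ h₂).1
        (mem_iff_of_restrictList_eq hrt hrt' (hcons S₁ h₁).1 (hcons S₂ h₂).1)

theorem length_eq_add (hd : Disjoint S₁ S₂) (hr : ∀ a ∈ r, a.2 ∈ S₁ ∪ S₂) :
    r.length = (restrictList S₁ r).length + (restrictList S₂ r).length := by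
  induction r with
  | nil => rfl
  | cons a r ih =>
    have ih := ih fun c hc => hr c (List.mem_cons_of_mem _ hc)
    rcases Finset.mem_union.mp (hr a List.mem_cons_self) with h | h
    · rw [restrictList_cons_of_mem h, restrictList_cons_of_notMem (Finset.disjoint_left.mp hd h),
        List.length_cons, List.length_cons, ih]
      omega
    · rw [restrictList_cons_of_mem h, restrictList_cons_of_notMem (Finset.disjoint_right.mp hd h),
        List.length_cons, List.length_cons, ih]
      omega

theorem IsWord.separates_right (hd : Disjoint S₁ S₂) (h : IsWord (S₁ ∪ S₂) r)
    (hs : Separates S₁ r) : Separates S₂ r := by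
  intro a ha
  have h1 := hs a ha
  have h2 := h.left a ha
  have h3 := h.right a ha
  have h4 : ∀ i, i ∈ S₁ → i ∉ S₂ := fun i hi => Finset.disjoint_left.mp hd hi
  have h5 := h4 a.1.1
  have h6 := h4 a.2
  rw [Finset.mem_union] at h2 h3
  tauto

theorem IsWord.restrictList {S S' : Finset (Fin n)} (h : IsWord S r) (hs : Separates S' r) :
    IsWord S' (restrictList S' r) where
  lt a ha := h.lt a (mem_restrictList.mp ha).1
  left a ha := (hs a (mem_restrictList.mp ha).1).mpr (mem_restrictList.mp ha).2
  right _ ha := (mem_restrictList.mp ha).2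
  sorted := h.sorted.filter _

theorem sum_splitWords {M : Type*} [AddCommMonoid M] (hd : Disjoint S₁ S₂) (k : ℕ)
    (g : List (Pt n × Fin n) → List (Pt n × Fin n) → M) :
    ∑ r ∈ splitWords S₁ S₂ k, g (restrictList S₁ r) (restrictList S₂ r) =
      ∑ j ∈ antidiagonal k, ∑ r₁ ∈ connWords S₁ j.1,
        ∑ r₂ ∈ connWords S₂ j.2, g r₁ r₂ := by
  simp only [← Finset.sum_product']
  rw [Finset.sum_sigma']
  refine Finset.sum_bij (fun r _ => ⟨((BHurwitz.restrictList S₁ r).length,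
    (BHurwitz.restrictList S₂ r).length), (BHurwitz.restrictList S₁ r,
      BHurwitz.restrictList S₂ r)⟩) ?_ ?_ ?_ ?_
  · intro r hr
    obtain ⟨⟨hk, hw⟩, hs, hc₁, hc₂⟩ := mem_splitWords.mp hr
    have hs₂ := hw.separates_right hd hs
    refine Finset.mem_sigma.mpr ⟨mem_antidiagonal.mpr ?_,
      Finset.mem_product.mpr ⟨?_, ?_⟩⟩
    · exact (length_eq_add hd hw.right).symm.trans hk
    · exact mem_connWords.mpr ⟨⟨rfl, hw.restrictList hs⟩, hs.isConn_restrict.mpr hc₁⟩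
    · exact mem_connWords.mpr ⟨⟨rfl, hw.restrictList hs₂⟩, hs₂.isConn_restrict.mpr hc₂⟩
  · intro r hr r' hr' h
    obtain ⟨⟨hk, hw⟩, -⟩ := mem_splitWords.mp hr
    obtain ⟨⟨hk', hw'⟩, -⟩ := mem_splitWords.mp hr'
    rw [Sigma.mk.injEq, heq_eq_eq] at h
    exact eq_of_restrictList_eq hw.right hw'.right hw.sorted hw'.sorted (Prod.ext_iff.mp h.2).1
      (Prod.ext_iff.mp h.2).2
  · rintro ⟨⟨k₁, k₂⟩, r₁, r₂⟩ h
    obtain ⟨h1, h2⟩ := (Finset.mem_sigma.mp h).imp_right Finset.mem_product.mp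
    obtain ⟨⟨hk₁, hw₁⟩, hc₁⟩ := mem_connWords.mp h2.1
    obtain ⟨⟨hk₂, hw₂⟩, hc₂⟩ := mem_connWords.mp h2.2
    obtain ⟨r, hr, hr₁, hr₂, hmem⟩ := exists_merge hd hw₁.right hw₂.right hw₁.sorted hw₂.sorted
    have hw : IsWord (S₁ ∪ S₂) r := by
      refine ⟨fun a ha => ?_, fun a ha => ?_, fun a ha => ?_, hr⟩
      · exact (hmem a ha).elim (hw₁.lt a) (hw₂.lt a)
      · exact Finset.mem_union.mpr ((hmem a ha).imp (hw₁.left a) (hw₂.left a))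
      · exact Finset.mem_union.mpr ((hmem a ha).imp (hw₁.right a) (hw₂.right a))
    have hs : Separates S₁ r := by
      intro a ha
      rcases hmem a ha with h | h
      · exact iff_of_true (hw₁.left a h) (hw₁.right a h)
      · exact iff_of_false (Finset.disjoint_right.mp hd (hw₂.left a h))
          (Finset.disjoint_right.mp hd (hw₂.right a h))
    have hs₂ := hw.separates_right hd hs
    dsimp only at hk₁ hk₂ hc₁ hc₂
    subst hr₁ hr₂ hk₁ hk₂
    refine ⟨r, mem_splitWords.mpr ⟨⟨?_, hw⟩, hs, hs.isConn_restrict.mp hc₁,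
      hs₂.isConn_restrict.mp hc₂⟩, rfl⟩
    rw [length_eq_add hd hw.right]
    exact mem_antidiagonal.mp h1
  · exact fun _ _ => rfl

end merge

section head

variable {S : Finset (Fin n)} {e : Fin n}

theorem IsWord.cons {r : List (Pt n × Fin n)} (hr : IsWord S r) (he : e ∈ S)
    (hmax : ∀ i ∈ S, i ≤ e) {p : Pt n} (hp : p.1 ∈ S) (hpe : p.1 ≠ e) : IsWord S ((p, e) :: r) := by
  refine ⟨fun a ha => ?_, fun a ha => ?_, fun a ha => ?_, List.pairwise_cons.mpr
    ⟨fun a ha => hmax _ (hr.right a ha), hr.sorted⟩⟩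
  · rcases List.mem_cons.mp ha with rfl | ha
    · exact lt_of_le_of_ne (hmax _ hp) hpe
    · exact hr.lt a ha
  · rcases List.mem_cons.mp ha with rfl | ha
    · exact hp
    · exact hr.left a ha
  · rcases List.mem_cons.mp ha with rfl | ha
    · exact he
    · exact hr.right a ha

/-- The head is the last transposition and has the largest `q_i`. If this were not the maximum `e`
of `S`, no letter would involve `e`, and `e` would be isolated. -/
theorem IsWord.head_eq {a : Pt n × Fin n} {r : List (Pt n × Fin n)} (h : IsWord S (a :: r))
    (hc : IsConn S (a :: r)) (he : e ∈ S) (hmax : ∀ i ∈ S, i ≤ e) : a.2 = e := by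
  have hlt := h.lt a List.mem_cons_self
  by_contra hne
  have hlt' : a.2 < e := lt_of_le_of_ne (hmax _ (h.right a List.mem_cons_self)) hne
  have hall : ∀ c ∈ a :: r, c.2 < e := by
    intro c hc
    rcases List.mem_cons.mp hc with rfl | hc
    · exact hlt'
    · exact ((List.pairwise_cons.mp h.sorted).1 c hc).trans_lt hlt'
  have h1 := (hc _ he _ (h.right a List.mem_cons_self)).iff_of_closed (P := fun z => z = e)
    fun c hc => iff_of_false ((h.lt c hc).trans (hall c hc)).ne (hall c hc).ne
  exact hne (h1.mp rfl)

theorem isConn_iff_of_mem {r : List (Pt n × Fin n)} (he : e ∈ S) :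
    IsConn S r ↔ ∀ i ∈ S, Joined r e i :=
  ⟨fun h i hi => h e he i hi, fun h i hi j hj => (h i hi).symm.trans (h j hj)⟩

/-- Removing the last transposition from a connected string. -/
theorem sum_connWords_succ {M : Type*} [AddCommMonoid M] (he : e ∈ S) (hmax : ∀ i ∈ S, i ≤ e)
    (k : ℕ)
    (g : List (Pt n × Fin n) → M) :
    ∑ r ∈ connWords S (k + 1), g r =
      ∑ r ∈ connWords S k, ∑ p : Pt n with p.1 ∈ S ∧ p.1 ≠ e, g ((p, e) :: r) +
        ∑ S₁ ∈ S.powerset with e ∈ S₁, ∑ r ∈ splitWords S₁ (S \ S₁) k,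
          ∑ p : Pt n with p.1 ∈ S \ S₁, g ((p, e) :: r) := by
  classical
  set D : Finset (List (Pt n × Fin n) × Pt n) :=
    (wordsOf S k ×ˢ Finset.univ.filter fun p : Pt n => p.1 ∈ S ∧ p.1 ≠ e).filter fun x =>
      IsConn S ((x.2, e) :: x.1) with hD
  have hmemD : ∀ x, x ∈ D ↔ (((x.1.length = k ∧ IsWord S x.1) ∧ x.2.1 ∈ S ∧ x.2.1 ≠ e) ∧
      IsConn S ((x.2, e) :: x.1)) := by
    intro x
    rw [hD, Finset.mem_filter, Finset.mem_product, mem_wordsOf, Finset.mem_filter,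
      and_iff_right (Finset.mem_univ _)]
  have h1 : ∑ r ∈ connWords S (k + 1), g r = ∑ x ∈ D, g ((x.2, e) :: x.1) := by
    refine (Finset.sum_bij (fun x _ => (x.2, e) :: x.1) ?_ ?_ ?_ fun _ _ => rfl).symm
    · intro x hx
      obtain ⟨⟨⟨hk, hw⟩, hp, hpe⟩, hc⟩ := (hmemD x).mp hx
      exact mem_connWords.mpr ⟨⟨by rw [List.length_cons, hk], hw.cons he hmax hp hpe⟩, hc⟩
    · rintro ⟨r, p⟩ _ ⟨r', p'⟩ _ h
      obtain ⟨h1, h2⟩ := List.cons.inj h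
      exact Prod.ext h2 (Prod.ext_iff.mp h1).1
    · intro r hr
      obtain ⟨⟨hk, hw⟩, hc⟩ := mem_connWords.mp hr
      cases r with
      | nil => simp at hk
      | cons a r =>
        have ha := hw.head_eq hc he hmax
        obtain ⟨p, e'⟩ := a
        dsimp only at ha
        subst ha
        refine ⟨(r, p), (hmemD _).mpr ⟨⟨⟨by simpa using hk, ?_⟩, ?_, ?_⟩, hc⟩, rfl⟩
        · exact ⟨fun a ha => hw.lt a (List.mem_cons_of_mem _ ha),
            fun a ha => hw.left a (List.mem_cons_of_mem _ ha),
            fun a ha => hw.right a (List.mem_cons_of_mem _ ha), (List.pairwise_cons.mp hw.sorted).2⟩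
        · exact hw.left _ List.mem_cons_self
        · exact (hw.lt _ List.mem_cons_self).ne
  rw [h1, ← Finset.sum_filter_add_sum_filter_not D fun x => IsConn S x.1]
  congr 1
  · rw [← Finset.sum_product']
    refine Finset.sum_congr ?_ fun _ _ => rfl
    ext x
    rw [Finset.mem_filter, hmemD, Finset.mem_product, mem_connWords, Finset.mem_filter,
      and_iff_right (Finset.mem_univ _)]
    constructor
    · tauto
    · rintro ⟨⟨h2, h3⟩, h4⟩
      exact ⟨⟨⟨h2, h4⟩, fun i hi j hj => (h3 i hi j hj).mono fun _ => List.mem_cons_of_mem _⟩, h3⟩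
  -- If the remaining string is not connected, the removed letter has joined the class `S₁` of `e`
  -- with that of `p`; hence the rest of `S` is a single class and `p` is any point over it.
  · rw [← Finset.sum_fiberwise_of_maps_to (s := D.filter fun x => ¬ IsConn S x.1)
      (t := S.powerset.filter fun S₁ => e ∈ S₁)
      (g := fun x => S.filter fun i => Joined x.1 e i)]
    · refine Finset.sum_congr rfl fun S₁ hS₁ => ?_
      obtain ⟨hsub, heS₁⟩ := Finset.mem_filter.mp hS₁
      rw [Finset.mem_powerset] at hsub
      rw [← Finset.sum_product']
      refine Finset.sum_congr ?_ fun _ _ => rfl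
      ext ⟨r, p⟩
      rw [Finset.mem_filter, Finset.mem_filter, hmemD, Finset.mem_product, mem_splitWords,
        Finset.mem_filter, and_iff_right (Finset.mem_univ _), Finset.union_sdiff_of_subset hsub]
      dsimp only
      have hcons : ∀ i, Joined ((p, e) :: r) e i ↔ Joined r e i ∨ Joined r p.1 i := fun i =>
        joined_cons_iff (a := (p, e))
      rw [isConn_iff_of_mem (r := (p, e) :: r) he, isConn_iff_of_mem (r := r) he,
        isConn_iff_of_mem (r := r) heS₁]
      simp only [hcons]
      constructor
      · rintro ⟨⟨⟨⟨hw, hp, hpe⟩, hc⟩, hnc⟩, hcomp⟩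
        have hmem : ∀ i, i ∈ S₁ ↔ i ∈ S ∧ Joined r e i := fun i => by
          rw [← hcomp, Finset.mem_filter]
        have hpS₁ : ¬ Joined r e p.1 := fun h => hnc fun i hi => (hc i hi).elim id h.trans
        have hall : ∀ i ∈ S \ S₁, Joined r p.1 i := by
          intro i hi
          obtain ⟨hiS, hiS₁⟩ := Finset.mem_sdiff.mp hi
          exact (hc i hiS).resolve_left fun h => hiS₁ ((hmem i).mpr ⟨hiS, h⟩)
        refine ⟨⟨hw, ?_, fun i hi => ((hmem i).mp hi).2, fun i hi j hj =>
          (hall i hi).symm.trans (hall j hj)⟩, Finset.mem_sdiff.mpr ⟨hp,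
            fun h => hpS₁ ((hmem _).mp h).2⟩⟩
        intro a ha
        have h2 := Joined.of_mem ha
        rw [hmem, hmem]
        exact and_congr (iff_of_true (hw.2.left a ha) (hw.2.right a ha))
          ⟨fun h => h.trans h2, fun h => h.trans h2.symm⟩
      · rintro ⟨⟨hw, hs, hc₁, hc₂⟩, hp⟩
        obtain ⟨hpS, hpS₁⟩ := Finset.mem_sdiff.mp hp
        have hjoin : ∀ i, Joined r e i → i ∈ S₁ := fun i hi => (hs.joined_restrict hi).1.mp heS₁
        refine ⟨⟨⟨⟨hw, hpS, ?_⟩, fun i hi => ?_⟩, fun h => hpS₁ (hjoin _ (h _ hpS))⟩, ?_⟩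
        · rintro rfl
          exact hpS₁ heS₁
        · by_cases hiS₁ : i ∈ S₁
          · exact Or.inl (hc₁ i hiS₁)
          · exact Or.inr (hc₂ _ hp _ (Finset.mem_sdiff.mpr ⟨hi, hiS₁⟩))
        · ext i
          rw [Finset.mem_filter]
          exact ⟨fun h => hjoin i h.2, fun h => ⟨hsub h, hc₁ i h⟩⟩
    · intro x hx
      exact Finset.mem_filter.mpr ⟨Finset.mem_powerset.mpr (Finset.filter_subset _ _),
        Finset.mem_filter.mpr ⟨he, Joined.refl e⟩⟩

end head

end BHurwitz

/-! ### Generating polynomials of connected strings -/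

namespace BHurwitz

open Finset.HasAntidiagonal MvPolynomial Equiv

variable {K : Type*} [Field K]

theorem pderiv_homPart_eq_zero {s x : ℕ} (h : s < x) (f : MvPolynomial ℕ K) :
    pderiv x (homPart s f) = 0 := by
  rw [← coeff_markWeight_pderiv, PowerSeries.coeff_X_pow_mul', if_neg (by omega)]

theorem weightDer_homPart (s : ℕ) (f : MvPolynomial ℕ K) :
    weightDer K (homPart s f) = (s : K) • homPart s f := by
  induction f using MvPolynomial.induction_on generalizing s with
  | C c =>
    rw [homPart, show (C c : MvPolynomial ℕ K) = algebraMap K _ c from rfl, AlgHom.commutes,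
      PowerSeries.algebraMap_apply, PowerSeries.coeff_C]
    split_ifs with h
    · rw [h, Derivation.map_algebraMap, Nat.cast_zero, zero_smul]
    · rw [map_zero, smul_zero]
  | add p q hp hq =>
    have h : ∀ p q : MvPolynomial ℕ K, homPart s (p + q) = homPart s p + homPart s q :=
      fun p q => by
      rw [homPart, map_add, map_add, homPart, homPart]
    rw [h, map_add, hp, hq, smul_add]
  | mul_X p i hp =>
    have h : homPart s (p * X i) = if i ≤ s then homPart (s - i) p * X i else 0 := by
      rw [homPart, map_mul, markWeight_X, mul_left_comm, PowerSeries.coeff_X_pow_mul',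
        PowerSeries.coeff_mul_C, homPart]
    rw [h]
    split_ifs with hi
    · rw [Derivation.leibniz, hp, weightDer, mkDerivation_X, Nat.cast_sub hi, smul_eq_mul,
        smul_eq_mul]
      rw [mul_smul_comm, mul_smul_comm, mul_comm (X i), ← add_smul, add_sub_cancel]
    · rw [map_zero, smul_zero]

theorem sum_X_mul_pderiv_homPart {s n : ℕ} (h : s ≤ n) (f : MvPolynomial ℕ K) :
    ∑ x ∈ Finset.range (n + 1), (x : K) • (X x * pderiv x (homPart s f)) =
      (s : K) • homPart s f := by
  set g := homPart s f with hg
  have h1 := X_mul_pderiv_sum_eq (N := n + 1 + (g.vars.sup id + 1)) (f := g) fun i hi =>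
    (Nat.lt_succ_of_le (Finset.le_sup (f := id) hi)).trans_le (Nat.le_add_left _ _)
  rw [← weightDer_homPart, ← hg, ← h1, Finset.sum_range_eq_add_Ico _ (Nat.succ_pos n),
    Nat.cast_zero, zero_smul, zero_add]
  refine Finset.sum_subset (Finset.Ico_subset_Ico_right (Nat.le_add_right _ _)) ?_
  intro x hx hx'
  rw [hg, pderiv_homPart_eq_zero, mul_zero, smul_zero]
  rw [Finset.mem_Ico] at hx hx'
  omega

/-- As `e` belongs to the first part, the number of subsets of a given size is a binomial
coefficient of `|s| - 1`. The hypothesis on `g` adds the missing empty first part. -/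
theorem sum_powerset_mem {α M : Type*} [DecidableEq α] [AddCommMonoid M] {s : Finset α} {e : α}
    (he : e ∈ s) (g : ℕ → ℕ → M) (hg : g 0 s.card = 0) :
    ∑ t ∈ s.powerset with e ∈ t, ((t.card - 1).factorial * (s \ t).card.factorial) •
      g t.card (s \ t).card =
        (s.card - 1).factorial • ∑ j ∈ antidiagonal s.card, g j.1 j.2 := by
  obtain ⟨s, hes, rfl⟩ : ∃ s', e ∉ s' ∧ s = insert e s' :=
    ⟨s.erase e, Finset.notMem_erase _ _, (Finset.insert_erase he).symm⟩
  rw [Finset.card_insert_of_notMem hes] at hg ⊢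
  rw [Finset.Nat.sum_antidiagonal_succ, hg, zero_add, Nat.add_sub_cancel,
    ← sum_powerset_factorial_smul s fun i j => g (i + 1) j]
  symm
  refine Finset.sum_bij (fun t _ => insert e t) ?_ ?_ ?_ ?_
  · intro t ht
    rw [Finset.mem_powerset] at ht
    exact Finset.mem_filter.mpr ⟨Finset.mem_powerset.mpr (Finset.insert_subset_insert _ ht),
      Finset.mem_insert_self _ _⟩
  · intro t ht t' ht' h
    rw [Finset.mem_powerset] at ht ht'
    have h1 := congrArg (fun u => Finset.erase u e) h
    simpa only [Finset.erase_insert (fun h => hes (ht h)),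
      Finset.erase_insert (fun h => hes (ht' h))] using h1
  · intro t ht
    obtain ⟨ht, het⟩ := Finset.mem_filter.mp ht
    refine ⟨t.erase e, Finset.mem_powerset.mpr ?_, Finset.insert_erase het⟩
    exact Finset.subset_insert_iff.mp (Finset.mem_powerset.mp ht)
  · intro t ht
    rw [Finset.mem_powerset] at ht
    have het : e ∉ t := fun h => hes (ht h)
    have h1 : insert e s \ insert e t = s \ t := by
      ext i
      simp only [Finset.mem_sdiff, Finset.mem_insert]
      by_cases hi : i = e
      · subst hi
        simp [hes]
      · simp [hi]
    rw [Finset.card_insert_of_notMem het, h1, Nat.add_sub_cancel]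

variable {n : ℕ}

/-- The generating polynomial of the connected strings on `S`. -/
noncomputable def wordSum (C J T : K) (S : Finset (Fin n)) (k : ℕ) : MvPolynomial ℕ K :=
  ∑ r ∈ connWords S k, listWeight C J T r • blockMon C⁻¹ (listInv r) S

/-- The generating polynomial of the connected strings on `S` for which the block of `i` has size
`x`, without the variable of this block. -/
noncomputable def markedSum (C J T : K) (S : Finset (Fin n)) (k : ℕ) (i : Fin n) (x : ℕ) :
    MvPolynomial ℕ K :=
  ∑ r ∈ connWords S k, listWeight C J T r • markedMon C⁻¹ i S x (listInv r)

theorem IsWord.separates {S : Finset (Fin n)} {r : List (Pt n × Fin n)} (h : IsWord S r) :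
    Separates S r := fun a ha => iff_of_true (h.left a ha) (h.right a ha)

/-- Strings are sorted by the size of the block of `i`, whose variable is restored. -/
theorem wordSum_eq (C J T : K) {S : Finset (Fin n)} {i : Fin n} (hi : i ∈ S) (k : ℕ) :
    wordSum C J T S k = ∑ x ∈ Finset.range (n + 1), X x * markedSum C J T S k i x := by
  simp only [markedSum, Finset.mul_sum]
  rw [wordSum, Finset.sum_comm]
  refine Finset.sum_congr rfl fun r hr => ?_
  have hw := (mem_connWords.mp hr).1.2
  have hm := isMatching_listInv r
  rw [hm.blockMon_eq_mul _ ((Separates.agreeOn hw.separates).blockClosed i hi)]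
  simp only [markedMon, smul_ite, mul_ite, smul_zero, mul_zero]
  rw [Finset.sum_ite_eq, if_pos, mul_smul_comm, mul_smul_comm, smul_mul_assoc]
  rw [Finset.mem_range]
  have := Finset.card_le_univ (blk (listInv r) i)
  rw [Fintype.card_fin] at this
  omega

theorem markedSum_zero (C J T : K) (S : Finset (Fin n)) (k : ℕ) (i : Fin n) :
    markedSum C J T S k i 0 = 0 := by
  refine Finset.sum_eq_zero fun r _ => ?_
  have hm := isMatching_listInv r
  rw [markedMon, if_neg, smul_zero]
  rw [Finset.card_eq_zero]
  exact Finset.ne_empty_of_mem (hm.mem_blk_self i)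

/-- The contribution of a pair of strings on complementary sets. -/
theorem sum_splitWords_join [CharZero K] {C : K} (hC : C ≠ 0) (J T : K) {S₁ S₂ : Finset (Fin n)}
    (hd : Disjoint S₁ S₂) {e : Fin n} (he : e ∈ S₁) (k x : ℕ) :
    ∑ r ∈ splitWords S₁ S₂ k, ∑ p : Pt n with p.1 ∈ S₂, listWeight C J T ((p, e) :: r) •
        markedMon C⁻¹ e (S₁ ∪ S₂) x (listInv ((p, e) :: r)) =
      ∑ a ∈ antidiagonal x, (2 * (C * J) * a.2) •
        ∑ j ∈ antidiagonal k,
          markedSum C J T S₁ j.1 e a.1 * pderiv a.2 (wordSum C J T S₂ j.2) := by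
  have h1 : ∀ r ∈ splitWords S₁ S₂ k, ∑ p : Pt n with p.1 ∈ S₂, listWeight C J T ((p, e) :: r) •
        markedMon C⁻¹ e (S₁ ∪ S₂) x (listInv ((p, e) :: r)) =
      ∑ a ∈ antidiagonal x, (2 * (C * J) * a.2) •
        ((listWeight C J T (restrictList S₁ r) •
          markedMon C⁻¹ e S₁ a.1 (listInv (restrictList S₁ r))) *
        (listWeight C J T (restrictList S₂ r) •
          pderiv a.2 (blockMon C⁻¹ (listInv (restrictList S₂ r)) S₂))) := by
    intro r hr
    obtain ⟨⟨-, hw⟩, hs₁, -⟩ := mem_splitWords.mp hr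
    have hs₂ := hw.separates_right hd hs₁
    have hA₁ := hs₁.agreeOn
    have hA₂ := hs₂.agreeOn
    have h2 := (isMatching_listInv r).sum_join_union hC J T (e := (e, false))
      (hA₁.blockClosed e he) hA₂.blockClosed hd x
    have h3 : ∀ p : Pt n, listWeight C J T ((p, e) :: r) •
        markedMon C⁻¹ e (S₁ ∪ S₂) x (listInv ((p, e) :: r)) = listWeight C J T r •
          (cjtWeight C J T (listInv r) (swap p (e, false)) •
            markedMon C⁻¹ e (S₁ ∪ S₂) x (act (swap p (e, false)) (listInv r))) := fun p => by
      rw [smul_smul, mul_comm]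
      rfl
    rw [Finset.sum_congr rfl fun p _ => h3 p, ← Finset.smul_sum, h2, Finset.smul_sum]
    refine Finset.sum_congr rfl fun a _ => ?_
    rw [smul_comm, listWeight_eq_mul C J T hd hw.lt hw.right hs₁ hs₂, smul_mul_smul_comm,
      hA₁.markedMon_eq _ he, hA₂.blockMon_eq _ (Finset.Subset.refl _)]
  rw [Finset.sum_congr rfl h1, Finset.sum_comm]
  refine Finset.sum_congr rfl fun a _ => ?_
  rw [← Finset.smul_sum, sum_splitWords hd k fun r₁ r₂ =>
    (listWeight C J T r₁ • markedMon C⁻¹ e S₁ a.1 (listInv r₁)) *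
      (listWeight C J T r₂ • pderiv a.2 (blockMon C⁻¹ (listInv r₂) S₂))]
  congr 1
  refine Finset.sum_congr rfl fun j _ => ?_
  rw [markedSum, wordSum, map_sum, Finset.sum_mul_sum]
  simp only [Derivation.map_smul]

end BHurwitz

/-! ### The refined recursion for monotone strings -/

namespace BHurwitz

open Finset.HasAntidiagonal MvPolynomial Equiv

variable {K : Type*} [Field K] {n : ℕ}

/-- The new transposition involves a point of the block of `e`, which is a cut or a twist, or a
point of another block, which is a join. -/
theorem sum_connWords_letter [CharZero K] {C : K} (hC : C ≠ 0) (J T : K) {S : Finset (Fin n)}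
    {e : Fin n} (he : e ∈ S) (k : ℕ) {x : ℕ} (hx : 1 ≤ x) :
    ∑ r ∈ connWords S k, ∑ p : Pt n with p.1 ∈ S ∧ p.1 ≠ e, listWeight C J T ((p, e) :: r) •
        markedMon C⁻¹ e S x (listInv ((p, e) :: r)) =
      (T * (x - 1)) • markedSum C J T S k e x +
        ∑ z ∈ Finset.Ioc x n, X (z - x) * markedSum C J T S k e z +
        ∑ a ∈ antidiagonal x, (2 * (C * J) * a.2) •
          pderiv a.2 (markedSum C J T S k e a.1) := by
  have h1 : ∀ r ∈ connWords S k, ∑ p : Pt n with p.1 ∈ S ∧ p.1 ≠ e,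
      listWeight C J T ((p, e) :: r) • markedMon C⁻¹ e S x (listInv ((p, e) :: r)) =
      listWeight C J T r • ((T * (x - 1)) • markedMon C⁻¹ e S x (listInv r) +
        ∑ z ∈ Finset.Ioc x n, X (z - x) * markedMon C⁻¹ e S z (listInv r) +
        ∑ a ∈ antidiagonal x, (2 * (C * J) * a.2) •
          pderiv a.2 (markedMon C⁻¹ e S a.1 (listInv r))) := by
    intro r hr
    have hw := (mem_connWords.mp hr).1.2
    have hm := isMatching_listInv r
    have hcl := (Separates.agreeOn hw.separates).blockClosed
    have hsub := hcl e he
    have h2 : (Finset.univ.filter fun p : Pt n => p.1 ∈ S ∧ p.1 ≠ e) =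
        (Finset.univ.filter fun p : Pt n => p.1 ∈ blk (listInv r) e ∧ p.1 ≠ e) ∪
          Finset.univ.filter fun p : Pt n => p.1 ∈ S \ blk (listInv r) e := by
      ext p
      have h3 := @hsub p.1
      have h4 : p.1 = e → p.1 ∈ blk (listInv r) e := fun h => h ▸ hm.mem_blk_self p.1
      simp only [Finset.mem_filter, Finset.mem_univ, true_and, Finset.mem_union, Finset.mem_sdiff]
      tauto
    have h3 : ∀ p : Pt n, listWeight C J T ((p, e) :: r) •
        markedMon C⁻¹ e S x (listInv ((p, e) :: r)) = listWeight C J T r •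
          (cjtWeight C J T (listInv r) (swap p (e, false)) •
            markedMon C⁻¹ e S x (act (swap p (e, false)) (listInv r))) := fun p => by
      rw [smul_smul, mul_comm]
      rfl
    rw [Finset.sum_congr rfl fun p _ => h3 p, ← Finset.smul_sum, h2, Finset.sum_union]
    · congr 2
      · exact hm.sum_cut_twist hC J T (e, false) hsub hx
      · exact hm.sum_join_self hC J T (e, false) hcl x
    · rw [Finset.disjoint_left]
      intro p hp hp'
      exact (Finset.mem_sdiff.mp (Finset.mem_filter.mp hp').2).2 (Finset.mem_filter.mp hp).2.1
  rw [Finset.sum_congr rfl h1]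
  simp only [smul_add, Finset.sum_add_distrib, Finset.smul_sum]
  congr 1
  · congr 1
    · rw [markedSum, Finset.smul_sum]
      exact Finset.sum_congr rfl fun r _ => smul_comm _ _ _
    · rw [Finset.sum_comm]
      refine Finset.sum_congr rfl fun z _ => ?_
      rw [markedSum, Finset.mul_sum]
      exact Finset.sum_congr rfl fun r _ => (mul_smul_comm _ _ _).symm
  · rw [Finset.sum_comm]
    refine Finset.sum_congr rfl fun a _ => ?_
    rw [markedSum, map_sum, Finset.smul_sum]
    refine Finset.sum_congr rfl fun r _ => ?_
    rw [smul_comm, Derivation.map_smul]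

theorem markedSum_succ [CharZero K] {C : K} (hC : C ≠ 0) (J T : K) {S : Finset (Fin n)} {e : Fin n}
    (he : e ∈ S) (hmax : ∀ i ∈ S, i ≤ e) (k : ℕ) {x : ℕ} (hx : 1 ≤ x) :
    markedSum C J T S (k + 1) e x = (T * (x - 1)) • markedSum C J T S k e x +
        ∑ z ∈ Finset.Ioc x n, X (z - x) * markedSum C J T S k e z +
        ∑ a ∈ antidiagonal x, (2 * (C * J) * a.2) •
          (pderiv a.2 (markedSum C J T S k e a.1) +
            ∑ j ∈ antidiagonal k, ∑ S₁ ∈ S.powerset with e ∈ S₁,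
              markedSum C J T S₁ j.1 e a.1 * pderiv a.2 (wordSum C J T (S \ S₁) j.2)) := by
  rw [markedSum, sum_connWords_succ he hmax k, sum_connWords_letter hC J T he k hx, add_assoc]
  simp only [smul_add, Finset.sum_add_distrib, add_assoc]
  congr 3
  have h1 : ∀ S₁ ∈ S.powerset.filter fun S₁ => e ∈ S₁, ∑ r ∈ splitWords S₁ (S \ S₁) k,
      ∑ p : Pt n with p.1 ∈ S \ S₁, listWeight C J T ((p, e) :: r) •
        markedMon C⁻¹ e S x (listInv ((p, e) :: r)) =
      ∑ a ∈ antidiagonal x, (2 * (C * J) * a.2) •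
        ∑ j ∈ antidiagonal k,
          markedSum C J T S₁ j.1 e a.1 * pderiv a.2 (wordSum C J T (S \ S₁) j.2) := by
    intro S₁ hS₁
    obtain ⟨hsub, heS₁⟩ := Finset.mem_filter.mp hS₁
    have h2 := sum_splitWords_join hC J T (Finset.disjoint_sdiff (s := S₁) (t := S)) heS₁ k x
    rwa [Finset.union_sdiff_of_subset (Finset.mem_powerset.mp hsub)] at h2
  rw [Finset.sum_congr rfl h1, Finset.sum_comm]
  refine Finset.sum_congr rfl fun a _ => ?_
  rw [← Finset.smul_sum, Finset.sum_comm]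

/-- Without transpositions only a one-element set is connected; there `2 J c = C⁻¹` matches the
factor of the single block. -/
theorem markedSum_base [CharZero K] {C J c : K} (hc : 2 * (C * J) * c = 1) (T : K)
    {S : Finset (Fin n)} {e : Fin n} (he : e ∈ S) (x : ℕ) :
    markedSum C J T S 0 e x = ((2 * J) ^ S.card * (S.card - 1).factorial * x) •
      pderiv x (homPart S.card (c • X 1)) := by
  rw [homPart_smul, homPart_X, Derivation.map_smul]
  by_cases hS : S = {e}
  · subst hS
    have hwords : connWords {e} 0 = {[]} := by
      ext r
      rw [mem_connWords, Finset.mem_singleton, List.length_eq_zero_iff]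
      constructor
      · exact fun h => h.1.1
      · rintro rfl
        refine ⟨⟨rfl, by simp, by simp, by simp, List.Pairwise.nil⟩, fun i hi j hj => ?_⟩
        rw [Finset.mem_singleton.mp hi, Finset.mem_singleton.mp hj]
        exact Joined.refl _
    have hblk : blk (tau n) e = {e} := by
      ext j
      have h1 := isMatching_tau.mem_blk (x := (e, false)) (y := (j, false))
      have h2 : flow (tau n) = 1 := by
        ext1 y
        exact tau_tau y
      rw [h2, Perm.sameCycle_one, Perm.sameCycle_one] at h1
      rw [Finset.mem_singleton]
      refine h1.trans ⟨?_, ?_⟩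
      · rintro (h3 | h3)
        · exact (congrArg Prod.fst h3).symm
        · exact (congrArg Prod.fst h3).symm
      · rintro rfl
        exact Or.inl rfl
    rw [markedSum, hwords, Finset.sum_singleton, Finset.card_singleton, if_pos rfl, listWeight,
      one_smul, markedMon, listInv, hblk, Finset.card_singleton, sdiff_self, Finset.bot_eq_empty,
      blockMon_empty, pderiv_X, Pi.single_apply]
    split_ifs with h1
    · subst h1
      rw [smul_smul]
      congr 1
      refine inv_eq_of_mul_eq_one_right ?_
      simp only [pow_one, Nat.sub_self, Nat.factorial_zero, Nat.cast_one, mul_one]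
      linear_combination hc
    · rw [smul_zero, smul_zero]
  · have hcard : S.card ≠ 1 := fun h => hS (by
      obtain ⟨i, rfl⟩ := Finset.card_eq_one.mp h
      rw [Finset.mem_singleton.mp he])
    rw [if_neg hcard, map_zero, smul_zero, smul_zero, markedSum]
    refine Finset.sum_eq_zero fun r hr => absurd ?_ hS
    obtain ⟨⟨h0, -⟩, hconn⟩ := mem_connWords.mp hr
    rw [List.length_eq_zero_iff] at h0
    subst h0
    refine Finset.eq_singleton_iff_unique_mem.mpr ⟨he, fun i hi => ?_⟩
    exact ((hconn e he i hi).iff_of_closed (P := fun z => z = e) (by simp)).mp rfl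

/-- The generating polynomials of the connected monotone strings satisfy the recursion of
`hurwitzPoly`. -/
theorem markedSum_eq [CharZero K] {C J b c : K} (hC : C ≠ 0) (hCJ : 2 * (C * J) = 1 + b)
    (hc : (1 + b) * c = 1) (k : ℕ) : ∀ (S : Finset (Fin n)) (e : Fin n), e ∈ S → (∀ i ∈ S, i ≤ e) →
      (∀ x, markedSum C J b S k e x = ((2 * J) ^ S.card * (S.card - 1).factorial * x) •
        pderiv x (homPart S.card (hurwitzPoly b c k))) ∧
      wordSum C J b S k = ((2 * J) ^ S.card * S.card.factorial) •
        homPart S.card (hurwitzPoly b c k) := by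
  induction k using Nat.strong_induction_on with
  | _ k ih =>
  intro S e he hmax
  -- Summing `X_x x ∂_x` over `x` multiplies the component of weight `|S|` by `|S|`, which completes
  -- `(|S| - 1)!` to `|S|!`.
  have hword : (∀ x, markedSum C J b S k e x = ((2 * J) ^ S.card * (S.card - 1).factorial * x) •
        pderiv x (homPart S.card (hurwitzPoly b c k))) →
      wordSum C J b S k = ((2 * J) ^ S.card * S.card.factorial) •
        homPart S.card (hurwitzPoly b c k) := by
    intro h
    have hn : S.card ≤ n := (Finset.card_le_univ S).trans (Fintype.card_fin n).le
    have hpos : 0 < S.card := Finset.card_pos.mpr ⟨e, he⟩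
    rw [wordSum_eq C J b he]
    simp only [h, mul_smul_comm, mul_smul]
    rw [← Finset.smul_sum, ← Finset.smul_sum, sum_X_mul_pderiv_homPart hn, smul_smul ((_ : ℕ) : K),
      ← Nat.cast_mul, mul_comm _ S.card, Nat.mul_factorial_pred hpos.ne']
  suffices h : ∀ x, markedSum C J b S k e x = ((2 * J) ^ S.card * (S.card - 1).factorial * x) •
      pderiv x (homPart S.card (hurwitzPoly b c k)) from ⟨h, hword h⟩
  intro x
  rcases Nat.eq_zero_or_pos x with rfl | hx
  · rw [markedSum_zero, Nat.cast_zero, mul_zero, zero_smul]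
  cases k with
  | zero => rw [markedSum_base (by rw [hCJ, hc]) b he, hurwitzPoly_zero]
  | succ k =>
    have hn : S.card ≤ n := (Finset.card_le_univ S).trans (Fintype.card_fin n).le
    have hk := (ih k (Nat.lt_succ_self k) S e he hmax).1
    -- Here the refined recursion is indispensable: the marked block is that of the largest element,
    -- so each `x` has to be treated separately.
    rw [markedSum_succ hC J b he hmax k hx, mul_smul _ (x : K),
      homPart_recursion (hurwitzPoly_recursion b c k x hx), smul_add, smul_add]
    congr 1
    · congr 1
      · rw [hk, smul_smul, smul_smul]
        congr 1
        ring
      · rw [mergeDer_eq_sum (n := n) fun z hz => pderiv_homPart_eq_zero (hn.trans_lt hz) _,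
          Finset.smul_sum]
        refine Finset.sum_congr rfl fun z _ => ?_
        rw [hk, smul_smul, mul_smul_comm]
    · rw [Finset.smul_sum, Finset.smul_sum]
      refine Finset.sum_congr rfl fun a _ => ?_
      obtain ⟨a₁, a₂⟩ := a
      dsimp only
      rcases Nat.eq_zero_or_pos a₂ with rfl | ha₂
      · simp
      rcases Nat.eq_zero_or_pos a₁ with rfl | ha₁
      · simp [markedSum_zero]
      have hterm : ∀ j ∈ antidiagonal k,
          ∑ S₁ ∈ S.powerset with e ∈ S₁,
            markedSum C J b S₁ j.1 e a₁ * pderiv a₂ (wordSum C J b (S \ S₁) j.2) =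
          ((2 * J) ^ S.card * (S.card - 1).factorial * a₁) •
            ∑ t ∈ antidiagonal S.card,
              pderiv a₁ (homPart t.1 (hurwitzPoly b c j.1)) *
                pderiv a₂ (homPart t.2 (hurwitzPoly b c j.2)) := by
        intro j hj
        rw [mem_antidiagonal] at hj
        have h1 : ∀ S₁ ∈ S.powerset.filter fun S₁ => e ∈ S₁,
            markedSum C J b S₁ j.1 e a₁ * pderiv a₂ (wordSum C J b (S \ S₁) j.2) =
            ((2 * J) ^ S.card * a₁) • (((S₁.card - 1).factorial * (S \ S₁).card.factorial) •
              (pderiv a₁ (homPart S₁.card (hurwitzPoly b c j.1)) *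
                pderiv a₂ (homPart (S \ S₁).card (hurwitzPoly b c j.2)))) := by
          intro S₁ hS₁
          obtain ⟨hsub, heS₁⟩ := Finset.mem_filter.mp hS₁
          rw [Finset.mem_powerset] at hsub
          rw [(ih j.1 (by omega) S₁ e heS₁ fun i hi => hmax i (hsub hi)).1]
          have h2 : pderiv a₂ (wordSum C J b (S \ S₁) j.2) =
              ((2 * J) ^ (S \ S₁).card * (S \ S₁).card.factorial) •
                pderiv a₂ (homPart (S \ S₁).card (hurwitzPoly b c j.2)) := by
            -- The induction hypothesis needs a largest element. For the empty complement both sides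
            -- vanish, because a component of weight `0` has no derivative in a variable of positive
            -- weight.
            rcases (S \ S₁).eq_empty_or_nonempty with h3 | h3
            · rw [h3, Finset.card_empty, pderiv_homPart_eq_zero ha₂, smul_zero, wordSum, map_sum]
              refine Finset.sum_eq_zero fun r _ => ?_
              rw [blockMon_empty, Derivation.map_smul, Derivation.map_one_eq_zero, smul_zero]
            · rw [(ih j.2 (by omega) (S \ S₁) _ (Finset.max'_mem _ h3)
                fun i hi => Finset.le_max' _ _ hi).2, Derivation.map_smul]
          rw [h2, smul_mul_smul_comm, ← Nat.cast_smul_eq_nsmul K, smul_smul]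
          congr 1
          rw [← Finset.card_sdiff_add_card_eq_card hsub, pow_add]
          push_cast
          ring
        rw [Finset.sum_congr rfl h1, ← Finset.smul_sum, sum_powerset_mem he fun t₁ t₂ =>
          pderiv a₁ (homPart t₁ (hurwitzPoly b c j.1)) *
            pderiv a₂ (homPart t₂ (hurwitzPoly b c j.2))]
        · rw [← Nat.cast_smul_eq_nsmul K, smul_smul]
          congr 1
          ring
        · rw [pderiv_homPart_eq_zero ha₁, zero_mul]
      rw [Finset.sum_congr rfl hterm, hk, Derivation.map_smul, ← Finset.smul_sum, ← smul_add,
        smul_smul, smul_smul, smul_smul, pderiv_comm a₂ a₁, hCJ]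
      congr 1
      ring

end BHurwitz

/-! ### Labellings of the cycles as coefficients of the monomial of the blocks -/

namespace BHurwitz

open MvPolynomial Equiv

variable {K : Type*} [Field K] {n : ℕ} {ρ : Perm (Pt n)}

/-- This counts blocks instead of elements: each block of size `β` occurs `β` times in
`pderiv_blockMon`. -/
theorem IsMatching.pderiv_blockMon_eq_sum [CharZero K] (h : IsMatching ρ) (c : K) {β : ℕ}
    (hβ : 0 < β) {S : Finset (Fin n)} (hS : BlockClosed ρ S) : pderiv β (blockMon c ρ S) =
      ∑ B ∈ S.image (blk ρ) with B.card = β, c • blockMon c ρ (S \ B) := by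
  have hβ' : (β : K) ≠ 0 := Nat.cast_ne_zero.mpr hβ.ne'
  have h1 : ∑ i ∈ S with (blk ρ i).card = β, c • blockMon c ρ (S \ blk ρ i) =
      (β : K) • ∑ B ∈ S.image (blk ρ) with B.card = β, c • blockMon c ρ (S \ B) := by
    rw [← Finset.sum_fiberwise_of_maps_to (s := S.filter fun i => (blk ρ i).card = β)
      (t := (S.image (blk ρ)).filter fun B => B.card = β) (g := blk ρ), Finset.smul_sum]
    · refine Finset.sum_congr rfl fun B hB => ?_
      obtain ⟨hB, hBβ⟩ := Finset.mem_filter.mp hB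
      obtain ⟨i, hi, rfl⟩ := Finset.mem_image.mp hB
      have h2 : (S.filter fun i => (blk ρ i).card = β).filter (fun j => blk ρ j = blk ρ i) =
          blk ρ i := by
        ext j
        rw [Finset.mem_filter, Finset.mem_filter, h.blk_eq_iff]
        refine ⟨fun h => h.2, fun hj => ⟨⟨hS i hi hj, ?_⟩, hj⟩⟩
        rw [h.blk_eq hj, hBβ]
      rw [h2, Finset.sum_congr rfl fun j hj => by rw [h.blk_eq hj], Finset.sum_const, hBβ,
        Nat.cast_smul_eq_nsmul]
    · intro i hi
      obtain ⟨hi, hiβ⟩ := Finset.mem_filter.mp hi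
      exact Finset.mem_filter.mpr ⟨Finset.mem_image_of_mem _ hi, hiβ⟩
  rw [← h.pderiv_blockMon c β hS] at h1
  exact smul_right_injective _ hβ' h1

/-- `g` lists the blocks in `S`, and their sizes are `m`. -/
structure IsBlockList {q : ℕ} (ρ : Perm (Pt n)) (S : Finset (Fin n)) (m : Fin q → ℕ)
    (g : Fin q → Finset (Fin n)) : Prop where
  mem : ∀ i, g i ∈ S.image (blk ρ)
  injective : Function.Injective g
  card : ∀ i, (g i).card = m i
  cover : ∀ j ∈ S, ∃ i, j ∈ g i

theorem IsMatching.isBlockList_cons (h : IsMatching ρ) {q : ℕ} {S : Finset (Fin n)}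
    {m : Fin (q + 1) → ℕ}
    {B : Finset (Fin n)} {g : Fin q → Finset (Fin n)} :
    IsBlockList ρ S m (Fin.cons B g : Fin (q + 1) → Finset (Fin n)) ↔
      (B ∈ S.image (blk ρ) ∧ B.card = m 0) ∧ IsBlockList ρ (S \ B) (Fin.tail m) g := by
  constructor
  · intro hg
    have hinj := Fin.cons_injective_iff.mp hg.injective
    refine ⟨⟨hg.mem 0, hg.card 0⟩, ⟨fun i => ?_, hinj.2, fun i => hg.card i.succ, fun j hj => ?_⟩⟩
    · obtain ⟨j, hj, hji⟩ := Finset.mem_image.mp (hg.mem i.succ)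
      rw [Fin.cons_succ] at hji
      refine Finset.mem_image.mpr ⟨j, Finset.mem_sdiff.mpr ⟨hj, fun hjB => ?_⟩, hji⟩
      obtain ⟨l, -, hl⟩ := Finset.mem_image.mp (hg.mem 0)
      rw [Fin.cons_zero] at hl
      refine hinj.1 ⟨i, ?_⟩
      rw [← hji, ← hl]
      exact h.blk_eq (hl ▸ hjB)
    · obtain ⟨hjS, hjB⟩ := Finset.mem_sdiff.mp hj
      obtain ⟨i, hi⟩ := hg.cover j hjS
      induction i using Fin.cases with
      | zero => exact absurd hi hjB
      | succ i => exact ⟨i, hi⟩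
  · rintro ⟨⟨hB, hBm⟩, hg⟩
    refine ⟨fun i => ?_, Fin.cons_injective_iff.mpr ⟨?_, hg.injective⟩, fun i => ?_, fun j hj => ?_⟩
    · induction i using Fin.cases with
      | zero => exact hB
      | succ i => exact Finset.image_subset_image Finset.sdiff_subset (hg.mem i)
    · rintro ⟨i, hi⟩
      obtain ⟨j, hj, hji⟩ := Finset.mem_image.mp (hg.mem i)
      refine (Finset.mem_sdiff.mp hj).2 ?_
      rw [← hi, ← hji]
      exact h.mem_blk_self j
    · induction i using Fin.cases with
      | zero => exact hBm
      | succ i => exact hg.card i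
    · by_cases hjB : j ∈ B
      · exact ⟨0, hjB⟩
      · obtain ⟨i, hi⟩ := hg.cover j (Finset.mem_sdiff.mpr ⟨hj, hjB⟩)
        exact ⟨i.succ, hi⟩

-- Each derivative selects a block of the prescribed size for one label, and taking the constant
-- term requires that no block is left over.
open Classical in
theorem IsMatching.partCoeff_blockMon [CharZero K] (h : IsMatching ρ) (c : K) {q : ℕ}
    {m : Fin q → ℕ} (hm : ∀ i, 0 < m i) {S : Finset (Fin n)} (hS : BlockClosed ρ S) :
    partCoeff Finset.univ m (blockMon c ρ S) =
      c ^ q * ∑ g : Fin q → Finset (Fin n), if IsBlockList ρ S m g then 1 else 0 := by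
  induction q generalizing S with
  | zero =>
    have hu : (Finset.univ : Finset (Fin 0)) = ∅ := rfl
    rw [hu, partCoeff_empty, pow_zero, one_mul, Fintype.sum_unique]
    rcases S.eq_empty_or_nonempty with rfl | ⟨i, hi⟩
    · rw [blockMon_empty, map_one, if_pos]
      exact ⟨fun i => i.elim0, fun i => i.elim0, fun i => i.elim0, fun j hj => by simp at hj⟩
    · rw [h.blockMon_eq_mul c (hS i hi), map_mul, if_neg]
      · simp
      · intro hg
        obtain ⟨j, -⟩ := hg.cover i hi
        exact j.elim0
  | succ q ih =>
    have h1 : ∀ f : MvPolynomial ℕ K, partCoeff Finset.univ m f =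
        partCoeff Finset.univ (Fin.tail m) (pderiv (m 0) f) := by
      intro f
      rw [partCoeff, partCoeff, Fin.univ_succ, Finset.cons_val, Multiset.map_cons, labCoeff_cons,
        Finset.map_val, Multiset.map_map]
      rfl
    rw [h1, h.pderiv_blockMon_eq_sum c (hm 0) hS, partCoeff_sum,
      ← (Fin.consEquiv fun _ : Fin (q + 1) => Finset (Fin n)).sum_comp, Fintype.sum_prod_type,
      Finset.mul_sum, Finset.sum_filter, ← Finset.sum_filter]
    have h2 : ∀ B : Finset (Fin n), (∑ g : Fin q → Finset (Fin n),
        if IsBlockList ρ S m (Fin.consEquiv (fun _ : Fin (q + 1) => Finset (Fin n)) (B, g))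
          then (1 : K) else 0) =
        if B ∈ (S.image (blk ρ)).filter (fun B => B.card = m 0) then
          ∑ g : Fin q → Finset (Fin n), if IsBlockList ρ (S \ B) (Fin.tail m) g then 1 else 0
        else 0 := by
      intro B
      have h3 : ∀ g : Fin q → Finset (Fin n), IsBlockList ρ S m
          (Fin.consEquiv (fun _ : Fin (q + 1) => Finset (Fin n)) (B, g)) ↔ _ :=
        fun g => h.isBlockList_cons
      simp only [h3, Finset.mem_filter]
      split_ifs with h4
      · simp only [h4, true_and]
      · simp only [h4, false_and, if_false, Finset.sum_const_zero]
    simp only [h2, mul_ite, mul_zero]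
    rw [Finset.sum_ite_mem, Finset.univ_inter]
    refine Finset.sum_congr rfl fun B hB => ?_
    obtain ⟨i, hi, rfl⟩ := Finset.mem_image.mp (Finset.mem_filter.mp hB).1
    rw [partCoeff_smul, ih (m := Fin.tail m) (fun i => hm i.succ) (h.blockClosed_sdiff hS i),
      pow_succ']
    ring

/-- The group generated by `τ` and `ρ` contains the flow, and `τ` exchanges the two cycles of the
flow that form a block. -/
theorem IsMatching.exists_closure_iff (h : IsMatching ρ) {x y : Pt n} :
    (∃ g ∈ Subgroup.closure {tau n, ρ}, g x = y) ↔ y.1 ∈ blk ρ x.1 := by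
  constructor
  · rintro ⟨g, hg, rfl⟩
    have hgen : ∀ σ ∈ ({tau n, ρ} : Set (Perm (Pt n))), ∀ z, (σ z).1 ∈ blk ρ z.1 := by
      intro σ hσ z
      rcases hσ with rfl | rfl
      · rw [tau_fst]
        exact h.mem_blk_self _
      · have h1 : flow σ (tau n z) = σ z := by rw [flow_apply, tau_tau]
        have h2 := h.mem_blk (x := tau n z) (y := σ z)
        rw [tau_fst] at h2
        refine h2.mpr (Or.inl ?_)
        rw [← h1, Perm.sameCycle_apply_right]
    have hall : ∀ z, blk ρ (g z).1 = blk ρ z.1 := by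
      induction hg using Subgroup.closure_induction with
      | mem σ hσ => exact fun z => h.blk_eq (hgen σ hσ z)
      | one => exact fun z => rfl
      | mul σ σ' _ _ h1 h2 => exact fun z => (h1 _).trans (h2 z)
      | inv σ _ h1 =>
        intro z
        rw [← h1 (σ⁻¹ z), show σ (σ⁻¹ z) = z from σ.apply_symm_apply z]
    exact h.blk_eq_iff.mp (hall x)
  · intro hy
    have hτ : tau n ∈ Subgroup.closure ({tau n, ρ} : Set (Perm (Pt n))) :=
      Subgroup.subset_closure (Or.inl rfl)
    have hf : flow ρ ∈ Subgroup.closure ({tau n, ρ} : Set (Perm (Pt n))) :=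
      mul_mem (Subgroup.subset_closure (Or.inr rfl)) hτ
    rcases h.mem_blk.mp hy with ⟨k, hk⟩ | ⟨k, hk⟩
    · exact ⟨flow ρ ^ k, zpow_mem hf k, hk⟩
    · exact ⟨tau n * flow ρ ^ k, mul_mem hτ (zpow_mem hf k), by rw [Perm.mul_apply, hk, tau_tau]⟩

theorem IsMatching.isCycleLabelling_iff (h : IsMatching ρ) {q : ℕ} {m : Fin q → ℕ}
    {ℓ : Pt n → Fin q} : IsCycleLabelling m ρ ℓ ↔ (∀ x y, ℓ x = ℓ y ↔ y.1 ∈ blk ρ x.1) ∧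
      ∀ i, (Finset.univ.filter fun x => ℓ x = i).card = 2 * m i := by
  have hcard : ∀ i, Nat.card {x // ℓ x = i} = (Finset.univ.filter fun x => ℓ x = i).card :=
    fun i => by
    rw [Nat.card_eq_fintype_card, Fintype.card_subtype]
  constructor
  · rintro ⟨h1, h2⟩
    exact ⟨fun x y => (h1 x y).trans h.exists_closure_iff, fun i => (hcard i).symm.trans (h2 i)⟩
  · rintro ⟨h1, h2⟩
    exact ⟨fun x y => (h1 x y).trans h.exists_closure_iff.symm, fun i => (hcard i).trans (h2 i)⟩

theorem card_filter_fst (p : Fin n → Prop) [DecidablePred p] :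
    (Finset.univ.filter fun x : Pt n => p x.1).card = 2 * (Finset.univ.filter p).card := by
  have : (Finset.univ.filter fun x : Pt n => p x.1) = (Finset.univ.filter p) ×ˢ Finset.univ := by
    ext x
    simp
  rw [this, Finset.card_product, mul_comm]
  rfl

open Classical in
theorem IsMatching.card_labellings (h : IsMatching ρ) {q : ℕ} {m : Fin q → ℕ} (hm : ∀ i, 0 < m i) :
    (Finset.univ.filter fun ℓ : Pt n → Fin q => IsCycleLabelling m ρ ℓ).card =
      (Finset.univ.filter fun g : Fin q → Finset (Fin n) => IsBlockList ρ Finset.univ m g).card := by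
  refine Finset.card_bij (fun ℓ _ i => Finset.univ.filter fun j => ℓ (j, false) = i) ?_ ?_ ?_
  · intro ℓ hℓ
    obtain ⟨h1, h2⟩ := h.isCycleLabelling_iff.mp (Finset.mem_filter.mp hℓ).2
    have h3 : ∀ x : Pt n, ℓ x = ℓ (x.1, false) := fun x => (h1 _ _).mpr (h.mem_blk_self _)
    have hcard : ∀ i, (Finset.univ.filter fun j => ℓ (j, false) = i).card = m i := by
      intro i
      have h4 := h2 i
      rw [Finset.filter_congr fun x _ => by rw [h3], card_filter_fst fun j => ℓ (j, false) =
        i] at h4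
      omega
    have hblk : ∀ i, ∃ j, ℓ (j, false) = i := by
      intro i
      obtain ⟨j, hj⟩ := Finset.card_pos.mp ((hm i).trans_eq (hcard i).symm)
      exact ⟨j, (Finset.mem_filter.mp hj).2⟩
    refine Finset.mem_filter.mpr ⟨Finset.mem_univ _, ⟨fun i => ?_, fun i i' hii => ?_, hcard,
      fun j _ => ⟨ℓ (j, false), Finset.mem_filter.mpr ⟨Finset.mem_univ _, rfl⟩⟩⟩⟩
    · obtain ⟨j, rfl⟩ := hblk i
      refine Finset.mem_image.mpr ⟨j, Finset.mem_univ _, ?_⟩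
      ext l
      rw [Finset.mem_filter, and_iff_right (Finset.mem_univ _), eq_comm]
      exact (h1 (j, false) (l, false)).symm
    · obtain ⟨j, rfl⟩ := hblk i
      have h5 : j ∈ Finset.univ.filter fun l => ℓ (l, false) = ℓ (j, false) :=
        Finset.mem_filter.mpr ⟨Finset.mem_univ _, rfl⟩
      rw [hii] at h5
      exact (Finset.mem_filter.mp h5).2
  · intro ℓ hℓ ℓ' hℓ' heq
    obtain ⟨h1, -⟩ := h.isCycleLabelling_iff.mp (Finset.mem_filter.mp hℓ).2
    obtain ⟨h1', -⟩ := h.isCycleLabelling_iff.mp (Finset.mem_filter.mp hℓ').2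
    have h3 : ∀ x : Pt n, ℓ x = ℓ (x.1, false) := fun x => (h1 _ _).mpr (h.mem_blk_self _)
    have h3' : ∀ x : Pt n, ℓ' x = ℓ' (x.1, false) := fun x => (h1' _ _).mpr (h.mem_blk_self _)
    funext x
    rw [h3, h3']
    have h4 : x.1 ∈ Finset.univ.filter fun j => ℓ (j, false) = ℓ (x.1, false) :=
      Finset.mem_filter.mpr ⟨Finset.mem_univ _, rfl⟩
    rw [congrFun heq (ℓ (x.1, false))] at h4
    exact (Finset.mem_filter.mp h4).2.symm
  · intro g hg
    have hg := (Finset.mem_filter.mp hg).2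
    choose f hf using fun j => hg.cover j (Finset.mem_univ j)
    have hblk : ∀ j, g (f j) = blk ρ j := by
      intro j
      obtain ⟨l, -, hl⟩ := Finset.mem_image.mp (hg.mem (f j))
      rw [← hl]
      exact (h.blk_eq (hl ▸ hf j)).symm
    have hiff : ∀ i j, f j = i ↔ j ∈ g i := by
      intro i j
      constructor
      · rintro rfl
        exact hf j
      · intro hj
        refine hg.injective ?_
        obtain ⟨l, -, hl⟩ := Finset.mem_image.mp (hg.mem i)
        rw [hblk, ← hl]
        exact h.blk_eq (hl ▸ hj)
    have hset : ∀ i, (Finset.univ.filter fun j => f j = i) = g i := by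
      intro i
      ext j
      rw [Finset.mem_filter, and_iff_right (Finset.mem_univ _), hiff]
    refine ⟨fun x => f x.1, Finset.mem_filter.mpr ⟨Finset.mem_univ _,
      h.isCycleLabelling_iff.mpr ⟨fun x y => ?_, fun i => ?_⟩⟩, funext hset⟩
    · rw [hiff, ← h.mem_blk_comm, hblk]
    · rw [card_filter_fst fun j => f j = i, hset, hg.card]

open Classical in
/-- The number of labellings of the cycles is a coefficient of the monomial of the blocks. -/
theorem IsMatching.card_labellings_eq [CharZero K] (h : IsMatching ρ) {q : ℕ} {m : Fin q → ℕ}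
    (hm : ∀ i, 0 < m i) {C : K} (hC : C ≠ 0) :
    ((Finset.univ.filter fun ℓ : Pt n → Fin q => IsCycleLabelling m ρ ℓ).card : K) =
      C ^ q * partCoeff Finset.univ m (blockMon C⁻¹ ρ Finset.univ) := by
  rw [h.partCoeff_blockMon C⁻¹ hm fun _ _ => Finset.subset_univ _, ← mul_assoc, ← mul_pow,
    mul_inv_cancel₀ hC, one_pow, one_mul, h.card_labellings hm, Finset.sum_boole]

end BHurwitz

/-! ### Evaluation of the Hurwitz numbers and the theorem -/

namespace BHurwitz

open MvPolynomial Equiv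

variable {n : ℕ}

theorem actList_append (ρ : Perm (Pt n)) (l : List (Perm (Pt n))) (σ : Perm (Pt n)) :
    actList ρ (l ++ [σ]) = act σ (actList ρ l) := by
  induction l generalizing ρ with
  | nil => rfl
  | cons a l ih => exact ih _

theorem weightList_append {K : Type*} [Field K] (C J T : K) (ρ : Perm (Pt n))
    (l : List (Perm (Pt n))) (σ : Perm (Pt n)) : weightList C J T ρ (l ++ [σ]) =
      cjtWeight C J T (actList ρ l) σ * weightList C J T ρ l := by
  induction l generalizing ρ with
  | nil => rfl
  | cons a l ih =>
    rw [List.cons_append, weightList, ih, weightList, actList, mul_left_comm]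

theorem actList_map_transp (r : List (Pt n × Fin n)) :
    actList (tau n) (r.reverse.map transp) = listInv r := by
  induction r with
  | nil => rfl
  | cons a r ih =>
    rw [List.reverse_cons, List.map_append, List.map_singleton, actList_append, ih, listInv]

theorem weightList_map_transp {K : Type*} [Field K] (C J T : K) (r : List (Pt n × Fin n)) :
    weightList C J T (tau n) (r.reverse.map transp) = listWeight C J T r := by
  induction r with
  | nil => rfl
  | cons a r ih =>
    rw [List.reverse_cons, List.map_append, List.map_singleton, weightList_append,
      actList_map_transp, ih, listWeight]

/-- Because `τ` exchanges `i` and `ī`, transitivity on the points is connectedness of the indices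
under the transpositions. -/
theorem transitive_iff_isConn {r : List (Pt n × Fin n)} {R : Set (Perm (Pt n))}
    (hR : ∀ σ, σ ∈ R ↔ ∃ a ∈ r, transp a = σ) :
    (∀ x y : Pt n, ∃ g ∈ Subgroup.closure ({tau n} ∪ R), g x = y) ↔ IsConn Finset.univ r := by
  constructor
  · intro h i _ j _
    obtain ⟨g, hg, hgi⟩ := h (i, false) (j, false)
    have hall : ∀ z, Joined r z.1 (g z).1 := by
      clear hgi
      induction hg using Subgroup.closure_induction with
      | mem σ hσ =>
        intro z
        rcases hσ with rfl | hσ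
        · rw [tau_fst]
          exact Joined.refl _
        · obtain ⟨a, ha, rfl⟩ := (hR σ).mp hσ
          rw [transp_eq, swap_apply_def]
          split_ifs with h1 h1
          · rw [h1]
            exact Joined.of_mem ha
          · rw [h1]
            exact (Joined.of_mem ha).symm
          · exact Joined.refl _
      | one => exact fun z => Joined.refl _
      | mul σ σ' _ _ h1 h2 => exact fun z => (h2 z).trans (h1 _)
      | inv σ _ h1 =>
        intro z
        have h2 := (h1 (σ⁻¹ z)).symm
        rwa [show σ (σ⁻¹ z) = z from σ.apply_symm_apply z] at h2
    have h1 := hall (i, false)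
    rwa [hgi] at h1
  · intro h
    set H := Subgroup.closure ({tau n} ∪ R) with hH
    have hτ : tau n ∈ H := Subgroup.subset_closure (Or.inl rfl)
    have hbar : ∀ x y : Pt n, x.1 = y.1 → ∃ g ∈ H, g x = y := by
      intro x y hxy
      by_cases h2 : x.2 = y.2
      · exact ⟨1, one_mem _, Prod.ext hxy h2⟩
      · refine ⟨tau n, hτ, ?_⟩
        rw [tau_apply]
        refine Prod.ext hxy ?_
        cases hx : x.2 <;> cases hy : y.2 <;> simp_all
    have htrans : ∀ x y z : Pt n, (∃ g ∈ H, g x = y) → (∃ g ∈ H, g y = z) → ∃ g ∈ H, g x = z := by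
      rintro x y z ⟨g, hg, rfl⟩ ⟨g', hg', rfl⟩
      exact ⟨g' * g, mul_mem hg' hg, rfl⟩
    have hsymm : ∀ x y : Pt n, (∃ g ∈ H, g x = y) → ∃ g ∈ H, g y = x := by
      rintro x y ⟨g, hg, rfl⟩
      exact ⟨g⁻¹, inv_mem hg, g.symm_apply_apply x⟩
    have hj : ∀ i j, Joined r i j → ∃ g ∈ H, g (i, false) = (j, false) := by
      intro i j hij
      induction hij with
      | rel x y hxy =>
        obtain ⟨a, ha, rfl, rfl⟩ := hxy
        refine htrans _ a.1 _ (hbar _ _ rfl) ⟨transp a, Subgroup.subset_closure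
          (Or.inr ((hR _).mpr ⟨a, ha, rfl⟩)), ?_⟩
        rw [transp_eq, swap_apply_left]
      | refl x => exact ⟨1, one_mem _, rfl⟩
      | symm x y _ ih => exact hsymm _ _ ih
      | trans x y z _ _ ih₁ ih₂ => exact htrans _ _ _ ih₁ ih₂
    intro x y
    exact htrans _ _ _ (hbar x (x.1, false) rfl) (htrans _ _ _
      (hj _ _ (h x.1 (Finset.mem_univ _) y.1 (Finset.mem_univ _))) (hbar (y.1, false) y rfl))

theorem isTransitiveMonotone_iff {k : ℕ} {t : Fin k → Pt n × Fin n} : IsTransitiveMonotone t ↔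
    IsWord Finset.univ (List.ofFn t).reverse ∧ IsConn Finset.univ (List.ofFn t).reverse := by
  have hmem : ∀ a, a ∈ (List.ofFn t).reverse ↔ ∃ i, t i = a := fun a => by
    rw [List.mem_reverse, List.mem_ofFn']
    rfl
  have htr := transitive_iff_isConn (r := (List.ofFn t).reverse)
    (R := Set.range fun i => transp (t i)) fun σ => by
      constructor
      · rintro ⟨i, rfl⟩
        exact ⟨t i, (hmem _).mpr ⟨i, rfl⟩, rfl⟩
      · rintro ⟨a, ha, rfl⟩
        obtain ⟨i, rfl⟩ := (hmem a).mp ha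
        exact ⟨i, rfl⟩
  have hsort : (List.ofFn t).reverse.Pairwise (fun a c => c.2 ≤ a.2) ↔
      Monotone fun i => (t i).2 := by
    rw [List.pairwise_reverse, List.pairwise_ofFn, monotone_iff_forall_lt]
  constructor
  · intro h
    refine ⟨⟨fun a ha => ?_, fun _ _ => Finset.mem_univ _, fun _ _ => Finset.mem_univ _,
      hsort.mpr h.monotone⟩, htr.mp h.transitive⟩
    obtain ⟨i, rfl⟩ := (hmem a).mp ha
    exact h.lt i
  · rintro ⟨h1, h2⟩
    exact ⟨fun i => h1.lt _ ((hmem _).mpr ⟨i, rfl⟩), hsort.mp h1.sorted, htr.mpr h2⟩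

theorem sum_isTransitiveMonotone {M : Type*} [AddCommMonoid M] (k : ℕ)
    [DecidablePred fun t : Fin k → Pt n × Fin n => IsTransitiveMonotone t]
    (f : List (Pt n × Fin n) → M) :
    ∑ t : Fin k → Pt n × Fin n with IsTransitiveMonotone t, f (List.ofFn t).reverse =
      ∑ r ∈ connWords Finset.univ k, f r := by
  refine Finset.sum_bij (fun t _ => (List.ofFn t).reverse) ?_ ?_ ?_ fun _ _ => rfl
  · intro t ht
    obtain ⟨h1, h2⟩ := isTransitiveMonotone_iff.mp (Finset.mem_filter.mp ht).2
    exact mem_connWords.mpr ⟨⟨by rw [List.length_reverse, List.length_ofFn], h1⟩, h2⟩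
  · exact fun t _ t' _ h => List.ofFn_injective (List.reverse_injective h)
  · intro r hr
    obtain ⟨⟨hl, hw⟩, hc⟩ := mem_connWords.mp hr
    have hl' : r.reverse.length = k := by rw [List.length_reverse, hl]
    subst hl'
    have h1 : (List.ofFn r.reverse.get).reverse = r := by
      rw [List.ofFn_get, List.reverse_reverse]
    exact ⟨r.reverse.get, Finset.mem_filter.mpr ⟨Finset.mem_univ _,
      isTransitiveMonotone_iff.mpr (by rw [h1]; exact ⟨hw, hc⟩)⟩, h1⟩

variable {K : Type*} [Field K] [CharZero K]

/-- The number of labellings of the final cycles is `C^q` times a coefficient of the monomial of the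
blocks, and this power cancels the one in the normalisation. -/
theorem refinedN_eq_partCoeff_wordSum (C J T : K) (hC : C ≠ 0) (G : ℕ) {d : ℕ}
    (m : Composition d) : refinedN C J T G m = partCoeff Finset.univ m.blocksFun
      (wordSum C J T (Finset.univ : Finset (Fin d)) (numTransp G m.length d)) / (2 * J) ^ d := by
  classical
  set k := numTransp G m.length d with hk
  have h1 : ∀ t : Fin k → Pt d × Fin d,
      string t = (List.ofFn t).reverse.reverse.map transp := fun t => by
    rw [List.reverse_reverse, List.map_ofFn]
    rfl
  have h2 : (∑ x : (Fin k → Pt d × Fin d) × (Pt d → Fin m.length) with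
      IsTransitiveMonotone x.1 ∧
        IsCycleLabelling m.blocksFun (actList (tau d) (string x.1)) x.2,
      weightList C J T (tau d) (string x.1)) = C ^ m.length * partCoeff Finset.univ m.blocksFun
        (wordSum C J T (Finset.univ : Finset (Fin d)) k) := by
    rw [wordSum, partCoeff_sum, Finset.mul_sum, ← sum_isTransitiveMonotone, Finset.sum_filter,
      Fintype.sum_prod_type, Finset.sum_filter]
    refine Finset.sum_congr rfl fun t _ => ?_
    simp only [h1, weightList_map_transp, actList_map_transp]
    split_ifs with ht
    · simp only [ht, true_and]
      rw [← Finset.sum_filter, Finset.sum_const, nsmul_eq_mul,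
        (isMatching_listInv _).card_labellings_eq (fun a => m.one_le_blocksFun a) hC,
        partCoeff_smul]
      ring
    · simp only [ht, false_and, if_false, Finset.sum_const_zero]
  rw [← mul_div_mul_left _ _ (pow_ne_zero m.length hC), ← h2, refinedN, mul_pow,
    mul_comm (2 ^ d), ← mul_assoc]

/-- The factor `(2 J)^d` of `markedSum_eq` cancels the rest of the normalisation, so that `C` and
`J` enter only through `2 C J = 1 + b`. -/
theorem refinedN_eq {b C J : K} (hb : 1 + b ≠ 0) (hCJ : C * J = (1 + b) / 2) (G : ℕ) {d : ℕ}
    (hd : 0 < d) (m : Composition d) : refinedN C J b G m =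
      d.factorial * partCoeff Finset.univ m.blocksFun
        (hurwitzPoly b (1 / (1 + b)) (numTransp G m.length d)) := by
  have hne : C * J ≠ 0 := hCJ ▸ div_ne_zero hb two_ne_zero
  obtain ⟨hC, hJ⟩ := mul_ne_zero_iff.mp hne
  have hu : (Finset.univ : Finset (Fin d)).Nonempty := ⟨⟨0, hd⟩, Finset.mem_univ _⟩
  have h1 := (markedSum_eq hC (b := b) (c := 1 / (1 + b)) (by rw [hCJ,
    mul_div_cancel₀ _ two_ne_zero])
    (mul_one_div_cancel hb) (numTransp G m.length d) Finset.univ _ (Finset.max'_mem _ hu)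
    fun i hi => Finset.le_max' _ _ hi).2
  have h2 : (Finset.univ.val.map m.blocksFun).sum = d := m.sum_blocksFun
  rw [refinedN_eq_partCoeff_wordSum C J b hC, h1, partCoeff_smul, Finset.card_univ,
    Fintype.card_fin,
    mul_assoc, mul_div_cancel_left₀ _ (pow_ne_zero d (mul_ne_zero two_ne_zero hJ))]
  congr 1
  have h3 := labCoeff_homPart (Finset.univ.val.map m.blocksFun)
    (hurwitzPoly b (1 / (1 + b)) (numTransp G m.length d))
  rw [h2] at h3
  exact h3

end BHurwitz

theorem theorem5 {K : Type*} [Field K] [CharZero K] (b C J : K) (hb : 1 + b ≠ 0)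
    (hCJ : C * J = (1 + b) / 2) (G d : ℕ) (hd : 0 < d) (m : Composition d) :
    Finite (BHurwitz.CoverClass (BHurwitz.numTransp G m.length d) d m.blocksFun) ∧
    (∀ Γ Γ' : BHurwitz.QuotientCover (BHurwitz.numTransp G m.length d) d m.blocksFun,
      (BHurwitz.coverSetoid _ d m.blocksFun) Γ Γ' →
        Γ.1.mult b m.blocksFun = Γ'.1.mult b m.blocksFun) ∧
    (d.factorial : K) * BHurwitz.singleMonotone C J b G m =
      BHurwitz.tropicalMonotone b G m := by
  refine ⟨?_, fun Γ Γ' h => ?_, ?_⟩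
  · have := BHurwitz.CoverData.finite_quotientCover (k := BHurwitz.numTransp G m.length d) (d := d)
      (m.length_pos_of_pos hd) fun a => m.one_le_blocksFun a
    exact Quotient.finite _
  · obtain ⟨σ, h1, h2⟩ := (BHurwitz.CoverData.coverSetoid_iff Γ Γ').mp h
    rw [h2]
    exact (h1.mult_relabel b m.blocksFun).symm
  · rw [BHurwitz.singleMonotone, mul_div_cancel₀ _ (Nat.cast_ne_zero.mpr d.factorial_ne_zero),
      BHurwitz.refinedN_eq hb hCJ G hd, BHurwitz.tropicalMonotone_eq b hb G hd]
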